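/- **Setting.** An ABE scheme with secure key leasing (ABE-SKL) for attribute spaces $\mathcal X=\{\mathcal X_\lambda\}$, $\mathcal Y=\{\mathcal Y_\lambda\}$ and a relation $R=\{R_\lambda:\mathcal X_\lambda\times\mathcal Y_\lambda\to\{0,1\}\}$, with message space $\{0,1\}^{\ell(\lambda)}$, consists of classical probabilistic polynomial-time algorithms $\mathsf{Setup}(1^\lambda)\to(\mathsf{pk},\mathsf{msk})$, $\mathsf{Enc}(\mathsf{pk},x,m)\to\mathsf{ct}$ and quantum polynomial-time (QPT) algorithms $\mathcal{KG}(\mathsf{msk},y)\to(\mathsf{usk},\mathsf{vk})$, $\mathcal{D}ec(\mathsf{usk},x,\mathsf{ct})\to m$ or $\bot$, and $\mathcal{V}rfy(\mathsf{vk},\mathsf{usk}')\to\top/\bot$, where $\mathsf{usk}$ is a quantum state and everything else is classical. As usual, $\mathcal Y_\lambda$ and $R_\lambda$ are decidable in classical polynomial time, and $\ell$ is polynomially bounded with $1^\lambda\mapsto 1^{\ell(\lambda)}$ computable in polynomial time. **Security.** Let $q:\mathbb N\to\mathbb N$. For $\mathsf{coin}\in\{0,1\}$ the experiment is as follows. The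 challenger runs $\mathsf{Setup}(1^\lambda)$, sends $\mathsf{pk}$ to the adversary $\mathcal A$, and keeps a list $L$, initially empty. Throughout, $\mathcal A$ may query two oracles. On $y\in\mathcal Y_\lambda$, the key oracle returns $\bot$ if $L$ has an entry $(y,\cdot,\cdot)$; otherwise it runs $(\mathsf{usk},\mathsf{vk})\leftarrow\mathcal{KG}(\mathsf{msk},y)$, returns $\mathsf{usk}$, and adds $(y,\mathsf{vk},\bot)$ to $L$. On $(y,\mathsf{usk}')$, the verification oracle takes the entry $(y,\mathsf{vk},V)$ of $L$ (and returns $\bot$ if there is none), returns $d\leftarrow\mathcal{V}rfy(\mathsf{vk},\mathsf{usk}')$, and replaces $V$ by $d$ if $V=\bot$. Once, $\mathcal A$ sends $(x^*,m_0,m_1)$ with $x^*\in\mathcal X_\lambda$ and $m_0,m_1\in\{0,1\}^{\ell(\lambda)}$. If $L$ has at most $q(\lambda)$ entries $(y,\mathsf{vk},V)$ with $R_\lambda(x^*,y)=1$, and all of these have $V=\top$, then $\mathcal A$ receives $\mathsf{Enc}(\mathsf{pk},x^*,m_{\mathsf{coin}})$; otherwise the experiment ends with output $0$. Afterwards key queries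 $y$ with $R_\lambda(x^*,y)=1$ are refused. Finally $\mathcal A$ outputs a bit, which is the output of the experiment. The scheme is *$q$-bounded distinguishing key Ada-IND-KLA secure* if for every QPT $\mathcal A$ the absolute difference of the probabilities of output $1$ for $\mathsf{coin}=0$ and $\mathsf{coin}=1$ is negligible in $\lambda$. *Sel-IND-KLA* security is defined in the same way, except that $\mathcal A$ has to declare $x^*$ at the beginning, before it receives $\mathsf{pk}$. **Construction.** Let $\mathsf{1ABE}$ be an ABE-SKL scheme as above, and let $v=v(\lambda)$, $w=w(\lambda)\ge 1$. The scheme $\mathsf{qABE}$, for the same relation and message space, is the following. - $\mathsf{Setup}$: run $(\mathsf{pk}_{i,j},\mathsf{msk}_{i,j})\leftarrow\mathsf{1ABE}.\mathsf{Setup}(1^\lambda)$ for $i\in[v]$, $j\in[w]$; $\mathsf{pk}=(\mathsf{pk}_{i,j})_{i,j}$, $\mathsf{msk}=(\mathsf{msk}_{i,j})_{i,j}$. - $\mathcal{KG}(\mathsf{msk},y)$: choose independent uniform $j_i\in[w]$ for $i\in[v]$, and run $(\mathsf{vk}_i,\mathsf{usk}_i)\leftarrow\mathsf{1ABE}.\mathcal{KG}(\mathsf{msk}_{i,j_i},y)$;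 $\mathsf{usk}=(j_i,\mathsf{usk}_i)_{i}$, $\mathsf{vk}=(\mathsf{vk}_i)_i$. - $\mathsf{Enc}(\mathsf{pk},x,m)$: choose uniform $\mu_1,\dots,\mu_{v-1}\in\{0,1\}^{\ell}$, set $\mu_v=\mu_1\oplus\dots\oplus\mu_{v-1}\oplus m$, and let $\mathsf{ct}$ consist of independent encryptions $\mathsf{ct}_{i,j}\leftarrow\mathsf{1ABE}.\mathsf{Enc}(\mathsf{pk}_{i,j},x,\mu_i)$ for $i\in[v]$, $j\in[w]$. - $\mathcal{D}ec(\mathsf{usk},x,\mathsf{ct})$: output $\bigoplus_i\mathsf{1ABE}.\mathcal{D}ec(\mathsf{usk}_i,x,\mathsf{ct}_{i,j_i})$. - $\mathcal{V}rfy(\mathsf{vk},\mathsf{usk}')$: accept if and only if $\mathsf{1ABE}.\mathcal{V}rfy(\mathsf{vk}_i,\mathsf{usk}'_i)=\top$ for all $i\in[v]$. **Theorem.** Let $q:\mathbb N\to\mathbb N$ with $q(\lambda)\ge 1$ for all $\lambda$ be polynomially bounded, with $1^\lambda\mapsto 1^{q(\lambda)}$ computable in polynomial time (for example, a polynomial).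 1. (Adaptive) Let $n:\mathbb N\to\mathbb N$ be polynomially bounded, with $1^\lambda\mapsto1^{n(\lambda)}$ computable in polynomial time (for example, a polynomial), and suppose $|\mathcal X_\lambda|\le 2^{n(\lambda)}$ for all $\lambda$. If $\mathsf{1ABE}$ is $1$-bounded distinguishing key Ada-IND-KLA secure, then $\mathsf{qABE}$ with $v=2(\lambda+n(\lambda))$ and $w=q(\lambda)^2$ is $q$-bounded distinguishing key Ada-IND-KLA secure. 2. (Selective) If $\mathsf{1ABE}$ is $1$-bounded distinguishing key Sel-IND-KLA secure, then $\mathsf{qABE}$ with $v=\lambda$ and $w=q(\lambda)^2$ is $q$-bounded distinguishing key Sel-IND-KLA secure. -/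

import Mathlib

open scoped Classical

noncomputable section

/-! ### Classical and quantum data -/

/-- Classical data: finite binary trees (bit strings, lists, tuples, tables are coded in them). -/
inductive Data where
  | nil : Data
  | pair : Data → Data → Data

namespace Data

/-- Number of internal nodes; a list of `n` empty items has size `n`. -/
def size : Data → ℕ
  | nil => 0
  | pair a b => a.size + b.size + 1

def fst : Data → Data
  | nil => nil
  | pair a _ => a

def snd : Data → Data
  | nil => nil
  | pair _ b => b

/-- The truth values: `nil` is false (and also stands for the reject symbol `⊥`). -/
def ofBool : Bool → Data
  | false => nil
  | true => pair nil nil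

def ofList : List Data → Data
  | [] => nil
  | a :: l => pair a (ofList l)

def toList : Data → List Data
  | nil => []
  | pair a b => a :: b.toList

/-- The number `n` in unary, i.e. the string `1^n`. -/
def unary : ℕ → Data
  | 0 => nil
  | n + 1 => pair nil (unary n)

end Data

/-- Data that may hold qubits: binary trees whose leaves are empty or (the address of) a qubit. -/
inductive QData where
  | nil : QData
  | qubit : ℕ → QData
  | pair : QData → QData → QData

namespace QData

def size : QData → ℕ
  | nil => 0
  | qubit _ => 1
  | pair a b => a.size + b.size + 1

def fst : QData → QData
  | pair a _ => a
  | _ => nil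

def snd : QData → QData
  | pair _ b => b
  | _ => nil

def ofList : List QData → QData
  | [] => nil
  | a :: l => pair a (ofList l)

/-- The `i`-th item of a list. -/
def get : QData → ℕ → QData
  | d, 0 => d.fst
  | d, i + 1 => d.snd.get i

/-- The classical part: all qubits are forgotten. -/
def erase : QData → Data
  | nil => Data.nil
  | qubit _ => Data.nil
  | pair a b => Data.pair a.erase b.erase

end QData

def Data.toQ : Data → QData
  | Data.nil => QData.nil
  | Data.pair a b => QData.pair a.toQ b.toQ

/-! ### The quantum memory -/

/-- A memory of qubits with addresses in `ℕ`. A basis state is the finite set of the addresses that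
hold `1`. The pure state `ψ` need not be normalized: it stands for its ray. The addresses `≥ next`
have never been handed out and hold `0`. -/
structure QState where
  next : ℕ
  ψ : Finset ℕ →₀ ℂ

namespace QState

def blank : QState := ⟨0, Finsupp.single ∅ 1⟩

/-- The squared norm. -/
def normSq (ψ : Finset ℕ →₀ ℂ) : NNReal := ψ.sum fun _ c => ‖c‖₊ ^ 2

/-- The one-qubit gate with matrix `U` on qubit `a`. -/
def gate (U : Bool → Bool → ℂ) (a : ℕ) (q : QState) : QState :=
  ⟨q.next, q.ψ.sum fun s c =>
    Finsupp.single (s.erase a) (U false (decide (a ∈ s)) * c) +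
      Finsupp.single (insert a s) (U true (decide (a ∈ s)) * c)⟩

/-- The Hadamard gate. -/
def hadamard : Bool → Bool → ℂ
  | true, true => -((Real.sqrt 2 : ℝ) : ℂ)⁻¹
  | _, _ => ((Real.sqrt 2 : ℝ) : ℂ)⁻¹

/-- The `π/8` gate. -/
def tMatrix : Bool → Bool → ℂ
  | false, false => 1
  | true, true => Complex.exp (Complex.I * (Real.pi / 4))
  | _, _ => 0

/-- The controlled-not gate, control `a`, target `b`. -/
def cnot (a b : ℕ) (q : QState) : QState :=
  if a = b then q
  else ⟨q.next, q.ψ.mapDomain fun s => if a ∈ s then symmDiff s {b} else s⟩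

/-- The probability that a measurement of qubit `a` gives `1`. -/
def prob (a : ℕ) (q : QState) : NNReal :=
  normSq (q.ψ.filter fun s => a ∈ s) / normSq q.ψ

theorem prob_le_one (a : ℕ) (q : QState) : q.prob a ≤ 1 := by
  unfold prob normSq
  refine div_le_one_of_le₀ ?_ (by positivity)
  rw [Finsupp.sum, Finsupp.sum, Finsupp.support_filter]
  refine le_trans (Finset.sum_le_sum fun s hs => ?_)
    (Finset.sum_le_sum_of_subset (Finset.filter_subset _ _))
  exact le_of_eq (by rw [Finsupp.filter_apply_pos (fun s : Finset ℕ => a ∈ s) q.ψ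
    (Finset.mem_filter.1 hs).2])

/-- A bit that is `1` with probability `p`. -/
def coinFlip (p : NNReal) (hp : p ≤ 1) : PMF Bool :=
  PMF.ofFintype (fun b => ((if b then p else 1 - p : NNReal) : ENNReal)) (by
    rw [Fintype.sum_bool]
    simp only [if_true, Bool.false_eq_true, if_false]
    rw [← ENNReal.coe_add, add_tsub_cancel_of_le hp, ENNReal.coe_one])

/-- The measurement of qubit `a` in the computational basis (Born rule and projection). -/
def measure (a : ℕ) (q : QState) : PMF (Bool × QState) :=
  (coinFlip (q.prob a) (q.prob_le_one a)).map fun b =>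
    (b, ⟨q.next, q.ψ.filter fun s => decide (a ∈ s) = b⟩)

end QState

/-- Randomized computations with a classical description of the result that act on the quantum
memory. -/
abbrev QM (α : Type) : Type := StateT QState PMF α

/-- Runs `f 0, f 1, …` one after the other and collects the results. -/
def seqFin {m : Type → Type} [Monad m] {α : Type} : {n : ℕ} → (Fin n → m α) → m (Fin n → α)
  | 0, _ => pure Fin.elim0
  | _ + 1, f => do
      let a ← f 0
      let g ← seqFin fun i => f i.succ
      pure (Fin.cons a g)

/-- The uniform distribution on a list (`nil` for the empty list). -/
def uniformList (l : List Data) : PMF Data :=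
  if h : 0 < l.length then
    haveI : Nonempty (Fin l.length) := ⟨⟨0, h⟩⟩
    (PMF.uniformOfFintype (Fin l.length)).map l.get
  else PMF.pure Data.nil

/-! ### Quantum programs and their running time -/

/-- Classical expressions over the program variables. -/
inductive Expr where
  | var : ℕ → Expr
  | nil : Expr
  | pair : Expr → Expr → Expr
  | fst : Expr → Expr
  | snd : Expr → Expr
  | eq : Expr → Expr → Expr

/-- Values of expressions; only the classical part of a variable can be read (no cloning). -/
def Expr.eval (s : ℕ → QData) : Expr → Data
  | var x => (s x).erase
  | nil => Data.nil
  | pair a b => Data.pair (a.eval s) (b.eval s)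
  | fst a => (a.eval s).fst
  | snd a => (a.eval s).snd
  | eq a b => Data.ofBool (decide (a.eval s = b.eval s))

/-- Quantum oracle programs: a structured language over finitely many variables (of the infinite
supply `ℕ`) with bounded loops, random choices, the universal gate set Hadamard, `π/8`,
controlled-not, measurements and oracle calls. Qubits are only moved, never copied: a program can
touch only qubits that it created or received and has not given away. With the costs defined below,
and trees shared in memory, polynomial time is that of a Turing machine with quantum gates. -/
inductive Prog where
  /-- do nothing -/
  | skip : Prog
  /-- `x := e`, a classical value -/
  | assign (x : ℕ) (e : Expr) : Prog
  /-- `x := (y, z)`; the contents of `y` and `z` are moved, not copied -/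
  | join (x y z : ℕ) : Prog
  /-- `(x, y) := z`; the content of `z` is moved, not copied -/
  | split (x y z : ℕ) : Prog
  /-- `x :=` a uniformly random element of the list `e` -/
  | choose (x : ℕ) (e : Expr) : Prog
  /-- `x :=` a new qubit in state `|0⟩` -/
  | new (x : ℕ) : Prog
  /-- the Hadamard gate on the qubit in `x` -/
  | had (x : ℕ) : Prog
  /-- the `π/8` gate on the qubit in `x` -/
  | tgate (x : ℕ) : Prog
  /-- the controlled-not gate, control `x`, target `y` -/
  | cnot (x y : ℕ) : Prog
  /-- measure the qubit in `y` and put the bit into `x` -/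
  | meas (x y : ℕ) : Prog
  /-- send the content of `y` to oracle number `k`, put the answer into `x` -/
  | call (k x y : ℕ) : Prog
  /-- first `P`, then `Q` -/
  | seq (P Q : Prog) : Prog
  /-- if `e` is not `nil` then `P` else `Q` -/
  | ite (e : Expr) (P Q : Prog) : Prog
  /-- repeat `P` as many times as the size of the present value of `e` -/
  | loop (e : Expr) (P : Prog) : Prog

/-- A stateful oracle with private state in `σ`: it receives a message on one of its channels,
and answers. -/
abbrev Oracle (σ : Type) : Type := ℕ → QData → σ → QM (QData × σ)

/-- A configuration of a running program: variables, state of the oracle, quantum memory, and the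
running time so far. -/
structure Conf (σ : Type) where
  store : ℕ → QData
  orc : σ
  mem : QState
  cost : ℕ

namespace Conf

variable {σ : Type}

/-- The input is in variable `0`, all other variables are empty. -/
def start (v : QData) (st : σ) (q : QState) : Conf σ :=
  ⟨fun x => if x = 0 then v else QData.nil, st, q, 0⟩

def set (c : Conf σ) (x : ℕ) (v : QData) : Conf σ :=
  { c with store := Function.update c.store x v }

def tick (c : Conf σ) (n : ℕ) : Conf σ := { c with cost := c.cost + n }

def setMem (c : Conf σ) (q : QState) : Conf σ := { c with mem := q }

end Conf

/-- Repeats a random step `n` times. -/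
def iterPMF {α : Type} (f : α → PMF α) : ℕ → α → PMF α
  | 0, a => PMF.pure a
  | n + 1, a => (f a).bind (iterPMF f n)

namespace Prog

/-- Execution. Every instruction costs one step; a message to an oracle also costs its size,
a random choice the length of the list, and a loop the number of its rounds. -/
def run {σ : Type} (O : Oracle σ) : Prog → Conf σ → PMF (Conf σ)
  | skip, c => PMF.pure (c.tick 1)
  | assign x e, c => PMF.pure ((c.tick 1).set x (e.eval c.store).toQ)
  | join x y z, c =>
      let c₁ := (c.tick 1).set y QData.nil
      let c₂ := c₁.set z QData.nil
      PMF.pure (c₂.set x (QData.pair (c.store y) (c₁.store z)))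
  | split x y z, c =>
      PMF.pure ((((c.tick 1).set z QData.nil).set x (c.store z).fst).set y (c.store z).snd)
  | choose x e, c =>
      (uniformList (e.eval c.store).toList).map fun d =>
        (c.tick (1 + (e.eval c.store).toList.length)).set x d.toQ
  | new x, c =>
      PMF.pure (((c.tick 1).set x (QData.qubit c.mem.next)).setMem ⟨c.mem.next + 1, c.mem.ψ⟩)
  | had x, c =>
      match c.store x with
      | QData.qubit a => PMF.pure ((c.tick 1).setMem (c.mem.gate QState.hadamard a))
      | _ => PMF.pure (c.tick 1)
  | tgate x, c =>
      match c.store x with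
      | QData.qubit a => PMF.pure ((c.tick 1).setMem (c.mem.gate QState.tMatrix a))
      | _ => PMF.pure (c.tick 1)
  | cnot x y, c =>
      match c.store x, c.store y with
      | QData.qubit a, QData.qubit b => PMF.pure ((c.tick 1).setMem (c.mem.cnot a b))
      | _, _ => PMF.pure (c.tick 1)
  | meas x y, c =>
      match c.store y with
      | QData.qubit a => (c.mem.measure a).map fun r =>
          (((c.tick 1).set y QData.nil).set x (Data.ofBool r.1).toQ).setMem r.2
      | _ => PMF.pure (c.tick 1)
  | call k x y, c =>
      (O k (c.store y) c.orc c.mem).map fun r =>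
        { ((c.tick (1 + (c.store y).size)).set y QData.nil).set x r.1.1 with
          orc := r.1.2, mem := r.2 }
  | seq P Q, c => (P.run O c).bind (Q.run O)
  | ite e P Q, c =>
      if e.eval c.store = Data.nil then Q.run O (c.tick 1) else P.run O (c.tick 1)
  | loop e P, c =>
      iterPMF (P.run O) (e.eval c.store).size (c.tick (1 + (e.eval c.store).size))

/-- The oracle that answers nothing. -/
def noOracle : Oracle Unit := fun _ _ _ => pure (QData.nil, ())

/-- Execution of a program without oracle. -/
def exec (P : Prog) (v : QData) (q : QState) : PMF (Conf Unit) :=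
  P.run noOracle (Conf.start v () q)

/-- Programs that call no oracle. -/
def CallFree : Prog → Prop
  | call _ _ _ => False
  | seq P Q => P.CallFree ∧ Q.CallFree
  | ite _ P Q => P.CallFree ∧ Q.CallFree
  | loop _ P => P.CallFree
  | _ => True

/-- Programs without quantum instructions. -/
def NoQubits : Prog → Prop
  | new _ | had _ | tgate _ | cnot _ _ | meas _ _ => False
  | seq P Q => P.NoQubits ∧ Q.NoQubits
  | ite _ P Q => P.NoQubits ∧ Q.NoQubits
  | loop _ P => P.NoQubits
  | _ => True

/-- The running time and the length of the output (variable `0`) are bounded by a polynomial in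
the length of the input. -/
def PolyTime (P : Prog) : Prop :=
  ∃ p : Polynomial ℕ, ∀ (v : QData) (q : QState), ∀ c ∈ (P.exec v q).support,
    c.cost + (c.store 0).size ≤ p.eval v.size

/-- A quantum polynomial-time algorithm without oracle. -/
def IsQPT (P : Prog) : Prop := P.CallFree ∧ P.PolyTime

/-- A classical probabilistic polynomial-time algorithm without oracle. -/
def IsPPT (P : Prog) : Prop := P.CallFree ∧ P.NoQubits ∧ P.PolyTime

/-- A quantum polynomial-time oracle algorithm: on input `1^lam` its running time is bounded by a
polynomial in `lam`, whatever the oracle answers. -/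
def IsQPTAdversary (A : Prog) : Prop :=
  ∃ p : Polynomial ℕ, ∀ (lam : ℕ) (σ : Type) (O : Oracle σ) (st : σ) (q : QState),
    ∀ c ∈ (A.run O (Conf.start (Data.unary lam).toQ st q)).support, c.cost ≤ p.eval lam

end Prog

/-- `1^lam ↦ 1^(f lam)` is computable in polynomial time (so `f` is polynomially bounded). -/
def UnaryComputable (f : ℕ → ℕ) : Prop :=
  ∃ P : Prog, P.IsPPT ∧ ∀ (lam : ℕ) (q : QState),
    ∀ c ∈ (P.exec (Data.unary lam).toQ q).support, c.store 0 = (Data.unary (f lam)).toQ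

/-! ### Attributes and messages -/

/-- Ciphertext attribute spaces `X`, key attribute spaces `Y`, and the relation. -/
structure AttrRel where
  X : ℕ → Set Data
  Y : ℕ → Set Data
  R : ℕ → Data → Data → Prop

/-- The relation on `X lam × Y lam` and membership in `Y lam` are decidable in polynomial time. -/
def AttrRel.PolyTimeDecidable (T : AttrRel) : Prop :=
  (∃ P : Prog, P.IsPPT ∧ ∀ (lam : ℕ), ∀ x ∈ T.X lam, ∀ y ∈ T.Y lam, ∀ (q : QState),
    ∀ c ∈ (P.exec (Data.pair (Data.unary lam) (Data.pair x y)).toQ q).support,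
      ((c.store 0).erase ≠ Data.nil ↔ T.R lam x y)) ∧
  (∃ P : Prog, P.IsPPT ∧ ∀ (lam : ℕ) (y : Data) (q : QState),
    ∀ c ∈ (P.exec (Data.pair (Data.unary lam) y).toQ q).support,
      ((c.store 0).erase ≠ Data.nil ↔ y ∈ T.Y lam))

/-- Messages: bit strings of length `l`; addition is bitwise XOR. -/
abbrev Msg (l : ℕ) : Type := Fin l → ZMod 2

def Msg.encode {l : ℕ} (m : Msg l) : Data :=
  Data.ofList (List.ofFn fun i => Data.ofBool (decide (m i = 1)))

/-- The message with the given code, if there is one (a code determines the message). -/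
def Msg.decode (l : ℕ) (d : Data) : Option (Msg l) :=
  if h : ∃ m : Msg l, m.encode = d then some h.choose else none

/-! ### ABE with secure key leasing -/

/-- An ABE-SKL scheme with message space `{0,1}^(ell lam)`: public keys, master secret keys,
verification keys and ciphertexts are classical, user secret keys are quantum data.
`setup` and `enc` are classical randomized; `kg`, `dec`, `vrfy` act on the quantum memory. -/
structure ABESKL (ell : ℕ → ℕ) where
  PK : ℕ → Type
  MSK : ℕ → Type
  VK : ℕ → Type
  CT : ℕ → Type
  /-- public keys as they are sent to other parties -/
  encodePK : ∀ lam, PK lam → Data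
  /-- ciphertexts as they are sent to other parties -/
  encodeCT : ∀ lam, CT lam → Data
  setup : ∀ lam, PMF (PK lam × MSK lam)
  /-- master secret key and key attribute to user secret key and verification key -/
  kg : ∀ lam, MSK lam → Data → QM (QData × VK lam)
  /-- public key, ciphertext attribute and message to ciphertext -/
  enc : ∀ lam, PK lam → Data → Msg (ell lam) → PMF (CT lam)
  /-- user secret key, ciphertext attribute and ciphertext to message or `⊥` -/
  dec : ∀ lam, QData → Data → CT lam → QM (Option (Msg (ell lam)))
  /-- verification key and (alleged) user secret key to accept or reject -/
  vrfy : ∀ lam, VK lam → QData → QM Bool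

/-- Five programs for an ABE-SKL scheme. -/
structure ABESKLPrograms where
  setup : Prog
  kg : Prog
  enc : Prog
  dec : Prog
  vrfy : Prog

/-- Setup and encryption are classical, key generation, decryption and verification are quantum,
and all of them run in polynomial time. -/
def ABESKLPrograms.Efficient (P : ABESKLPrograms) : Prop :=
  P.setup.IsPPT ∧ P.kg.IsQPT ∧ P.enc.IsPPT ∧ P.dec.IsQPT ∧ P.vrfy.IsQPT

/-- The scheme that the programs compute. Every algorithm also receives `1^lam`; inputs and outputs
are tuples. -/
def ABESKLPrograms.scheme (P : ABESKLPrograms) (ell : ℕ → ℕ) : ABESKL ell where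
  PK _ := Data
  MSK _ := Data
  VK _ := Data
  CT _ := Data
  encodePK _ pk := pk
  encodeCT _ ct := ct
  setup lam := (P.setup.exec (Data.unary lam).toQ QState.blank).map fun c =>
    ((c.store 0).fst.erase, (c.store 0).snd.erase)
  kg lam msk y := fun q =>
    (P.kg.exec (Data.pair (Data.unary lam) (Data.pair msk y)).toQ q).map fun c =>
      (((c.store 0).fst, (c.store 0).snd.erase), c.mem)
  enc lam pk x m :=
    (P.enc.exec (Data.pair (Data.unary lam) (Data.pair pk (Data.pair x m.encode))).toQ
      QState.blank).map fun c => (c.store 0).erase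
  dec lam usk x ct := fun q =>
    (P.dec.exec (QData.pair (Data.unary lam).toQ (QData.pair usk (Data.pair x ct).toQ)) q).map
      fun c => (Msg.decode (ell lam) (c.store 0).erase, c.mem)
  vrfy lam vk usk := fun q =>
    (P.vrfy.exec (QData.pair (Data.unary lam).toQ (QData.pair vk.toQ usk)) q).map
      fun c => (decide ((c.store 0).erase ≠ Data.nil), c.mem)

/-! ### The security experiment -/

section Experiment

variable {ell : ℕ → ℕ} (S : ABESKL ell) (T : AttrRel) (selective : Bool) (q : ℕ → ℕ)
  (coin : Bool) (lam : ℕ)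

/-- The state of the challenger, apart from its keys. -/
structure ChalState where
  /-- the public key has been sent -/
  started : Bool
  /-- the target declared at the beginning (selective experiment only) -/
  target : Option Data
  /-- the list of the entries `(y, vk, V)` -/
  keys : List (Data × S.VK lam × Bool)
  /-- the attribute of the challenge ciphertext, once this has been sent -/
  challenged : Option Data
  /-- the experiment has been stopped with output `0` -/
  aborted : Bool

/-- Start of the experiment: the public key is sent. In the selective experiment the adversary's
message is its target, declared before it sees the public key. -/
def startOracle (pk : S.PK lam) (msg : QData) (st : ChalState S lam) :
    QM (QData × ChalState S lam) :=
  if st.started then pure (QData.nil, st)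
  else pure ((S.encodePK lam pk).toQ,
    { st with started := true, target := if selective then some msg.erase else none })

/-- The key generation oracle. It refuses with `nil` attributes outside `Y lam`, repeated ones,
and, after the challenge, those that are related to the challenge attribute. -/
def kgOracle (msk : S.MSK lam) (msg : QData) (st : ChalState S lam) :
    QM (QData × ChalState S lam) :=
  if st.started = true ∧ st.aborted = false ∧ msg.erase ∈ T.Y lam ∧
      (∀ e ∈ st.keys, e.1 ≠ msg.erase) ∧ (∀ x ∈ st.challenged, ¬ T.R lam x msg.erase) then do
    let k ← S.kg lam msk msg.erase
    pure (QData.pair k.1 QData.nil, { st with keys := (msg.erase, k.2, false) :: st.keys })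
  else pure (QData.nil, st)

/-- The verification oracle, on a message `(y, usk')`. -/
def vrfyOracle (msg : QData) (st : ChalState S lam) : QM (QData × ChalState S lam) :=
  if st.started = true ∧ st.aborted = false then
    match st.keys.find? fun e => decide (e.1 = msg.fst.erase) with
    | none => pure (QData.nil, st)
    | some e => do
        let d ← S.vrfy lam e.2.1 msg.snd
        pure ((Data.ofBool d).toQ,
          { st with keys := st.keys.map fun e' =>
              if e'.1 = msg.fst.erase then (e'.1, e'.2.1, e'.2.2 || d) else e' })
  else pure (QData.nil, st)

/-- The challenge query, on a message `(x, (m₀, m₁))` (in the selective experiment the declared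
target replaces `x`). The challenger goes on only if the query is well-formed, at most `q lam`
entries have an attribute related to `x`, and all of these have been returned. -/
def challengeOracle (pk : S.PK lam) (msg : QData) (st : ChalState S lam) :
    QM (QData × ChalState S lam) :=
  if st.started = true ∧ st.aborted = false ∧ st.challenged = none then
    let x := st.target.getD msg.erase.fst
    let dist := st.keys.filter fun e => decide (T.R lam x e.1)
    match Msg.decode (ell lam) msg.erase.snd.fst, Msg.decode (ell lam) msg.erase.snd.snd with
    | some m₀, some m₁ =>
        if x ∈ T.X lam ∧ dist.length ≤ q lam ∧ ∀ e ∈ dist, e.2.2 = true then do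
          let ct ← StateT.lift (S.enc lam pk x (if coin then m₁ else m₀))
          pure ((S.encodeCT lam ct).toQ, { st with challenged := some x })
        else pure (QData.nil, { st with aborted := true })
    | _, _ => pure (QData.nil, { st with aborted := true })
  else pure (QData.nil, st)

/-- The challenger: channel `0` starts the experiment, `1` is the key generation oracle,
`2` the verification oracle, `3` the challenge query. -/
def challenger (pk : S.PK lam) (msk : S.MSK lam) : Oracle (ChalState S lam)
  | 0, msg, st => startOracle S selective lam pk msg st
  | 1, msg, st => kgOracle S T lam msk msg st
  | 2, msg, st => vrfyOracle S lam msg st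
  | 3, msg, st => challengeOracle S T q coin lam pk msg st
  | _, _, st => pure (QData.nil, st)

/-- The experiment with adversary `A`, whose guess is left in variable `0`. -/
def experiment (A : Prog) : PMF Bool := do
  let keys ← S.setup lam
  let c ← A.run (challenger S T selective q coin lam keys.1 keys.2)
    (Conf.start (Data.unary lam).toQ ⟨false, none, [], none, false⟩ QState.blank)
  pure (!c.orc.aborted && decide ((c.store 0).erase ≠ Data.nil))

/-- The advantage of `A`. -/
def advantage (A : Prog) : ℝ :=
  |(experiment S T selective q false lam A true).toReal -
    (experiment S T selective q true lam A true).toReal|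

/-- `q`-bounded distinguishing key security (selective or adaptive): every quantum polynomial-time
adversary has negligible advantage. -/
def BoundedKeySecure : Prop :=
  ∀ A : Prog, A.IsQPTAdversary →
    Asymptotics.SuperpolynomialDecay Filter.atTop (fun lam : ℕ => (lam : ℝ))
      fun lam => advantage S T selective q lam A

end Experiment

/-- `q`-bounded distinguishing key Ada-IND-KLA security. -/
abbrev AdaINDKLA {ell : ℕ → ℕ} (S : ABESKL ell) (T : AttrRel) (q : ℕ → ℕ) : Prop :=
  BoundedKeySecure S T false q

/-- `q`-bounded distinguishing key Sel-IND-KLA security. -/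
abbrev SelINDKLA {ell : ℕ → ℕ} (S : ABESKL ell) (T : AttrRel) (q : ℕ → ℕ) : Prop :=
  BoundedKeySecure S T true q

/-! ### The balls-and-bins construction -/

/-- The shares of `m`: all but the last are given, the last is the XOR of these and `m`. -/
def shares {l : ℕ} (v : ℕ) (μ : Fin (v - 1) → Msg l) (m : Msg l) (i : Fin v) : Msg l :=
  if h : (i : ℕ) < v - 1 then μ ⟨i, h⟩ else (∑ k, μ k) + m

/-- The balls-and-bins construction from `v × w` instances of `S`. -/
def ballsAndBins {ell : ℕ → ℕ} (S : ABESKL ell) (v w : ℕ → ℕ) (hw : ∀ lam, 0 < w lam) :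
    ABESKL ell where
  PK lam := Fin (v lam) → Fin (w lam) → S.PK lam
  MSK lam := Fin (v lam) → Fin (w lam) → S.MSK lam
  VK lam := Fin (v lam) → S.VK lam
  CT lam := Fin (v lam) → Fin (w lam) → S.CT lam
  encodePK lam pk := Data.ofList (List.ofFn fun i => Data.ofList (List.ofFn fun j =>
    S.encodePK lam (pk i j)))
  encodeCT lam ct := Data.ofList (List.ofFn fun i => Data.ofList (List.ofFn fun j =>
    S.encodeCT lam (ct i j)))
  setup lam := do
    let t ← seqFin fun _ : Fin (v lam) => seqFin fun _ : Fin (w lam) => S.setup lam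
    pure (fun i j => (t i j).1, fun i j => (t i j).2)
  kg lam msk y :=
    haveI : Nonempty (Fin (w lam)) := ⟨⟨0, hw lam⟩⟩
    do
    let j ← StateT.lift (PMF.uniformOfFintype (Fin (v lam) → Fin (w lam)))
    let k ← seqFin fun i => S.kg lam (msk i (j i)) y
    pure (QData.ofList (List.ofFn fun i => QData.pair (Data.unary (j i)).toQ (k i).1),
      fun i => (k i).2)
  enc lam pk x m := do
    let μ ← PMF.uniformOfFintype (Fin (v lam - 1) → Msg (ell lam))
    seqFin fun i => seqFin fun j => S.enc lam (pk i j) x (shares (v lam) μ m i)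
  dec lam usk x ct := do
    let r ← seqFin fun i : Fin (v lam) =>
      let j := (usk.get i).fst.erase.size
      if h : j < w lam then S.dec lam (usk.get i).snd x (ct i ⟨j, h⟩) else pure none
    pure (if ∀ i, (r i).isSome then some (∑ i, (r i).getD 0) else none)
  vrfy lam vk usk := do
    let d ← seqFin fun i => S.vrfy lam (vk i) (usk.get i).snd
    pure (decide (∀ i, d i = true))

end

/-! Keys behave like balls: in each of the `v` rows a key occupies one of the `w = q²` instances,
uniformly and independently. Fix a challenge attribute. When the challenge is granted there are at
most `q` keys related to it, and none can be added later. In one row two of them share an instance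
with probability at most `q(q-1)/2 / q² ≤ 1/2`, so all rows have such a collision with probability
at most `2^(-v)`. In the selective experiment the attribute is known before the first key; in the
adaptive one a union bound over at most `2^n` attributes still leaves at most `2^(-lam)`. Since keys
are requested adaptively, the estimate takes the form of a supermartingale along the run
(`potential`, `expect_potential_cons`, `Prog.run_expect_le`).

If some row has no collision, let `i` be the first such row. The shares can be sampled so that only
the share of row `i` depends on the message (`map_shares`). Its `w` encryptions are switched from
`m₀` to `m₁` one column at a time (`hybridEnc`). Instance `(i, k)` holds at most one related key
because row `i` is free of collisions (`Sim.outerKeys_related_length`), so 1-bounded security covers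
each switch. The reduction guesses `i` and `k`, places its own challenger (the outer instance) at
`(i, k)` and creates everything else itself. At the challenge it checks that `i` is the first
collision-free row; otherwise it sends an ill-formed query, and both experiments end with output 0.
A key that is accepted as a whole is accepted in row `i`, so the outer challenger also counts it as
returned. Runs without a challenge do not depend on the coin. Telescoping over `k` and summing over
`i` gives advantage at most `v * w` times that of the reduction plus the collision probability
(`advantage_le_hybrids`, `advantage_le_reduction`).

The longest part shows that the reduction is a polynomial-time program and that its simulation is
exact. Programs are assembled from closure properties of polynomial-time operations that never copy
qubits (`QPoly`, `EPoly`) and of classical ones (`RPoly`, `DPoly`, `BPoly`); `exists_reduction`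
compiles an adversary with simulated oracles into one program. Exactness is proved by couplings:
`Prog.subst_rel` and `Prog.run_rel` lift a coupling of single oracle calls to whole runs, and
`Sim.Rel` is the invariant relating the reduction to the hybrid experiment. -/

noncomputable section

open scoped ENNReal
open Function (update update_apply update_of_ne update_self)

/-! ### Couplings -/

/-- There is a coupling of `μ` and `ν` that is supported on the relation `R`. -/
def PMFRel {α β : Type*} (R : α → β → Prop) (μ : PMF α) (ν : PMF β) : Prop :=
  ∃ ρ : PMF (α × β), ρ.map Prod.fst = μ ∧ ρ.map Prod.snd = ν ∧ ∀ p ∈ ρ.support, R p.1 p.2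

theorem PMF.bind_congr_support {α β : Type*} (p : PMF α) {f g : α → PMF β}
    (h : ∀ a ∈ p.support, f a = g a) : p.bind f = p.bind g := by
  ext b
  simp only [PMF.bind_apply]
  refine tsum_congr fun a => ?_
  by_cases ha : p a = 0
  · simp [ha]
  · rw [h a ((PMF.mem_support_iff _ _).2 ha)]

theorem PMF.map_congr_support {α β : Type*} (p : PMF α) {f g : α → β}
    (h : ∀ a ∈ p.support, f a = g a) : p.map f = p.map g :=
  p.bind_congr_support fun a ha => by simp [h a ha]

theorem PMF.eq_pure_of_support {α : Type*} (p : PMF α) {a : α} (h : ∀ b ∈ p.support, b = a) :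
    p = PMF.pure a := by
  have : p.map id = p.map (fun _ => a) := p.map_congr_support h
  rw [PMF.map_id] at this
  rw [this]
  exact p.map_const a

namespace PMFRel

variable {α β γ δ : Type*} {R : α → β → Prop} {μ : PMF α} {ν : PMF β}

theorem pure {a : α} {b : β} (h : R a b) : PMFRel R (PMF.pure a) (PMF.pure b) :=
  ⟨PMF.pure (a, b), PMF.pure_map _ _, PMF.pure_map _ _, by
    intro p hp
    rw [PMF.support_pure, Set.mem_singleton_iff] at hp
    rw [hp]; exact h⟩

theorem mono {R' : α → β → Prop} (h : PMFRel R μ ν) (hR : ∀ a b, R a b → R' a b) :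
    PMFRel R' μ ν := by
  obtain ⟨ρ, h1, h2, h3⟩ := h
  exact ⟨ρ, h1, h2, fun p hp => hR _ _ (h3 p hp)⟩

/-- The independent coupling works. It is used once both runs are in bad states and their joint
behaviour no longer matters. -/
theorem of_support (h : ∀ a ∈ μ.support, ∀ b ∈ ν.support, R a b) : PMFRel R μ ν := by
  refine ⟨μ.bind fun a => ν.map fun b => (a, b), ?_, ?_, ?_⟩
  · rw [PMF.map_bind]
    conv_rhs => rw [← PMF.bind_pure μ]
    congr 1; funext a
    rw [PMF.map_comp]; exact PMF.map_const ν a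
  · rw [PMF.map_bind]
    have : (fun a => PMF.map Prod.snd (PMF.map (fun b => (a, b)) ν)) = fun _ : α => ν := by
      funext a
      rw [PMF.map_comp]; exact PMF.map_id ν
    rw [this, PMF.bind_const]
  · intro p hp
    rw [PMF.mem_support_bind_iff] at hp
    obtain ⟨a, ha, hp⟩ := hp
    rw [PMF.mem_support_map_iff] at hp
    obtain ⟨b, hb, rfl⟩ := hp
    exact h a ha b hb

theorem refl (μ : PMF α) : PMFRel (fun a b => a = b) μ μ := by
  refine ⟨μ.map fun a => (a, a), ?_, ?_, ?_⟩
  · rw [PMF.map_comp]; exact PMF.map_id μ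
  · rw [PMF.map_comp]; exact PMF.map_id μ
  · intro p hp
    rw [PMF.mem_support_map_iff] at hp
    obtain ⟨a, _, rfl⟩ := hp
    rfl

theorem refl_support (μ : PMF α) : PMFRel (fun a b => a = b ∧ a ∈ μ.support) μ μ := by
  refine ⟨μ.map fun a => (a, a), ?_, ?_, ?_⟩
  · rw [PMF.map_comp]; exact PMF.map_id μ
  · rw [PMF.map_comp]; exact PMF.map_id μ
  · intro p hp
    rw [PMF.mem_support_map_iff] at hp
    obtain ⟨a, ha, rfl⟩ := hp
    exact ⟨rfl, ha⟩

theorem bind {S : γ → δ → Prop} {f : α → PMF γ} {g : β → PMF δ} (h : PMFRel R μ ν)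
    (hfg : ∀ a b, R a b → PMFRel S (f a) (g b)) : PMFRel S (μ.bind f) (ν.bind g) := by
  obtain ⟨ρ, rfl, rfl, h3⟩ := h
  -- `choose!` needs a default coupling for unrelated pairs; the support of `ρ` is nonempty and
  -- supplies one.
  have : Nonempty (PMF (γ × δ)) := by
    obtain ⟨p, hp⟩ := ρ.support_nonempty
    obtain ⟨τ, -⟩ := hfg _ _ (h3 p hp)
    exact ⟨τ⟩
  choose! τ hτ using hfg
  refine ⟨ρ.bindOnSupport fun p _ => τ p.1 p.2, ?_, ?_, ?_⟩
  · have : (ρ.bindOnSupport fun p _ => τ p.1 p.2) = ρ.bind fun p => τ p.1 p.2 :=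
      PMF.bindOnSupport_eq_bind ρ _
    rw [this, PMF.map_bind, PMF.bind_map]
    exact ρ.bind_congr_support fun p hp => (hτ _ _ (h3 p hp)).1
  · have : (ρ.bindOnSupport fun p _ => τ p.1 p.2) = ρ.bind fun p => τ p.1 p.2 :=
      PMF.bindOnSupport_eq_bind ρ _
    rw [this, PMF.map_bind, PMF.bind_map]
    exact ρ.bind_congr_support fun p hp => (hτ _ _ (h3 p hp)).2.1
  · intro p hp
    rw [PMF.mem_support_bindOnSupport_iff] at hp
    obtain ⟨x, hx, hp⟩ := hp
    exact (hτ _ _ (h3 x hx)).2.2 p hp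

theorem map {S : γ → δ → Prop} {f : α → γ} {g : β → δ} (h : PMFRel R μ ν)
    (hfg : ∀ a b, R a b → S (f a) (g b)) : PMFRel S (μ.map f) (ν.map g) :=
  h.bind fun a b hab => PMFRel.pure (hfg a b hab)

theorem map_left {S : γ → β → Prop} {f : α → γ} (h : PMFRel R μ ν)
    (hfg : ∀ a b, R a b → S (f a) b) : PMFRel S (μ.map f) ν := by
  have := h.map (S := S) (f := f) (g := id) hfg
  rwa [PMF.map_id] at this

theorem map_eq {f : α → γ} {g : β → γ} (h : PMFRel R μ ν)
    (hfg : ∀ a b, R a b → f a = g b) : μ.map f = ν.map g := by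
  obtain ⟨ρ, rfl, rfl, h3⟩ := h
  rw [PMF.map_comp, PMF.map_comp]
  exact ρ.map_congr_support fun p hp => hfg _ _ (h3 p hp)

theorem symm (h : PMFRel R μ ν) : PMFRel (fun b a => R a b) ν μ := by
  obtain ⟨ρ, rfl, rfl, h3⟩ := h
  refine ⟨ρ.map Prod.swap, ?_, ?_, ?_⟩
  · rw [PMF.map_comp]; rfl
  · rw [PMF.map_comp]; rfl
  · intro p hp
    rw [PMF.mem_support_map_iff] at hp
    obtain ⟨a, ha, rfl⟩ := hp
    exact h3 _ ha

/-- Gluing of couplings over the common marginal `ν`: sample from `ρ`, then from the law `κ` of `τ`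
conditioned on its first component. Outside the support of `ν` conditioning is undefined and `κ`
takes the irrelevant value `τ`. -/
theorem trans {S : β → γ → Prop} {ξ : PMF γ} (h : PMFRel R μ ν) (h' : PMFRel S ν ξ) :
    PMFRel (fun a c => ∃ b, R a b ∧ S b c) μ ξ := by
  obtain ⟨ρ, rfl, hρ, h1⟩ := h
  obtain ⟨τ, h2, rfl, h3⟩ := h'
  let κ : β → PMF (β × γ) := fun b =>
    if h : ∃ a ∈ {x : β × γ | x.1 = b}, a ∈ τ.support then τ.filter _ h else τ
  have hκ : ∀ b ∈ ν.support, ∀ x ∈ (κ b).support, x.1 = b ∧ x ∈ τ.support := by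
    intro b hb x hx
    have h : ∃ a ∈ {x : β × γ | x.1 = b}, a ∈ τ.support := by
      rw [← h2, PMF.mem_support_map_iff] at hb
      obtain ⟨a, ha, rfl⟩ := hb
      exact ⟨a, rfl, ha⟩
    simp only [κ, dif_pos h, PMF.mem_support_filter_iff] at hx
    exact hx
  have hτ : ν.bind κ = τ := by
    ext x
    rw [PMF.bind_apply, tsum_eq_single x.1]
    · by_cases hx : τ x = 0
      · rw [hx, mul_eq_zero]
        by_cases hb : ν x.1 = 0
        · exact Or.inl hb
        · refine Or.inr ?_
          by_contra h
          exact (PMF.mem_support_iff _ _).1 (hκ x.1 ((PMF.mem_support_iff _ _).2 hb) x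
            ((PMF.mem_support_iff _ _).2 h)).2 hx
      · have h : ∃ a ∈ {y : β × γ | y.1 = x.1}, a ∈ τ.support :=
          ⟨x, rfl, (PMF.mem_support_iff _ _).2 hx⟩
        have hν : ν x.1 = ∑' a, ({y : β × γ | y.1 = x.1}).indicator τ a := by
          rw [← h2, PMF.map_apply]
          refine tsum_congr fun a => ?_
          simp only [Set.indicator_apply, Set.mem_ofPred_eq, eq_comm]
        simp only [κ, dif_pos h, PMF.filter_apply]
        rw [← hν, Set.indicator_of_mem (by simp), mul_comm, mul_assoc, ENNReal.inv_mul_cancel,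
          mul_one]
        · rw [hν]
          intro h0
          rw [ENNReal.tsum_eq_zero] at h0
          have := h0 x
          rw [Set.indicator_of_mem (by simp)] at this
          exact hx this
        · exact PMF.apply_ne_top _ _
    · intro b hb
      rw [mul_eq_zero]
      by_cases h : ν b = 0
      · exact Or.inl h
      · refine Or.inr ?_
        by_contra h'
        exact hb ((hκ b ((PMF.mem_support_iff _ _).2 h) x ((PMF.mem_support_iff _ _).2 h')).1).symm
  refine ⟨ρ.bind fun p => (κ p.2).map fun x => (p.1, x.2), ?_, ?_, ?_⟩
  · rw [PMF.map_bind]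
    refine ρ.bind_congr_support fun p _ => ?_
    rw [PMF.map_comp]
    exact PMF.map_const _ _
  · have : (ρ.map Prod.snd).bind (fun b => (κ b).map Prod.snd) = τ.map Prod.snd := by
      rw [hρ, ← PMF.map_bind, hτ]
    rw [← this, PMF.map_bind, PMF.bind_map]
    refine ρ.bind_congr_support fun p _ => ?_
    rw [PMF.map_comp]
    rfl
  · intro y hy
    rw [PMF.mem_support_bind_iff] at hy
    obtain ⟨p, hp, hy⟩ := hy
    rw [PMF.mem_support_map_iff] at hy
    obtain ⟨x, hx, rfl⟩ := hy
    obtain ⟨e, hx'⟩ := hκ p.2 (by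
      rw [← hρ, PMF.mem_support_map_iff]; exact ⟨p, hp, rfl⟩) x hx
    exact ⟨p.2, h1 p hp, e ▸ h3 x hx'⟩

theorem exists_right (h : PMFRel R μ ν) {a : α} (ha : a ∈ μ.support) :
    ∃ b ∈ ν.support, R a b := by
  obtain ⟨ρ, rfl, rfl, h3⟩ := h
  rw [PMF.mem_support_map_iff] at ha
  obtain ⟨p, hp, rfl⟩ := ha
  exact ⟨p.2, (PMF.mem_support_map_iff _ _ _).2 ⟨p, hp, rfl⟩, h3 p hp⟩

theorem exists_left (h : PMFRel R μ ν) {b : β} (hb : b ∈ ν.support) :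
    ∃ a ∈ μ.support, R a b := h.symm.exists_right hb

theorem and_support (h : PMFRel R μ ν) :
    PMFRel (fun a b => R a b ∧ a ∈ μ.support ∧ b ∈ ν.support) μ ν := by
  obtain ⟨ρ, rfl, rfl, h3⟩ := h
  exact ⟨ρ, rfl, rfl, fun p hp => ⟨h3 p hp, (PMF.mem_support_map_iff _ _ _).2 ⟨p, hp, rfl⟩,
    (PMF.mem_support_map_iff _ _ _).2 ⟨p, hp, rfl⟩⟩⟩

theorem iterPMF {α β : Type} {R : α → β → Prop} {f : α → PMF α} {g : β → PMF β} (hfg : ∀ a b, R a b → PMFRel R (f a) (g b))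
    (n : ℕ) : ∀ a b, R a b → PMFRel R (iterPMF f n a) (iterPMF g n b) := by
  induction n with
  | zero => exact fun a b h => PMFRel.pure h
  | succ n ih => exact fun a b h => (hfg a b h).bind ih

end PMFRel

/-! ### Programs: renaming of variables and replacement of oracle calls -/

namespace Expr

def rename (f : ℕ → ℕ) : Expr → Expr
  | var x => var (f x)
  | nil => nil
  | pair a b => pair (a.rename f) (b.rename f)
  | fst a => fst (a.rename f)
  | snd a => snd (a.rename f)
  | eq a b => eq (a.rename f) (b.rename f)

theorem eval_rename (f : ℕ → ℕ) (s : ℕ → QData) (e : Expr) :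
    (e.rename f).eval s = e.eval (s ∘ f) := by
  induction e <;> simp_all [rename, eval]

end Expr

namespace Prog

/-- Renames the variables along `f`, and replaces the oracle calls by programs. -/
def subst (f : ℕ → ℕ) (C : ℕ → ℕ → ℕ → Prog) : Prog → Prog
  | skip => skip
  | assign x e => assign (f x) (e.rename f)
  | join x y z => join (f x) (f y) (f z)
  | split x y z => split (f x) (f y) (f z)
  | choose x e => choose (f x) (e.rename f)
  | new x => new (f x)
  | had x => had (f x)
  | tgate x => tgate (f x)
  | cnot x y => cnot (f x) (f y)
  | meas x y => meas (f x) (f y)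
  | call k x y => C k x y
  | seq P Q => seq (P.subst f C) (Q.subst f C)
  | ite e P Q => ite (e.rename f) (P.subst f C) (Q.subst f C)
  | loop e P => loop (e.rename f) (P.subst f C)

variable {σ σ' : Type}

/-- A function of the oracle's state whose mean does not grow in oracle calls does not grow in
mean during the run of a program. -/
theorem run_expect_le (O : Oracle σ) (Φ : σ → ENNReal)
    (hO : ∀ k msg st q, ∑' r, O k msg st q r * Φ r.1.2 ≤ Φ st) (P : Prog) :
    ∀ c : Conf σ, ∑' c', P.run O c c' * Φ c'.orc ≤ Φ c.orc := by
  have hpure : ∀ (c c' : Conf σ), c'.orc = c.orc → ∑' d, PMF.pure c' d * Φ d.orc ≤ Φ c.orc := by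
    intro c c' h
    rw [tsum_eq_single c' (by intro d hd; simp [hd])]
    simp [h]
  have hbind : ∀ {α β : Type} (p : PMF α) (f : α → PMF β) (g : β → ENNReal),
      ∑' b, p.bind f b * g b = ∑' a, p a * ∑' b, f a b * g b := by
    intro α β p f g
    simp only [PMF.bind_apply, ← ENNReal.tsum_mul_right, ← ENNReal.tsum_mul_left]
    rw [ENNReal.tsum_comm]
    simp only [mul_assoc]
  have hmap : ∀ {α : Type} (p : PMF α) (f : α → Conf σ) (c : Conf σ),
      (∀ a, (f a).orc = c.orc) → ∑' d, p.map f d * Φ d.orc ≤ Φ c.orc := by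
    intro α p f c h
    change ∑' d, (p.bind fun a => PMF.pure (f a)) d * Φ d.orc ≤ Φ c.orc
    rw [hbind]
    calc _ ≤ ∑' a, p a * Φ c.orc :=
          ENNReal.tsum_le_tsum fun a => mul_le_mul_right (hpure _ _ (h a)) _
      _ = Φ c.orc := by rw [ENNReal.tsum_mul_right, p.tsum_coe, one_mul]
  have hseq : ∀ {μ : PMF (Conf σ)} {f : Conf σ → PMF (Conf σ)} {c : Conf σ},
      ∑' d, μ d * Φ d.orc ≤ Φ c.orc → (∀ d, ∑' e, f d e * Φ e.orc ≤ Φ d.orc) →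
      ∑' e, μ.bind f e * Φ e.orc ≤ Φ c.orc := by
    intro μ f c h1 h2
    rw [hbind]
    exact (ENNReal.tsum_le_tsum fun a => mul_le_mul_right (h2 a) _).trans h1
  induction P with
  | skip => exact fun c => hpure _ _ rfl
  | assign x e => exact fun c => hpure _ _ rfl
  | join x y z => exact fun c => hpure _ _ rfl
  | split x y z => exact fun c => hpure _ _ rfl
  | choose x e => exact fun c => hmap _ _ _ fun _ => rfl
  | new x => exact fun c => hpure _ _ rfl
  | had x => intro c; simp only [run]; split <;> exact hpure _ _ rfl
  | tgate x => intro c; simp only [run]; split <;> exact hpure _ _ rfl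
  | cnot x y => intro c; simp only [run]; split <;> exact hpure _ _ rfl
  | meas x y =>
    intro c; simp only [run]; split
    · exact hmap _ _ _ fun _ => rfl
    · exact hpure _ _ rfl
  | call k x y =>
    intro c
    simp only [run, PMF.map]
    rw [hbind]
    refine le_trans (ENNReal.tsum_le_tsum fun r => mul_le_mul_right ?_ _) (hO k (c.store y) c.orc c.mem)
    exact hpure _ _ rfl
  | seq P Q ihP ihQ => exact fun c => hseq (ihP c) ihQ
  | ite e P Q ihP ihQ =>
    intro c; simp only [run]; split
    · exact ihQ _
    · exact ihP _
  | loop e P ih =>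
    intro c; simp only [run]
    have : ∀ n (d : Conf σ), ∑' c', iterPMF (P.run O) n d c' * Φ c'.orc ≤ Φ d.orc := by
      intro n
      induction n with
      | zero => exact fun d => hpure _ _ rfl
      | succ n ihn => exact fun d => hseq (ih d) ihn
    exact this _ _

/-- Apply the mean bound to the indicator of the complement of `J`: its mean starts at 0 and cannot
grow, so states outside `J` have probability 0. -/
theorem run_inv (O : Oracle σ) (J : σ → Prop)
    (hO : ∀ k msg st q, J st → ∀ r ∈ (O k msg st q).support, J r.1.2) (P : Prog) (c : Conf σ)
    (hc : J c.orc) : ∀ c' ∈ (P.run O c).support, J c'.orc := by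
  have h := run_expect_le O (fun s => if J s then 0 else 1) (by
    intro k msg st q
    by_cases hs : J st
    · rw [if_pos hs, nonpos_iff_eq_zero, ENNReal.tsum_eq_zero]
      intro r
      by_cases hr : r ∈ (O k msg st q).support
      · simp [hO k msg st q hs r hr]
      · rw [PMF.mem_support_iff, not_not] at hr
        simp [hr]
    · rw [if_neg hs]
      calc _ ≤ ∑' r, O k msg st q r := ENNReal.tsum_le_tsum fun r => by
            split <;> simp
        _ = 1 := PMF.tsum_coe _
        _ ≤ 1 := le_rfl) P c
  rw [if_pos hc, nonpos_iff_eq_zero, ENNReal.tsum_eq_zero] at h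
  intro c' hc'
  by_contra hJ
  have := h c'
  rw [if_neg hJ, mul_one] at this
  exact (PMF.mem_support_iff _ _).1 hc' this

/-! ### Coupling a program with a renamed copy whose oracle calls are replaced -/

section Simulation

variable (O₁ : Oracle σ) (O₂ : Oracle σ') (f : ℕ → ℕ) (M : QState → QState → Prop)
  (Fr : (ℕ → QData) → σ → ℕ → σ' → ℕ → Prop)

/-- The relation between a configuration and its simulation, whose variables are renamed by `f`;
`Fr` relates what the simulated program does not see. -/
structure Simulates (c : Conf σ) (d : Conf σ') : Prop where
  store : c.store ∘ f = d.store
  mem : M c.mem d.mem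
  frame : Fr c.store c.orc c.cost d.orc d.cost

variable {f M Fr}

theorem Simulates.step
    (hFr : ∀ s o n o' n' s' t, Fr s o n o' n' → (∀ x ∉ Set.range f, s' x = s x) →
      Fr s' o (n + t) o' (n' + t)) {c : Conf σ} {d : Conf σ'} (h : Simulates f M Fr c d)
    {c' : Conf σ} {d' : Conf σ'} (t : ℕ) (hs : c'.store ∘ f = d'.store)
    (hs' : ∀ x ∉ Set.range f, c'.store x = c.store x)
    (hM : M c'.mem d'.mem) (ho : c'.orc = c.orc) (hc : c'.cost = c.cost + t)
    (ho' : d'.orc = d.orc) (hc' : d'.cost = d.cost + t) : Simulates f M Fr c' d' := by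
  refine ⟨hs, hM, ?_⟩
  rw [ho, hc, ho', hc']
  exact hFr _ _ _ _ _ _ _ h.frame hs'

theorem subst_rel (hf : f.Injective)
    (hFr : ∀ s o n o' n' s' t, Fr s o n o' n' → (∀ x ∉ Set.range f, s' x = s x) →
      Fr s' o (n + t) o' (n' + t))
    (B : σ → Prop) (B' : σ' → Prop)
    (hB : ∀ k msg st q, B st → ∀ r ∈ (O₁ k msg st q).support, B r.1.2)
    (hB' : ∀ k msg st q, B' st → ∀ r ∈ (O₂ k msg st q).support, B' r.1.2)
    (C : ℕ → ℕ → ℕ → Prog) (P : Prog) (hM : M = Eq ∨ P.NoQubits)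
    (hC : P.CallFree ∨ ∀ k x y c d, Simulates f M Fr c d →
      PMFRel (fun c d => Simulates f M Fr c d ∨ B c.orc ∧ B' d.orc)
        ((C k x y).run O₁ c) ((call k x y).run O₂ d)) :
    ∀ c d, Simulates f M Fr c d ∨ B c.orc ∧ B' d.orc →
      PMFRel (fun c d => Simulates f M Fr c d ∨ B c.orc ∧ B' d.orc)
        ((P.subst f C).run O₁ c) (P.run O₂ d) := by
  have hu : ∀ {s : ℕ → QData} {x : ℕ} {v : QData},
      (update s (f x) v) ∘ f = update (s ∘ f) x v :=
    fun {s x v} => Function.update_comp_eq_of_injective s hf x v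
  have hu' : ∀ {s : ℕ → QData} {x y : ℕ} {v : QData}, y ∉ Set.range f →
      update s (f x) v y = s y := fun {s x y v} hy => by
    rw [update_of_ne]; rintro rfl; exact hy ⟨x, rfl⟩
  -- Bad states are absorbing on both sides, so from there on the independent coupling is good
  -- enough.
  suffices h : ∀ c d, Simulates f M Fr c d →
      PMFRel (fun c d => Simulates f M Fr c d ∨ B c.orc ∧ B' d.orc)
        ((P.subst f C).run O₁ c) (P.run O₂ d) by
    rintro c d (h' | ⟨h1, h2⟩)
    · exact h c d h'
    · exact PMFRel.of_support fun a ha b hb =>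
        Or.inr ⟨run_inv O₁ B hB _ c h1 a ha, run_inv O₂ B' hB' _ d h2 b hb⟩
  have hev : ∀ {c : Conf σ} {d : Conf σ'} (e : Expr), Simulates f M Fr c d →
      (e.rename f).eval c.store = e.eval d.store := by
    intro c d e h; rw [Expr.eval_rename, h.store]
  have hst : ∀ {c : Conf σ} {d : Conf σ'} (x : ℕ), Simulates f M Fr c d →
      c.store (f x) = d.store x := by
    intro c d x h; rw [← h.store]; rfl
  have hstep := @Simulates.step σ σ' f M Fr hFr
  induction P with
  | skip =>
    intro c d h
    exact PMFRel.pure (Or.inl (hstep h 1 h.store (fun _ _ => rfl) h.mem rfl rfl rfl rfl))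
  | assign x e =>
    intro c d h
    refine PMFRel.pure (Or.inl (hstep h 1 ?_ ?_ h.mem rfl rfl rfl rfl))
    · simp only [Conf.set, Conf.tick, hu, hev e h, h.store]
    · exact fun y hy => hu' hy
  | join x y z =>
    intro c d h
    refine PMFRel.pure (Or.inl (hstep h 1 ?_ ?_ h.mem rfl rfl rfl rfl))
    · simp only [Conf.set, Conf.tick, hu, hst _ h, ← h.store]
      rw [show update c.store (f y) QData.nil (f z) =
        update (c.store ∘ f) y QData.nil z from congrFun hu z]
    · intro w hw
      simp only [Conf.set, Conf.tick, hu' hw]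
  | split x y z =>
    intro c d h
    refine PMFRel.pure (Or.inl (hstep h 1 ?_ ?_ h.mem rfl rfl rfl rfl))
    · simp only [Conf.set, Conf.tick, hu, hst _ h, h.store]
    · intro w hw
      simp only [Conf.set, Conf.tick, hu' hw]
  | choose x e =>
    intro c d h
    simp only [subst, run, hev e h]
    refine (PMFRel.refl _).map fun a b hab => Or.inl (hstep h _ ?_ ?_ h.mem rfl rfl rfl rfl)
    · subst hab
      simp only [Conf.set, Conf.tick, hu, h.store]
    · intro w hw
      simp only [Conf.set, Conf.tick, hu' hw]
  | new x =>
    intro c d h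
    obtain rfl : M = Eq := hM.resolve_right id
    refine PMFRel.pure (Or.inl (hstep h 1 ?_ ?_ ?_ rfl rfl rfl rfl))
    · simp only [Conf.set, Conf.tick, Conf.setMem, hu, h.store, h.mem]
    · intro w hw
      simp only [Conf.set, Conf.tick, Conf.setMem, hu' hw]
    · simp only [Conf.setMem, h.mem]
  | had x =>
    intro c d h
    obtain rfl : M = Eq := hM.resolve_right id
    simp only [subst, run, hst _ h]
    split
    · exact PMFRel.pure (Or.inl (hstep h 1 h.store (fun _ _ => rfl)
        (by simp only [Conf.setMem, h.mem]) rfl rfl rfl rfl))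
    · exact PMFRel.pure (Or.inl (hstep h 1 h.store (fun _ _ => rfl) h.mem rfl rfl rfl rfl))
  | tgate x =>
    intro c d h
    obtain rfl : M = Eq := hM.resolve_right id
    simp only [subst, run, hst _ h]
    split
    · exact PMFRel.pure (Or.inl (hstep h 1 h.store (fun _ _ => rfl)
        (by simp only [Conf.setMem, h.mem]) rfl rfl rfl rfl))
    · exact PMFRel.pure (Or.inl (hstep h 1 h.store (fun _ _ => rfl) h.mem rfl rfl rfl rfl))
  | cnot x y =>
    intro c d h
    obtain rfl : M = Eq := hM.resolve_right id
    simp only [subst, run, hst _ h]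
    split
    · exact PMFRel.pure (Or.inl (hstep h 1 h.store (fun _ _ => rfl)
        (by simp only [Conf.setMem, h.mem]) rfl rfl rfl rfl))
    · exact PMFRel.pure (Or.inl (hstep h 1 h.store (fun _ _ => rfl) h.mem rfl rfl rfl rfl))
  | meas x y =>
    intro c d h
    obtain rfl : M = Eq := hM.resolve_right id
    simp only [subst, run, hst _ h]
    split
    · rw [h.mem]
      refine (PMFRel.refl _).map fun a b hab =>
        Or.inl (hstep h 1 ?_ ?_ ?_ rfl rfl rfl rfl)
      · subst hab
        simp only [Conf.set, Conf.tick, Conf.setMem, hu, h.store]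
      · intro w hw
        simp only [Conf.set, Conf.tick, Conf.setMem, hu' hw]
      · subst hab; rfl
    · exact PMFRel.pure (Or.inl (hstep h 1 h.store (fun _ _ => rfl) h.mem rfl rfl rfl rfl))
  | call k x y => exact fun c d h => (hC.resolve_left id) k x y c d h
  | seq P Q ihP ihQ =>
    intro c d h
    have hP := ihP (hM.imp_right And.left) (hC.imp_left And.left)
    have hQ := ihQ (hM.imp_right And.right) (hC.imp_left And.right)
    refine (hP c d h).bind ?_
    rintro c' d' (h' | ⟨h1, h2⟩)
    · exact hQ c' d' h'
    · exact PMFRel.of_support fun a ha b hb =>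
        Or.inr ⟨run_inv O₁ B hB _ _ h1 a ha, run_inv O₂ B' hB' _ _ h2 b hb⟩
  | ite e P Q ihP ihQ =>
    intro c d h
    have hP := ihP (hM.imp_right And.left) (hC.imp_left And.left)
    have hQ := ihQ (hM.imp_right And.right) (hC.imp_left And.right)
    simp only [subst, run, hev e h]
    split
    · exact hQ _ _ (hstep h 1 h.store (fun _ _ => rfl) h.mem rfl rfl rfl rfl)
    · exact hP _ _ (hstep h 1 h.store (fun _ _ => rfl) h.mem rfl rfl rfl rfl)
  | loop e P ih =>
    intro c d h
    simp only [subst, run, hev e h]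
    refine PMFRel.iterPMF ?_ _ _ _ (Or.inl (hstep h _ h.store (fun _ _ => rfl) h.mem rfl rfl rfl rfl))
    rintro c' d' (h' | ⟨h1, h2⟩)
    · exact ih hM hC c' d' h'
    · exact PMFRel.of_support fun a ha b hb =>
        Or.inr ⟨run_inv O₁ B hB _ _ h1 a ha, run_inv O₂ B' hB' _ _ h2 b hb⟩

end Simulation

end Prog

/-! ### Sizes -/

theorem Polynomial.eval_mono_nat (p : Polynomial ℕ) : Monotone fun n => p.eval n := by
  intro a b hab
  simp only [Polynomial.eval_eq_sum_range]
  gcongr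

namespace Data

@[simp] theorem erase_toQ (d : Data) : d.toQ.erase = d := by
  induction d <;> simp_all [toQ, QData.erase]

@[simp] theorem size_toQ (d : Data) : d.toQ.size = d.size := by
  induction d <;> simp_all [toQ, QData.size, size]

theorem size_fst_le (d : Data) : d.fst.size ≤ d.size := by
  cases d <;> simp [fst, size]; omega

theorem size_snd_le (d : Data) : d.snd.size ≤ d.size := by
  cases d <;> simp [snd, size]; omega

@[simp] theorem toList_ofList (l : List Data) : (ofList l).toList = l := by
  induction l <;> simp_all [ofList, toList]

@[simp] theorem ofList_toList (d : Data) : ofList d.toList = d := by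
  induction d <;> simp_all [ofList, toList]

@[simp] theorem size_unary (n : ℕ) : (unary n).size = n := by
  induction n <;> simp_all [unary, size]

theorem length_toList_le (d : Data) : d.toList.length ≤ d.size := by
  induction d with
  | nil => simp [toList]
  | pair a b _ ih => simp [toList, size]; omega

@[simp] theorem toQ_fst (d : Data) : d.toQ.fst = d.fst.toQ := by
  cases d <;> simp [toQ, QData.fst, fst]

@[simp] theorem toQ_snd (d : Data) : d.toQ.snd = d.snd.toQ := by
  cases d <;> simp [toQ, QData.snd, snd]

end Data

namespace QData

theorem size_erase_le (d : QData) : d.erase.size ≤ d.size := by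
  induction d with
  | nil => simp [erase, Data.size]
  | qubit => simp [erase, Data.size]
  | pair a b iha ihb => simp [erase, Data.size, size]; omega

theorem size_fst_le (d : QData) : d.fst.size ≤ d.size := by
  cases d <;> simp [fst, size]; omega

theorem size_snd_le (d : QData) : d.snd.size ≤ d.size := by
  cases d <;> simp [snd, size]; omega

@[simp] theorem erase_fst (d : QData) : d.fst.erase = d.erase.fst := by
  cases d <;> simp [fst, erase, Data.fst]

@[simp] theorem erase_snd (d : QData) : d.snd.erase = d.erase.snd := by
  cases d <;> simp [snd, erase, Data.snd]

def toList : QData → List QData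
  | pair a b => a :: b.toList
  | _ => []

theorem length_toList_le (d : QData) : d.toList.length ≤ d.erase.size := by
  induction d with
  | nil => simp [toList]
  | qubit => simp [toList]
  | pair a b _ ih => simp [toList, erase, Data.size]; omega

@[simp] theorem toList_toQ (d : Data) : d.toQ.toList = d.toList.map Data.toQ := by
  induction d <;> simp_all [toList, Data.toList, Data.toQ]

@[simp] theorem toList_ofList (l : List QData) : (ofList l).toList = l := by
  induction l <;> simp_all [ofList, toList]

end QData

/-! ### Polynomial-time computable quantum operations -/

theorem QM.bind_apply {α β : Type} (m : QM α) (f : α → QM β) (q : QState) :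
    (m >>= f) q = (m q).bind fun r => f r.1 r.2 := rfl

theorem QM.pure_apply {α : Type} (a : α) (q : QState) :
    (pure a : QM α) q = PMF.pure (a, q) := rfl

/-- The outcome `c'` of a program that is started in `c` and leaves the output `r.1` in variable `a`,
in at most `n` steps. -/
def QPost {σ : Type} (a : ℕ) (c : Conf σ) (n : ℕ) (c' : Conf σ) (r : QData × QState) : Prop :=
  c'.store = update c.store a r.1 ∧ c'.orc = c.orc ∧ c'.mem = r.2 ∧
    c'.cost ≤ c.cost + n ∧ r.1.size ≤ n

/-- The operation is computed by a program in polynomial time. The program takes its input from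
variable `a` and leaves the output there; it uses the variables above `a` as a work space, which
must be empty and is emptied in the end. -/
def QPoly (F : QData → QM QData) : Prop :=
  ∃ (P : ℕ → Prog) (p : Polynomial ℕ), ∀ (a : ℕ) (σ : Type) (O : Oracle σ) (c : Conf σ),
    (∀ x, a < x → c.store x = QData.nil) →
    PMFRel (QPost a c (p.eval (c.store a).size)) ((P a).run O c) (F (c.store a) c.mem)

theorem Expr.size_eval_le (e : Expr) :
    ∃ p : Polynomial ℕ, ∀ v : QData, (e.eval fun _ => v).size ≤ p.eval v.size := by
  induction e with
  | var x => exact ⟨Polynomial.X, fun v => by simpa [eval] using v.size_erase_le⟩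
  | nil => exact ⟨0, fun v => by simp [eval, Data.size]⟩
  | pair a b iha ihb =>
    obtain ⟨p, hp⟩ := iha
    obtain ⟨q, hq⟩ := ihb
    exact ⟨p + q + 1, fun v => by
      have := hp v; have := hq v
      simp [eval, Data.size]; omega⟩
  | fst a ih =>
    obtain ⟨p, hp⟩ := ih
    exact ⟨p, fun v => (Data.size_fst_le _).trans (hp v)⟩
  | snd a ih =>
    obtain ⟨p, hp⟩ := ih
    exact ⟨p, fun v => (Data.size_snd_le _).trans (hp v)⟩
  | eq a b =>
    exact ⟨1, fun v => by
      simp only [eval]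
      cases decide (a.eval (fun _ => v) = b.eval fun _ => v) <;> simp [Data.ofBool, Data.size]⟩

theorem run_seq_rel {σ β γ : Type} {O : Oracle σ} {P Q : Prog} {c : Conf σ} {R : Conf σ → β → Prop}
    {S : Conf σ → γ → Prop} {ν : PMF β} {g : β → PMF γ} (hP : PMFRel R (P.run O c) ν)
    (hQ : ∀ c' b, R c' b → PMFRel S (Q.run O c') (g b)) :
    PMFRel S ((Prog.seq P Q).run O c) (ν.bind g) := hP.bind hQ

theorem run_seq_pure {σ : Type} {O : Oracle σ} {P Q : Prog} {c c' : Conf σ}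
    (hP : P.run O c = PMF.pure c') : (Prog.seq P Q).run O c = Q.run O c' := by
  simp [Prog.run, hP]

namespace QPoly

variable {F G : QData → QM QData}

/-- The bound on the size of the output. -/
theorem size_le (h : QPoly F) :
    ∃ p : Polynomial ℕ, ∀ v q, ∀ r ∈ (F v q).support, r.1.size ≤ p.eval v.size := by
  obtain ⟨P, p, hP⟩ := h
  refine ⟨p, fun v q r hr => ?_⟩
  obtain ⟨c, -, -, -, -, -, hc⟩ := (hP 0 Unit Prog.noOracle (Conf.start v () q) (by
    intro x hx; simp [Conf.start, hx.ne'])).exists_left hr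
  simpa [Conf.start] using hc

/-- Operations that are computed by a program without loops and random choices. -/
theorem of_pure (g : QData → QData) (P : ℕ → Prog) (k : ℕ) (p : Polynomial ℕ)
    (hp : ∀ v, (g v).size ≤ p.eval v.size)
    (hP : ∀ (a : ℕ) (σ : Type) (O : Oracle σ) (s : ℕ → QData) (o : σ) (m : QState) (n : ℕ),
      (∀ x, a < x → s x = QData.nil) →
      (P a).run O ⟨s, o, m, n⟩ = PMF.pure ⟨update s a (g (s a)), o, m, n + k⟩) :
    QPoly fun v => pure (g v) := by
  refine ⟨P, p + Polynomial.C k, fun a σ O c hc => ?_⟩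
  obtain ⟨s, o, m, n⟩ := c
  rw [hP a σ O s o m n hc]
  have := hp (s a)
  refine PMFRel.pure ⟨rfl, rfl, rfl, ?_, ?_⟩ <;> simp <;> omega

/-- Every variable of `e` stands for the single input; hence the constant store and the renaming of
all variables to `a`. -/
theorem expr (e : Expr) : QPoly fun v => pure (e.eval fun _ => v).toQ := by
  obtain ⟨p, hp⟩ := e.size_eval_le
  refine of_pure (fun v => (e.eval fun _ => v).toQ) (fun a => Prog.assign a (e.rename fun _ => a))
    1 p (by simpa using hp) ?_
  intro a σ O s o m n _
  simp only [Prog.run, Conf.tick, Conf.set, Expr.eval_rename]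
  rfl

theorem bind (hF : QPoly F) (hG : QPoly G) : QPoly fun v => F v >>= G := by
  obtain ⟨P, p, hP⟩ := hF
  obtain ⟨Q, q, hQ⟩ := hG
  refine ⟨fun a => Prog.seq (P a) (Q a), p + q.comp p, fun a σ O c hc => ?_⟩
  refine run_seq_rel (hP a σ O c hc) ?_
  rintro c' ⟨r, m⟩ ⟨h1, h2, h3, h4, h5⟩
  simp only at h1 h2 h3 h4 h5
  subst h3
  have h7 : c'.store a = r := by rw [h1]; simp
  have := hQ a σ O c' (fun x hx => by rw [h1, update_of_ne hx.ne']; exact hc x hx)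
  rw [h7] at this
  refine this.mono ?_
  rintro c'' r' ⟨g1, g2, g3, g4, g5⟩
  have h6 : q.eval r.size ≤ q.eval (p.eval (c.store a).size) := q.eval_mono_nat h5
  refine ⟨by rw [g1, h1, Function.update_idem], g2.trans h2, g3, ?_, ?_⟩
  all_goals simp only [Polynomial.eval_add, Polynomial.eval_comp]; omega

/-- Runs the operation on a copy of the classical part of the input. -/
theorem keep (hF : QPoly F) :
    QPoly fun v => F v.erase.toQ >>= fun r => pure (QData.pair v r) := by
  obtain ⟨P, p, hP⟩ := hF
  refine ⟨fun a => Prog.seq (Prog.assign (a + 1) (Expr.var a))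
    (Prog.seq (P (a + 1)) (Prog.join a a (a + 1))), p + Polynomial.X + 2, fun a σ O c hc => ?_⟩
  rw [run_seq_pure rfl]
  have := hP (a + 1) σ O ((c.tick 1).set (a + 1) (c.store a).erase.toQ) (fun x hx => by
    simp only [Conf.set, Conf.tick]
    rw [update_of_ne (by omega)]; exact hc x (by omega))
  refine run_seq_rel (by simpa [Conf.set, Conf.tick, Expr.eval] using this) ?_
  rintro c' ⟨r, m⟩ ⟨h1, h2, h3, h4, h5⟩
  have h8 : p.eval (c.store a).erase.size ≤ p.eval (c.store a).size :=
    p.eval_mono_nat (c.store a).size_erase_le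
  simp only [Function.update_idem] at h1 h2 h3 h4 h5
  refine PMFRel.pure ⟨?_, h2, h3, ?_, ?_⟩
  · funext x
    simp only [Conf.set, Conf.tick, h1, update_apply]
    have := hc (a + 1) (by omega)
    grind
  · simp [Conf.set, Conf.tick]; omega
  · simp [QData.size]; omega

/-- Qubits cannot be copied, so the first component is parked in variable `a` while `F` works on the
second one from `a + 1` on. Together with permutations of components this lets an operation reach
any part of its input. -/
theorem onSnd (hF : QPoly F) :
    QPoly fun v => F v.snd >>= fun r => pure (QData.pair v.fst r) := by
  obtain ⟨P, p, hP⟩ := hF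
  refine ⟨fun a => Prog.seq (Prog.split a (a + 1) a)
    (Prog.seq (P (a + 1)) (Prog.join a a (a + 1))), p + Polynomial.X + 2, fun a σ O c hc => ?_⟩
  rw [run_seq_pure rfl]
  have := hP (a + 1) σ O ((((c.tick 1).set a QData.nil).set a (c.store a).fst).set (a + 1)
    (c.store a).snd) (fun x hx => by
      simp only [Conf.set, Conf.tick]
      rw [update_of_ne (by omega), update_of_ne (by omega),
        update_of_ne (by omega)]
      exact hc x (by omega))
  refine run_seq_rel (by simpa [Conf.set, Conf.tick, Expr.eval] using this) ?_
  rintro c' ⟨r, m⟩ ⟨h1, h2, h3, h4, h5⟩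
  have h8 : p.eval (c.store a).snd.size ≤ p.eval (c.store a).size :=
    p.eval_mono_nat (c.store a).size_snd_le
  have h9 := (c.store a).size_fst_le
  simp only [Function.update_idem] at h1 h2 h3 h4 h5
  refine PMFRel.pure ⟨?_, h2, h3, ?_, ?_⟩
  · funext x
    simp only [Conf.set, Conf.tick, h1, update_apply]
    have := hc (a + 1) (by omega)
    grind
  · simp [Conf.set, Conf.tick]; omega
  · simp [QData.size]; omega

theorem swap : QPoly fun v => pure (QData.pair v.snd v.fst) := by
  refine of_pure _ (fun a => Prog.seq (Prog.split (a + 1) a a) (Prog.join a a (a + 1))) 2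
    (2 * Polynomial.X + 1) (fun v => ?_) ?_
  · have := v.size_fst_le
    have := v.size_snd_le
    simp [QData.size]; omega
  · intro a σ O s o m n hs
    rw [run_seq_pure rfl]
    simp only [Prog.run, Conf.set, Conf.tick]
    congr 2
    funext x
    have := hs (a + 1) (by omega)
    simp only [update_apply]
    grind

/-- Runs `F` or `G` on the first component, depending on the second one. -/
theorem cond (hF : QPoly F) (hG : QPoly G) :
    QPoly fun v => if v.snd.erase = Data.nil then G v.fst else F v.fst := by
  obtain ⟨P, p, hP⟩ := hF
  obtain ⟨Q, q, hQ⟩ := hG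
  refine ⟨fun a => Prog.seq (Prog.split a (a + 1) a) (Prog.ite (Expr.var (a + 1))
    (Prog.seq (Prog.assign (a + 1) Expr.nil) (P a))
    (Prog.seq (Prog.assign (a + 1) Expr.nil) (Q a))), p + q + 3, fun a σ O c hc => ?_⟩
  rw [run_seq_pure rfl]
  have key : ∀ (P : ℕ → Prog) (p : Polynomial ℕ) (F : QData → QM QData),
      (∀ (a : ℕ) (σ : Type) (O : Oracle σ) (c : Conf σ), (∀ x, a < x → c.store x = QData.nil) →
      PMFRel (QPost a c (p.eval (c.store a).size)) ((P a).run O c) (F (c.store a) c.mem)) →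
      PMFRel (QPost a c (p.eval (c.store a).size + 3)) ((P a).run O ⟨update c.store a
        (c.store a).fst, c.orc, c.mem, c.cost + 3⟩) (F (c.store a).fst c.mem) := by
    intro P p F hP
    have := hP a σ O ⟨update c.store a (c.store a).fst, c.orc, c.mem, c.cost + 3⟩
      (fun x hx => by
        simp only
        rw [update_of_ne (by omega)]
        exact hc x (by omega))
    simp only [update_self] at this
    refine this.mono ?_
    rintro c' r ⟨h1, h2, h3, h4, h5⟩
    have h8 : p.eval (c.store a).fst.size ≤ p.eval (c.store a).size :=
      p.eval_mono_nat (c.store a).size_fst_le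
    exact ⟨by simpa using h1, h2, h3, by simp at h4; omega, by omega⟩
  have hstore : update (update (update (update c.store a
      QData.nil) a (c.store a).fst) (a + 1) (c.store a).snd) (a + 1) QData.nil =
      update c.store a (c.store a).fst := by
    funext x
    have := hc (a + 1) (by omega)
    simp only [update_apply]
    grind
  simp only [Prog.run, Conf.set, Conf.tick, Expr.eval, update_self, PMF.pure_bind,
    Data.toQ, hstore]
  split
  · refine (key Q q G hQ).mono ?_
    rintro c' r ⟨h1, h2, h3, h4, h5⟩
    exact ⟨h1, h2, h3, by simp; omega, by simp; omega⟩
  · refine (key P p F hP).mono ?_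
    rintro c' r ⟨h1, h2, h3, h4, h5⟩
    exact ⟨h1, h2, h3, by simp; omega, by simp; omega⟩

/-! ### Bounded loops: folds over lists -/

section Fold

/-- The body of the loop of a fold: the context is in `a`, the rest of the list in `a + 1`. -/
def foldBody (P : ℕ → Prog) (a : ℕ) : Prog :=
  Prog.ite (Expr.var (a + 1))
    (Prog.seq (Prog.split (a + 3) (a + 1) (a + 1)) (Prog.seq (Prog.join (a + 2) (a + 2) (a + 3))
      (Prog.seq (Prog.assign (a + 3) (Expr.var a)) (Prog.seq (Prog.join (a + 2) (a + 3) (a + 2))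
        (P (a + 2)))))) Prog.skip

/-- The layout inside the loop: the classical context is in `a`, the remaining list in `a + 1`, the
accumulator in `a + 2`; `a + 3` is scratch. -/
def foldStore (s₀ : ℕ → QData) (a : ℕ) (c : Data) (l s : QData) : ℕ → QData :=
  update (update (update s₀ a c.toQ) (a + 1) l) (a + 2) s

variable {P : ℕ → Prog} {p : Polynomial ℕ}

theorem foldBody_pair
    (hP : ∀ (a : ℕ) (σ : Type) (O : Oracle σ) (c : Conf σ), (∀ x, a < x → c.store x = QData.nil) →
      PMFRel (QPost a c (p.eval (c.store a).size)) ((P a).run O c) (F (c.store a) c.mem))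
    {σ : Type} (O : Oracle σ) {s₀ : ℕ → QData} {a : ℕ} (hs : ∀ x, a < x → s₀ x = QData.nil)
    (c : Data) (x l s : QData) (o : σ) (m : QState) (n : ℕ) :
    PMFRel (fun c' r => c'.store = foldStore s₀ a c l r.1 ∧ c'.orc = o ∧ c'.mem = r.2 ∧
      c'.cost ≤ n + 5 + p.eval (QData.pair c.toQ (QData.pair s x)).size)
      ((foldBody P a).run O ⟨foldStore s₀ a c (QData.pair x l) s, o, m, n⟩)
      (F (QData.pair c.toQ (QData.pair s x)) m) := by
  have h1 : (foldBody P a).run O ⟨foldStore s₀ a c (QData.pair x l) s, o, m, n⟩ =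
      (P (a + 2)).run O ⟨foldStore s₀ a c l (QData.pair c.toQ (QData.pair s x)), o, m, n + 5⟩ := by
    have e1 : (Expr.var (a + 1)).eval (foldStore s₀ a c (QData.pair x l) s) ≠ Data.nil := by
      simp [Expr.eval, foldStore, QData.erase]
    have h3 := hs (a + 3) (by omega)
    rw [foldBody, Prog.run, if_neg e1,
      run_seq_pure (c' := ⟨update (foldStore s₀ a c l s) (a + 3) x, o, m, n + 2⟩) ?_,
      run_seq_pure (c' := ⟨foldStore s₀ a c l (QData.pair s x), o, m, n + 3⟩) ?_,
      run_seq_pure (c' := ⟨update (foldStore s₀ a c l (QData.pair s x)) (a + 3) c.toQ,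
        o, m, n + 4⟩) ?_,
      run_seq_pure (c' := ⟨foldStore s₀ a c l (QData.pair c.toQ (QData.pair s x)), o, m, n + 5⟩) ?_]
    all_goals
      simp only [Prog.run, Conf.set, Conf.tick, foldStore]
      congr 2
      funext y
      simp only [update_apply, Expr.eval, Nat.add_left_cancel_iff, Nat.add_eq_left,
        Nat.left_eq_add, OfNat.ofNat_ne_zero, Nat.reduceEqDiff, one_ne_zero,
        OfNat.one_ne_ofNat, OfNat.ofNat_ne_one, if_true, if_false, QData.fst, QData.snd,
        Data.erase_toQ]
      try grind
  rw [h1]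
  have h2 := hP (a + 2) σ O ⟨foldStore s₀ a c l (QData.pair c.toQ (QData.pair s x)), o, m, n + 5⟩
    (fun y hy => by
      simp only [foldStore, update_apply]
      rw [if_neg (by omega), if_neg (by omega), if_neg (by omega)]
      exact hs y (by omega))
  simp only [foldStore, update_self] at h2
  refine h2.mono ?_
  rintro c' r ⟨g1, g2, g3, g4, g5⟩
  exact ⟨by rw [g1, foldStore, Function.update_idem], g2, g3, by simpa using g4⟩

/-- The invariant is that the accumulator plus the growth still allowed for the remaining items
stays below `S`. Growth by a bounded amount, rather than by a factor, in each step is what keeps the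
result polynomial. The number of rounds `i` may exceed the length of the list, because a loop runs
as often as the size of its expression; the surplus rounds do nothing. -/
theorem foldBody_iter
    (hP : ∀ (a : ℕ) (σ : Type) (O : Oracle σ) (c : Conf σ), (∀ x, a < x → c.store x = QData.nil) →
      PMFRel (QPost a c (p.eval (c.store a).size)) ((P a).run O c) (F (c.store a) c.mem))
    (g : Polynomial ℕ) (hg : ∀ (c : Data) s x q, ∀ r ∈ (F (QData.pair c.toQ (QData.pair s x)) q).support,
      r.1.size ≤ s.size + g.eval (c.size + x.size))
    {σ : Type} (O : Oracle σ) {s₀ : ℕ → QData} {a : ℕ} (hs : ∀ x, a < x → s₀ x = QData.nil)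
    (c : Data) (o : σ) (M S : ℕ) (i : ℕ) :
    ∀ (l s : QData) (m : QState) (n : ℕ), l.toList.length ≤ i → c.size + l.size ≤ M →
    s.size + l.toList.length * g.eval M ≤ S →
    PMFRel (fun c' r => (∃ l', c'.store = foldStore s₀ a c l' r.1) ∧ c'.orc = o ∧ c'.mem = r.2 ∧
      c'.cost ≤ n + i * (6 + p.eval (M + S + 2)) ∧ r.1.size ≤ S)
      (iterPMF ((foldBody P a).run O) i ⟨foldStore s₀ a c l s, o, m, n⟩)
      (l.toList.foldlM (fun s x => F (QData.pair c.toQ (QData.pair s x))) s m) := by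
  induction i with
  | zero =>
    intro l s m n hl hM hS
    rw [List.length_eq_zero_iff.1 (Nat.le_zero.1 hl)]
    exact PMFRel.pure ⟨⟨l, rfl⟩, rfl, rfl, by simp, by simp at hS ⊢; omega⟩
  | succ i ih =>
    intro l s m n hl hM hS
    have hskip : l.erase = Data.nil →
        (foldBody P a).run O ⟨foldStore s₀ a c l s, o, m, n⟩ =
          PMF.pure ⟨foldStore s₀ a c l s, o, m, n + 2⟩ := by
      intro h
      have e1 : (Expr.var (a + 1)).eval (foldStore s₀ a c l s) = Data.nil := by
        simp [Expr.eval, foldStore, h]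
      rw [foldBody, Prog.run, if_pos e1]
      rfl
    have hnil : l.erase = Data.nil → l.toList = [] → PMFRel (fun c' r =>
        (∃ l', c'.store = foldStore s₀ a c l' r.1) ∧ c'.orc = o ∧ c'.mem = r.2 ∧
        c'.cost ≤ n + (i + 1) * (6 + p.eval (M + S + 2)) ∧ r.1.size ≤ S)
        (iterPMF ((foldBody P a).run O) (i + 1) ⟨foldStore s₀ a c l s, o, m, n⟩)
        (l.toList.foldlM (fun s x => F (QData.pair c.toQ (QData.pair s x))) s m) := by
      intro h h'
      rw [iterPMF, hskip h, PMF.pure_bind]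
      refine (ih l s m (n + 2) (by rw [h']; simp) hM hS).mono ?_
      rintro c' r ⟨g1, g2, g3, g4, g5⟩
      exact ⟨g1, g2, g3, by rw [Nat.succ_mul]; omega, g5⟩
    cases l with
    | nil => exact hnil rfl rfl
    | qubit b => exact hnil rfl rfl
    | pair x l =>
      simp only [QData.toList, List.length_cons, QData.size] at hl hM hS ⊢
      rw [iterPMF, List.foldlM_cons, QM.bind_apply]
      have hsx : g.eval (c.size + x.size) ≤ g.eval M := g.eval_mono_nat (by omega)
      have hp : p.eval (QData.pair c.toQ (QData.pair s x)).size ≤ p.eval (M + S + 2) :=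
        p.eval_mono_nat (by
          simp only [QData.size, Data.size_toQ]
          have : s.size ≤ S := le_trans (Nat.le_add_right _ _) hS
          omega)
      refine (foldBody_pair hP O hs c x l s o m n).and_support.bind ?_
      rintro ⟨st, o', m', n'⟩ ⟨r, m''⟩ ⟨⟨g1, g2, g3, g4⟩, -, g5⟩
      simp only at g1 g2 g3 g4
      subst g1 g2 g3
      have := hg c s x m _ g5
      simp only at this
      refine (ih l r m' n' (by omega) (by omega) (by rw [Nat.succ_mul] at hS; omega)).mono ?_
      rintro c' r ⟨g1, g2, g3, g4, g5⟩
      exact ⟨g1, g2, g3, by rw [Nat.succ_mul]; omega, g5⟩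

/-- Folds over lists, if the result of every step is by a bounded amount longer than its state. -/
theorem fold (hF : QPoly F)
    (g : Polynomial ℕ) (hg : ∀ (c : Data) s x q, ∀ r ∈ (F (QData.pair c.toQ (QData.pair s x)) q).support,
      r.1.size ≤ s.size + g.eval (c.size + x.size)) :
    QPoly fun v => v.snd.snd.toList.foldlM
      (fun s x => F (QData.pair v.fst.erase.toQ (QData.pair s x))) v.snd.fst := by
  obtain ⟨P, p, hP⟩ := hF
  refine ⟨fun a => Prog.seq (Prog.split a (a + 1) a) (Prog.seq (Prog.assign a (Expr.var a))
    (Prog.seq (Prog.split (a + 2) (a + 1) (a + 1)) (Prog.seq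
      (Prog.loop (Expr.var (a + 1)) (foldBody P a)) (Prog.seq (Prog.assign (a + 1) Expr.nil)
        (Prog.seq (Prog.join a (a + 2) (a + 1)) (Prog.split a (a + 1) a)))))),
    (7 + 2 * Polynomial.X + Polynomial.X * g + Polynomial.X * (6 + p.comp
      (2 + 2 * Polynomial.X + Polynomial.X * g))),
    fun a σ O c hc => ?_⟩
  obtain ⟨st, o, m, n⟩ := c
  simp only at hc
  generalize hv : st a = v
  simp only [hv]
  rw [run_seq_pure rfl, run_seq_pure rfl, run_seq_pure rfl]
  have hst : ∀ (c : Conf σ), c.store = st → c = ⟨st, c.orc, c.mem, c.cost⟩ := by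
    rintro ⟨⟩ rfl; rfl
  have h1 : ∀ x, a < x → st x = QData.nil := hc
  have e0 : ((((((((Conf.mk st o m n).tick 1).set a QData.nil).set a (st a).fst).set (a + 1)
      (st a).snd).tick 1).set a ((Expr.var a).eval (((((Conf.mk st o m n).tick 1).set a
      QData.nil).set a (st a).fst).set (a + 1) (st a).snd).store).toQ)) =
      ⟨update (update st a v.fst.erase.toQ) (a + 1) v.snd, o, m, n + 2⟩ := by
    simp only [Conf.set, Conf.tick, hv, Expr.eval]
    congr 1
    funext y
    simp only [update_apply]
    grind
  have e1 : ((((Conf.mk (update (update st a v.fst.erase.toQ) (a + 1) v.snd)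
      o m (n + 2)).tick 1).set (a + 1) QData.nil).set (a + 2) v.snd.fst).set (a + 1) v.snd.snd =
      ⟨foldStore st a v.fst.erase v.snd.snd v.snd.fst, o, m, n + 3⟩ := by
    simp only [Conf.set, Conf.tick, foldStore]
    congr 1
    funext y
    simp only [update_apply]
    grind
  simp only [e0, update_self, e1]
  have hl := v.snd.snd.length_toList_le
  have hl' := v.snd.snd.size_erase_le
  have hv1 := v.snd.size_snd_le
  have hv2 := v.snd.size_fst_le
  have hv3 := v.size_snd_le
  have hv4 : v.fst.erase.size + v.snd.snd.size ≤ v.size := by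
    have h5 := v.fst.size_erase_le
    cases v with
    | nil => simp [QData.fst, QData.snd, QData.size, QData.erase, Data.size]
    | qubit => simp [QData.fst, QData.snd, QData.size, QData.erase, Data.size]
    | pair a b =>
      have := b.size_snd_le
      simp only [QData.fst, QData.snd, QData.size] at *; omega
  have h2 := foldBody_iter (F := F) (P := P) hP g hg O hc v.fst.erase o v.size
    (v.size + v.size * g.eval v.size) v.snd.snd.erase.size v.snd.snd v.snd.fst m
    (n + 3 + (1 + v.snd.snd.erase.size)) hl hv4 (by
      have : v.snd.snd.toList.length * g.eval v.size ≤ v.size * g.eval v.size :=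
        Nat.mul_le_mul_right _ (by omega)
      omega)
  have hbd : v.snd.snd.erase.size * (6 + p.eval (v.size + (v.size + v.size * g.eval v.size) + 2)) ≤
      v.size * (6 + p.eval (2 + 2 * v.size + v.size * g.eval v.size)) := by
    rw [show v.size + (v.size + v.size * g.eval v.size) + 2 =
      2 + 2 * v.size + v.size * g.eval v.size by ring]
    exact Nat.mul_le_mul_right _ (by omega)
  have e2 : (Expr.var (a + 1)).eval (foldStore st a v.fst.erase v.snd.snd v.snd.fst) =
      v.snd.snd.erase := by
    simp [Expr.eval, foldStore]
  rw [← PMF.bind_pure (v.snd.snd.toList.foldlM (fun s x => F (v.fst.erase.toQ.pair (s.pair x)))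
    v.snd.fst m)]
  refine run_seq_rel (by rw [Prog.run, e2]; exact h2) ?_
  rintro ⟨st', o', m', n'⟩ ⟨r, m''⟩ ⟨⟨l', g1⟩, g2, g3, g4, g5⟩
  simp only at g1 g2 g3 g4 g5
  subst g1 g2 g3
  rw [run_seq_pure rfl, run_seq_pure rfl]
  have h3 := hc (a + 1) (by omega)
  have h4 := hc (a + 2) (by omega)
  refine PMFRel.pure ⟨?_, rfl, rfl, ?_, ?_⟩
  · funext y
    simp only [Conf.set, Conf.tick, foldStore, update_apply]
    simp only [show a + 1 ≠ a + 2 by omega, show a + 1 ≠ a by omega,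
      show a + 2 ≠ a + 1 by omega, show a + 2 ≠ a by omega, show a ≠ a + 1 by omega,
      show a ≠ a + 2 by omega, if_true, if_false, QData.fst, QData.snd,
      Expr.eval, Data.toQ]
    clear hv4 hl hl' hbd
    grind
  · simp [Conf.set, Conf.tick]
    omega
  · simp
    omega

end Fold

end QPoly

/-! ### Moving a stand-alone program to a fresh block of variables -/

namespace Prog

/-- All variables that the program changes are below the bound. -/
def bound : Prog → ℕ
  | skip => 0
  | assign x _ => x + 1
  | join x y z => x + y + z + 1
  | split x y z => x + y + z + 1
  | choose x _ => x + 1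
  | new x => x + 1
  | had _ => 0
  | tgate _ => 0
  | cnot _ _ => 0
  | meas x y => x + y + 1
  | call _ x y => x + y + 1
  | seq P Q => max P.bound Q.bound
  | ite _ P Q => max P.bound Q.bound
  | loop _ P => P.bound

theorem store_of_bound_le {σ : Type} (O : Oracle σ) (P : Prog) {x : ℕ} : ∀ (c : Conf σ),
    P.bound ≤ x → ∀ c' ∈ (P.run O c).support, c'.store x = c.store x := by
  have hmap : ∀ {α : Type} {p : PMF α} {f : α → Conf σ} {c : Conf σ},
      (∀ a, (f a).store x = c.store x) → ∀ c' ∈ (p.map f).support, c'.store x = c.store x := by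
    intro α p f c h c' hc'
    obtain ⟨a, -, rfl⟩ := (PMF.mem_support_map_iff _ _ _).1 hc'
    exact h a
  have hpure : ∀ {c d : Conf σ}, d.store x = c.store x →
      ∀ c' ∈ (PMF.pure d).support, c'.store x = c.store x := by
    intro c d h c' hc'
    rw [PMF.support_pure, Set.mem_singleton_iff] at hc'
    rw [hc', h]
  induction P with
  | skip => exact fun c _ => hpure rfl
  | assign y e =>
    intro c h
    simp only [bound] at h
    exact hpure (by simp only [Conf.set, Conf.tick, update_apply]; grind)
  | join y z w =>
    intro c h
    simp only [bound] at h
    exact hpure (by simp only [Conf.set, Conf.tick, update_apply]; grind)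
  | split y z w =>
    intro c h
    simp only [bound] at h
    exact hpure (by simp only [Conf.set, Conf.tick, update_apply]; grind)
  | choose y e =>
    intro c h
    simp only [bound] at h
    exact hmap (fun a => by simp only [Conf.set, Conf.tick, update_apply]; grind)
  | new y =>
    intro c h
    simp only [bound] at h
    exact hpure (by simp only [Conf.set, Conf.setMem, Conf.tick, update_apply]; grind)
  | had y => intro c h; simp only [run]; split <;> exact hpure rfl
  | tgate y => intro c h; simp only [run]; split <;> exact hpure rfl
  | cnot y z => intro c h; simp only [run]; split <;> exact hpure rfl
  | meas y z =>
    intro c h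
    simp only [bound] at h
    simp only [run]; split
    · exact hmap (fun a => by
        simp only [Conf.set, Conf.setMem, Conf.tick, update_apply]; grind)
    · exact hpure rfl
  | call k y z =>
    intro c h
    simp only [bound] at h
    exact hmap (fun a => by simp only [Conf.set, Conf.tick, update_apply]; grind)
  | seq P Q ihP ihQ =>
    intro c h c' hc'
    simp only [bound, max_le_iff] at h
    rw [run, PMF.mem_support_bind_iff] at hc'
    obtain ⟨d, hd, hc'⟩ := hc'
    rw [ihQ d h.2 c' hc', ihP c h.1 d hd]
  | ite e P Q ihP ihQ =>
    intro c h
    simp only [bound, max_le_iff] at h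
    simp only [run]; split
    · exact ihQ (c.tick 1) h.2
    · exact ihP (c.tick 1) h.1
  | loop e P ih =>
    intro c h
    simp only [bound] at h
    simp only [run]
    have : ∀ n (d : Conf σ), ∀ c' ∈ (iterPMF (P.run O) n d).support, c'.store x = d.store x := by
      intro n
      induction n with
      | zero => exact fun d => hpure rfl
      | succ n ihn =>
        intro d c' hc'
        rw [iterPMF, PMF.mem_support_bind_iff] at hc'
        obtain ⟨e, he, hc'⟩ := hc'
        rw [ihn e c' hc', ih d h e he]
    exact this _ (c.tick _)

/-- Empties the variables `a, …, a + n - 1`. -/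
def clear (a : ℕ) : ℕ → Prog
  | 0 => skip
  | n + 1 => seq (clear a n) (assign (a + n) Expr.nil)

theorem run_clear {σ : Type} (O : Oracle σ) (a n : ℕ) (s : ℕ → QData) (o : σ) (m : QState) (t : ℕ) :
    (clear a n).run O ⟨s, o, m, t⟩ =
      PMF.pure ⟨fun x => if a ≤ x ∧ x < a + n then QData.nil else s x, o, m, t + n + 1⟩ := by
  induction n with
  | zero =>
    simp only [clear, run, Conf.tick]
    congr 2
    funext x
    rw [if_neg (by omega)]
  | succ n ih =>
    rw [clear, run_seq_pure ih]
    simp only [run, Conf.set, Conf.tick, Expr.eval, Data.toQ]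
    congr 2
    funext x
    simp only [update_apply]
    grind

/-- The operation that a program without oracle computes. -/
def kernel (P : Prog) : QData → QM QData := fun v q =>
  (P.exec v q).map fun c => (c.store 0, c.mem)

/-- A program without oracle calls, moved to the variables from `a` on. -/
theorem run_shift {P : Prog} (hP : P.CallFree) {σ : Type} (O : Oracle σ) (a : ℕ) (s : ℕ → QData)
    (o : σ) (m : QState) (n : ℕ) (hs : ∀ x, a < x → s x = QData.nil) :
    PMFRel (fun c d => c.store ∘ (· + a) = d.store ∧ c.mem = d.mem ∧
      (∀ x < a, c.store x = s x) ∧ c.orc = o ∧ c.cost = d.cost + n)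
      ((P.subst (· + a) fun _ _ _ => skip).run O ⟨s, o, m, n⟩) (P.exec (s a) m) := by
  have := subst_rel O noOracle (f := (· + a)) (M := Eq)
    (Fr := fun s' o' n' _ n'' => (∀ x < a, s' x = s x) ∧ o' = o ∧ n' = n'' + n)
    (add_left_injective a) (by
      rintro s o n o' n' s' t ⟨h1, h2, h3⟩ h
      refine ⟨fun x hx => ?_, h2, by omega⟩
      rw [h x (by rintro ⟨y, rfl⟩; simp at hx), h1 x hx])
    (fun _ => False) (fun _ => False) (by simp) (by simp) (fun _ _ _ => skip) P (Or.inl rfl)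
    (Or.inl hP) ⟨s, o, m, n⟩ (Conf.start (s a) () m) (Or.inl ⟨by
      funext x
      by_cases hx : x = 0
      · simp [Conf.start, hx]
      · simp only [Conf.start, Function.comp, if_neg hx]
        exact hs _ (by omega), rfl, fun _ _ => rfl, rfl, by simp [Conf.start]⟩)
  refine this.mono ?_
  rintro c d (⟨h1, h2, h3, h4, h5⟩ | ⟨h, -⟩)
  · exact ⟨h1, h2, h3, h4, h5⟩
  · exact h.elim

end Prog

/-- The program is moved to the variables from `a` on. It may leave garbage behind, but only in
variables below its fixed bound, so a constant number of assignments restores the empty work space.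
-/
theorem QPoly.of_isQPT {P : Prog} (hP : P.IsQPT) : QPoly P.kernel := by
  obtain ⟨hcf, p, hp⟩ := hP
  refine ⟨fun a => Prog.seq (P.subst (· + a) fun _ _ _ => Prog.skip) (Prog.clear (a + 1) P.bound),
    p + Polynomial.C (P.bound + 1), fun a σ O c hc => ?_⟩
  obtain ⟨s, o, m, n⟩ := c
  have h := (Prog.run_shift hcf O a s o m n hc).and_support
  rw [Prog.kernel, PMF.map]
  refine run_seq_rel h ?_
  rintro ⟨s', o', m', n'⟩ d ⟨⟨h1, h2, h3, h4, h5⟩, -, h6⟩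
  simp only at h1 h2 h3 h4 h5
  rw [Prog.run_clear]
  have h7 := hp _ _ _ h6
  have hst : ∀ y, s' (y + a) = d.store y := fun y => congrFun h1 y
  refine PMFRel.pure ⟨?_, h4, h2, ?_, ?_⟩
  · funext x
    simp only [update_apply]
    rcases lt_trichotomy x a with hx | hx | hx
    · rw [if_neg (by omega), if_neg (by omega), h3 x hx]
    · subst hx
      rw [if_neg (by omega), if_pos rfl, ← hst 0, zero_add]
    · rw [if_neg hx.ne', show s x = QData.nil from hc x hx]
      split
      · rfl
      · rename_i h8
        have := Prog.store_of_bound_le Prog.noOracle P (x := x - a) _ (by omega) d h6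
        rw [← hst, Nat.sub_add_cancel hx.le] at this
        rw [this]
        simp only [Conf.start]
        rw [if_neg (by omega)]
  · simp; omega
  · simp; omega

/-- Running a program without qubits on another memory. -/
theorem Prog.kernel_of_noQubits {P : Prog} (hc : P.CallFree) (hq : P.NoQubits) (v : QData)
    (m : QState) :
    P.kernel v m = (P.exec v QState.blank).map fun c => (c.store 0, m) := by
  have hid : P.subst id Prog.call = P := by
    have he : ∀ e : Expr, e.rename id = e := fun e => by
      induction e <;> simp_all [Expr.rename]
    clear hc hq
    induction P <;> simp_all [Prog.subst]
  -- The identity renaming, with two different memories: without quantum instructions neither memory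
  -- changes, so they may be fixed as `m` and the blank one.
  have := Prog.subst_rel Prog.noOracle Prog.noOracle (f := id) (M := fun m₁ m₂ => m₁ = m ∧ m₂ = QState.blank)
    (Fr := fun _ _ _ _ _ => True) Function.injective_id (by simp)
    (fun _ => False) (fun _ => False) (by simp) (by simp) Prog.call P (Or.inr hq)
    (Or.inl hc) (Conf.start v () m) (Conf.start v () QState.blank) (Or.inl ⟨rfl, ⟨rfl, rfl⟩, trivial⟩)
  rw [hid] at this
  refine this.map_eq ?_
  rintro c d (⟨h1, h2, -⟩ | ⟨h, -⟩)
  · simp only [Function.comp_id] at h1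
    simp only [h1, h2.1]
  · exact h.elim

/-! ### Polynomial-time computable randomized functions on classical data -/

def QM.ofPMF (p : PMF Data) : QM QData := fun q => p.map fun d => (d.toQ, q)

theorem QM.ofPMF_pure (d : Data) : QM.ofPMF (PMF.pure d) = pure d.toQ := by
  funext q; exact PMF.pure_map _ _

theorem QM.ofPMF_bind (p : PMF Data) (f : QData → QM QData) :
    QM.ofPMF p >>= f = fun q => p.bind fun d => f d.toQ q := by
  funext q
  rw [QM.bind_apply, QM.ofPMF, PMF.bind_map]; rfl

/-- Only the classical part of the input is used. Such data can be copied, and this is the source of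
the richer closure properties below. -/
def RPoly (F : Data → PMF Data) : Prop := QPoly fun v => QM.ofPMF (F v.erase)

def DPoly (f : Data → Data) : Prop := RPoly fun d => PMF.pure (f d)

def BPoly (c : Data → Prop) : Prop := DPoly fun d => Data.ofBool (decide (c d))

theorem QPoly.congr {F G : QData → QM QData} (h : QPoly F) (hFG : ∀ v, G v = F v) : QPoly G := by
  rwa [funext hFG]

theorem RPoly.congr {F G : Data → PMF Data} (h : RPoly F) (hFG : ∀ v, G v = F v) : RPoly G := by
  rwa [funext hFG]

theorem DPoly.congr {f g : Data → Data} (h : DPoly f) (hfg : ∀ v, g v = f v) : DPoly g := by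
  rwa [funext hfg]

theorem RPoly.qpoly {F : Data → PMF Data} (h : RPoly F) : QPoly fun v => QM.ofPMF (F v.erase) := h

theorem RPoly.of_qpoly {F : Data → PMF Data} {G : QData → QM QData} (h : QPoly G)
    (hG : ∀ v, QM.ofPMF (F v.erase) = G v) : RPoly F := h.congr hG

theorem DPoly.rpoly {f : Data → Data} (h : DPoly f) : RPoly fun d => PMF.pure (f d) := h

theorem DPoly.qpoly {f : Data → Data} (h : DPoly f) : QPoly fun v => pure (f v.erase).toQ :=
  h.rpoly.qpoly.congr fun _ => (QM.ofPMF_pure _).symm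

theorem BPoly.dpoly {c : Data → Prop} (h : BPoly c) : DPoly fun d => Data.ofBool (decide (c d)) := h

theorem RPoly.size_le {F : Data → PMF Data} (h : RPoly F) :
    ∃ p : Polynomial ℕ, ∀ d, ∀ r ∈ (F d).support, r.size ≤ p.eval d.size := by
  obtain ⟨p, hp⟩ := QPoly.size_le h
  refine ⟨p, fun d r hr => ?_⟩
  have := hp d.toQ QState.blank (r.toQ, QState.blank) (by
    rw [Data.erase_toQ, QM.ofPMF, PMF.mem_support_map_iff]
    exact ⟨r, hr, rfl⟩)
  simpa using this

theorem DPoly.size_le {f : Data → Data} (h : DPoly f) :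
    ∃ p : Polynomial ℕ, ∀ d, (f d).size ≤ p.eval d.size := by
  obtain ⟨p, hp⟩ := RPoly.size_le h
  exact ⟨p, fun d => hp d _ (by simp)⟩

theorem DPoly.of_expr {f : Data → Data} (e : Expr)
    (he : ∀ v : QData, (e.eval fun _ => v) = f v.erase) : DPoly f :=
  RPoly.of_qpoly (QPoly.expr e) fun v => by rw [QM.ofPMF_pure, he]

theorem DPoly.id : DPoly fun d => d := of_expr (Expr.var 0) fun _ => rfl

theorem DPoly.const_nil : DPoly fun _ => Data.nil := of_expr Expr.nil fun _ => rfl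

theorem RPoly.bind {F G : Data → PMF Data} (hF : RPoly F) (hG : RPoly G) :
    RPoly fun d => (F d).bind G :=
  RPoly.of_qpoly (QPoly.bind hF.qpoly hG.qpoly) fun v => by
    rw [QM.ofPMF_bind]
    funext q
    simp only [QM.ofPMF, PMF.map_bind, Data.erase_toQ]

theorem RPoly.comp {f : Data → Data} {G : Data → PMF Data} (hG : RPoly G) (hf : DPoly f) :
    RPoly fun d => G (f d) := (RPoly.bind hf hG).congr fun d => by simp

theorem DPoly.comp {f g : Data → Data} (hg : DPoly g) (hf : DPoly f) : DPoly fun d => g (f d) :=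
  RPoly.comp (G := fun d => PMF.pure (g d)) hg hf

theorem RPoly.keep {F : Data → PMF Data} (hF : RPoly F) :
    RPoly fun d => (F d).map fun r => Data.pair d r :=
  RPoly.of_qpoly (DPoly.id.qpoly.bind (QPoly.keep hF.qpoly)) fun v => by
    rw [pure_bind, QM.ofPMF_bind]
    funext q
    simp only [QM.ofPMF, PMF.map_comp, Data.erase_toQ]
    rfl

/-- The composition rule used most: `keep` saves a copy of the argument, so the continuation sees
both the argument and the sampled value. -/
theorem RPoly.bind₂ {F : Data → PMF Data} {G : Data → Data → PMF Data} (hF : RPoly F)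
    (hG : RPoly fun p => G p.fst p.snd) : RPoly fun d => (F d).bind (G d) :=
  (hF.keep.bind hG).congr fun d => by rw [PMF.bind_map]; rfl

theorem DPoly.fst {f : Data → Data} (hf : DPoly f) : DPoly fun d => (f d).fst :=
  comp (g := Data.fst) (of_expr (Expr.fst (Expr.var 0)) fun _ => rfl) hf

theorem DPoly.snd {f : Data → Data} (hf : DPoly f) : DPoly fun d => (f d).snd :=
  comp (g := Data.snd) (of_expr (Expr.snd (Expr.var 0)) fun _ => rfl) hf

theorem DPoly.pair {f g : Data → Data} (hf : DPoly f) (hg : DPoly g) :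
    DPoly fun d => Data.pair (f d) (g d) := by
  refine (RPoly.bind₂ (F := fun d => PMF.pure (f d))
    (G := fun d r => (PMF.pure (g d)).bind fun t => PMF.pure (Data.pair r t)) hf
    (RPoly.bind₂ (F := fun p => PMF.pure (g p.fst)) (G := fun p t => PMF.pure (Data.pair p.snd t))
    (hg.comp DPoly.id.fst) ?_)).congr fun d => by simp
  exact DPoly.of_expr (Expr.pair (Expr.snd (Expr.fst (Expr.var 0))) (Expr.snd (Expr.var 0)))
    fun _ => rfl

theorem BPoly.eq {f g : Data → Data} (hf : DPoly f) (hg : DPoly g) : BPoly fun d => f d = g d :=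
  DPoly.comp (g := fun d => Data.ofBool (decide (d.fst = d.snd)))
    (DPoly.of_expr (Expr.eq (Expr.fst (Expr.var 0)) (Expr.snd (Expr.var 0))) fun _ => rfl)
    (hf.pair hg)

theorem RPoly.ite {c : Data → Prop} {F G : Data → PMF Data} (hc : BPoly c) (hF : RPoly F)
    (hG : RPoly G) : RPoly fun d => if c d then F d else G d :=
  RPoly.of_qpoly (QPoly.bind hc.dpoly.rpoly.keep.qpoly (QPoly.cond hF.qpoly hG.qpoly)) fun v => by
    rw [QM.ofPMF_bind]
    funext q
    rw [PMF.pure_map, PMF.pure_bind]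
    by_cases h : c v.erase <;> simp [h, Data.ofBool, Data.toQ, QData.snd, QData.fst, QData.erase]

theorem DPoly.ite {c : Data → Prop} {f g : Data → Data} (hc : BPoly c) (hf : DPoly f)
    (hg : DPoly g) : DPoly fun d => if c d then f d else g d :=
  RPoly.congr (RPoly.ite hc hf.rpoly hg.rpoly) fun d => by dsimp only; split <;> rfl

theorem DPoly.const (a : Data) : DPoly fun _ => a := by
  induction a with
  | nil => exact const_nil
  | pair a b iha ihb => exact iha.pair ihb

theorem BPoly.congr {c c' : Data → Prop} (h : BPoly c) (hc : ∀ d, c' d ↔ c d) : BPoly c' := by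
  rwa [funext fun d => propext (hc d)]

theorem BPoly.ite {b c c' : Data → Prop} (hb : BPoly b) (hc : BPoly c)
    (hc' : BPoly c') : BPoly fun d => if b d then c d else c' d :=
  DPoly.congr (DPoly.ite hb hc.dpoly hc'.dpoly) fun d => by dsimp only; split <;> rfl

theorem BPoly.true : BPoly fun _ => True := DPoly.congr (DPoly.const (Data.ofBool Bool.true)) fun _ => by simp

theorem BPoly.false : BPoly fun _ => False := DPoly.congr (DPoly.const (Data.ofBool Bool.false)) fun _ => by simp

theorem BPoly.and {c c' : Data → Prop} (hc : BPoly c) (hc' : BPoly c') :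
    BPoly fun d => c d ∧ c' d := (BPoly.ite hc hc' BPoly.false).congr fun d => by
  by_cases h : c d <;> simp [h]

theorem BPoly.not {c : Data → Prop} (hc : BPoly c) :
    BPoly fun d => ¬ c d := (BPoly.ite hc BPoly.false BPoly.true).congr fun d => by
  by_cases h : c d <;> simp [h]

theorem BPoly.comp {c : Data → Prop} {f : Data → Data} (hc : BPoly c) (hf : DPoly f) :
    BPoly fun d => c (f d) := DPoly.comp hc hf

theorem DPoly.ofBool {c : Data → Prop} (hc : BPoly c) : DPoly fun d => Data.ofBool (decide (c d)) :=
  hc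

/-- Folds over lists, in a context. -/
theorem RPoly.fold {F : Data → Data → Data → PMF Data} {s l : Data → Data}
    (hF : RPoly fun p => F p.fst p.snd.fst p.snd.snd) (g : Polynomial ℕ)
    (hg : ∀ c s x, ∀ r ∈ (F c s x).support, r.size ≤ s.size + g.eval (c.size + x.size))
    (hs : DPoly s) (hl : DPoly l) :
    RPoly fun d => (l d).toList.foldlM (F d) (s d) := by
  refine RPoly.of_qpoly (QPoly.bind (DPoly.id.pair (hs.pair hl)).qpoly (QPoly.fold hF.qpoly g ?_))
    fun v => ?_
  · intro c s x q r hr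
    simp only [QData.erase, Data.fst, Data.snd, QM.ofPMF, PMF.mem_support_map_iff] at hr
    obtain ⟨d, hd, rfl⟩ := hr
    have h1 := hg _ _ _ d hd
    rw [Data.erase_toQ] at h1
    have h2 : g.eval (c.size + x.erase.size) ≤ g.eval (c.size + x.size) :=
      g.eval_mono_nat (by have := x.size_erase_le; omega)
    have := s.size_erase_le
    simp only [Data.size_toQ]
    omega
  · rw [pure_bind]
    simp only [Data.toQ, QData.fst, QData.snd, Data.erase_toQ, QData.toList_toQ]
    generalize (l v.erase).toList = L
    generalize s v.erase = t
    induction L generalizing t with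
    | nil => exact QM.ofPMF_pure t
    | cons x L ih =>
      simp only [List.map_cons, List.foldlM_cons]
      rw [show (QData.pair v.erase.toQ (QData.pair t.toQ x.toQ)).erase =
        Data.pair v.erase (Data.pair t x) by simp [QData.erase], QM.ofPMF_bind]
      funext q
      change PMF.map _ (PMF.bind _ _) = _
      rw [PMF.map_bind]
      refine congrArg _ (funext fun d => ?_)
      exact congrFun (ih d) q

theorem DPoly.fold {f : Data → Data → Data → Data} {s l : Data → Data}
    (hf : DPoly fun p => f p.fst p.snd.fst p.snd.snd) (g : Polynomial ℕ)
    (hg : ∀ c s x, (f c s x).size ≤ s.size + g.eval (c.size + x.size))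
    (hs : DPoly s) (hl : DPoly l) :
    DPoly fun d => (l d).toList.foldl (f d) (s d) :=
  (RPoly.fold (F := fun c s x => PMF.pure (f c s x)) hf g (by simpa using hg) hs hl).congr
    fun d => by
      dsimp only
      generalize (l d).toList = L
      generalize s d = t
      induction L generalizing t with
      | nil => rfl
      | cons x L ih =>
        rw [List.foldl_cons, ih, List.foldlM_cons]
        exact (PMF.pure_bind (f d t x) fun s => L.foldlM (fun s x => PMF.pure (f d s x)) s).symm

namespace DPoly

theorem reverse {l : Data → Data} (hl : DPoly l) :
    DPoly fun d => Data.ofList (l d).toList.reverse :=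
  (DPoly.fold (f := fun _ s x => Data.pair x s) (id.snd.snd.pair id.snd.fst) (Polynomial.X + 1)
    (fun c s x => by simp [Data.size]; omega) (const Data.nil) hl).congr fun d => by
      have : ∀ (L : List Data) (t : Data),
          L.foldl (fun s x => Data.pair x s) t = Data.ofList (L.reverse ++ t.toList) := by
        intro L
        induction L with
        | nil => simp
        | cons x L ih => intro t; simp [ih, Data.toList]
      rw [this]
      simp [Data.toList]

theorem append {l m : Data → Data} (hl : DPoly l) (hm : DPoly m) :
    DPoly fun d => Data.ofList ((l d).toList ++ (m d).toList) :=
  (DPoly.fold (f := fun _ s x => Data.pair x s) (id.snd.snd.pair id.snd.fst) (Polynomial.X + 1)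
    (fun c s x => by simp [Data.size]; omega) hm hl.reverse).congr fun d => by
      have : ∀ (L : List Data) (t : Data),
          L.foldl (fun s x => Data.pair x s) t = Data.ofList (L.reverse ++ t.toList) := by
        intro L
        induction L with
        | nil => simp
        | cons x L ih => intro t; simp [ih, Data.toList]
      rw [this]
      simp

end DPoly

/-- The results of a randomized computation for all items of a list. -/
theorem RPoly.mapM {F : Data → Data → PMF Data} {l : Data → Data}
    (hF : RPoly fun p => F p.fst p.snd) (hl : DPoly l) :
    RPoly fun d => ((l d).toList.mapM (F d)).map Data.ofList := by
  obtain ⟨g, hg⟩ := hF.size_le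
  have h1 : RPoly fun d => (l d).toList.foldlM
      (fun s x => (F d x).bind fun r => PMF.pure (Data.pair r s)) Data.nil := by
    refine RPoly.fold (F := fun c s x => (F c x).bind fun r => PMF.pure (Data.pair r s))
      (s := fun _ => Data.nil) ?_ (1 + g.comp (Polynomial.X + 1)) ?_ (DPoly.const _) hl
    · refine RPoly.bind₂ (F := fun p => F p.fst p.snd.snd)
        (G := fun p r => PMF.pure (Data.pair r p.snd.fst)) ?_ ?_
      · exact hF.comp (f := fun p => Data.pair p.fst p.snd.snd)
          (DPoly.id.fst.pair DPoly.id.snd.snd)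
      · exact DPoly.id.snd.pair DPoly.id.fst.snd.fst
    · intro c s x r hr
      rw [PMF.mem_support_bind_iff] at hr
      obtain ⟨t, ht, hr⟩ := hr
      rw [PMF.support_pure, Set.mem_singleton_iff] at hr
      subst hr
      have := hg (Data.pair c x) t ht
      simp [Data.size] at this ⊢
      omega
  refine (h1.bind (DPoly.id.reverse).rpoly).congr fun d => ?_
  generalize (l d).toList = L
  have : ∀ (L : List Data) (t : Data),
      L.foldlM (fun s x => (F d x).bind fun r => PMF.pure (Data.pair r s)) t =
        (L.mapM (F d)).map fun rs => Data.ofList (rs.reverse ++ t.toList) := by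
    intro L
    induction L with
    | nil =>
      intro t
      rw [List.mapM_nil]
      exact ((PMF.pure_map _ _).trans (by simp; rfl)).symm
    | cons x L ih =>
      intro t
      rw [List.foldlM_cons, List.mapM_cons]
      change PMF.bind (PMF.bind _ _) _ = PMF.map _ (PMF.bind _ _)
      rw [PMF.bind_bind, PMF.map_bind]
      refine congrArg _ (funext fun r => ?_)
      rw [PMF.pure_bind]
      change _ = PMF.map _ (PMF.bind _ _)
      rw [ih, PMF.map_bind]
      simp only [PMF.map]
      refine congrArg _ (funext fun rs => ?_)
      change _ = (PMF.pure _).bind _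
      simp [Data.toList]
  rw [this, PMF.bind_map, PMF.map]
  refine congrArg _ (funext fun rs => ?_)
  simp [Data.toList]

theorem List.mapM_pure_pmf {α β : Type} (f : α → β) (l : List α) :
    l.mapM (fun a => (PMF.pure (f a) : PMF β)) = PMF.pure (l.map f) :=
  List.mapM_pure (m := PMF)

namespace DPoly

theorem map {f : Data → Data → Data} {l : Data → Data}
    (hf : DPoly fun p => f p.fst p.snd) (hl : DPoly l) :
    DPoly fun d => Data.ofList ((l d).toList.map (f d)) :=
  (RPoly.mapM (F := fun c x => PMF.pure (f c x)) hf hl).congr fun d => by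
    rw [List.mapM_pure_pmf, PMF.pure_map]

/-- Drops as many items as the length of a list. -/
theorem drop {n l : Data → Data} (hn : DPoly n) (hl : DPoly l) :
    DPoly fun d => Data.ofList ((l d).toList.drop (n d).toList.length) :=
  (DPoly.fold (f := fun _ s _ => s.snd) id.snd.fst.snd 0
    (fun c s x => by simpa using s.size_snd_le) hl hn).congr fun d => by
      generalize (n d).toList = L
      generalize l d = t
      induction L generalizing t with
      | nil => simp
      | cons x L ih =>
        rw [List.foldl_cons, ← ih]
        cases t <;> simp [Data.toList, Data.snd]

theorem get {n l : Data → Data} (hn : DPoly n) (hl : DPoly l) :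
    DPoly fun d => (l d).toList.getD (n d).toList.length Data.nil :=
  (drop hn hl).fst.congr fun d => by
    rw [List.getD_eq_getElem?_getD, ← List.head?_drop]
    cases ((l d).toList.drop (n d).toList.length) <;> simp [Data.ofList, Data.fst]

/-- The result codes an option: `nil` means that nothing was found, `pair x nil` that `x` was. The
fold keeps its state once it is different from `nil`. -/
theorem find {c : Data → Data → Prop} {l : Data → Data} (hc : BPoly fun p => c p.fst p.snd)
    (hl : DPoly l) :
    DPoly fun d => ((l d).toList.find? fun x => decide (c d x)).elim Data.nil
      fun x => Data.pair x Data.nil :=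
  (DPoly.fold (f := fun d s x => if s = Data.nil then if c d x then Data.pair x Data.nil
      else Data.nil else s)
    (ite (BPoly.eq id.snd.fst (const _)) (ite (hc.comp (f := fun p => Data.pair p.fst p.snd.snd)
      (id.fst.pair id.snd.snd)) (id.snd.snd.pair (const _)) (const _)) id.snd.fst)
    (Polynomial.X + 1) (fun c s x => by
      split
      · split <;> simp [Data.size]; omega
      · simp) (const Data.nil) hl).congr fun d => by
      generalize (l d).toList = L
      have h : ∀ (L : List Data) (t : Data), t ≠ Data.nil → L.foldl (fun s x =>
          if s = Data.nil then if c d x then Data.pair x Data.nil else Data.nil else s) t = t := by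
        intro L t ht
        induction L with
        | nil => rfl
        | cons x L ih => rw [List.foldl_cons, if_neg ht, ih]
      induction L with
      | nil => rfl
      | cons x L ih =>
        rw [List.foldl_cons, if_pos rfl, List.find?_cons]
        by_cases hx : c d x
        · simp [hx, h]
        · simp [hx, ih]

end DPoly

theorem BPoly.all {c : Data → Data → Prop} {l : Data → Data} (hc : BPoly fun p => c p.fst p.snd)
    (hl : DPoly l) : BPoly fun d => ∀ x ∈ (l d).toList, c d x := by
  refine (BPoly.eq (DPoly.find (c := fun d x => ¬ c d x) (BPoly.not hc) hl)
    (DPoly.const Data.nil)).congr fun d => ?_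
  generalize h : List.find? _ (l d).toList = o
  cases o with
  | none =>
    refine iff_of_true ?_ rfl
    simpa only [List.find?_eq_none, decide_eq_true_eq, not_not] using h
  | some y =>
    have h1 := List.find?_some h
    have h2 := List.mem_of_find?_eq_some h
    simp at h1
    exact iff_of_false (fun h3 => h1 (h3 y h2)) (by simp)

namespace DPoly

theorem filter {c : Data → Data → Prop} {l : Data → Data} (hc : BPoly fun p => c p.fst p.snd)
    (hl : DPoly l) :
    DPoly fun d => Data.ofList ((l d).toList.filter fun x => decide (c d x)) :=
  (DPoly.fold (f := fun d s x => if c d x then Data.pair x s else s)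
    (ite (hc.comp (f := fun p => Data.pair p.fst p.snd.snd)
      (id.fst.pair id.snd.snd)) (id.snd.snd.pair id.snd.fst) id.snd.fst)
    (Polynomial.X + 1) (fun c s x => by
      split <;> simp [Data.size]; omega) (const Data.nil) hl).reverse.congr fun d => by
      generalize (l d).toList = L
      have h : ∀ (L : List Data) (t : Data), (L.foldl (fun s x =>
          if c d x then Data.pair x s else s) t).toList =
          (L.filter fun x => decide (c d x)).reverse ++ t.toList := by
        intro L
        induction L with
        | nil => intro t; simp
        | cons x L ih =>
          intro t
          rw [List.foldl_cons, ih, List.filter_cons]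
          by_cases hx : c d x <;> simp [hx, Data.toList]
      rw [h]
      simp [Data.toList]

end DPoly

namespace Data

/-- The list of the unary numbers below `n`. -/
def range (n : ℕ) : Data := ofList ((List.range n).map unary)

@[simp] theorem length_toList_unary (n : ℕ) : (unary n).toList.length = n := by
  induction n <;> simp_all [unary, toList]

@[simp] theorem toList_range (n : ℕ) : (range n).toList = (List.range n).map unary := by
  simp [range]

theorem unary_injective : Function.Injective unary := by
  intro a b h
  have := congrArg size h
  simpa using this

theorem ofList_injective : Function.Injective ofList := by
  intro a b h
  have := congrArg toList h
  simpa using this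

theorem ofBool_injective : Function.Injective ofBool := by
  intro a b h
  cases a <;> cases b <;> simp_all [ofBool]

@[simp] theorem ofBool_eq_nil (b : Bool) : ofBool b = nil ↔ b = false := by
  cases b <;> simp [ofBool]

theorem toList_unary (n : ℕ) : (unary n).toList = List.replicate n nil := by
  induction n <;> simp_all [unary, toList, List.replicate_succ]

end Data

namespace DPoly

/-- The number of items of a list, in unary. -/
theorem length {l : Data → Data} (hl : DPoly l) :
    DPoly fun d => Data.unary (l d).toList.length :=
  (map (f := fun _ _ => Data.nil) (const _) hl).congr fun d => by
    generalize (l d).toList = L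
    induction L <;> simp_all [Data.unary, Data.ofList]

/-- The list is built from its end: when the accumulator has length `j`, the number `n - j - 1` is
put in front of it. -/
theorem range {n : Data → Data} (hn : DPoly n) :
    DPoly fun d => Data.range (n d).toList.length := by
  have h1 : DPoly fun p => Data.unary ((n p.fst).toList.length - p.snd.fst.toList.length - 1) :=
    (drop id.snd.fst (hn.comp id.fst).length).snd.congr fun d => by
      simp only [Data.toList_unary, List.drop_replicate]
      cases h : (n d.fst).toList.length - d.snd.fst.toList.length <;>
        simp [Data.ofList, Data.unary, Data.snd, List.replicate_succ, ← Data.toList_unary]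
  obtain ⟨p, hp⟩ := hn.size_le
  refine (DPoly.fold (f := fun d s _ => Data.pair (Data.unary ((n d).toList.length -
    s.toList.length - 1)) s) (h1.pair id.snd.fst) (p + 1) (fun c s x => ?_) (const Data.nil)
    hn).congr fun d => ?_
  · have h2 := hp c
    have h3 : p.eval c.size ≤ p.eval (c.size + x.size) := p.eval_mono_nat (by omega)
    have := (n c).length_toList_le
    simp [Data.size]
    omega
  · generalize (n d).toList = L
    have : ∀ (M : List Data) (j : ℕ), M.length + j ≤ L.length → M.foldl
        (fun s _ => Data.pair (Data.unary (L.length - s.toList.length - 1)) s)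
        (Data.ofList ((List.range' (L.length - j) j).map Data.unary)) =
        Data.ofList ((List.range' (L.length - (M.length + j)) (M.length + j)).map Data.unary) := by
      intro M
      induction M with
      | nil => intro j _; simp
      | cons x M ih =>
        intro j hj
        rw [List.length_cons] at hj
        have := ih (j + 1) (by omega)
        rw [List.foldl_cons, List.length_cons, add_right_comm, add_assoc, ← this]
        congr 1
        simp only [Data.toList_ofList, List.length_map, List.length_range']
        rw [show L.length - (j + 1) = L.length - j - 1 by omega, List.range'_succ]
        simp only [List.map_cons, Data.ofList]
        rw [show L.length - j - 1 + 1 = L.length - j by omega]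
    have h4 := this L 0 (by simp)
    simp only [List.range'_zero, List.map_nil, Data.ofList, add_zero, Nat.sub_self] at h4
    rw [h4, Data.range, List.range_eq_range']

end DPoly

theorem RPoly.choose {l : Data → Data} (hl : DPoly l) : RPoly fun d => uniformList (l d).toList := by
  refine RPoly.comp (G := fun d => uniformList d.toList) (RPoly.of_qpoly
    (G := fun v => QM.ofPMF (uniformList v.erase.toList)) ?_ fun v => rfl) hl
  refine ⟨fun a => Prog.choose a (Expr.var a), Polynomial.X + 1, fun a σ O c hc => ?_⟩
  have h0 := (c.store a).size_erase_le
  have h1 := (c.store a).erase.length_toList_le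
  have hsup : ∀ d ∈ (uniformList (c.store a).erase.toList).support,
      d.size ≤ (c.store a).erase.size := by
    intro d hd
    have hmem : ∀ (t : Data), ∀ x ∈ t.toList, x.size ≤ t.size := by
      intro t
      induction t with
      | nil => simp [Data.toList]
      | pair x y _ ih =>
        intro z hz
        simp only [Data.toList, List.mem_cons] at hz
        rcases hz with rfl | hz
        · simp [Data.size]; omega
        · have := ih z hz
          simp [Data.size]; omega
    rw [uniformList] at hd
    split at hd
    · rw [PMF.mem_support_map_iff] at hd
      obtain ⟨i, -, rfl⟩ := hd
      exact hmem _ _ (List.get_mem _ _)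
    · rw [PMF.support_pure, Set.mem_singleton_iff] at hd
      simp [hd, Data.size]
  refine (PMFRel.refl_support _).map ?_
  rintro d d' ⟨rfl, hd⟩
  have := hsup d hd
  refine ⟨rfl, rfl, rfl, ?_, ?_⟩
  · simp [Conf.set, Conf.tick, Expr.eval]; omega
  · simp; omega

/-! ### Simulation of an oracle by programs -/

/-- One layer of the context of an answer: `(tag, x)` puts `x` to the left or to the right of the
answer, replaces the answer by `x`, or takes its first component. -/
def plugFrame (z f : QData) : QData :=
  if f.fst.erase.fst = Data.nil then
    if f.fst.erase.snd = Data.nil then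
      if f.fst.erase = Data.nil then QData.pair f.snd z else QData.pair z f.snd
    else z.fst
  else f.snd.erase.toQ

/-- What the simulator does with a call of oracle `k` with input `v` (the message and its own
state): it calls its own oracle at most once, and puts the answer into a context. -/
def handlerSem (pre post : ℕ → QData → QM QData) {σ : Type} (O : Oracle σ) (k : ℕ) (v : QData)
    (st : σ) : QM (QData × σ) :=
  pre k v >>= fun r =>
    (if r.fst.erase = Data.nil then pure (r.snd.fst, st) else O k r.snd.fst st) >>= fun a =>
      post k (QData.pair (Data.ofBool (decide (a.1.erase ≠ Data.nil))).toQ r.snd.snd) >>= fun p =>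
        pure (QData.pair (p.snd.toList.foldl plugFrame a.1) p.fst, a.2)

/-- The simulated oracle. Its state consists of the simulator's state and that of its oracle. -/
def simOracle (pre post : ℕ → QData → QM QData) {σ : Type} (O : Oracle σ) : Oracle (QData × σ) :=
  fun k msg st => do
    let r ← handlerSem pre post O k (QData.pair msg st.1) st.2
    pure (r.1.fst, (r.1.snd, r.2))

namespace Prog

/-- The answer of the outer oracle is in variable 3, the remaining frames in 5; 6, 7 and 8 are
scratch. Variable 3 is only moved, split or overwritten, so the cost of a round does not depend on
the size of the answer. -/
def plugBody : Prog :=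
  ite (Expr.var 5) (seq (split 6 5 5) (seq (split 7 8 6)
    (ite (Expr.fst (Expr.var 7)) (assign 3 (Expr.var 8))
      (ite (Expr.snd (Expr.var 7)) (split 3 8 3)
        (ite (Expr.var 7) (join 3 3 8) (join 3 8 3)))))) skip

/-- The store of the handler while it puts the answer into its context. -/
def plugStore (t z l u w x : QData) : ℕ → QData := fun y =>
  if y = 2 then t else if y = 3 then z else if y = 5 then l else if y = 6 then u
  else if y = 7 then w else if y = 8 then x else QData.nil

theorem run_plugBody {σ : Type} (O : Oracle σ) (o : σ) (m : QState) (n : ℕ) (t z f l u w x : QData) :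
    ∃ k ≤ 10, ∃ u' w' x', plugBody.run O ⟨plugStore t z (QData.pair f l) u w x, o, m, n⟩ =
      PMF.pure ⟨plugStore t (plugFrame z f) l u' w' x', o, m, n + k⟩ := by
  have e1 : (Expr.var 5).eval (plugStore t z (QData.pair f l) u w x) ≠ Data.nil := by
    simp [Expr.eval, plugStore, QData.erase]
  have h1 : (split 6 5 5).run O ⟨plugStore t z (QData.pair f l) u w x, o, m, n + 1⟩ =
      PMF.pure ⟨plugStore t z l f w x, o, m, n + 2⟩ := by
    simp only [run, Conf.set, Conf.tick]
    congr 2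
    funext y
    simp only [plugStore, update_apply, Nat.reduceEqDiff,
      if_true, if_false, QData.fst, QData.snd]
    try grind
  have h2 : (split 7 8 6).run O ⟨plugStore t z l f w x, o, m, n + 2⟩ =
      PMF.pure ⟨plugStore t z l QData.nil f.fst f.snd, o, m, n + 3⟩ := by
    simp only [run, Conf.set, Conf.tick]
    congr 2
    funext y
    simp only [plugStore, update_apply, Nat.reduceEqDiff,
      if_true, if_false, QData.fst, QData.snd]
    try grind
  rw [plugBody, run, if_neg e1, Conf.tick, run_seq_pure h1, run_seq_pure h2]
  simp only [run, Conf.tick, Conf.set, Expr.eval, plugFrame,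
    show plugStore t z l QData.nil f.fst f.snd 7 = f.fst from rfl]
  by_cases c1 : f.fst.erase.fst = Data.nil
  · by_cases c2 : f.fst.erase.snd = Data.nil
    · by_cases c3 : f.fst.erase = Data.nil
      · simp only [c3, Data.fst, Data.snd, if_true]
        refine ⟨7, by norm_num, QData.nil, f.fst, QData.nil, ?_⟩
        congr 2
        funext y
        simp only [plugStore, update_apply, Nat.reduceEqDiff,
          if_true, if_false, QData.fst, QData.snd]
        try grind
      · simp only [c1, c2, c3, if_true, if_false]
        refine ⟨7, by norm_num, QData.nil, f.fst, QData.nil, ?_⟩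
        congr 2
        funext y
        simp only [plugStore, update_apply, Nat.reduceEqDiff,
          if_true, if_false, QData.fst, QData.snd]
        try grind
    · simp only [c1, c2, if_true, if_false]
      refine ⟨6, by norm_num, QData.nil, f.fst, z.snd, ?_⟩
      congr 2
      funext y
      simp only [plugStore, update_apply, Nat.reduceEqDiff,
        if_true, if_false, QData.fst, QData.snd]
      try grind
  · simp only [c1, if_false]
    refine ⟨5, by norm_num, QData.nil, f.fst, f.snd, ?_⟩
    congr 2
    funext y
    simp only [plugStore, update_apply, Nat.reduceEqDiff,
      if_true, if_false, QData.fst, QData.snd]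
    try grind

theorem iter_plugBody {σ : Type} (O : Oracle σ) (o : σ) (m : QState) (t : QData) (i : ℕ) :
    ∀ (n : ℕ) (z l u w x : QData), l.toList.length ≤ i →
    ∃ k ≤ 10 * i, ∃ l' u' w' x', iterPMF (plugBody.run O) i ⟨plugStore t z l u w x, o, m, n⟩ =
      PMF.pure ⟨plugStore t (l.toList.foldl plugFrame z) l' u' w' x', o, m, n + k⟩ := by
  induction i with
  | zero =>
    intro n z l u w x hl
    refine ⟨0, le_rfl, l, u, w, x, ?_⟩
    rw [List.length_eq_zero_iff.1 (Nat.le_zero.1 hl)]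
    rfl
  | succ i ih =>
    intro n z l u w x hl
    have hnil : l.erase = Data.nil → l.toList = [] → ∃ k ≤ 10 * (i + 1), ∃ l' u' w' x',
        iterPMF (plugBody.run O) (i + 1) ⟨plugStore t z l u w x, o, m, n⟩ =
        PMF.pure ⟨plugStore t (l.toList.foldl plugFrame z) l' u' w' x', o, m, n + k⟩ := by
      intro h h'
      have e1 : (Expr.var 5).eval (plugStore t z l u w x) = Data.nil := by
        simp [Expr.eval, plugStore, h]
      obtain ⟨k, hk, l', u', w', x', h2⟩ := ih (n + 2) z l u w x (by rw [h']; simp)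
      refine ⟨k + 2, by omega, l', u', w', x', ?_⟩
      rw [iterPMF, plugBody, run, if_pos e1, run, PMF.pure_bind]
      rw [plugBody] at h2
      rw [show n + (k + 2) = n + 2 + k by omega]
      exact h2
    cases l with
    | nil => exact hnil rfl rfl
    | qubit b => exact hnil rfl rfl
    | pair f l =>
      simp only [QData.toList, List.length_cons] at hl
      obtain ⟨k, hk, u', w', x', h1⟩ := run_plugBody O o m n t z f l u w x
      obtain ⟨k', hk', l'', u'', w'', x'', h2⟩ := ih (n + k) (plugFrame z f) l u' w' x' (by omega)
      refine ⟨k + k', by omega, l'', u'', w'', x'', ?_⟩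
      rw [iterPMF, h1, PMF.pure_bind, h2]
      simp [QData.toList, add_assoc]

/-- The program of the simulator for calls of oracle `k`, from programs for its two parts. -/
def handler (P Q : ℕ → Prog) (k : ℕ) : Prog :=
  seq (P 0) (seq (split 1 2 0) (seq (split 3 4 2) (seq (ite (Expr.var 1) (call k 3 3) skip)
    (seq (assign 1 (Expr.eq (Expr.eq (Expr.var 3) Expr.nil) Expr.nil)) (seq (join 4 1 4) (seq (Q 4)
      (seq (split 2 5 4) (seq (loop (Expr.var 5) plugBody) (seq (join 0 3 2) (clear 1 8))))))))))

end Prog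

/-- The running time of an adversary must be bounded whatever its oracle answers, and answers may be
arbitrarily large. Therefore `post` learns a single bit about the answer, and the answer itself is
only spliced into its context, at constant cost per frame. Channels from 4 on behave alike, so five
pairs of programs suffice and one polynomial bounds them all. -/
theorem exists_handler {pre post : ℕ → QData → QM QData} (hpre : ∀ k, QPoly (pre k))
    (hpost : ∀ k, QPoly (post k)) (hpre' : ∀ k, pre k = pre (min k 4))
    (hpost' : ∀ k, post k = post (min k 4)) :
    ∃ (H : ℕ → Prog) (p : Polynomial ℕ), ∀ (k : ℕ) (σ : Type) (O : Oracle σ) (v : QData) (st : σ)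
      (m : QState), PMFRel (fun c r => c.store = (fun x => if x = 0 then r.1.1 else QData.nil) ∧
        c.orc = r.1.2 ∧ c.mem = r.2 ∧ c.cost ≤ p.eval v.size) ((H k).run O (Conf.start v st m))
        (handlerSem pre post O k v st m) := by
  choose P p hP using hpre
  choose Q q hQ using hpost
  refine ⟨fun k => Prog.handler (P (min k 4)) (Q (min k 4)) k,
    -- The first part costs `p`, and the message it sends has size at most `p`; the second part is
    -- run on an input of size at most `p + 4` and leaves at most `q (p + 4)` frames, each taking at
    -- most ten steps. The constant 100 covers the administration.
    ∑ i ∈ Finset.range 5, (100 + 2 * p i + 12 * (q i).comp (p i + 4)), fun k σ O v st m => ?_⟩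
  suffices h : PMFRel (fun c r => c.store = (fun x => if x = 0 then r.1.1 else QData.nil) ∧
      c.orc = r.1.2 ∧ c.mem = r.2 ∧
      c.cost ≤ (100 + 2 * p (min k 4) + 12 * (q (min k 4)).comp (p (min k 4) + 4)).eval v.size)
      ((Prog.handler (P (min k 4)) (Q (min k 4)) k).run O (Conf.start v st m))
      (handlerSem pre post O k v st m) by
    refine h.mono ?_
    rintro c r ⟨h1, h2, h3, h4⟩
    refine ⟨h1, h2, h3, h4.trans ?_⟩
    rw [Polynomial.eval_finsetSum]
    exact Finset.single_le_sum (f := fun i => (100 + 2 * p i + 12 * (q i).comp (p i + 4)).eval v.size)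
      (fun _ _ => Nat.zero_le _) (Finset.mem_range.2 (by omega))
  replace hP := hP (min k 4)
  replace hQ := hQ (min k 4)
  rw [← hpre' k] at hP
  rw [← hpost' k] at hQ
  generalize P (min k 4) = P at hP ⊢
  generalize Q (min k 4) = Q at hQ ⊢
  generalize p (min k 4) = p at hP ⊢
  generalize q (min k 4) = q at hQ ⊢
  have hfun : ∀ (s s' : ℕ → QData), s 0 = s' 0 → s 1 = s' 1 → s 2 = s' 2 → s 3 = s' 3 → s 4 = s' 4 →
      s 5 = s' 5 → (∀ x, 5 < x → s x = s' x) → s = s' := by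
    intro s s' h0 h1 h2 h3 h4 h5 h
    funext x
    by_cases hx : 5 < x
    · exact h x hx
    · interval_cases x <;> assumption
  rw [handlerSem, QM.bind_apply, Prog.handler]
  have h1 := hP 0 σ O (Conf.start v st m) (fun x hx => by simp [Conf.start, hx.ne'])
  simp only [Conf.start, if_true] at h1
  refine run_seq_rel h1 ?_
  rintro ⟨s, o, m', n⟩ ⟨r, m''⟩ ⟨g1, g2, g3, g4, g5⟩
  simp only at g1 g2 g3 g4 g5
  subst g1 g2 g3
  simp only [QM.bind_apply]
  let S : QData → QData → QData → ℕ → QData := fun a b c x =>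
    if x = 1 then a else if x = 3 then b else if x = 4 then c else QData.nil
  rw [run_seq_pure rfl, run_seq_pure (c' := ⟨S r.fst r.snd.fst r.snd.snd, o, m', n + 2⟩) (by
    simp only [Prog.run, Conf.set, Conf.tick]
    congr 2
    apply hfun <;> intros <;> simp [S, update_apply] <;> grind)]
  have h2 : PMFRel (fun c a => c.store = S r.fst a.1.1 r.snd.snd ∧ c.orc = a.1.2 ∧ c.mem = a.2 ∧
      c.cost ≤ n + 4 + r.size)
      ((Prog.ite (Expr.var 1) (Prog.call k 3 3) Prog.skip).run O
        ⟨S r.fst r.snd.fst r.snd.snd, o, m', n + 2⟩)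
      ((if r.fst.erase = Data.nil then pure (r.snd.fst, o) else O k r.snd.fst o : QM (QData × σ))
        m') := by
    rw [Prog.run]
    simp only [Expr.eval, show S r.fst r.snd.fst r.snd.snd 1 = r.fst from rfl]
    split
    · exact PMFRel.pure ⟨rfl, rfl, rfl, by simp [Conf.tick]⟩
    · refine ((PMFRel.refl _).map_left (R := fun a b => a = b) ?_)
      rintro a b rfl
      refine ⟨?_, rfl, rfl, ?_⟩
      · simp only [Conf.set, Conf.tick]
        apply hfun <;> intros <;> simp [S, update_apply]
        grind
      · have := r.size_snd_le
        have := r.snd.size_fst_le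
        simp [Conf.set, Conf.tick, S]
        omega
  refine run_seq_rel h2 ?_
  rintro ⟨s, o', m'', n'⟩ ⟨⟨a, o''⟩, m'''⟩ ⟨g1, g2, g3, g6⟩
  simp only at g1 g2 g3 g6
  subst g1 g2 g3
  let bit := Data.ofBool (decide (a.erase ≠ Data.nil))
  rw [run_seq_pure rfl, run_seq_pure (c' := ⟨S QData.nil a (QData.pair bit.toQ r.snd.snd), o', m'',
      n' + 2⟩) (by
    simp only [Prog.run, Conf.set, Conf.tick]
    congr 2
    apply hfun <;> intros <;> simp [S, update_apply, Expr.eval, bit]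
    grind)]
  have h3 := hQ 4 σ O ⟨S QData.nil a (QData.pair bit.toQ r.snd.snd), o', m'', n' + 2⟩ (by
    intro x hx
    simp only [S]
    grind)
  simp only [show S QData.nil a (QData.pair bit.toQ r.snd.snd) 4 = QData.pair bit.toQ r.snd.snd
    from rfl] at h3
  refine run_seq_rel h3 ?_
  rintro ⟨s, o'', m₃, n''⟩ ⟨p', m₄⟩ ⟨g1, g2, g3, g7, g8⟩
  simp only at g1 g2 g3 g7 g8
  subst g1 g2 g3
  rw [run_seq_pure (c' := ⟨Prog.plugStore p'.fst a p'.snd QData.nil QData.nil QData.nil, o'', m₃,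
      n'' + 1⟩) (by
    simp only [Prog.run, Conf.set, Conf.tick]
    congr 2
    apply hfun
    any_goals (simp [S, update_apply, Prog.plugStore]; done)
    intro x hx
    simp only [update_apply, S, Prog.plugStore]
    grind)]
  obtain ⟨i, hi, l', u', w', x', h4⟩ := Prog.iter_plugBody O o'' m₃ p'.fst p'.snd.erase.size
    (n'' + 1 + (1 + p'.snd.erase.size)) a p'.snd QData.nil QData.nil QData.nil
    p'.snd.length_toList_le
  have h5 : (Prog.loop (Expr.var 5) Prog.plugBody).run O
      ⟨Prog.plugStore p'.fst a p'.snd QData.nil QData.nil QData.nil, o'', m₃, n'' + 1⟩ =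
      PMF.pure ⟨Prog.plugStore p'.fst (p'.snd.toList.foldl plugFrame a) l' u' w' x', o'', m₃,
        n'' + 1 + (1 + p'.snd.erase.size) + i⟩ := h4
  rw [run_seq_pure h5, run_seq_pure rfl]
  simp only [Conf.set, Conf.tick]
  rw [Prog.run_clear]
  refine PMFRel.pure ⟨?_, rfl, rfl, ?_⟩
  · simp only
    apply hfun
    any_goals (simp [update_apply, Prog.plugStore]; done)
    intro x hx
    simp only [update_apply, Prog.plugStore]
    grind
  · have e1 := r.size_snd_le
    have e2 := r.snd.size_snd_le
    have e3 : bit.size ≤ 1 := by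
      simp only [bit]
      cases decide (a.erase ≠ Data.nil) <;> simp [Data.ofBool, Data.size]
    have e4 : q.eval (QData.pair bit.toQ r.snd.snd).size ≤ q.eval (p.eval v.size + 4) :=
      q.eval_mono_nat (by simp [QData.size]; omega)
    have e5 := p'.snd.size_erase_le
    have e6 := p'.size_snd_le
    rw [QData.erase_snd] at e5 hi
    simp
    omega

/-! ### Reductions -/

namespace Prog

/-- The program `A`, on the even variables, whose calls are answered by the programs `H k`, on the
odd variables. The simulator's state is in variable `3`. -/
def compile (H : ℕ → Prog) (A : Prog) : Prog :=
  A.subst (fun x => 2 * x) fun k x y =>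
    seq (join 1 (2 * y) 3) (seq ((H k).subst (fun x => 2 * x + 1)
      fun k x y => call k (2 * x + 1) (2 * y + 1)) (split (2 * x) 3 1))

/-- A handler runs on the odd variables, so the even ones, which belong to the simulated program,
are preserved. Oracle calls are kept and reach the same oracle. -/
theorem run_rename {P : Prog} {σ : Type} (O : Oracle σ) (s : ℕ → QData)
    (o : σ) (m : QState) (n : ℕ) (v : QData) (hs1 : s 1 = v)
    (hs : ∀ x, x ≠ 0 → s (2 * x + 1) = QData.nil) :
    PMFRel (fun c d => (∀ x, c.store (2 * x + 1) = d.store x) ∧ c.mem = d.mem ∧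
      (∀ x, c.store (2 * x) = s (2 * x)) ∧ c.orc = d.orc ∧ c.cost = d.cost + n)
      ((P.subst (fun x => 2 * x + 1) fun k x y => call k (2 * x + 1) (2 * y + 1)).run O ⟨s, o, m, n⟩)
      (P.run O (Conf.start v o m)) := by
  have hinj : Function.Injective fun x : ℕ => 2 * x + 1 := fun x y h => by
    simp only at h; omega
  have hev : ∀ x : ℕ, 2 * x ∉ Set.range fun x : ℕ => 2 * x + 1 := by
    rintro x ⟨y, hy⟩; simp only at hy; omega
  have := subst_rel O O (f := fun x => 2 * x + 1) (M := Eq)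
    (Fr := fun s' o' n' o'' n'' => (∀ x, s' (2 * x) = s (2 * x)) ∧ o' = o'' ∧ n' = n'' + n)
    hinj (by
      rintro s o n o' n' s' t ⟨h1, h2, h3⟩ h
      exact ⟨fun x => by rw [h _ (hev x), h1 x], h2, by omega⟩)
    (fun _ => False) (fun _ => False) (by simp) (by simp)
    (fun k x y => call k (2 * x + 1) (2 * y + 1)) P (Or.inl rfl)
    (Or.inr (by
      rintro k x y ⟨s₁, o₁, m₁, n₁⟩ ⟨s₂, o₂, m₂, n₂⟩ ⟨h1, h2, h3, h4, h5⟩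
      simp only at h1 h2 h3 h4 h5
      subst h1 h2 h4 h5
      refine (PMFRel.refl _).map ?_
      rintro r _ rfl
      refine Or.inl ⟨?_, rfl, fun z => ?_, rfl, ?_⟩
      · simp only [Conf.set, Conf.tick]
        rw [Function.update_comp_eq_of_injective _ hinj, Function.update_comp_eq_of_injective _ hinj]
      · simp only [Conf.set, Conf.tick]
        rw [update_of_ne (by omega), update_of_ne (by omega), h3]
      · simp only [Conf.set, Conf.tick, Function.comp]; omega))
    ⟨s, o, m, n⟩ (Conf.start v o m) (Or.inl ⟨by
      funext x
      by_cases hx : x = 0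
      · simp [Conf.start, hx, hs1]
      · simp only [Conf.start, Function.comp, if_neg hx, hs x hx], rfl, fun _ => rfl, rfl,
        by simp [Conf.start]⟩)
  refine this.mono ?_
  rintro c d (⟨h1, h2, h3, h4, h5⟩ | ⟨h, -⟩)
  · exact ⟨fun x => congrFun h1 x, h2, h3, h4, h5⟩
  · exact h.elim

/-- The run of a program with simulated oracle. Its running time is bounded as long as the running
time of the simulated program is at most `T`. -/
theorem run_compile {pre post : ℕ → QData → QM QData} {σ : Type} (O : Oracle σ) {H : ℕ → Prog}
    {p : Polynomial ℕ} (hH : ∀ (k : ℕ) (v : QData) (st : σ) (m : QState),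
      PMFRel (fun c r => c.store = (fun x => if x = 0 then r.1.1 else QData.nil) ∧
        c.orc = r.1.2 ∧ c.mem = r.2 ∧ c.cost ≤ p.eval v.size) ((H k).run O (Conf.start v st m))
        (handlerSem pre post O k v st m))
    (T K X : ℕ) (Good : ℕ → QData → Prop) (hmono : ∀ n n' s, n ≤ n' → Good n s → Good n' s)
    (hgood : ∀ (k : ℕ) (msg s : QData) (n : ℕ) (st : σ) (m : QState), Good n s →
      n + 1 + msg.size ≤ T → ∀ r ∈ (handlerSem pre post O k (QData.pair msg s) st m).support,
      Good (n + 1 + msg.size) r.1.1.snd)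
    (hK : ∀ (msg s : QData) (n : ℕ), Good n s → n + 1 + msg.size ≤ T →
      p.eval (QData.pair msg s).size ≤ K) (A : Prog) (s : ℕ → QData) (o : σ) (m : QState) (n : ℕ)
    (hs : ∀ x, x ≠ 1 → s (2 * x + 1) = QData.nil) (hs' : Good 0 (s 3)) (hn : n ≤ X) :
    PMFRel (fun c d => (∀ x, c.store (2 * x) = d.store x) ∧ c.store 3 = d.orc.1 ∧ c.orc = d.orc.2 ∧
      c.mem = d.mem ∧ (d.cost ≤ T → c.cost ≤ (K + 2) * d.cost + X))
      ((compile H A).run O ⟨s, o, m, n⟩)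
      (A.run (simOracle pre post O) ⟨fun x => s (2 * x), (s 3, o), m, 0⟩) := by
  have hinj : Function.Injective fun x : ℕ => 2 * x := fun x y h => by
    simp only at h; omega
  have hev : ∀ x : ℕ, 2 * x + 1 ∉ Set.range fun x : ℕ => 2 * x := by
    rintro x ⟨y, hy⟩; simp only at hy; omega
  have := subst_rel O (simOracle pre post O) (f := fun x => 2 * x) (M := Eq)
    -- Each simulated call costs at most `K` for the handler and 2 for packing and unpacking. The
    -- bound is conditional on `n' ≤ T`: only then is the simulator's state known to be small enough
    -- for `K` to apply.
    (Fr := fun s o n o' n' => (∀ x, x ≠ 1 → s (2 * x + 1) = QData.nil) ∧ s 3 = o'.1 ∧ o = o'.2 ∧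
      (n' ≤ T → n ≤ (K + 2) * n' + X ∧ Good n' o'.1)) hinj (by
      rintro s o n o' n' s' t ⟨h1, h2, h3, h4⟩ h
      refine ⟨fun x hx => by rw [h _ (hev x), h1 x hx], by rw [h 3 (hev 1), h2], h3, fun ht => ?_⟩
      obtain ⟨h5, h6⟩ := h4 (by omega)
      refine ⟨?_, hmono _ _ _ (by omega) h6⟩
      nlinarith)
    (fun _ => False) (fun _ => False) (by simp) (by simp)
    (fun k x y =>
      seq (join 1 (2 * y) 3) (seq ((H k).subst (fun x => 2 * x + 1)
        fun k x y => call k (2 * x + 1) (2 * y + 1)) (split (2 * x) 3 1))) A (Or.inl rfl)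
    (Or.inr ?_)
    ⟨s, o, m, n⟩ ⟨fun x => s (2 * x), (s 3, o), m, 0⟩ (Or.inl ⟨rfl, rfl, hs, rfl, rfl,
      fun _ => ⟨by simpa using hn, hs'⟩⟩)
  · refine this.mono ?_
    rintro c d (⟨h1, h2, h3, h4, h5, h6⟩ | ⟨h, -⟩)
    · exact ⟨fun x => congrFun h1 x, h4, h5, h2, fun h => (h6 h).1⟩
    · exact h.elim
  clear s o m n hs hs' hn
  rintro k x y ⟨s, o, m, n⟩ ⟨s', ⟨v, o'⟩, m', n'⟩ ⟨h1, h2, h3, h4, h5, h6⟩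
  simp only at h1 h2 h3 h4 h5 h6
  subst h1 h2 h4 h5
  rw [run_seq_pure rfl]
  simp only [Conf.set, Conf.tick]
  rw [run]
  have e1 : update s (2 * y) QData.nil 3 = s 3 := update_of_ne (by omega) _ _
  simp only [e1]
  have hr := run_rename (P := H k) O (update (update (update s (2 * y)
    QData.nil) 3 QData.nil) 1 (QData.pair (s (2 * y)) (s 3))) o m (n + 1)
    (QData.pair (s (2 * y)) (s 3)) (by simp) (fun x hx => by
      simp only [update_apply]
      rw [if_neg (by omega)]
      split
      · rfl
      · rw [if_neg (by omega)]
        exact h3 x (by omega))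
  have hH' := (hH k (QData.pair (s (2 * y)) (s 3)) o m).and_support
  simp only [run, simOracle, QM.bind_apply, QM.pure_apply]
  rw [PMF.map_bind]
  simp only [PMF.pure_map]
  -- Two couplings are glued over the run of the handler started on its own: renamed handler against
  -- handler, and handler against its meaning.
  have hcomb : PMFRel (fun c r => (∀ x, c.store (2 * x + 1) = if x = 0 then r.1.1 else QData.nil) ∧
      c.mem = r.2 ∧ (∀ x, c.store (2 * x) = update s (2 * y) QData.nil (2 * x)) ∧
      c.orc = r.1.2 ∧ c.cost ≤ p.eval (QData.pair (s (2 * y)) (s 3)).size + (n + 1) ∧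
      r ∈ (handlerSem pre post O k (QData.pair (s (2 * y)) (s 3)) o m).support)
      (((H k).subst (fun x => 2 * x + 1) fun k x y => call k (2 * x + 1) (2 * y + 1)).run O
        ⟨update (update (update s (2 * y)
          QData.nil) 3 QData.nil) 1 (QData.pair (s (2 * y)) (s 3)), o, m, n + 1⟩)
      (handlerSem pre post O k (QData.pair (s (2 * y)) (s 3)) o m) := by
    obtain ⟨ρ, hρ1, hρ2, hρ⟩ := hH'
    have h := hr
    rw [← hρ1] at h
    have h2 : PMFRel (fun d p => d = p.1 ∧ p ∈ ρ.support) (ρ.map Prod.fst) ρ := by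
      refine (PMFRel.refl_support ρ).map_left ?_
      rintro a b ⟨rfl, h⟩
      exact ⟨rfl, h⟩
    have h3 := (PMFRel.bind (S := fun c (r : (QData × σ) × QState) =>
      (∀ x, c.store (2 * x + 1) = if x = 0 then r.1.1 else QData.nil) ∧
      c.mem = r.2 ∧ (∀ x, c.store (2 * x) = update s (2 * y) QData.nil (2 * x)) ∧
      c.orc = r.1.2 ∧ c.cost ≤ p.eval (QData.pair (s (2 * y)) (s 3)).size + (n + 1) ∧
      r ∈ (handlerSem pre post O k (QData.pair (s (2 * y)) (s 3)) o m).support) (f := PMF.pure) (h.trans h2) (g := fun p => PMF.pure p.2) ?_)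
    · rw [PMF.bind_pure] at h3
      have e : (ρ.bind fun p => PMF.pure p.2) = handlerSem pre post O k
          (QData.pair (s (2 * y)) (s 3)) o m := hρ2
      rw [e] at h3
      exact h3
    · rintro c p ⟨d, ⟨g1, g2, g3, g4, g5⟩, rfl, hp⟩
      obtain ⟨⟨f1, f2, f3, f4⟩, -, f5⟩ := hρ p hp
      refine PMFRel.pure ⟨fun x => by rw [g1, f1], by rw [g2, f3], fun x => ?_, by rw [g4, f2],
        by omega, f5⟩
      rw [g3, update_of_ne (by omega), update_of_ne (by omega)]
  refine hcomb.bind ?_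
  rintro ⟨s₁, o₁, m₁, n₁⟩ ⟨⟨v, o₂⟩, m₂⟩ ⟨g1, g2, g3, g4, g5, g6⟩
  simp only at g1 g2 g3 g4 g5
  subst g2 g4
  have a1 : s₁ 1 = v := g1 0
  have a3 : s₁ 3 = QData.nil := g1 1
  refine PMFRel.pure (Or.inl ⟨?_, rfl, fun z hz => ?_, ?_, rfl, fun ht => ?_⟩)
  · funext z
    simp only [Conf.set, Conf.tick, Function.comp, a1, update_apply, g3]
    grind
  · simp only [Conf.set, Conf.tick, a1, update_apply, g1]
    grind
  · simp only [Conf.set, Conf.tick, a1, update_apply]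
    grind
  · simp only [Conf.set, Conf.tick, Function.comp] at ht ⊢
    obtain ⟨b1, b2⟩ := h6 (by omega)
    have := hK _ _ _ b2 (by omega : n' + 1 + (s (2 * y)).size ≤ T)
    refine ⟨?_, ?_⟩
    · nlinarith
    · rw [← add_assoc]
      exact hgood k _ _ _ _ _ b2 (by omega) _ g6

end Prog

open Data (pair nil unary ofBool ofList)

/-- The reduction with simulated oracles: the simulator's state `(c, s)` is sampled from `1^lam`,
its part `c` is never changed in size, `s` grows by a bounded amount in every call. -/
theorem exists_reduction {pre post : ℕ → QData → QM QData} (hpre : ∀ k, QPoly (pre k))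
    (hpost : ∀ k, QPoly (post k)) (hpre' : ∀ k, pre k = pre (min k 4))
    (hpost' : ∀ k, post k = post (min k 4)) {init : Data → PMF Data} (hinit : RPoly init)
    (g : Polynomial ℕ)
    (hg : ∀ k msg s m, ∀ r ∈ (pre k (QData.pair msg s) m).support, ∀ b m',
      ∀ p ∈ (post k (QData.pair b r.1.snd.snd) m').support, p.1.fst.fst.size ≤ s.fst.size ∧
      p.1.fst.snd.size ≤ s.snd.size + g.eval (s.fst.size + msg.size))
    {A : Prog} (hA : A.IsQPTAdversary) :
    ∃ B : Prog, B.IsQPTAdversary ∧ ∀ (lam : ℕ) (σ : Type) (O : Oracle σ) (st : σ) (m : QState),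
      (B.run O (Conf.start (unary lam).toQ st m)).map
        (fun c => (c.orc, decide ((c.store 0).erase ≠ nil))) =
      (init (unary lam)).bind fun s =>
        (A.run (simOracle pre post O) (Conf.start (unary lam).toQ (s.toQ, st) m)).map
          fun c => (c.orc.2, decide ((c.store 0).erase ≠ nil)) := by
  obtain ⟨H, p, hH⟩ := exists_handler hpre hpost hpre' hpost'
  obtain ⟨I, pI, hI⟩ := hinit
  obtain ⟨pA, hA⟩ := hA
  -- Within the running time `pA` a message has size at most `pA`, the fixed part of the state at
  -- most `pI`, and the growing part at most `pI + pA * g (pI + pA)`. So `K` bounds the cost of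
  -- every handler.
  let K : Polynomial ℕ := p.comp (pA + 2 * pI + pA * g.comp (pI + pA) + 3)
  -- Variable 3 is where `compile` keeps the simulator's state. Variable 0 still holds `1^lam`, the
  -- input of the simulated adversary.
  let B : Prog := Prog.seq (Prog.assign 3 (Expr.var 0)) (Prog.seq (I 3) (Prog.compile H A))
  have main : ∀ (lam : ℕ) (σ : Type) (O : Oracle σ) (st : σ) (m : QState),
      PMFRel (fun c d => c.orc = d.orc.2 ∧ c.cost ≤ ((K + 2) * pA + pI + 4).eval lam ∧
        c.store 0 = d.store 0)
        (B.run O (Conf.start (unary lam).toQ st m))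
        ((init (unary lam)).bind fun s =>
          A.run (simOracle pre post O) (Conf.start (unary lam).toQ (s.toQ, st) m)) := by
    intro lam σ O st m
    simp only [B]
    rw [run_seq_pure rfl]
    have h1 := hI 3 σ O (((Conf.start (unary lam).toQ st m).tick 1).set 3
      (unary lam).toQ) (fun x hx => by
        simp only [Conf.set, Conf.tick, Conf.start]
        rw [update_of_ne (by omega), if_neg (by omega)])
    have e1 : ((((Conf.start (unary lam).toQ st m).tick 1).set 3 (unary lam).toQ).store 3)
      = (unary lam).toQ := by simp [Conf.set]
    rw [e1] at h1
    simp only [Data.erase_toQ, Data.size_toQ, Data.size_unary, QM.ofPMF] at h1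
    have e2 : (Conf.set (Conf.tick (Conf.start (unary lam).toQ st m) 1) 3
        (Expr.eval (Conf.start (unary lam).toQ st m).store (Expr.var 0)).toQ) =
        (((Conf.start (unary lam).toQ st m).tick 1).set 3 (unary lam).toQ) := by
      simp [Expr.eval, Conf.start]
    rw [e2]
    have h2 : PMFRel (fun (c : Conf σ) (d : Data) => QPost 3 (((Conf.start (unary lam).toQ st m).tick 1).set 3
      (unary lam).toQ) (pI.eval lam) c (d.toQ, m)) ((I 3).run O (((Conf.start (unary lam).toQ st m).tick 1).set 3
      (unary lam).toQ)) (init (unary lam)) := by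
      obtain ⟨ρ, r1, r2, r3⟩ := h1
      -- The second marginal is a sampler of classical data, so it leaves the memory alone and its
      -- results are recovered from their classical parts.
      have : ∀ p ∈ ρ.support, p.2.2 = m ∧ p.2.1 = p.2.1.erase.toQ := by
        intro p hp
        have : p.2 ∈ (ρ.map Prod.snd).support := (PMF.mem_support_map_iff _ _ _).2 ⟨p, hp, rfl⟩
        rw [r2, PMF.mem_support_map_iff] at this
        obtain ⟨d, -, hd⟩ := this
        rw [← hd]
        exact ⟨rfl, by simp⟩
      refine ⟨ρ.map fun p => (p.1, p.2.1.erase), ?_, ?_, ?_⟩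
      · rw [PMF.map_comp, ← r1]; rfl
      · have : (ρ.map Prod.snd).map (fun p => p.1.erase) = init (unary lam) := by
          rw [r2, PMF.map_comp]
          simp only [Function.comp_def, Data.erase_toQ]
          exact PMF.map_id _
        rw [← this, PMF.map_comp, PMF.map_comp]; rfl
      · intro x hx
        rw [PMF.mem_support_map_iff] at hx
        obtain ⟨p, hp, rfl⟩ := hx
        have h3 := r3 p hp
        obtain ⟨h4, h5⟩ := this p hp
        have : (p.2.1.erase.toQ, m) = p.2 := by rw [← h5, ← h4]
        simp only [this]
        exact h3
    refine run_seq_rel h2 ?_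
    rintro ⟨s, o, m', n⟩ s₀ ⟨g1, g2, g3, g4, g5⟩
    simp only [Conf.set, Conf.tick, Conf.start, Data.size_toQ] at g1 g2 g3 g4 g5
    subst g2 g3
    have gs : ∀ x, s x = if x = 0 then (unary lam).toQ else if x = 3 then s₀.toQ
        else QData.nil := by
      intro x
      rw [g1]
      simp only [update_apply]
      grind
    have h3 := Prog.run_compile O (fun k v st m => hH k σ O v st m) (pA.eval lam) (K.eval lam)
      (pI.eval lam + 1)
      (fun n s => s.fst.size ≤ pI.eval lam ∧
        s.snd.size ≤ pI.eval lam + n * g.eval (pI.eval lam + pA.eval lam))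
      (fun n n' s hn h => ⟨h.1, h.2.trans (by gcongr)⟩)
      (by
        rintro k msg s n st m ⟨a1, a2⟩ hT r hr
        simp only [handlerSem, QM.bind_apply, PMF.mem_support_bind_iff] at hr
        obtain ⟨r₁, hr₁, a, -, p₁, hp₁, hr⟩ := hr
        rw [QM.pure_apply, PMF.support_pure, Set.mem_singleton_iff] at hr
        subst hr
        obtain ⟨b1, b2⟩ := hg k msg s m r₁ hr₁ _ _ p₁ hp₁
        refine ⟨b1.trans a1, b2.trans ?_⟩
        have : g.eval (s.fst.size + msg.size) ≤ g.eval (pI.eval lam + pA.eval lam) :=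
          g.eval_mono_nat (by omega)
        nlinarith)
      (by
        rintro msg s n ⟨a1, a2⟩ hT
        simp only [K, Polynomial.eval_comp, Polynomial.eval_add, Polynomial.eval_mul]
        refine p.eval_mono_nat ?_
        have : s.size ≤ s.fst.size + s.snd.size + 1 := by
          cases s <;> simp [QData.size, QData.fst, QData.snd]
        have : n * g.eval (pI.eval lam + pA.eval lam) ≤ pA.eval lam *
          g.eval (pI.eval lam + pA.eval lam) := Nat.mul_le_mul_right _ (by omega)
        simp [QData.size]
        omega) A s o m' n
      (fun x hx => by rw [gs, if_neg (by omega), if_neg (by omega)])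
      (by
        rw [gs]
        have := s₀.toQ.size_fst_le
        have := s₀.toQ.size_snd_le
        simp at *
        omega) (by omega)
    have e3 : (⟨fun x => s (2 * x), (s 3, o), m', 0⟩ : Conf (QData × σ)) =
        Conf.start (unary lam).toQ (s₀.toQ, o) m' := by
      rw [Conf.start]
      congr 2
      · funext x
        rw [gs]
        by_cases hx : x = 0
        · simp [hx]
        · rw [if_neg (by omega), if_neg (by omega), if_neg hx]
      · rw [gs]; simp
    rw [e3] at h3
    refine h3.and_support.mono ?_
    rintro c d ⟨⟨b1, b2, b3, b4, b5⟩, -, hd⟩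
    have hc := hA lam _ _ _ _ d hd
    have b6 := b5 hc
    refine ⟨b3, ?_, b1 0⟩
    have : (K.eval lam + 2) * d.cost ≤ (K.eval lam + 2) * pA.eval lam :=
      Nat.mul_le_mul_left _ hc
    simp
    omega
  refine ⟨B, ⟨(K + 2) * pA + pI + 4, fun lam σ O st q c hc => ?_⟩, fun lam σ O st m => ?_⟩
  · obtain ⟨d, -, -, h, -⟩ := (main lam σ O st q).exists_right hc
    exact h
  · rw [(main lam σ O st m).map_eq (g := fun c => (c.orc.2, decide ((c.store 0).erase ≠ nil)))
      ?_, PMF.map_bind]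
    rintro c d ⟨h1, -, h3⟩
    rw [h1, h3]

/-! ### Runs with related oracles -/

theorem Expr.rename_id (e : Expr) : e.rename (fun x => x) = e := by
  induction e <;> simp_all [Expr.rename]

theorem Prog.subst_id (P : Prog) : P.subst (fun x => x) call = P := by
  induction P <;> simp_all [Prog.subst, Expr.rename_id]

/-- Runs with oracles that behave in the same way as long as nothing bad happens. -/
theorem Prog.run_rel {σ σ' : Type} (O : Oracle σ) (O' : Oracle σ') (R : σ → σ' → Prop)
    (B : σ → Prop) (B' : σ' → Prop)
    (hB : ∀ k msg st q, B st → ∀ r ∈ (O k msg st q).support, B r.1.2)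
    (hB' : ∀ k msg st q, B' st → ∀ r ∈ (O' k msg st q).support, B' r.1.2)
    (hR : ∀ k msg st st' q, R st st' → PMFRel (fun r r' => (r.1.1 = r'.1.1 ∧ r.2 = r'.2 ∧
      R r.1.2 r'.1.2) ∨ B r.1.2 ∧ B' r'.1.2) (O k msg st q) (O' k msg st' q))
    (P : Prog) (v : QData) (st : σ) (st' : σ') (q : QState) (h : R st st') :
    PMFRel (fun c d => (c.store = d.store ∧ R c.orc d.orc) ∨ B c.orc ∧ B' d.orc)
      (P.run O (Conf.start v st q)) (P.run O' (Conf.start v st' q)) := by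
  have := subst_rel O O' (f := fun x => x) (M := Eq) (Fr := fun _ o _ o' _ => R o o')
    (fun _ _ h => h) (fun _ _ _ _ _ _ _ h _ => h) B B' hB hB' call P (Or.inl rfl) (Or.inr ?_)
    (Conf.start v st q) (Conf.start v st' q) (Or.inl ⟨rfl, rfl, h⟩)
  · rw [subst_id] at this
    refine this.mono ?_
    rintro c d (⟨h1, h2, h3⟩ | h)
    · exact Or.inl ⟨h1, h3⟩
    · exact Or.inr h
  · rintro k x y ⟨s, o, m, n⟩ ⟨s', o', m', n'⟩ ⟨h1, h2, h3⟩
    simp only at h1 h2 h3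
    subst h1 h2
    refine (hR k (s y) o o' m h3).map ?_
    rintro r r' (⟨g1, g2, g3⟩ | g)
    · refine Or.inl ⟨?_, g2, g3⟩
      simp only [Conf.set, Conf.tick, Function.comp_def, g1]
    · exact Or.inr g

theorem QM.lift_apply {α : Type} (p : PMF α) (q : QState) :
    (StateT.lift p : QM α) q = p.map fun a => (a, q) := rfl

/-! ### Experiments with a changed challenge query -/

section Game

variable {ell : ℕ → ℕ} (S : ABESKL ell) (T : AttrRel) (selective : Bool) (q : ℕ → ℕ) (lam : ℕ)

variable {S lam} in
/-- The verification keys of the keys with attributes related to `x`. -/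
def relatedKeys (x : Data) (keys : List (Data × S.VK lam × Bool)) : List (S.VK lam) :=
  (keys.filter fun e => decide (T.R lam x e.1)).map fun e => e.2.1

/-- The challenge query with an additional condition `ok` on the verification keys of the keys with
related attributes; the challenge ciphertext is `encf x m₀ m₁`. -/
def gameChallenge (ok : List (S.VK lam) → Prop)
    (encf : Data → Msg (ell lam) → Msg (ell lam) → PMF Data) (msg : QData) (st : ChalState S lam) :
    QM (QData × ChalState S lam) :=
  if st.started = true ∧ st.aborted = false ∧ st.challenged = none then
    let x := st.target.getD msg.erase.fst
    let dist := st.keys.filter fun e => decide (T.R lam x e.1)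
    match Msg.decode (ell lam) msg.erase.snd.fst, Msg.decode (ell lam) msg.erase.snd.snd with
    | some m₀, some m₁ =>
        if (x ∈ T.X lam ∧ dist.length ≤ q lam ∧ ∀ e ∈ dist, e.2.2 = true) ∧
            ok (relatedKeys T x st.keys) then do
          let ct ← StateT.lift (encf x m₀ m₁)
          pure (ct.toQ, { st with challenged := some x })
        else pure (QData.nil, { st with aborted := true })
    | _, _ => pure (QData.nil, { st with aborted := true })
  else pure (QData.nil, st)

/-- The challenger with a changed challenge query. -/
def game (ok : List (S.VK lam) → Prop)
    (encf : Data → Msg (ell lam) → Msg (ell lam) → PMF Data)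
    (pk : S.PK lam) (msk : S.MSK lam) : Oracle (ChalState S lam)
  | 0, msg, st => startOracle S selective lam pk msg st
  | 1, msg, st => kgOracle S T lam msk msg st
  | 2, msg, st => vrfyOracle S lam msg st
  | 3, msg, st => gameChallenge S T q lam ok encf msg st
  | _, _, st => pure (QData.nil, st)

/-- The initial state of the challenger. -/
def ChalState.init : ChalState S lam := ⟨false, none, [], none, false⟩

variable {S lam}

/-- The output of an experiment. -/
def outcome (c : Conf (ChalState S lam)) : Bool :=
  !c.orc.aborted && decide ((c.store 0).erase ≠ nil)

/-- Verification keys stay with the challenger, so they may carry additional information that `φ`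
forgets without the adversary noticing. This allows the columns drawn by the balls-and-bins scheme
to be recorded. The coupling is exact, with impossible bad events. -/
theorem challenger_run_eq {S' : ABESKL ell} (φ : S'.VK lam → S.VK lam) (coin : Bool) (pk : S.PK lam)
    (msk : S.MSK lam) (pk' : S'.PK lam) (msk' : S'.MSK lam)
    (hpk : S.encodePK lam pk = S'.encodePK lam pk')
    (hkg : ∀ y, S.kg lam msk y = S'.kg lam msk' y >>= fun k => pure (k.1, φ k.2))
    (hvrfy : ∀ vk u, S.vrfy lam (φ vk) u = S'.vrfy lam vk u) (A : Prog) (d : QData) (m : QState) :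
    (A.run (challenger S T selective q coin lam pk msk)
      (Conf.start d (ChalState.init _ lam) m)).map outcome =
    (A.run (game S' T selective q lam (fun _ => True) (fun x m₀ m₁ =>
        (S.enc lam pk x (if coin then m₁ else m₀)).map (S.encodeCT lam)) pk' msk')
      (Conf.start d (ChalState.init _ lam) m)).map outcome := by
  let f : Data × S'.VK lam × Bool → Data × S.VK lam × Bool := fun e => (e.1, φ e.2.1, e.2.2)
  let F : ChalState S' lam → ChalState S lam := fun st =>
    ⟨st.started, st.target, st.keys.map f, st.challenged, st.aborted⟩
  refine PMFRel.map_eq (Prog.run_rel _ _ (fun st st' => st = F st') (fun _ => False)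
    (fun _ => False) (by simp) (by simp) ?_ A d _ _ m rfl) ?_
  swap
  · rintro c d (⟨h1, h2⟩ | ⟨h, -⟩)
    · simp [outcome, h1, h2, F]
    · exact h.elim
  rintro k msg _ ⟨started, target, keys, challenged, aborted⟩ m rfl
  have hpure : ∀ (a : QData) (st : ChalState S lam) (st' : ChalState S' lam) m, st = F st' →
      PMFRel (fun r r' => (r.1.1 = r'.1.1 ∧ r.2 = r'.2 ∧ r.1.2 = F r'.1.2) ∨ False ∧ False)
      ((pure (a, st) : QM (QData × _)) m) ((pure (a, st') : QM (QData × _)) m) := fun a st st' m h =>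
    PMFRel.pure (Or.inl ⟨rfl, rfl, h⟩)
  match k with
  | 0 =>
    simp only [challenger, game, startOracle, F, hpk]
    split
    · exact hpure _ _ _ _ rfl
    · exact hpure _ _ _ _ rfl
  | 1 =>
    simp only [challenger, game, kgOracle, F, List.forall_mem_map, f, hkg]
    split
    · simp only [QM.bind_apply, PMF.bind_bind]
      refine (PMFRel.refl _).bind ?_
      rintro r _ rfl
      change PMFRel _ ((PMF.pure ((r.1.1, φ r.1.2), r.2)).bind _) _
      rw [PMF.pure_bind]
      exact hpure _ _ _ _ rfl
    · exact hpure _ _ _ _ rfl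
  | 2 =>
    simp only [challenger, game, vrfyOracle, F, List.find?_map, Function.comp_def, f]
    split
    · cases h : keys.find? fun e => decide (e.1 = msg.fst.erase) with
      | none => exact hpure _ _ _ _ rfl
      | some e =>
        simp only [Option.map_some, QM.bind_apply, hvrfy]
        refine (PMFRel.refl _).bind ?_
        rintro r _ rfl
        refine hpure _ _ _ _ ?_
        simp only [F, List.map_map]
        congr 1
        refine List.map_congr_left fun e _ => ?_
        simp only [Function.comp, f]
        split <;> rfl
    · exact hpure _ _ _ _ rfl
  | 3 =>
    simp only [challenger, game, challengeOracle, gameChallenge, F, List.filter_map, List.length_map,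
      List.forall_mem_map, and_true]
    split
    · cases Msg.decode (ell lam) msg.erase.snd.fst with
      | none => exact hpure _ _ _ _ rfl
      | some m₀ =>
        cases Msg.decode (ell lam) msg.erase.snd.snd with
        | none => exact hpure _ _ _ _ rfl
        | some m₁ =>
          simp only [Function.comp_def, f]
          split
          · simp only [QM.bind_apply, QM.lift_apply, PMF.bind_map, PMF.map_comp]
            refine (PMFRel.refl _).bind ?_
            rintro r _ rfl
            exact hpure _ _ _ _ rfl
          · exact hpure _ _ _ _ rfl
    · exact hpure _ _ _ _ rfl
  | k + 4 => exact hpure _ _ _ _ rfl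

variable {ok : List (S.VK lam) → Prop} {encf : Data → Msg (ell lam) → Msg (ell lam) → PMF Data}
  {pk : S.PK lam} {msk : S.MSK lam}

variable {T selective q} in
/-- What the oracles can do to the state. -/
theorem game_cases {k : ℕ} {msg : QData} {st : ChalState S lam} {m : QState}
    {r : (QData × ChalState S lam) × QState}
    (hr : r ∈ (game S T selective q lam ok encf pk msk k msg st m).support) :
    r.1.2 = st ∨
    (st.started = false ∧ r.1.2 = { st with started := true, target := if selective then some msg.erase else none }) ∨
    (k = 1 ∧ st.started = true ∧ st.aborted = false ∧ msg.erase ∈ T.Y lam ∧ (∀ e ∈ st.keys, e.1 ≠ msg.erase) ∧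
      (∀ x ∈ st.challenged, ¬ T.R lam x msg.erase) ∧ ∃ vk, r.1.2 = { st with keys := (msg.erase, vk, false) :: st.keys }) ∨
    (∃ d : Bool, r.1.2 = { st with keys := st.keys.map fun e' =>
              if e'.1 = msg.fst.erase then (e'.1, e'.2.1, e'.2.2 || d) else e' }) ∨
    (k = 3 ∧ st.started = true ∧ st.challenged = none ∧ st.aborted = false ∧
      ((r.1.2 = { st with aborted := true }) ∨
      (st.target.getD msg.erase.fst ∈ T.X lam ∧
        (relatedKeys T (st.target.getD msg.erase.fst) st.keys).length ≤ q lam ∧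
        ok (relatedKeys T (st.target.getD msg.erase.fst) st.keys) ∧
        r.1.2 = { st with challenged := some (st.target.getD msg.erase.fst) }))) := by
  have hpure : ∀ {a : QData} {st' : ChalState S lam} {m : QState},
      r ∈ ((pure (a, st') : QM (QData × _)) m).support → r.1.2 = st' := by
    intro a st' m h
    rw [QM.pure_apply, PMF.support_pure, Set.mem_singleton_iff] at h
    rw [h]
  match k with
  | 0 =>
    simp only [game, startOracle] at hr
    split at hr
    · exact Or.inl (hpure hr)
    · rename_i h
      exact Or.inr (Or.inl ⟨by simpa using h, hpure hr⟩)
  | 1 =>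
    simp only [game, kgOracle] at hr
    split at hr
    · rename_i h
      rw [QM.bind_apply, PMF.mem_support_bind_iff] at hr
      obtain ⟨k, -, hr⟩ := hr
      exact Or.inr (Or.inr (Or.inl ⟨rfl, h.1, h.2.1, h.2.2.1, h.2.2.2.1, h.2.2.2.2, _, hpure hr⟩))
    · exact Or.inl (hpure hr)
  | 2 =>
    simp only [game, vrfyOracle] at hr
    split at hr
    · rcases hf : st.keys.find? fun e => decide (e.1 = msg.fst.erase) with _ | e
      · rw [hf] at hr
        exact Or.inl (hpure hr)
      · rw [hf] at hr
        dsimp only at hr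
        rw [QM.bind_apply, PMF.mem_support_bind_iff] at hr
        obtain ⟨k, -, hr⟩ := hr
        exact Or.inr (Or.inr (Or.inr (Or.inl ⟨_, hpure hr⟩)))
    · exact Or.inl (hpure hr)
  | 3 =>
    simp only [game, gameChallenge] at hr
    split at hr
    · rename_i h
      refine Or.inr (Or.inr (Or.inr (Or.inr ⟨rfl, h.1, h.2.2, h.2.1, ?_⟩)))
      rcases h0 : Msg.decode (ell lam) msg.erase.snd.fst with _ | m₀
      · rw [h0] at hr
        exact Or.inl (hpure hr)
      rcases h1 : Msg.decode (ell lam) msg.erase.snd.snd with _ | m₁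
      · rw [h0, h1] at hr
        exact Or.inl (hpure hr)
      · rw [h0, h1] at hr
        dsimp only at hr
        split at hr
        · rename_i h'
          rw [QM.bind_apply, PMF.mem_support_bind_iff] at hr
          obtain ⟨k, -, hr⟩ := hr
          exact Or.inr ⟨h'.1.1, by simpa [relatedKeys] using h'.1.2.1, h'.2, hpure hr⟩
        · exact Or.inl (hpure hr)
    · exact Or.inl (hpure hr)
  | k + 4 => exact Or.inl (hpure hr)

theorem relatedKeys_map (x y : Data) (d : Bool) (keys : List (Data × S.VK lam × Bool)) :
    relatedKeys T x (keys.map fun e' => if e'.1 = y then (e'.1, e'.2.1, e'.2.2 || d) else e') =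
      relatedKeys T x keys := by
  induction keys with
  | nil => rfl
  | cons e keys ih =>
    have h1 : (if e.1 = y then (e.1, e.2.1, e.2.2 || d) else e).1 = e.1 := by split <;> rfl
    have h2 : (if e.1 = y then (e.1, e.2.1, e.2.2 || d) else e).2.1 = e.2.1 := by split <;> rfl
    simp only [relatedKeys] at ih ⊢
    rw [List.map_cons, List.filter_cons, List.filter_cons, h1]
    split
    · rw [List.map_cons, List.map_cons, ih, h2]
    · exact ih

theorem relatedKeys_cons (x y : Data) (vk : S.VK lam) (V : Bool) (keys : List (Data × S.VK lam × Bool)) :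
    relatedKeys T x ((y, vk, V) :: keys) = if T.R lam x y then vk :: relatedKeys T x keys
      else relatedKeys T x keys := by
  simp only [relatedKeys, List.filter_cons, decide_eq_true_eq]
  split <;> rfl

variable {T selective q}

theorem game_aborted {k : ℕ} {msg : QData} {st : ChalState S lam} {m : QState}
    (h : st.aborted = true) {r : (QData × ChalState S lam) × QState}
    (hr : r ∈ (game S T selective q lam ok encf pk msk k msg st m).support) :
    r.1.2.aborted = true := by
  rcases game_cases hr with h1 | ⟨-, h1⟩ | ⟨-, -, -, -, -, -, vk, h1⟩ | ⟨d, h1⟩ | ⟨-, -, -, -, h1 | ⟨-, -, -, h1⟩⟩ <;>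
    simp [h1, h]

/-- After the challenge the key oracle refuses related attributes, and verification changes only the
status of an entry. So the list of related keys is frozen and a condition on it can be tested at the
end of the run. -/
theorem game_related {k : ℕ} {msg : QData} {st : ChalState S lam} {m : QState} {x : Data}
    (h : st.challenged = some x) {r : (QData × ChalState S lam) × QState}
    (hr : r ∈ (game S T selective q lam ok encf pk msk k msg st m).support) :
    r.1.2.challenged = some x ∧ relatedKeys T x r.1.2.keys = relatedKeys T x st.keys := by
  rcases game_cases hr with h1 | ⟨-, h1⟩ | ⟨-, -, -, -, -, h2, vk, h1⟩ | ⟨d, h1⟩ | ⟨-, -, h2, -⟩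
  · simp [h1, h]
  · simp [h1, h]
  · rw [h1]
    exact ⟨h, by rw [relatedKeys_cons, if_neg (h2 x h)]⟩
  · rw [h1]
    exact ⟨h, relatedKeys_map _ _ _ _ _⟩
  · rw [h] at h2
    cases h2

/-- The experiment with an additional condition for the challenge. -/
theorem game_run_ok (ok : List (S.VK lam) → Prop)
    (encf : Data → Msg (ell lam) → Msg (ell lam) → PMF Data) (pk : S.PK lam) (msk : S.MSK lam)
    (A : Prog) (d : QData) (m : QState) :
    (A.run (game S T selective q lam (fun _ => True) encf pk msk)
      (Conf.start d (ChalState.init _ lam) m)).map (fun c => outcome c &&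
        decide (∀ x ∈ c.orc.challenged, ok (relatedKeys T x c.orc.keys))) =
    (A.run (game S T selective q lam ok encf pk msk)
      (Conf.start d (ChalState.init _ lam) m)).map outcome := by
  refine PMFRel.map_eq (Prog.run_rel _ _
    -- The two games coincide until a challenge violates `ok`. Then the right one aborts while the
    -- left one goes on, with the violation preserved because the related keys are frozen. Both
    -- outputs are 0 from then on.
    (fun st st' => st = st' ∧ ∀ x ∈ st.challenged, ok (relatedKeys T x st.keys))
    (fun st => ∃ x, st.challenged = some x ∧ ¬ ok (relatedKeys T x st.keys))
    (fun st => st.aborted = true) ?_ ?_ ?_ A d _ _ m ⟨rfl, by simp [ChalState.init]⟩) ?_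
  · rintro k msg st m ⟨x, hx, h⟩ r hr
    obtain ⟨h1, h2⟩ := game_related hx hr
    exact ⟨x, h1, by rwa [h2]⟩
  · intro k msg st m h r hr
    exact game_aborted h hr
  swap
  · rintro c d (⟨h1, h2, h3⟩ | ⟨⟨x, h1, h2⟩, h3⟩)
    · rw [outcome, outcome, decide_eq_true h3, Bool.and_true, h1, h2]
    · have : ¬ ∀ x ∈ c.orc.challenged, ok (relatedKeys T x c.orc.keys) := fun h => h2 (h x h1)
      rw [decide_eq_false this, Bool.and_false, outcome, h3]
      rfl
  · rintro k msg st _ m ⟨rfl, hok⟩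
    by_cases hk : k = 3
    · subst hk
      have hpure : ∀ (a : QData), PMFRel (fun r r' => (r.1.1 = r'.1.1 ∧ r.2 = r'.2 ∧ r.1.2 = r'.1.2 ∧
          ∀ x ∈ r.1.2.challenged, ok (relatedKeys T x r.1.2.keys)) ∨
          (∃ x, r.1.2.challenged = some x ∧ ¬ ok (relatedKeys T x r.1.2.keys)) ∧
          r'.1.2.aborted = true) ((pure (a, st) : QM (QData × _)) m) ((pure (a, st) : QM (QData × _)) m) :=
        fun a => PMFRel.pure (Or.inl ⟨rfl, rfl, rfl, hok⟩)
      have hpure' : ∀ (a : QData), PMFRel (fun r r' => (r.1.1 = r'.1.1 ∧ r.2 = r'.2 ∧ r.1.2 = r'.1.2 ∧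
          ∀ x ∈ r.1.2.challenged, ok (relatedKeys T x r.1.2.keys)) ∨
          (∃ x, r.1.2.challenged = some x ∧ ¬ ok (relatedKeys T x r.1.2.keys)) ∧
          r'.1.2.aborted = true) ((pure (a, { st with aborted := true }) : QM (QData × _)) m)
            ((pure (a, { st with aborted := true }) : QM (QData × _)) m) :=
        fun a => PMFRel.pure (Or.inl ⟨rfl, rfl, rfl, hok⟩)
      simp only [game, gameChallenge]
      split
      · cases Msg.decode (ell lam) msg.erase.snd.fst with
        | none => exact hpure' _
        | some m₀ =>
          cases Msg.decode (ell lam) msg.erase.snd.snd with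
          | none => exact hpure' _
          | some m₁ =>
            simp only [and_true]
            split
            · by_cases ho : ok (relatedKeys T (st.target.getD msg.erase.fst) st.keys)
              · rename_i h'
                rw [if_pos ⟨h', ho⟩]
                simp only [QM.bind_apply]
                refine (PMFRel.refl _).bind ?_
                rintro r _ rfl
                refine PMFRel.pure (Or.inl ⟨rfl, rfl, rfl, ?_⟩)
                rintro x hx
                cases hx
                exact ho
              · rw [if_neg (fun h => ho h.2)]
                refine PMFRel.of_support ?_
                intro r hr r' hr'
                rw [QM.bind_apply, PMF.mem_support_bind_iff] at hr
                obtain ⟨k, -, hr⟩ := hr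
                rw [QM.pure_apply, PMF.support_pure, Set.mem_singleton_iff] at hr hr'
                subst hr hr'
                exact Or.inr ⟨⟨_, rfl, ho⟩, rfl⟩
            · rename_i h'
              rw [if_neg (fun h => h' h.1)]
              exact hpure' _
      · exact hpure _
    · have h1 : game S T selective q lam ok encf pk msk k msg st =
          game S T selective q lam (fun _ => True) encf pk msk k msg st := by
        match k with
        | 0 => rfl
        | 1 => rfl
        | 2 => rfl
        | 3 => exact absurd rfl hk
        | k + 4 => rfl
      rw [h1]
      refine (PMFRel.refl_support _).mono ?_
      rintro r _ ⟨rfl, hr⟩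
      refine Or.inl ⟨rfl, rfl, rfl, ?_⟩
      rcases h : st.challenged with _ | x
      · intro x hx
        rcases game_cases hr with h1 | ⟨-, h1⟩ | ⟨-, -, -, -, -, h2, vk, h1⟩ | ⟨d, h1⟩ | ⟨h2, -⟩
        · simp [h1, h] at hx
        · simp [h1, h] at hx
        · simp [h1, h] at hx
        · simp [h1, h] at hx
        · exact absurd h2 hk
      · obtain ⟨h1, h2⟩ := game_related h hr
        rw [h1]
        rintro y hy
        cases hy
        rw [h2]
        exact hok x h

end Game

/-! ### Balls and bins -/

/-- The mean of a nonnegative function. -/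
def PMF.expect {α : Type*} (p : PMF α) (f : α → ℝ≥0∞) : ℝ≥0∞ := ∑' a, p a * f a

namespace PMF

variable {α β : Type*} (p : PMF α)

theorem expect_bind (g : α → PMF β) (f : β → ℝ≥0∞) :
    (p.bind g).expect f = p.expect fun a => (g a).expect f := by
  simp only [expect, PMF.bind_apply, ← ENNReal.tsum_mul_right, ← ENNReal.tsum_mul_left]
  rw [ENNReal.tsum_comm]
  simp only [mul_assoc]

theorem expect_pure (a : α) (f : α → ℝ≥0∞) : (PMF.pure a).expect f = f a := by
  rw [expect, tsum_eq_single a (by intro d hd; simp [hd])]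
  simp

theorem expect_map (g : α → β) (f : β → ℝ≥0∞) : (p.map g).expect f = p.expect (f ∘ g) := by
  rw [PMF.map, expect_bind]
  simp [Function.comp_def, expect_pure]

theorem expect_mono {f g : α → ℝ≥0∞} (h : ∀ a ∈ p.support, f a ≤ g a) : p.expect f ≤ p.expect g := by
  refine ENNReal.tsum_le_tsum fun a => ?_
  by_cases ha : p a = 0
  · simp [ha]
  · exact mul_le_mul_right (h a ((PMF.mem_support_iff _ _).2 ha)) _

theorem expect_const (c : ℝ≥0∞) : p.expect (fun _ => c) = c := by
  rw [expect, ENNReal.tsum_mul_right, p.tsum_coe, one_mul]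

theorem expect_le_const {f : α → ℝ≥0∞} {c : ℝ≥0∞} (h : ∀ a ∈ p.support, f a ≤ c) :
    p.expect f ≤ c := (p.expect_mono h).trans_eq (p.expect_const c)

end PMF

/-- A bound for the probability that a bin with `l` so far will have a collision once it has `Q`
balls. -/
def rowPotential (Q W : ℕ) (l : List (Fin W)) : ℝ≥0∞ :=
  if l.Nodup then (∑ t ∈ Finset.Ico l.length Q, (t : ℝ≥0∞)) / W else 1

/-- A bound for the probability that every row will have a collision once there are `Q` keys. -/
def potential (Q V W : ℕ) (J : List (Fin V → Fin W)) : ℝ≥0∞ :=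
  if Q < J.length then 0 else ∏ r, rowPotential Q W (J.map fun j => j r)

/-- If there is no collision yet, the next ball hits one of the `l.length` occupied bins with
probability `l.length / W`. This is exactly the first term of the sum; the remaining terms bound the
future. After a collision the potential stays 1. -/
theorem rowPotential_cons {Q W : ℕ} (hW : 0 < W) (l : List (Fin W)) (hl : l.length < Q) :
    ∑ j, (W : ℝ≥0∞)⁻¹ * rowPotential Q W (j :: l) ≤ rowPotential Q W l := by
  have hW0 : (W : ℝ≥0∞) ≠ 0 := by exact_mod_cast hW.ne'
  have hWt : (W : ℝ≥0∞) ≠ ⊤ := ENNReal.natCast_ne_top W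
  by_cases h : l.Nodup
  · set c : ℝ≥0∞ := (∑ t ∈ Finset.Ico (l.length + 1) Q, (t : ℝ≥0∞)) / W with hc
    have h1 : ∀ j, rowPotential Q W (j :: l) ≤ (if j ∈ l.toFinset then 1 else 0) + c := by
      intro j
      rw [rowPotential]
      split
      · rw [List.length_cons, ← hc]
        exact le_add_self
      · rename_i h'
        rw [List.nodup_cons] at h'
        rw [if_pos]
        · exact le_self_add
        · rw [List.mem_toFinset]
          by_contra h2
          exact h' ⟨h2, h⟩
    calc ∑ j, (W : ℝ≥0∞)⁻¹ * rowPotential Q W (j :: l)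
        ≤ ∑ j : Fin W, (W : ℝ≥0∞)⁻¹ * ((if j ∈ l.toFinset then 1 else 0) + c) :=
          Finset.sum_le_sum fun j _ => mul_le_mul_right (h1 j) _
      _ = (W : ℝ≥0∞)⁻¹ * (l.length + W * c) := by
          rw [← Finset.mul_sum, Finset.sum_add_distrib, Finset.sum_ite_mem]
          simp [List.toFinset_card_of_nodup h]
      _ = rowPotential Q W l := by
          rw [rowPotential, if_pos h, Finset.sum_eq_sum_Ico_succ_bot hl, mul_add, ← mul_assoc,
            ENNReal.inv_mul_cancel hW0 hWt, one_mul, hc, ENNReal.add_div]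
          simp only [ENNReal.div_eq_inv_mul]
  · have h1 : ∀ j, rowPotential Q W (j :: l) = 1 := by
      intro j
      rw [rowPotential, if_neg]
      rw [List.nodup_cons]
      exact fun h' => h h'.2
    have h0 : rowPotential Q W l = 1 := if_neg h
    simp only [h1, h0, mul_one, Finset.sum_const, Finset.card_univ,
      Fintype.card_fin, nsmul_eq_mul, ENNReal.mul_inv_cancel hW0 hWt, le_refl]

/-- The rows are independent, so the mean of the product over rows is the product of the means, and
each factor is a supermartingale. With more than `Q` balls the potential drops to 0, which is
harmless because the challenge is not granted then. -/
theorem expect_potential_cons {Q V W : ℕ} (hW : 0 < W) [Nonempty (Fin W)] (J : List (Fin V → Fin W)) :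
    (PMF.uniformOfFintype (Fin V → Fin W)).expect (fun j => potential Q V W (j :: J)) ≤
      potential Q V W J := by
  by_cases hJ : J.length < Q
  · have h1 : ∀ j : Fin V → Fin W, potential Q V W (j :: J) =
        ∏ r, rowPotential Q W (j r :: J.map fun j => j r) := by
      intro j
      rw [potential, if_neg (by simpa using hJ)]
      rfl
    rw [potential, if_neg (by omega), PMF.expect, tsum_fintype]
    simp only [h1, PMF.uniformOfFintype_apply, Fintype.card_pi, Fintype.card_fin,
      Finset.prod_const, Finset.card_univ, Nat.cast_pow]
    have h2 : ∀ j : Fin V → Fin W, ((W : ℝ≥0∞) ^ V)⁻¹ * ∏ r, rowPotential Q W (j r :: J.map fun j => j r) =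
        ∏ r, ((W : ℝ≥0∞)⁻¹ * rowPotential Q W (j r :: J.map fun j => j r)) := by
      intro j
      rw [Finset.prod_mul_distrib]
      simp [ENNReal.inv_pow]
    simp only [h2]
    have h3 := Finset.prod_univ_sum (fun _ : Fin V => (Finset.univ : Finset (Fin W)))
      (fun r j => (W : ℝ≥0∞)⁻¹ * rowPotential Q W (j :: J.map fun j => j r))
    rw [Fintype.piFinset_univ] at h3
    rw [← h3]
    exact Finset.prod_le_prod' fun r _ => rowPotential_cons hW _ (by simpa using hJ)
  · refine PMF.expect_le_const _ fun j _ => ?_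
    rw [potential, if_pos (by simp; omega)]
    exact zero_le

/-- The birthday bound: `0 + 1 + ... + (Q - 1) = Q (Q - 1) / 2` is at most half of `Q ^ 2`, so every
row contributes a factor of at most 1/2. -/
theorem potential_nil_le (Q V : ℕ) (hQ : 0 < Q) : potential Q V (Q ^ 2) [] ≤ (2⁻¹) ^ V := by
  rw [potential, if_neg (by simp)]
  simp only [List.map_nil, rowPotential, List.nodup_nil, if_true, List.length_nil,
    Finset.prod_const, Finset.card_univ, Fintype.card_fin]
  refine pow_le_pow_left₀ zero_le ?_ _
  have h : (∑ t ∈ Finset.Ico 0 Q, t) * 2 ≤ Q ^ 2 := by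
    rw [← Finset.range_eq_Ico, Finset.sum_range_id_mul_two, pow_two]
    exact Nat.mul_le_mul_left _ (Nat.sub_le _ _)
  rw [ENNReal.div_le_iff_le_mul (by left; positivity) (by left; exact ENNReal.natCast_ne_top _)]
  rw [← ENNReal.div_eq_inv_mul, ENNReal.le_div_iff_mul_le (by simp) (by simp)]
  have h' := (Nat.cast_le (α := ℝ≥0∞)).2 h
  rwa [Nat.cast_mul, Nat.cast_sum, Nat.cast_ofNat] at h'

theorem potential_eq_one {Q V W : ℕ} {J : List (Fin V → Fin W)} (hJ : J.length ≤ Q)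
    (h : ∀ r, ¬ (J.map fun j => j r).Nodup) : potential Q V W J = 1 := by
  rw [potential, if_neg (by omega)]
  exact Finset.prod_eq_one fun r _ => by rw [rowPotential, if_neg (h r)]

/-! ### The collision bound inside the security experiment -/

section Game

variable {ell : ℕ → ℕ} {S : ABESKL ell} {T : AttrRel} {q : ℕ → ℕ} {lam : ℕ}
  {ok : List (S.VK lam) → Prop} {encf : Data → Msg (ell lam) → Msg (ell lam) → PMF Data}
  {pk : S.PK lam} {msk : S.MSK lam} {V W : ℕ} {js : S.VK lam → Fin V → Fin W}

/-- In every row, there are two keys with attributes related to the challenge attribute that belong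
to the same instance. -/
def AllCollide (T : AttrRel) (js : S.VK lam → Fin V → Fin W) (st : ChalState S lam) : Prop :=
  ∃ x, st.challenged = some x ∧ ∀ r, ¬ ((relatedKeys T x st.keys).map fun vk => js vk r).Nodup

variable (T q js) in
/-- The potential of the state of the challenger for the target `x`. -/
def keysPotential (x : Data) (keys : List (Data × S.VK lam × Bool)) : ℝ≥0∞ :=
  potential (q lam) V W ((relatedKeys T x keys).map js)

theorem keysPotential_map (x y : Data) (d : Bool) (keys : List (Data × S.VK lam × Bool)) :
    keysPotential T q js x (keys.map fun e' => if e'.1 = y then (e'.1, e'.2.1, e'.2.2 || d) else e') =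
      keysPotential T q js x keys := by
  rw [keysPotential, relatedKeys_map]; rfl

/-- A related key throws one new ball into each row, uniformly and independently of what the
adversary saw; an unrelated key changes nothing. -/
theorem expect_keysPotential_cons (hW : 0 < W) [Nonempty (Fin W)]
    (hkg : ∀ y m, (S.kg lam msk y m).map (fun r => js r.1.2) =
      PMF.uniformOfFintype (Fin V → Fin W)) (x y : Data) (m : QState)
    (keys : List (Data × S.VK lam × Bool)) :
    (S.kg lam msk y m).expect (fun r => keysPotential T q js x ((y, r.1.2, false) :: keys)) ≤
      keysPotential T q js x keys := by
  simp only [keysPotential, relatedKeys_cons]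
  by_cases h : T.R lam x y
  · simp only [if_pos h, List.map_cons]
    have := (PMF.expect_map (S.kg lam msk y m) (fun r => js r.1.2) (fun j =>
      potential (q lam) V W (j :: (relatedKeys T x keys).map js))).symm
    rw [hkg] at this
    exact this.trans_le (expect_potential_cons hW _)
  · simp only [if_neg h]
    exact (PMF.expect_const _ _).le

/-- Only key generation changes the relevant part of the state at random, so the supermartingale
property has to be checked for that oracle alone. -/
theorem game_expect_le {selective : Bool} (Φ : ChalState S lam → ℝ≥0∞)
    (hstart : ∀ st tgt, st.started = false → Φ { st with started := true, target := if selective then tgt else none } ≤ Φ st)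
    (hchal : ∀ st b x, Φ { st with aborted := b, challenged := x } = Φ st)
    (hvrfy : ∀ st y d, Φ { st with keys := st.keys.map fun e' =>
              if e'.1 = y then (e'.1, e'.2.1, e'.2.2 || d) else e' } = Φ st)
    (hkg : ∀ st y m, st.started = true → (S.kg lam msk y m).expect (fun r =>
      Φ { st with keys := (y, r.1.2, false) :: st.keys }) ≤ Φ st)
    (A : Prog) (d : QData) (m : QState) :
    (A.run (game S T selective q lam ok encf pk msk) (Conf.start d (ChalState.init _ lam) m)).expect
      (fun c => Φ c.orc) ≤ Φ (ChalState.init _ lam) := by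
  refine Prog.run_expect_le _ Φ (fun k msg st m => ?_) A _
  change (game S T selective q lam ok encf pk msk k msg st m).expect (fun r => Φ r.1.2) ≤ Φ st
  by_cases hk : k = 1
  · subst hk
    simp only [game, kgOracle]
    split
    · rename_i h
      rw [QM.bind_apply, PMF.expect_bind]
      simp only [QM.pure_apply, PMF.expect_pure]
      exact hkg st _ m h.1
    · exact PMF.expect_le_const _ (by simp [QM.pure_apply])
  · refine PMF.expect_le_const _ fun r hr => ?_
    rcases game_cases hr with h1 | ⟨h0, h1⟩ | ⟨h, -⟩ | ⟨d, h1⟩ | ⟨-, -, -, -, h1 | ⟨-, -, -, h1⟩⟩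
    · rw [h1]
    · rw [h1]; exact hstart _ _ h0
    · exact absurd h hk
    · rw [h1, hvrfy]
    · rw [h1]; exact (hchal st _ _).le
    · rw [h1]; exact (hchal st _ _).le

/-- What holds after the challenge. -/
theorem game_challenged {selective : Bool} (A : Prog) (d : QData) (m : QState) :
    ∀ c ∈ (A.run (game S T selective q lam ok encf pk msk)
      (Conf.start d (ChalState.init _ lam) m)).support,
    ∀ x, c.orc.challenged = some x → x ∈ T.X lam ∧ (relatedKeys T x c.orc.keys).length ≤ q lam ∧
      c.orc.started = true ∧ (selective = true → c.orc.target = some x) := by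
  have h := Prog.run_inv (game S T selective q lam ok encf pk msk)
    (fun st => (∀ x, st.challenged = some x → x ∈ T.X lam ∧
      (relatedKeys T x st.keys).length ≤ q lam ∧ st.started = true ∧
      (selective = true → st.target = some x)) ∧
      (selective = true → st.started = true → st.target.isSome = true)) ?_ A
    (Conf.start d (ChalState.init _ lam) m) ⟨by simp [Conf.start, ChalState.init], by
      simp [Conf.start, ChalState.init]⟩
  · exact fun c hc => (h c hc).1
  rintro k msg st m ⟨h1, h2⟩ r hr
  rcases h : st.challenged with _ | x
  · rcases game_cases hr with h3 | ⟨h0, h3⟩ | ⟨-, h0, -, -, -, -, vk, h3⟩ | ⟨d, h3⟩ |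
      ⟨-, h0, -, -, h3 | ⟨h4, h5, -, h3⟩⟩
    · rw [h3]; exact ⟨h1, h2⟩
    · rw [h3]; simp [h]
    · rw [h3]; simpa [h] using h2
    · rw [h3]; simpa [h] using h2
    · rw [h3]; simpa [h] using h2
    · rw [h3]
      refine ⟨?_, h2⟩
      rintro x hx
      simp only [Option.some.injEq] at hx
      subst hx
      refine ⟨h4, h5, h0, fun hs => ?_⟩
      obtain ⟨y, hy⟩ := Option.isSome_iff_exists.1 (h2 hs h0)
      simp [hy]
  · obtain ⟨g1, g2⟩ := game_related h hr
    obtain ⟨a1, a2, a3, a4⟩ := h1 x h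
    have : r.1.2.started = true ∧ r.1.2.target = st.target := by
      rcases game_cases hr with h3 | ⟨h0, h3⟩ | ⟨-, h0, -, -, -, -, vk, h3⟩ | ⟨d, h3⟩ |
      ⟨-, h0, -, -, h3 | ⟨h4, h5, -, h3⟩⟩
      · rw [h3]; exact ⟨a3, rfl⟩
      · rw [a3] at h0; cases h0
      · rw [h3]; exact ⟨a3, rfl⟩
      · rw [h3]; exact ⟨a3, rfl⟩
      · rw [h3]; exact ⟨a3, rfl⟩
      · rw [h3]; exact ⟨a3, rfl⟩
    refine ⟨?_, fun hs _ => by rw [this.2]; exact h2 hs a3⟩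
    intro y hy
    rw [g1] at hy
    cases hy
    rw [g2, this.2]
    exact ⟨a1, a2, this.1, a4⟩

theorem keysPotential_eq_one {x : Data} {st : ChalState S lam} (h : st.challenged = some x)
    (hl : (relatedKeys T x st.keys).length ≤ q lam) (hc : AllCollide T js st) :
    keysPotential T q js x st.keys = 1 := by
  obtain ⟨y, hy, hc⟩ := hc
  rw [h] at hy
  cases hy
  exact potential_eq_one (by simpa using hl) fun r => by simpa [Function.comp_def] using hc r

/-- The union bound over the challenge attribute, at the level of potentials: a sum of
supermartingales is one, and on the bad event the summand of the attribute actually chosen equals 1.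
-/
theorem game_allCollide_adaptive (hW : 0 < W) [Nonempty (Fin W)]
    (hkg : ∀ y m, (S.kg lam msk y m).map (fun r => js r.1.2) =
      PMF.uniformOfFintype (Fin V → Fin W)) (A : Prog) (d : QData) (m : QState) :
    (A.run (game S T false q lam ok encf pk msk)
      (Conf.start d (ChalState.init _ lam) m)).expect
      (fun c => if AllCollide T js c.orc then 1 else 0) ≤
      (T.X lam).encard.toENNReal * potential (q lam) V W [] := by
  have h := game_expect_le (T := T) (q := q) (ok := ok) (encf := encf) (pk := pk) (msk := msk)
    (selective := false) (fun st => ∑' x : T.X lam, keysPotential T q js x st.keys)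
    (fun _ _ _ => le_rfl) (fun _ _ _ => rfl) (fun st y d => by simp only [keysPotential_map])
    (fun st y m _ => by
      simp only [PMF.expect, ← ENNReal.tsum_mul_left]
      rw [ENNReal.tsum_comm]
      exact ENNReal.tsum_le_tsum fun x => expect_keysPotential_cons hW hkg x y m st.keys) A d m
  refine (PMF.expect_mono _ fun c hc => ?_).trans (h.trans_eq ?_)
  · split
    · rename_i hbad
      obtain ⟨x, hx, -⟩ := id hbad
      obtain ⟨h1, h2, -⟩ := game_challenged A d m c hc x hx
      rw [← keysPotential_eq_one hx h2 hbad]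
      exact ENNReal.le_tsum (f := fun x : T.X lam => keysPotential T q js x c.orc.keys) ⟨x, h1⟩
    · exact zero_le
  · simp only [ChalState.init]
    have : ∀ x, keysPotential T q js x [] = potential (q lam) V W [] := fun x => by
      simp [keysPotential, relatedKeys]
    simp only [this]
    rw [ENNReal.tsum_const]
    rfl

theorem game_allCollide_selective (hW : 0 < W) [Nonempty (Fin W)]
    (hkg : ∀ y m, (S.kg lam msk y m).map (fun r => js r.1.2) =
      PMF.uniformOfFintype (Fin V → Fin W)) (A : Prog) (d : QData) (m : QState) :
    (A.run (game S T true q lam ok encf pk msk)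
      (Conf.start d (ChalState.init _ lam) m)).expect
      (fun c => if AllCollide T js c.orc then 1 else 0) ≤ potential (q lam) V W [] := by
  have h := game_expect_le (T := T) (q := q) (ok := ok) (encf := encf) (pk := pk) (msk := msk)
    -- Before the start the target is unknown, but there are no keys, so the initial value serves
    -- for every target. The value `⊤` covers the unreachable states with keys before the start, and
    -- 0 those without a target.
    (selective := true) (fun st => if st.started = true then
      st.target.elim 0 fun x => keysPotential T q js x st.keys
      else if st.keys = [] then potential (q lam) V W [] else ⊤)
    (fun st tgt h0 => by
      simp only [h0, if_true]
      cases tgt with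
      | none => exact zero_le
      | some x =>
        by_cases hk : st.keys = []
        · simp [hk, keysPotential, relatedKeys]
        · simp [hk])
    (fun _ _ _ => rfl)
    (fun st y d => by simp only [keysPotential_map, List.map_eq_nil_iff])
    (fun st y m h0 => by
      simp only [h0, if_true]
      cases st.target with
      | none => exact PMF.expect_le_const _ fun _ _ => le_rfl
      | some x => exact expect_keysPotential_cons hW hkg x y m st.keys) A d m
  refine (PMF.expect_mono _ fun c hc => ?_).trans (h.trans_eq ?_)
  · split
    · rename_i hbad
      obtain ⟨x, hx, -⟩ := id hbad
      obtain ⟨h1, h2, h3, h4⟩ := game_challenged A d m c hc x hx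
      rw [if_pos h3, h4 rfl, Option.elim_some, keysPotential_eq_one hx h2 hbad]
    · exact zero_le
  · simp [ChalState.init]

end Game

/-! ### Uniform distributions and secret sharing -/

namespace PMF

variable {α β : Type*} [Fintype α] [Nonempty α] [Fintype β] [Nonempty β]

theorem map_uniformOfFintype_equiv (e : α ≃ β) :
    (uniformOfFintype α).map e = uniformOfFintype β := by
  ext b
  rw [PMF.map_apply, tsum_eq_single (e.symm b)]
  · simp [Fintype.card_congr e]
  · intro a ha
    rw [if_neg]
    rintro rfl
    simp at ha

theorem map_uniformOfFintype_injective {f : α → α} (hf : f.Injective) :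
    (uniformOfFintype α).map f = uniformOfFintype α :=
  map_uniformOfFintype_equiv (Equiv.ofBijective f (Finite.injective_iff_bijective.1 hf))

theorem uniformOfFintype_prod :
    ((uniformOfFintype α).bind fun a => (uniformOfFintype β).map (Prod.mk a)) =
      uniformOfFintype (α × β) := by
  ext ⟨a, b⟩
  rw [PMF.bind_apply, tsum_eq_single a]
  · rw [PMF.map_apply, tsum_eq_single b]
    · simp [ENNReal.mul_inv]
    · intro b' hb
      rw [if_neg]
      rintro h
      cases h
      exact hb rfl
  · intro a' ha
    rw [PMF.map_apply, mul_eq_zero]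
    refine Or.inr (ENNReal.tsum_eq_zero.2 fun b' => ?_)
    rw [if_neg]
    rintro h
    cases h
    exact ha rfl

theorem map_snd_uniformOfFintype :
    (uniformOfFintype (α × β)).map Prod.snd = uniformOfFintype β := by
  rw [← uniformOfFintype_prod, PMF.map_bind]
  have : (fun a : α => PMF.map Prod.snd ((uniformOfFintype β).map (Prod.mk a))) =
      fun _ => uniformOfFintype β := by
    funext a
    rw [PMF.map_comp]
    exact PMF.map_id _
  rw [this, PMF.bind_const]

theorem map_removeNth_uniformOfFintype {n : ℕ} (i : Fin (n + 1)) :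
    (uniformOfFintype (Fin (n + 1) → α)).map (fun f j => f (i.succAbove j)) =
      uniformOfFintype (Fin n → α) := by
  rw [← map_uniformOfFintype_equiv (Fin.insertNthEquiv (fun _ => α) i), PMF.map_comp,
    ← map_snd_uniformOfFintype (α := α) (β := Fin n → α)]
  congr 1
  funext p j
  simp [Fin.insertNthEquiv]

end PMF

theorem uniformOfFintype_pi {α : Type} [Fintype α] [Nonempty α] (n : ℕ) :
    PMF.uniformOfFintype (Fin n → α) = seqFin fun _ => PMF.uniformOfFintype α := by
  induction n with
  | zero =>
    refine (PMF.eq_pure_of_support _ fun b _ => ?_)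
    exact Subsingleton.elim _ _
  | succ n ih =>
    rw [← PMF.map_uniformOfFintype_equiv (Fin.consEquiv fun _ => α), ← PMF.uniformOfFintype_prod,
      PMF.map_bind]
    change _ = (PMF.uniformOfFintype α).bind fun a =>
      (seqFin fun _ : Fin n => PMF.uniformOfFintype α).bind
      fun g : Fin n → α => PMF.pure (Fin.cons (α := fun _ => α) a g)
    rw [← ih]
    congr 1
    funext a
    rw [PMF.map_comp]
    rfl

theorem Msg.add_self {l : ℕ} (m : Msg l) : m + m = 0 := by
  funext i
  exact CharTwo.add_self_eq_zero _

/-- Shares of `m`, where the share with index `i` depends on the other ones. -/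
def hiddenShares {l v : ℕ} (i : Fin v) (μ : Fin v → Msg l) (m : Msg l) (r : Fin v) : Msg l :=
  if r = i then μ i + ∑ s, μ s + m else μ r

theorem sum_hiddenShares {l v : ℕ} (i : Fin v) (μ : Fin v → Msg l) (m : Msg l) :
    ∑ r, hiddenShares i μ m r = m := by
  have h1 : ∀ r, hiddenShares i μ m r = μ r + if r = i then ∑ s, μ s + m else 0 := by
    intro r
    rw [hiddenShares]
    split
    · rename_i h; rw [h, add_assoc]
    · rw [add_zero]
  simp only [h1, Finset.sum_add_distrib, Finset.sum_ite_eq', Finset.mem_univ, if_true]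
  rw [← add_assoc, Msg.add_self, zero_add]

/-- Any index can play the role of the dependent share. The map `f` keeps the shares away from `j`
and stores the redundant entry `μ i` at `j`; it is injective, hence preserves the uniform
distribution, and turns one description into the other. -/
theorem map_hiddenShares {l v : ℕ} (i j : Fin v) (m : Msg l) :
    (PMF.uniformOfFintype (Fin v → Msg l)).map (fun μ => hiddenShares i μ m) =
      (PMF.uniformOfFintype (Fin v → Msg l)).map (fun μ => hiddenShares j μ m) := by
  let f : (Fin v → Msg l) → Fin v → Msg l := fun μ r => if r = j then μ i else hiddenShares i μ m r
  have hs : ∀ μ, ∑ r, f μ r = μ i + hiddenShares i μ m j + m := by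
    intro μ
    have h1 : ∀ r, f μ r = hiddenShares i μ m r + if r = j then μ i + hiddenShares i μ m j else 0 := by
      intro r
      simp only [f]
      split
      · rename_i h
        rw [h, add_comm, add_assoc, Msg.add_self, add_zero]
      · rw [add_zero]
    simp only [h1, Finset.sum_add_distrib, Finset.sum_ite_eq', Finset.mem_univ, if_true,
      sum_hiddenShares]
    rw [add_comm]
  have h : ∀ μ, hiddenShares j (f μ) m = hiddenShares i μ m := by
    intro μ
    funext r
    rw [hiddenShares]
    split
    · rename_i h
      rw [hs, h]
      simp only [f, if_true]
      rw [← add_assoc, ← add_assoc, Msg.add_self, zero_add, add_assoc, Msg.add_self, add_zero]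
    · rename_i h
      simp only [f, if_neg h]
  have hf : f.Injective := by
    intro μ ν hμν
    have h1 : hiddenShares i μ m = hiddenShares i ν m := by rw [← h, ← h, hμν]
    have h2 : μ i = ν i := by
      have := congrFun hμν j
      simpa [f] using this
    funext r
    by_cases hr : r = i
    · rw [hr, h2]
    · have := congrFun h1 r
      simpa [hiddenShares, hr] using this
  conv_rhs => rw [← PMF.map_uniformOfFintype_injective hf, PMF.map_comp]
  simp only [Function.comp_def, h]

/-- The entry `μ i` cancels in `hiddenShares i` in characteristic 2, so for the last index a vector
of length `v` carries the same information as the `v - 1` free shares of the scheme. The index is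
then moved from the last one to `i`. -/
theorem map_shares {l v : ℕ} (i : Fin v) (m : Msg l) :
    (PMF.uniformOfFintype (Fin (v - 1) → Msg l)).map (fun μ => shares v μ m) =
      (PMF.uniformOfFintype (Fin v → Msg l)).map (fun μ => hiddenShares i μ m) := by
  obtain ⟨n, rfl⟩ : ∃ n, v = n + 1 := ⟨v - 1, by have := i.2; omega⟩
  rw [map_hiddenShares i (Fin.last n)]
  change (PMF.uniformOfFintype (Fin n → Msg l)).map _ = _
  rw [← PMF.map_removeNth_uniformOfFintype (Fin.last n), PMF.map_comp]
  congr 1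
  funext μ r
  simp only [Function.comp, shares, hiddenShares, Nat.add_sub_cancel]
  by_cases h : r = Fin.last n
  · subst h
    rw [dif_neg (by simp), if_pos rfl, Fin.sum_univ_castSucc]
    simp only [Fin.succAbove_last]
    rw [add_comm _ (μ (Fin.last n)), ← add_assoc (μ (Fin.last n)), Msg.add_self, zero_add]
    rfl
  · have h' : (r : ℕ) < n := by
      have := r.2
      rcases Nat.lt_succ_iff_lt_or_eq.1 this with h2 | h2
      · exact h2
      · exact absurd (Fin.ext h2) h
    rw [dif_pos h', if_neg h]
    simp [Fin.succAbove_last]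

/-! ### The hybrid encryptions and the recorded scheme -/

section Hybrid

variable {ell : ℕ → ℕ} (S : ABESKL ell) (v w : ℕ → ℕ) (hw : ∀ lam, 0 < w lam)

/-- The encryption of shares of a message, where the share with index `i` depends on the other
ones. In row `i`, the first `k` ciphertexts belong to `m₁`, the other ones to `m₀`. -/
def hybridEnc (lam : ℕ) (i : Fin (v lam)) (k : ℕ) (pk : Fin (v lam) → Fin (w lam) → S.PK lam)
    (x : Data) (m₀ m₁ : Msg (ell lam)) : PMF (Fin (v lam) → Fin (w lam) → S.CT lam) :=
  (PMF.uniformOfFintype (Fin (v lam) → Msg (ell lam))).bind fun μ =>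
    seqFin fun r => seqFin fun j : Fin (w lam) => S.enc lam (pk r j) x
      (hiddenShares i μ (if (j : ℕ) < k then m₁ else m₀) r)

/-- The two ends of the hybrid chain: with `k = 0` or `k = w` the same message is used in all
columns, and the shares may be resampled so that row `i` is the dependent one. -/
theorem enc_eq_hybridEnc (lam : ℕ) (i : Fin (v lam)) (pk : Fin (v lam) → Fin (w lam) → S.PK lam)
    (x : Data) (m₀ m₁ : Msg (ell lam)) (coin : Bool) :
    (ballsAndBins S v w hw).enc lam pk x (if coin then m₁ else m₀) =
      hybridEnc S v w lam i (if coin then w lam else 0) pk x m₀ m₁ := by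
  have h : ∀ m : Msg (ell lam), (ballsAndBins S v w hw).enc lam pk x m =
      ((PMF.uniformOfFintype (Fin (v lam - 1) → Msg (ell lam))).map
        (fun μ => shares (v lam) μ m)).bind fun σ =>
          seqFin fun r => seqFin fun j => S.enc lam (pk r j) x (σ r) := by
    intro m
    rw [PMF.bind_map]
    rfl
  rw [h, map_shares i, PMF.bind_map, hybridEnc]
  congr 1
  funext μ
  simp only [Function.comp]
  cases coin <;> simp

/-- The balls-and-bins construction; the verification keys also tell the instances. -/
def recorded : ABESKL ell where
  PK lam := Fin (v lam) → Fin (w lam) → S.PK lam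
  MSK lam := Fin (v lam) → Fin (w lam) → S.MSK lam
  VK lam := (Fin (v lam) → Fin (w lam)) × (Fin (v lam) → S.VK lam)
  CT lam := Fin (v lam) → Fin (w lam) → S.CT lam
  encodePK := (ballsAndBins S v w hw).encodePK
  encodeCT := (ballsAndBins S v w hw).encodeCT
  setup := (ballsAndBins S v w hw).setup
  kg lam msk y :=
    haveI : Nonempty (Fin (w lam)) := ⟨⟨0, hw lam⟩⟩
    do
    let j ← StateT.lift (PMF.uniformOfFintype (Fin (v lam) → Fin (w lam)))
    let k ← seqFin fun i => S.kg lam (msk i (j i)) y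
    pure (QData.ofList (List.ofFn fun i => QData.pair (unary (j i)).toQ (k i).1),
      (j, fun i => (k i).2))
  enc := (ballsAndBins S v w hw).enc
  dec := (ballsAndBins S v w hw).dec
  vrfy lam vk usk := (ballsAndBins S v w hw).vrfy lam vk.2 usk

end Hybrid

/-! ### Decomposition of the advantage -/

/-- The first row without collisions. -/
def firstGood {V W : ℕ} (J : List (Fin V → Fin W)) : Option (Fin V) :=
  (List.finRange V).find? fun r => decide (J.map fun j => j r).Nodup

theorem PMF.toReal_map_true {α : Type} [Fintype α] (p : PMF α) (f : α → Bool) :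
    (p.map f true).toReal = ∑ a, if f a = true then (p a).toReal else 0 := by
  rw [PMF.map_apply, tsum_fintype, ENNReal.toReal_sum]
  · refine Finset.sum_congr rfl fun a _ => ?_
    by_cases h : f a = true
    · rw [if_pos h, if_pos h.symm]
    · rw [if_neg h, if_neg (fun h' => h h'.symm), ENNReal.toReal_zero]
  · intro a _
    split
    · exact PMF.apply_ne_top _ _
    · exact ENNReal.zero_ne_top

theorem PMF.apply_le_expect {α β : Type*} (p : PMF α) (f : α → β) (b : β) {g : α → ℝ≥0∞}
    (h : ∀ a, f a = b → 1 ≤ g a) : p.map f b ≤ p.expect g := by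
  rw [PMF.map_apply, PMF.expect]
  refine ENNReal.tsum_le_tsum fun a => ?_
  split
  · rename_i hb
    exact le_mul_of_one_le_right zero_le (h a hb.symm)
  · exact zero_le

/-- An experiment that outputs `1` in a case that does not depend on `b`, in one of the cases `i`,
or in an unlikely case. -/
theorem abs_sub_le_of_cases {I : Type} [Fintype I]
    (D : Bool → PMF (Option (Option (Option I)))) (ε : ℝ)
    (h0 : (D false).map (fun t => decide (t = some none)) = (D true).map fun t => decide (t = some none))
    (hε : ∀ b, (D b (some (some none))).toReal ≤ ε) :
    |((D false).map (fun t => decide (t ≠ none)) true).toReal -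
      ((D true).map (fun t => decide (t ≠ none)) true).toReal| ≤
    |∑ i, (((D false).map (fun t => decide (t = some none ∨ t = some (some (some i)))) true).toReal -
      ((D true).map (fun t => decide (t = some none ∨ t = some (some (some i)))) true).toReal)| + ε := by
  have h1 : ∀ b, ((D b).map (fun t => decide (t = some none)) true).toReal =
      (D b (some none)).toReal := by
    intro b
    rw [PMF.toReal_map_true]
    simp
  have h2 : ∀ b, ((D b).map (fun t => decide (t ≠ none)) true).toReal =
      (D b (some none)).toReal + (D b (some (some none))).toReal +
        ∑ i, (D b (some (some (some i)))).toReal := by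
    intro b
    rw [PMF.toReal_map_true, Fintype.sum_option, Fintype.sum_option, Fintype.sum_option]
    simp
    ring
  have h3 : ∀ b i, ((D b).map (fun t => decide (t = some none ∨ t = some (some (some i)))) true).toReal =
      (D b (some none)).toReal + (D b (some (some (some i)))).toReal := by
    intro b i
    rw [PMF.toReal_map_true, Fintype.sum_option, Fintype.sum_option, Fintype.sum_option]
    simp
  have h4 : (D false (some none)).toReal = (D true (some none)).toReal := by
    rw [← h1, ← h1, h0]
  simp only [h2, h3, h4, add_sub_add_left_eq_sub]
  rw [Finset.sum_sub_distrib]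
  have e1 := hε false
  have e2 := hε true
  have e3 : 0 ≤ (D false (some (some none))).toReal := ENNReal.toReal_nonneg
  have e4 : 0 ≤ (D true (some (some none))).toReal := ENNReal.toReal_nonneg
  have := abs_add_le (∑ i, (D false (some (some (some i)))).toReal - ∑ i, (D true (some (some (some i)))).toReal)
    ((D false (some (some none))).toReal - (D true (some (some none))).toReal)
  have e5 : |(D false (some (some none))).toReal - (D true (some (some none))).toReal| ≤ ε := by
    rw [abs_le]; constructor <;> linarith
  refine le_trans (le_of_eq ?_) (this.trans (by linarith))
  congr 1
  ring

/-- If no challenge is ever granted, no ciphertext is computed. Hence runs without a challenge are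
the same for both coins. -/
theorem game_false {ell : ℕ → ℕ} (S : ABESKL ell) (T : AttrRel) (selective : Bool) (q : ℕ → ℕ)
    (lam : ℕ) (encf encf' : Data → Msg (ell lam) → Msg (ell lam) → PMF Data) (pk : S.PK lam)
    (msk : S.MSK lam) : game S T selective q lam (fun _ => False) encf pk msk =
      game S T selective q lam (fun _ => False) encf' pk msk := by
  funext k msg st
  match k with
  | 0 => rfl
  | 1 => rfl
  | 2 => rfl
  | 3 => simp only [game, gameChallenge, and_false, if_false]
  | k + 4 => rfl

section Games

variable {ell : ℕ → ℕ} (S : ABESKL ell) (v w : ℕ → ℕ) (hw : ∀ lam, 0 < w lam) (T : AttrRel)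
  (selective : Bool) (q : ℕ → ℕ) (lam : ℕ) (A : Prog)

variable {S v w hw lam} in
/-- The instances of a key. -/
def instances (vk : (recorded S v w hw).VK lam) : Fin (v lam) → Fin (w lam) := vk.1

/-- The run of a game with the recorded scheme. -/
def gameRun (ok : List ((recorded S v w hw).VK lam) → Prop)
    (encf : (Fin (v lam) → Fin (w lam) → S.PK lam) → Data → Msg (ell lam) → Msg (ell lam) →
      PMF (Fin (v lam) → Fin (w lam) → S.CT lam)) :
    PMF (Conf (ChalState (recorded S v w hw) lam)) :=
  ((ballsAndBins S v w hw).setup lam).bind fun keys =>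
    A.run (game (recorded S v w hw) T selective q lam ok
      (fun x m₀ m₁ => (encf keys.1 x m₀ m₁).map ((ballsAndBins S v w hw).encodeCT lam)) keys.1 keys.2)
      (Conf.start (unary lam).toQ (ChalState.init _ lam) QState.blank)

theorem experiment_eq (coin : Bool) :
    experiment (ballsAndBins S v w hw) T selective q coin lam A =
      (gameRun S v w hw T selective q lam A (fun _ => True) fun pk x m₀ m₁ =>
        (ballsAndBins S v w hw).enc lam pk x (if coin then m₁ else m₀)).map outcome := by
  refine Eq.trans ?_ (PMF.map_bind _ _ _).symm
  change ((ballsAndBins S v w hw).setup lam).bind (fun keys => (A.run _ _).map outcome) = _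
  congr 1
  funext keys
  exact challenger_run_eq T selective q (S := ballsAndBins S v w hw) (S' := recorded S v w hw)
    (fun vk => vk.2) coin keys.1 keys.2 keys.1 keys.2 rfl (fun y => by
      funext m
      refine Eq.symm ((PMF.bind_bind _ _ _).trans ?_)
      refine congrArg _ (funext fun j => ?_)
      refine (PMF.bind_bind _ _ _).trans ?_
      exact congrArg _ (funext fun k => PMF.pure_bind _ _)) (fun _ _ => rfl) A _ _

/-- The game in which `i` must be the first row without collisions, and the challenge is the hybrid
encryption. -/
def hybrid (i : Fin (v lam)) (k : ℕ) : PMF Bool :=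
  (gameRun S v w hw T selective q lam A
    (fun vks => firstGood (vks.map instances) = some i) (hybridEnc S v w lam i k)).map outcome

/-- The columns are drawn before anything else, so their law is uniform whatever the quantum part of
key generation does with the memory. -/
theorem recorded_kg [Nonempty (Fin (w lam))] (msk : Fin (v lam) → Fin (w lam) → S.MSK lam) (y : Data) (m : QState) :
    ((recorded S v w hw).kg lam msk y m).map (fun r => instances r.1.2) =
      PMF.uniformOfFintype (Fin (v lam) → Fin (w lam)) := by
  have key : ∀ {α β γ : Type} (p : PMF α) (F : α → PMF β) (f : β → γ) (g : α → γ),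
      (∀ a, ∀ b ∈ (F a).support, f b = g a) → (p.bind F).map f = p.map g := by
    intro α β γ p F f g h
    rw [PMF.map_bind]
    refine PMF.bind_congr_support _ fun a _ => ?_
    exact PMF.eq_pure_of_support _ fun c hc => by
      rw [PMF.mem_support_map_iff] at hc
      obtain ⟨b, hb, rfl⟩ := hc
      exact h a b hb
  refine (key ((PMF.uniformOfFintype (Fin (v lam) → Fin (w lam))).map fun a => (a, m)) _ _
    (fun a => a.1) ?_).trans ?_
  · intro a b hb
    obtain ⟨k, -, hk⟩ := (PMF.mem_support_bind_iff _ _ _).1 hb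
    have hk' := (PMF.mem_support_pure_iff _ _).1 hk
    rw [hk']
    rfl
  · rw [PMF.map_comp]
    exact PMF.map_id _

/-- Runs with output 1 are classified by the first collision-free row at the challenge. Those
without a challenge cancel between the coins, those in which every row collides cost at most `ε`,
and the remaining ones are counted by the hybrids with the chain ends `0` and `w lam`. Each hybrid
also counts the runs without a challenge, which cancel again. -/
theorem advantage_le_hybrids (ε : ℝ≥0∞) (hε' : ε ≠ ⊤)
    (hε : ∀ encf, (gameRun S v w hw T selective q lam A (fun _ => True) encf).expect
      (fun c => if AllCollide T instances c.orc then 1 else 0) ≤ ε) :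
    advantage (ballsAndBins S v w hw) T selective q lam A ≤
      |∑ i, ((hybrid S v w hw T selective q lam A i 0 true).toReal -
        (hybrid S v w hw T selective q lam A i (w lam) true).toReal)| + ε.toReal := by
  -- The nested options mean: output 0; output 1 without a challenge; output 1 with collisions in
  -- all rows; output 1 with first collision-free row `i`.
  let cls : Conf (ChalState (recorded S v w hw) lam) → Option (Option (Option (Fin (v lam)))) :=
    fun c => if outcome c = true then
      some (c.orc.challenged.map fun x => firstGood ((relatedKeys T x c.orc.keys).map instances))
      else none
  let encf : Bool → (Fin (v lam) → Fin (w lam) → S.PK lam) → Data → Msg (ell lam) → Msg (ell lam) →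
      PMF (Fin (v lam) → Fin (w lam) → S.CT lam) := fun b pk x m₀ m₁ =>
    (ballsAndBins S v w hw).enc lam pk x (if b then m₁ else m₀)
  let D : Bool → PMF (Option (Option (Option (Fin (v lam))))) := fun b =>
    (gameRun S v w hw T selective q lam A (fun _ => True) (encf b)).map cls
  -- A test for output 1 together with `ok` at the challenge, if there was one, has the law of the
  -- game that enforces `ok` at once (`game_run_ok`).
  have hok : ∀ b (ok : List ((recorded S v w hw).VK lam) → Prop) (t : Option (Option (Option (Fin (v lam)))) → Bool),
      (∀ c, t (cls c) = true ↔ (outcome c = true ∧ ∀ x ∈ c.orc.challenged, ok (relatedKeys T x c.orc.keys))) →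
      (D b).map t =
        (gameRun S v w hw T selective q lam A ok (encf b)).map outcome := by
    intro b ok t ht
    simp only [D, gameRun, PMF.map_comp, PMF.map_bind]
    congr 1
    funext keys
    refine Eq.trans ?_ (game_run_ok ok _ keys.1 keys.2 A _ _)
    congr 1
    funext c
    rw [Function.comp, Bool.eq_iff_iff, ht, Bool.and_eq_true, decide_eq_true_iff]
  have hexp : ∀ b, experiment (ballsAndBins S v w hw) T selective q b lam A =
      (D b).map fun t => decide (t ≠ none) := by
    intro b
    rw [experiment_eq]
    refine (hok b (fun _ => True) _ fun c => ?_).symm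
    simp only [decide_eq_true_iff, cls]
    by_cases h : outcome c = true <;> simp [h]
  have hfalse : ∀ b, (D b).map (fun t => decide (t = some none)) =
      (gameRun S v w hw T selective q lam A (fun _ => False) (encf b)).map outcome := by
    intro b
    refine hok b (fun _ => False) _ fun c => ?_
    simp only [decide_eq_true_iff, cls]
    by_cases h : outcome c = true <;> simp [h]
    cases c.orc.challenged <;> simp
  have hhyb : ∀ b i, (D b).map (fun t => decide (t = some none ∨ t = some (some (some i)))) =
      hybrid S v w hw T selective q lam A i (if b then w lam else 0) := by
    intro b i
    have h1 := hok b (fun vks => firstGood (vks.map instances) = some i)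
      (fun t => decide (t = some none ∨ t = some (some (some i)))) fun c => by
        simp only [decide_eq_true_iff, cls]
        by_cases h : outcome c = true <;> simp [h]
        cases c.orc.challenged <;> simp
    refine Eq.trans h1 ?_
    rw [hybrid]
    have h2 : encf b = hybridEnc S v w lam i (if b then w lam else 0) := by
      funext pk x m₀ m₁
      exact enc_eq_hybridEnc S v w hw lam i pk x m₀ m₁ b
    rw [h2]
  have h0 : (D false).map (fun t => decide (t = some none)) =
      (D true).map fun t => decide (t = some none) := by
    rw [hfalse, hfalse]
    have h1 : gameRun S v w hw T selective q lam A (fun _ => False) (encf false) =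
        gameRun S v w hw T selective q lam A (fun _ => False) (encf true) := by
      unfold gameRun
      exact congrArg (PMF.bind _) (funext fun keys =>
        congrArg (fun O => A.run O _) (game_false _ _ _ _ _ _ _ _ _))
    rw [h1]
  have hN : ∀ b, (D b (some (some none))).toReal ≤ ε.toReal := by
    intro b
    refine ENNReal.toReal_mono hε' (le_trans ?_ (hε (encf b)))
    refine PMF.apply_le_expect _ _ _ fun c hc => ?_
    rw [if_pos]
    simp only [cls] at hc
    split at hc
    · rw [Option.some.injEq] at hc
      rcases h : c.orc.challenged with _ | x
      · rw [h] at hc; cases hc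
      · rw [h, Option.map_some, Option.some.injEq, firstGood, List.find?_eq_none] at hc
        refine ⟨x, h, fun r => ?_⟩
        have := hc r (List.mem_finRange r)
        simpa [Function.comp_def] using this
    · cases hc
  have := abs_sub_le_of_cases D ε.toReal h0 hN
  rw [advantage, hexp, hexp]
  refine this.trans (le_of_eq ?_)
  congr 2
  refine Finset.sum_congr rfl fun i _ => ?_
  have e1 : hybrid S v w hw T selective q lam A i 0 = _ := (hhyb false i).symm
  have e2 : hybrid S v w hw T selective q lam A i (w lam) = _ := (hhyb true i).symm
  rw [e1, e2]
  congr!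

end Games

/-! ### Rearrangement of data that may hold qubits -/

namespace QPoly

variable {F G : QData → QM QData}

theorem id : QPoly fun v => pure v := by
  refine of_pure (fun v => v) (fun _ => Prog.skip) 1 Polynomial.X (fun v => by simp) ?_
  intro a σ O s o m n hs
  simp only [Prog.run, Conf.tick, Function.update_eq_self]

theorem fst : QPoly fun v => pure v.fst := by
  refine of_pure (fun v => v.fst) (fun a => Prog.seq (Prog.split a (a + 1) a) (Prog.assign (a + 1) Expr.nil)) 2
    Polynomial.X (fun v => by simpa using v.size_fst_le) ?_
  intro a σ O s o m n hs
  rw [run_seq_pure rfl]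
  simp only [Prog.run, Conf.set, Conf.tick, Expr.eval]
  congr 2
  funext x
  have := hs (a + 1) (by omega)
  simp only [update_apply, Data.toQ]
  grind

theorem snd : QPoly fun v => pure v.snd :=
  (swap.bind fst).congr fun v => by rw [pure_bind]; rfl

/-- `(x, (y, z)) ↦ (y, (x, z))` -/
theorem exch : QPoly fun v => pure (QData.pair v.snd.fst (QData.pair v.fst v.snd.snd)) := by
  refine of_pure (fun v => QData.pair v.snd.fst (QData.pair v.fst v.snd.snd))
    (fun a => Prog.seq (Prog.split a (a + 1) a) (Prog.seq (Prog.split (a + 1) (a + 2) (a + 1))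
      (Prog.seq (Prog.join a a (a + 2)) (Prog.join a (a + 1) a)))) 4
    (3 * Polynomial.X + 2) (fun v => ?_) ?_
  · have := v.size_fst_le
    have := v.size_snd_le
    have := v.snd.size_snd_le
    have := v.snd.size_fst_le
    simp [QData.size]; omega
  · intro a σ O s o m n hs
    rw [run_seq_pure rfl, run_seq_pure rfl, run_seq_pure rfl]
    simp only [Prog.run, Conf.set, Conf.tick]
    congr 2
    funext x
    have := hs (a + 1) (by omega)
    have := hs (a + 2) (by omega)
    simp only [update_apply]
    grind

/-- `(x, (y, z)) ↦ ((x, y), z)` -/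
theorem assocL : QPoly fun v => pure (QData.pair (QData.pair v.fst v.snd.fst) v.snd.snd) :=
  ((onSnd swap).bind (exch.bind swap)).congr fun v => by
    simp only [pure_bind, QData.fst, QData.snd]

/-- `((x, y), z) ↦ (x, (y, z))` -/
theorem assocR : QPoly fun v => pure (QData.pair v.fst.fst (QData.pair v.fst.snd v.snd)) :=
  (swap.bind (exch.bind (onSnd swap))).congr fun v => by
    simp only [pure_bind, QData.fst, QData.snd]

/-- Puts classical data to the left. -/
theorem tag {f : Data → Data} (hf : DPoly f) :
    QPoly fun v => pure (QData.pair (f v.erase).toQ v) :=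
  ((keep hf.qpoly).bind swap).congr fun v => by
    simp only [pure_bind, QData.fst, QData.snd, Data.erase_toQ]

/-- Samples classical data from the classical part, and replaces the left component by it. -/
theorem env {F : Data → PMF Data} (hF : RPoly F) :
    QPoly fun v => QM.ofPMF (F v.erase) >>= fun r => pure (QData.pair r v.snd) :=
  ((keep hF.qpoly).bind (swap.bind (onSnd snd))).congr fun v => by
    simp only [pure_bind, bind_assoc, QData.fst, QData.snd, Data.erase_toQ]

/-- Replaces the left component by a function of the classical part. -/
theorem setEnv {f : Data → Data} (hf : DPoly f) :
    QPoly fun v => pure (QData.pair (f v.erase).toQ v.snd) :=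
  (env hf.rpoly).congr fun v => by rw [QM.ofPMF_pure, pure_bind]

/-- Runs an operation on classical data that are computed from the classical part. -/
theorem call (hF : QPoly F) {f : Data → Data} (hf : DPoly f) :
    QPoly fun v => F (f v.erase).toQ >>= fun r => pure (QData.pair v.fst (QData.pair r v.snd)) :=
  ((keep (hf.qpoly.bind hF)).bind (swap.bind exch)).congr fun v => by
    simp only [pure_bind, bind_assoc, QData.fst, QData.snd, Data.erase_toQ]

/-- Puts classical data to the left of the right component. -/
theorem push {f : Data → Data} (hf : DPoly f) :
    QPoly fun v => pure (QData.pair v.fst (QData.pair (f v.erase).toQ v.snd)) :=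
  (call id hf).congr fun v => by rw [pure_bind]

theorem ite {c : Data → Prop} (hc : BPoly c) (hF : QPoly F) (hG : QPoly G) :
    QPoly fun v => if c v.erase then F v else G v :=
  ((keep hc.dpoly.qpoly).bind (cond hF hG)).congr fun v => by
    simp only [pure_bind, Data.erase_toQ, QData.fst, QData.snd]
    by_cases h : c v.erase <;> simp [h, Data.ofBool]

end QPoly

@[simp] theorem QData.fst_pair (a b : QData) : (QData.pair a b).fst = a := rfl

@[simp] theorem QData.snd_pair (a b : QData) : (QData.pair a b).snd = b := rfl

@[simp] theorem Data.fst_pair (a b : Data) : (Data.pair a b).fst = a := rfl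

@[simp] theorem Data.snd_pair (a b : Data) : (Data.pair a b).snd = b := rfl

@[simp] theorem QData.erase_pair (a b : QData) : (QData.pair a b).erase = a.erase.pair b.erase := rfl

@[simp] theorem Data.toQ_pair (a b : Data) : (Data.pair a b).toQ = a.toQ.pair b.toQ := rfl

/-! ### Operations with a classical environment -/

/-- A polynomial-time operation on data that may hold qubits, with a classical parameter. -/
def EPoly (F : Data → QData → QM QData) : Prop := QPoly fun v => F v.fst.erase v.snd

namespace EPoly

variable {F G : Data → QData → QM QData}

theorem congr (h : EPoly F) (hFG : ∀ e q, G e q = F e q) : EPoly G :=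
  QPoly.congr h fun _ => hFG _ _

theorem of_qpoly {F : QData → QM QData} (hF : QPoly F) : EPoly fun _ q => F q :=
  (QPoly.snd.bind hF).congr fun v => by rw [pure_bind]

theorem bind (hF : EPoly F) (hG : EPoly G) : EPoly fun e q => F e q >>= G e :=
  ((QPoly.tag DPoly.id.fst).bind ((QPoly.onSnd hF).bind hG)).congr fun v => by
    simp only [pure_bind, bind_assoc, QData.erase_pair, Data.fst_pair, QData.snd_pair, Data.erase_toQ, QData.erase_fst]

/-- Recomputes the environment from it and the classical part of the argument. -/
theorem env (hF : EPoly F) {f : Data → Data} (hf : DPoly f) :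
    EPoly fun e q => F (f (Data.pair e q.erase)) q :=
  ((QPoly.setEnv (f := fun d => f (Data.pair d.fst d.snd))
    (hf.comp (DPoly.id.fst.pair DPoly.id.snd))).bind hF).congr fun v => by
    simp only [pure_bind, QData.erase_pair, Data.fst_pair, QData.snd_pair, Data.erase_toQ, QData.erase_fst, QData.erase_snd]

theorem comp (hF : EPoly F) {f : Data → Data} (hf : DPoly f) : EPoly fun e q => F (f e) q :=
  (hF.env (hf.comp DPoly.id.fst)).congr fun _ _ => rfl

/-- Samples classical data and adds them to the environment. -/
theorem sample {R : Data → PMF Data} (hR : RPoly R) (hF : EPoly F) :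
    EPoly fun e q => (StateT.lift (R e) : QM Data) >>= fun a => F (Data.pair e a) q :=
  ((QPoly.env (F := fun d => (R d.fst).map fun a => Data.pair d.fst a)
    (((hR.comp DPoly.id.fst).bind₂ (G := fun d a => PMF.pure (Data.pair d.fst a))
      (DPoly.id.fst.fst.pair DPoly.id.snd)))).bind hF).congr fun v => by
    rw [bind_assoc]
    simp only [pure_bind, QData.fst_pair, QData.snd_pair]
    rw [QM.ofPMF_bind]
    funext m
    rw [QM.bind_apply, QM.lift_apply, PMF.bind_map, PMF.bind_map]
    simp only [Function.comp_def, Data.erase_toQ, QData.erase_fst]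

theorem pure {f : Data → Data} (hf : DPoly f) : EPoly fun e _ => pure (f e).toQ :=
  (hf.comp DPoly.id.fst).qpoly.congr fun v => by simp only [QData.erase_fst]

theorem push {f : Data → Data} (hf : DPoly f) : EPoly fun e q => Pure.pure (QData.pair (f e).toQ q) :=
  (QPoly.setEnv (hf.comp DPoly.id.fst)).congr fun v => by simp only [QData.erase_fst]

/-- Runs an operation on classical data. -/
theorem call {F : QData → QM QData} (hF : QPoly F) {f : Data → Data} (hf : DPoly f) :
    EPoly fun e q => F (f e).toQ >>= fun r => Pure.pure (QData.pair r q) :=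
  ((QPoly.call hF (hf.comp DPoly.id.fst)).bind QPoly.snd).congr fun v => by
    simp only [pure_bind, bind_assoc, QData.snd_pair, QData.erase_fst]

theorem onSnd (hF : EPoly F) :
    EPoly fun e q => F e q.snd >>= fun r => Pure.pure (QData.pair q.fst r) :=
  (QPoly.exch.bind (QPoly.onSnd hF)).congr fun v => by
    simp only [pure_bind, QData.fst_pair, QData.snd_pair]

theorem onFst (hF : EPoly F) :
    EPoly fun e q => F e q.fst >>= fun r => Pure.pure (QData.pair r q.snd) :=
  ((of_qpoly QPoly.swap).bind ((onSnd hF).bind (of_qpoly QPoly.swap))).congr fun e q => by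
    simp only [pure_bind, bind_assoc, QData.fst_pair, QData.snd_pair]

theorem ite {c : Data → Prop} (hc : BPoly c) (hF : EPoly F) (hG : EPoly G) :
    EPoly fun e q => if c (Data.pair e q.erase) then F e q else G e q :=
  (QPoly.ite (c := fun d => c (Data.pair d.fst d.snd)) (hc.comp (DPoly.id.fst.pair DPoly.id.snd))
    hF hG).congr fun v => by simp only [QData.erase_fst, QData.erase_snd]

theorem ite' {c : Data → Prop} (hc : BPoly c) (hF : EPoly F) (hG : EPoly G) :
    EPoly fun e q => if c e then F e q else G e q :=
  (ite (hc.comp DPoly.id.fst) hF hG).congr fun _ _ => rfl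

/-- A fold over a list in the environment. -/
theorem fold (hF : EPoly F) (g : Polynomial ℕ)
    (hg : ∀ e s m, ∀ r ∈ (F e s m).support, r.1.size ≤ s.size + g.eval e.size) {l : Data → Data}
    (hl : DPoly l) :
    EPoly fun e q => (l e).toList.foldlM (fun s x => F (Data.pair e x) s) q := by
  have h1 : QPoly fun v => F (Data.pair v.fst.erase v.snd.snd.erase) v.snd.fst :=
    ((QPoly.tag (f := fun d => Data.pair d.fst d.snd.snd)
      (DPoly.id.fst.pair DPoly.id.snd.snd)).bind ((QPoly.onSnd (QPoly.snd.bind QPoly.fst)).bind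
        hF)).congr fun v => by
      simp only [pure_bind, QData.erase_pair, Data.fst_pair, QData.snd_pair, Data.erase_toQ, QData.erase_fst,
        QData.erase_snd]
  refine ((QPoly.push (f := fun d => l d.fst) (hl.comp DPoly.id.fst)).bind
    ((QPoly.onSnd QPoly.swap).bind (h1.fold (g.comp (Polynomial.X + 1)) ?_))).congr fun v => ?_
  · intro c s x q r hr
    have := hg _ _ _ _ hr
    simp only [QData.fst_pair, QData.snd_pair, Data.erase_toQ, Data.size] at this
    refine this.trans (Nat.add_le_add_left ?_ _)
    simp only [Polynomial.eval_comp, Polynomial.eval_add, Polynomial.eval_X, Polynomial.eval_one]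
    refine g.eval_mono_nat ?_
    have := x.size_erase_le
    omega
  · simp only [pure_bind, QData.fst_pair, QData.erase_pair, Data.fst_pair, QData.snd_pair, Data.erase_toQ, QData.erase_fst, QData.erase_snd,
      QData.toList_toQ, List.foldlM_map]

theorem size_le (hF : EPoly F) : ∃ p : Polynomial ℕ, ∀ e q m, ∀ r ∈ (F e q m).support,
    r.1.size ≤ p.eval (e.size + q.size) := by
  obtain ⟨p, hp⟩ := QPoly.size_le hF
  refine ⟨p.comp (Polynomial.X + 1), fun e q m r hr => ?_⟩
  have := hp (QData.pair e.toQ q) m r (by simpa [QData.fst_pair, QData.erase_pair, Data.fst_pair, Data.snd_pair, QData.snd_pair] using hr)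
  simpa [QData.size] using this

end EPoly

/-- Reverses a list of data that may hold qubits. -/
theorem QPoly.reverse : QPoly fun v => pure (QData.ofList v.toList.reverse) := by
  have h1 : QPoly fun v => pure (QData.pair v.snd.snd v.snd.fst) :=
    (snd.bind swap).congr fun v => by simp only [pure_bind]
  refine ((tag (DPoly.const nil)).bind ((tag (DPoly.const nil)).bind
    ((exch.bind
    (h1.fold (Polynomial.X + 1) ?_))))).congr fun v => ?_
  · intro c s x m r hr
    rw [QM.pure_apply, PMF.support_pure, Set.mem_singleton_iff] at hr
    rw [hr]
    simp [QData.size]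
    omega
  · simp only [pure_bind, QData.fst_pair, QData.snd_pair]
    have : ∀ (l : List QData) (s : QData), l.foldlM (m := QM) (fun s x => pure (QData.pair x s)) s =
        pure (l.foldl (fun s x => QData.pair x s) s) := fun l s => List.foldlM_pure
    rw [this]
    have : ∀ (l l' : List QData), l.foldl (fun s x => QData.pair x s) (QData.ofList l') =
        QData.ofList (l.reverse ++ l') := by
      intro l
      induction l with
      | nil => simp
      | cons a l ih => intro l'; simpa [QData.ofList] using ih (a :: l')
    have := this v.toList []
    rw [List.append_nil] at this
    rw [← this]
    rfl

/-! ### Sequences of random operations -/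

section Monad

variable {m : Type → Type} [Monad m] [LawfulMonad m] {α β γ : Type}

theorem List.foldlM_eq_mapM (f : α → m β) (g : γ → β → γ) (l : List α) (s : γ) :
    l.foldlM (fun s x => f x >>= fun b => pure (g s b)) s =
      l.mapM f >>= fun L => pure (L.foldl g s) := by
  induction l generalizing s with
  | nil => simp
  | cons a l ih => simp only [List.foldlM_cons, List.mapM_cons, bind_assoc, pure_bind, ih, List.foldl_cons]

theorem List.mapM_ofFn {n : ℕ} (g : Fin n → α) (f : α → m β) :
    (List.ofFn g).mapM f = seqFin (fun r => f (g r)) >>= fun t => pure (List.ofFn t) := by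
  induction n with
  | zero => simp [seqFin]
  | succ n ih => simp [List.ofFn_succ, seqFin, ih]

theorem seqFin_map {n : ℕ} (f : Fin n → m α) (g : Fin n → α → β) :
    seqFin (fun r => f r >>= fun a => pure (g r a)) =
      seqFin f >>= fun t => pure fun r => g r (t r) := by
  induction n with
  | zero =>
    simp only [seqFin, pure_bind]
    congr 1
    funext r
    exact r.elim0
  | succ n ih =>
    simp only [seqFin, ih, bind_assoc, pure_bind]
    congr 1
    funext a
    congr 1
    funext t
    congr 1
    funext r
    refine Fin.cases ?_ (fun r => ?_) r <;> simp

theorem List.ofFn_eq_take_cons_drop {n : ℕ} (g : Fin n → α) (i : Fin n) :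
    List.ofFn g = (List.ofFn g).take i ++ g i :: (List.ofFn g).drop (i + 1) := by
  have h : (i : ℕ) < (List.ofFn g).length := by simp
  conv_lhs => rw [← List.take_append_drop i (List.ofFn g), List.drop_eq_getElem_cons h]
  simp

/-- The reduction treats the rows above `i`, row `i` itself, and the rows below `i` by different
code. This identity joins the three stages; the order of execution is kept, as it must be for
operations on a shared quantum memory. -/
theorem mapM_take_cons_drop {n : ℕ} (g : Fin n → α) (f : α → m β) (i : Fin n)
    (K : List β → β → List β → m γ) :
    (((List.ofFn g).take i).mapM f >>= fun L => f (g i) >>= fun b =>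
      ((List.ofFn g).drop (i + 1)).mapM f >>= fun L' => K L b L') =
    seqFin (fun r => f (g r)) >>= fun t =>
      K ((List.ofFn t).take i) (t i) ((List.ofFn t).drop (i + 1)) := by
  induction n generalizing K with
  | zero => exact i.elim0
  | succ n ih =>
    refine Fin.cases ?_ (fun i => ?_) i
    · simp [seqFin, List.ofFn_succ, List.mapM_ofFn]
    · have := fun b => ih (fun r => g r.succ) i (K := fun L b' L' => K (b :: L) b' L')
      simp only [seqFin, Fin.val_succ, List.ofFn_succ, List.take_succ_cons, List.drop_succ_cons,
        List.mapM_cons, bind_assoc, pure_bind, Fin.cons_zero, Fin.cons_succ] at this ⊢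
      congr 1
      funext b
      exact this b

end Monad

/-- Entry `i` may be processed after all the others, because independent classical samplings
commute. This justifies sampling a complete table and replacing one entry afterwards. -/
theorem seqFin_update {α : Type} {n : ℕ} (f : Fin n → PMF α) (i : Fin n) (K : α → PMF α) :
    ((seqFin f).bind fun t => (K (t i)).map (update t i)) =
      seqFin (update f i ((f i).bind K)) := by
  have e1 : ∀ {n : ℕ} (f : Fin (n + 1) → PMF α), seqFin f =
      (f 0).bind fun a => (seqFin fun r => f r.succ).bind fun t =>
        PMF.pure (Fin.cons (α := fun _ => α) a t) := fun f => rfl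
  induction n with
  | zero => exact i.elim0
  | succ n ih =>
    rw [e1, e1]
    simp only [PMF.bind_bind, PMF.pure_bind]
    refine Fin.cases ?_ (fun i => ?_) i
    · simp only [update_self, Fin.cons_zero, PMF.bind_bind]
      refine congrArg _ (funext fun a => ?_)
      rw [PMF.bind_comm]
      simp only [Fin.update_cons_zero, PMF.map, Function.comp_def, ne_eq, Fin.succ_ne_zero,
        not_false_eq_true, update_of_ne]
    · have h1 : ∀ (a : α) (t : Fin n → α), (K (t i)).map (update
          (Fin.cons (α := fun _ => α) a t) i.succ) = ((K (t i)).map (update t i)).bind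
            fun t => PMF.pure (Fin.cons (α := fun _ => α) a t) := by
        intro a t
        rw [PMF.bind_map, PMF.map]
        simp only [Function.comp_def, Fin.cons_update]
      have h2 : (fun r : Fin n => update f i.succ ((f i.succ).bind K) r.succ) =
          update (fun r : Fin n => f r.succ) i ((f i.succ).bind K) := by
        funext r
        by_cases h : r = i
        · subst h; simp
        · simp [update_of_ne, h]
      rw [h2, ← ih, update_of_ne (Fin.succ_ne_zero i).symm]
      simp only [Fin.cons_succ, h1, PMF.bind_bind]

theorem seqFin_update₂ {α : Type} {n m : ℕ} (f : Fin n → Fin m → PMF α) (i : Fin n) (k : Fin m)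
    (p : PMF α) :
    ((seqFin fun r => seqFin (f r)).bind fun t =>
      p.map fun a => update t i (update (t i) k a)) =
    seqFin fun r => seqFin (update f i (update (f i) k p) r) := by
  have h1 := seqFin_update (fun r => seqFin (f r)) i fun t => p.map (update t k)
  have h2 := seqFin_update (f i) k fun _ => p
  rw [PMF.bind_const] at h2
  rw [h2] at h1
  simp only [PMF.map_comp] at h1
  refine Eq.trans ?_ (h1.trans ?_)
  · rfl
  · congr 1
    funext r
    by_cases h : r = i
    · subst h; simp
    · simp [update_of_ne, h]

theorem uniformList_range (n : ℕ) [Nonempty (Fin n)] :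
    uniformList ((List.range n).map unary) =
      (PMF.uniformOfFintype (Fin n)).map fun j : Fin n => unary j := by
  have hn : 0 < n := Fin.pos_iff_nonempty.2 inferInstance
  have h : 0 < ((List.range n).map unary).length := by simpa
  rw [uniformList, dif_pos h]
  have : Nonempty (Fin ((List.range n).map unary).length) := ⟨⟨0, h⟩⟩
  rw [← PMF.map_uniformOfFintype_equiv (finCongr (show ((List.range n).map unary).length = n by simp)),
    PMF.map_comp]
  congr 1
  funext j
  simp

/-- Sampling classical randomness does not touch the quantum memory, so it commutes with every
operation. -/
theorem QM.lift_bind_comm {α β γ : Type} (p : PMF α) (x : QM β) (f : α → β → QM γ) :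
    ((StateT.lift p : QM α) >>= fun a => x >>= fun b => f a b) =
      x >>= fun b => (StateT.lift p : QM α) >>= fun a => f a b := by
  funext m
  simp only [QM.bind_apply, QM.lift_apply, PMF.bind_map, Function.comp_def]
  rw [PMF.bind_comm]

theorem QM.lift_bind {α β : Type} (p : PMF α) (f : α → PMF β) :
    (StateT.lift (p >>= f) : QM β) = (StateT.lift p : QM α) >>= fun a => StateT.lift (f a) := by
  funext m
  rw [QM.bind_apply, QM.lift_apply, QM.lift_apply, PMF.bind_map]
  exact PMF.map_bind _ _ _

theorem QM.lift_pure {α : Type} (a : α) : (StateT.lift (pure a : PMF α) : QM α) = pure a := by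
  funext m
  exact PMF.pure_map _ _

/-- Drawing all columns first, as the scheme does, is equivalent to drawing each column just before
its row is processed, as the reduction does. -/
theorem lift_seqFin_bind {α β : Type} {n : ℕ} (p : Fin n → PMF α) (K : Fin n → α → QM β) :
    ((StateT.lift (seqFin p) : QM (Fin n → α)) >>= fun js => seqFin (fun r => K r (js r)) >>= fun t =>
      pure (fun r => (js r, t r))) =
    seqFin fun r => (StateT.lift (p r) : QM α) >>= fun j => K r j >>= fun b => pure (j, b) := by
  induction n with
  | zero =>
    simp only [seqFin, QM.lift_pure, pure_bind]
    congr 1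
    funext r
    exact r.elim0
  | succ n ih =>
    have h := ih (fun r => p r.succ) fun r => K r.succ
    simp only [seqFin, QM.lift_bind, QM.lift_pure, bind_assoc, pure_bind, Fin.cons_zero,
      Fin.cons_succ] at h ⊢
    rw [← h]
    refine congrArg _ (funext fun j => ?_)
    simp only [bind_assoc, pure_bind]
    rw [QM.lift_bind_comm]
    refine congrArg _ (funext fun b => congrArg _ (funext fun js => congrArg _ (funext fun t => ?_)))
    congr 1
    funext r
    refine Fin.cases ?_ (fun r => ?_) r <;> simp

theorem DPoly.take {n l : Data → Data} (hn : DPoly n) (hl : DPoly l) :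
    DPoly fun d => ofList ((l d).toList.take (n d).toList.length) :=
  (DPoly.reverse (DPoly.drop (DPoly.drop hn hl) (DPoly.reverse hl))).congr fun d => by
    simp only [Data.toList_ofList, List.length_drop]
    congr 1
    rw [List.drop_reverse, List.reverse_reverse]
    by_cases h : (n d).toList.length ≤ (l d).toList.length
    · congr 1; omega
    · rw [List.take_of_length_le (by omega), List.take_of_length_le (by omega)]

/-! ### Contexts -/

/-- The frames for the item with number `n` of a list. -/
def listFrames (n : ℕ) (l : List Data) : List Data :=
  pair (pair nil nil) (ofList (l.drop (n + 1))) ::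
    (l.take n).reverse.map (pair nil)

theorem plugFrame_left (z x : QData) : plugFrame z (QData.pair QData.nil x) = QData.pair x z := by
  simp [plugFrame, QData.erase, Data.fst, Data.snd]

theorem plugFrame_right (z x : QData) :
    plugFrame z (QData.pair (QData.pair QData.nil QData.nil) x) = QData.pair z x := by
  simp [plugFrame, QData.erase, Data.fst, Data.snd]

theorem plugFrame_strip (z x : QData) :
    plugFrame z (QData.pair (pair nil (pair nil nil)).toQ x) = z.fst := by
  simp [plugFrame, Data.toQ, QData.erase, Data.fst, Data.snd]

theorem plugFrame_replace (z x : QData) :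
    plugFrame z (QData.pair (pair (pair nil nil) nil).toQ x) = x.erase.toQ := by
  simp [plugFrame, Data.toQ, QData.erase, Data.fst]

theorem foldl_plugFrame_left (L : List QData) (z : QData) :
    (L.map (QData.pair QData.nil)).foldl plugFrame z = L.foldl (fun z x => QData.pair x z) z := by
  induction L generalizing z with
  | nil => rfl
  | cons a L ih => simp only [List.map_cons, List.foldl_cons, ih, plugFrame_left]

theorem foldl_pair_ofList (L L' : List QData) :
    L.foldl (fun z x => QData.pair x z) (QData.ofList L') = QData.ofList (L.reverse ++ L') := by
  induction L generalizing L' with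
  | nil => rfl
  | cons a L ih => simpa [QData.ofList] using ih (a :: L')

theorem Data.toQ_ofList (l : List Data) : (Data.ofList l).toQ = QData.ofList (l.map Data.toQ) := by
  induction l with
  | nil => rfl
  | cons a l ih => simp [ofList, QData.ofList, ih]

/-- The first frame attaches the tail of the list to the right of the answer, and the other frames
put the earlier items to its left, the nearest one first. -/
theorem foldl_listFrames (n : ℕ) (l : List Data) (z : Data) (hn : n < l.length) :
    ((listFrames n l).map Data.toQ).foldl plugFrame z.toQ = (ofList (l.set n z)).toQ := by
  rw [listFrames, List.map_cons, List.foldl_cons]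
  have h1 : plugFrame z.toQ (pair (pair nil nil) (ofList (l.drop (n + 1)))).toQ =
      (ofList (z :: l.drop (n + 1))).toQ := plugFrame_right _ _
  have h2 : List.map Data.toQ (List.map (pair nil) (l.take n).reverse) =
      ((l.take n).reverse.map Data.toQ).map (QData.pair QData.nil) := by
    simp [Function.comp_def, Data.toQ]
  rw [h1, h2, foldl_plugFrame_left, Data.toQ_ofList, foldl_pair_ofList, Data.toQ_ofList,
    List.set_eq_take_append_cons_drop, if_pos hn]
  simp

/-- A table. -/
def tableData {V W : ℕ} (t : Fin V → Fin W → Data) : Data :=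
  ofList (List.ofFn fun r => ofList (List.ofFn (t r)))

/-- The frames for a cell of a table. -/
def tableFrames (n k : ℕ) (l : List Data) : List Data :=
  listFrames k (l.getD n nil).toList ++ listFrames n l

theorem foldl_tableFrames {V W : ℕ} (t : Fin V → Fin W → Data) (i : Fin V) (k : Fin W) (z : Data) :
    ((tableFrames i k (tableData t).toList).map Data.toQ).foldl plugFrame z.toQ =
      (tableData (update t i (update (t i) k z))).toQ := by
  have hset : ∀ {α : Type} {n : ℕ} (f : Fin n → α) (i : Fin n) (a : α),
      (List.ofFn f).set i a = List.ofFn (update f i a) := by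
    intro α n f i a
    refine List.ext_getElem (by simp) fun j h1 h2 => ?_
    rw [List.getElem_set]
    simp only [List.getElem_ofFn, update_apply, Fin.ext_iff]
    simp only [eq_comm]
  rw [tableFrames, List.map_append, List.foldl_append, tableData, Data.toList_ofList,
    List.getD_eq_getElem _ _ (by simp), List.getElem_ofFn, Data.toList_ofList,
    foldl_listFrames _ _ _ (by simp), foldl_listFrames _ _ _ (by simp), hset, hset, tableData]
  congr 3
  funext r
  by_cases h : r = i
  · subst h; simp
  · simp [update_of_ne, h]

theorem DPoly.listFrames {n l : Data → Data} (hn : DPoly n) (hl : DPoly l) :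
    DPoly fun d => ofList (listFrames (n d).toList.length (l d).toList) :=
  ((DPoly.const (Data.pair nil nil)).pair (DPoly.drop (n := fun d => Data.pair nil (n d))
    ((DPoly.const nil).pair hn) hl)).pair
    (DPoly.map (f := fun _ x => Data.pair nil x) ((DPoly.const nil).pair DPoly.id.snd)
      (DPoly.reverse (DPoly.take hn hl))) |>.congr fun d => by
    simp [_root_.listFrames, ofList, Data.toList]

theorem DPoly.tableFrames {n k l : Data → Data} (hn : DPoly n) (hk : DPoly k) (hl : DPoly l) :
    DPoly fun d => ofList (tableFrames (n d).toList.length (k d).toList.length (l d).toList) :=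
  (DPoly.append (DPoly.listFrames hk (DPoly.get hn hl)) (DPoly.listFrames hn hl)).congr fun d => by
    simp [_root_.tableFrames]

/-! ### The programs as operations -/

/-- The classical result of a program. -/
def Prog.result (P : Prog) (d : Data) : PMF Data :=
  (P.exec d.toQ QState.blank).map fun c => (c.store 0).erase

/-- A program without quantum instructions gives the same results on any memory and does not change
it, so it can be run in the presence of the adversary's qubits. -/
theorem RPoly.of_isPPT {P : Prog} (hP : P.IsPPT) : RPoly P.result := by
  obtain ⟨hc, hq, hp⟩ := hP
  refine RPoly.of_qpoly (G := fun v => P.kernel v.erase.toQ >>= fun r => pure r.erase.toQ)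
    (DPoly.id.qpoly.bind ((QPoly.of_isQPT ⟨hc, hp⟩).bind DPoly.id.qpoly) |>.congr fun v => by
      simp only [pure_bind]) fun v => ?_
  funext m
  rw [QM.bind_apply, Prog.kernel_of_noQubits hc hq, PMF.bind_map, QM.ofPMF, Prog.result, PMF.map_comp]
  rfl

theorem Prog.result_eq_pure {P : Prog} {d r : Data}
    (h : ∀ c ∈ (P.exec d.toQ QState.blank).support, (c.store 0).erase = r) :
    P.result d = PMF.pure r := by
  refine PMF.eq_pure_of_support _ fun a ha => ?_
  obtain ⟨c, hc, rfl⟩ := (PMF.mem_support_map_iff _ _ _).1 ha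
  exact h c hc

/-- The operation `f` on natural numbers is computable in polynomial time in unary. -/
def UPoly (f : ℕ → ℕ) : Prop := DPoly fun d => unary (f d.toList.length)

theorem UPoly.of_unaryComputable {f : ℕ → ℕ} (h : UnaryComputable f) : UPoly f := by
  obtain ⟨P, hP, h⟩ := h
  change RPoly fun d => PMF.pure (unary (f d.toList.length))
  refine (RPoly.comp (RPoly.of_isPPT hP) (DPoly.id.length)).congr fun d => ?_
  refine (Prog.result_eq_pure fun c hc => ?_).symm
  rw [h _ _ c hc, Data.erase_toQ]

theorem UPoly.add {f g : ℕ → ℕ} (hf : UPoly f) (hg : UPoly g) : UPoly fun n => f n + g n :=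
  (DPoly.length (DPoly.append hf hg)).congr fun d => by simp

theorem UPoly.id : UPoly fun n => n := DPoly.id.length

theorem UPoly.mul {f g : ℕ → ℕ} (hf : UPoly f) (hg : UPoly g) : UPoly fun n => f n * g n := by
  obtain ⟨p, hp⟩ := DPoly.size_le hg
  refine (DPoly.fold (f := fun c s _ => ofList (s.toList ++ (unary (g c.toList.length)).toList))
    (DPoly.append DPoly.id.snd.fst (hg.comp DPoly.id.fst)) (p + 1) (fun c s x => ?_)
    (DPoly.const nil) hf).congr fun d => ?_
  · have h1 : ∀ l l' : List Data, (ofList (l ++ l')).size = (ofList l).size + (ofList l').size := by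
      intro l l'
      induction l with
      | nil => simp [ofList, Data.size]
      | cons a l ih => simp [ofList, Data.size, ih]; omega
    have h2 := hp c
    have h3 : p.eval c.size ≤ p.eval (c.size + x.size) := p.eval_mono_nat (by omega)
    rw [h1, Data.ofList_toList, Data.ofList_toList]
    simp only [Polynomial.eval_add, Polynomial.eval_one]
    omega
  · simp only [Data.toList_unary]
    generalize d.toList.length = n
    generalize g n = m
    have : ∀ (k j : ℕ), (List.replicate k nil).foldl (fun s _ => ofList (s.toList ++
        List.replicate m nil)) (unary j) = unary (j + k * m) := by
      intro k
      induction k with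
      | zero => simp
      | succ k ih =>
        intro j
        have h : ofList ((unary j).toList ++ List.replicate m nil) = unary (j + m) := by
          rw [← Data.ofList_toList (unary (j + m)), Data.toList_unary, Data.toList_unary,
            List.replicate_add]
        rw [List.replicate_succ, List.foldl_cons, h, ih]
        congr 1
        ring
    have := this (f n) 0
    rw [zero_add] at this
    exact this.symm

theorem UPoly.poly_bound {f : ℕ → ℕ} (h : UPoly f) : ∃ p : Polynomial ℕ, ∀ n, f n ≤ p.eval n := by
  obtain ⟨p, hp⟩ := DPoly.size_le h
  exact ⟨p, fun n => by simpa using hp (unary n)⟩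

theorem BPoly.lt {f g : Data → Data} (hf : DPoly f) (hg : DPoly g) :
    BPoly fun d => (f d).toList.length < (g d).toList.length :=
  (BPoly.not (BPoly.eq (DPoly.drop hf hg) (DPoly.const nil))).congr fun d => by
    rw [show nil = ofList [] from rfl, Data.ofList_injective.eq_iff, List.drop_eq_nil_iff]
    omega

theorem BPoly.ne_nil {f : Data → Data} (hf : DPoly f) : BPoly fun d => f d ≠ nil :=
  BPoly.not (BPoly.eq hf (DPoly.const _))

theorem BPoly.or {c c' : Data → Prop} (hc : BPoly c) (hc' : BPoly c') :
    BPoly fun d => c d ∨ c' d := (BPoly.ite hc BPoly.true hc').congr fun d => by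
  by_cases h : c d <;> simp [h]

theorem BPoly.mem {f l : Data → Data} (hf : DPoly f) (hl : DPoly l) :
    BPoly fun d => f d ∈ (l d).toList :=
  (BPoly.not (BPoly.all (c := fun d x => ¬ x = f d) (BPoly.not (BPoly.eq DPoly.id.snd
    (hf.comp DPoly.id.fst))) hl)).congr fun d => by simp

theorem BPoly.nodup {l : Data → Data} (hl : DPoly l) : BPoly fun d => (l d).toList.Nodup :=
  (BPoly.all (c := fun d x => ¬ 1 < ((l d).toList.filter fun y => decide (y = x)).length)
    ((BPoly.not (BPoly.lt (f := fun _ => unary 1) (DPoly.const _) (DPoly.filter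
      (c := fun p y => y = p.snd) (l := fun p => l p.fst) (BPoly.eq DPoly.id.snd DPoly.id.fst.snd)
      (hl.comp DPoly.id.fst)))).congr fun d => by simp) hl).congr fun d => by
    have h1 : ∀ x, ((l d).toList.filter fun y => decide (y = x)).length = (l d).toList.count x := by
      intro x
      rw [List.count_eq_length_filter]
      congr 2
    simp only [h1, not_lt]
    rw [List.nodup_iff_count_le_one]
    refine ⟨fun h x _ => h x, fun h x => ?_⟩
    by_cases hx : x ∈ (l d).toList
    · exact h x hx
    · rw [List.count_eq_zero_of_not_mem hx]
      exact zero_le_one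

/-! ### Messages -/

/-- The sum of messages with `e` bits. -/
def xorData (e : ℕ) (L : List Data) : Data :=
  ofList ((List.range e).map fun j => L.foldl (fun s x =>
    ofBool (decide (¬ (s = nil ↔ x.toList.getD j nil = nil)))) nil)

theorem getD_encode {l : ℕ} (m : Msg l) (j : Fin l) :
    m.encode.toList.getD j nil = ofBool (decide (m j = 1)) := by
  simp [Msg.encode]

theorem xorData_encode {l : ℕ} (L : List (Msg l)) : xorData l (L.map Msg.encode) = L.sum.encode := by
  have h2 : ∀ a : ZMod 2, a = 0 ∨ a = 1 := by decide
  have key : ∀ (j : Fin l) (a : ZMod 2), (L.map Msg.encode).foldl (fun s x =>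
      ofBool (decide (¬ (s = nil ↔ x.toList.getD j nil = nil))))
      (ofBool (decide (a = 1))) = ofBool (decide (a + L.sum j = 1)) := by
    intro j
    induction L with
    | nil => intro a; simp
    | cons m L ih =>
      intro a
      rw [List.map_cons, List.foldl_cons, getD_encode, List.sum_cons, Pi.add_apply, ← add_assoc, ← ih]
      congr 2
      have : ∀ a b : ZMod 2, (¬ (¬ a = 1 ↔ ¬ b = 1)) ↔ a + b = 1 := by decide
      simp only [Data.ofBool_eq_nil, decide_eq_false_iff_not, decide_eq_decide]
      exact this _ _
  rw [xorData, Msg.encode]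
  congr 1
  refine List.ext_getElem (by simp) fun j h1 h2 => ?_
  have := key ⟨j, by simpa using h2⟩ 0
  simpa [ofBool] using this

theorem DPoly.xorData {e L : Data → Data} (he : DPoly e) (hL : DPoly L) :
    DPoly fun d => xorData (e d).toList.length (L d).toList :=
  (DPoly.map (f := fun d j => (L d).toList.foldl (fun s x =>
    Data.ofBool (decide (¬ (s = nil ↔ x.toList.getD j.toList.length nil = nil))))
      nil) (l := fun d => Data.range (e d).toList.length)
    (DPoly.fold (f := fun p s x => Data.ofBool (decide (¬ (s = nil ↔
      x.toList.getD p.snd.toList.length nil = nil))))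
      (l := fun p => L p.fst) (s := fun _ => nil)
      (DPoly.congr (DPoly.ofBool (c := fun p => ¬ (p.snd.fst = nil ↔
        p.snd.snd.toList.getD p.fst.snd.toList.length nil = nil)) (((BPoly.and (BPoly.eq DPoly.id.snd.fst (DPoly.const nil))
        (BPoly.ne_nil (DPoly.get DPoly.id.fst.snd DPoly.id.snd.snd))).or (BPoly.and
        (BPoly.ne_nil DPoly.id.snd.fst) (BPoly.eq (DPoly.get DPoly.id.fst.snd DPoly.id.snd.snd)
          (DPoly.const nil)))).congr fun d => by tauto)) fun _ => by congr) 1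
      (fun c s x => by
        simp only [Polynomial.eval_one]
        refine le_trans ?_ (Nat.le_add_left 1 _)
        have : ∀ b : Bool, (Data.ofBool b).size ≤ 1 := by decide
        exact this _)
      (DPoly.const nil) (hL.comp DPoly.id.fst)) (DPoly.range he)).congr fun d => by
    simp [_root_.xorData, Function.comp_def]

/-- Being the code of a message with `e` bits. -/
def IsMsg (e : ℕ) (d : Data) : Prop :=
  d.toList.length = e ∧ ∀ a ∈ d.toList, a = nil ∨ a = ofBool true

theorem encode_injective {l : ℕ} : Function.Injective (Msg.encode (l := l)) := by
  intro m m' h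
  funext j
  have h1 := getD_encode m j
  rw [h, getD_encode] at h1
  have h2 : ∀ a b : ZMod 2, (a = 1 ↔ b = 1) → a = b := by decide
  exact h2 _ _ (decide_eq_decide.1 (Data.ofBool_injective h1.symm))

theorem decode_encode {l : ℕ} (m : Msg l) : Msg.decode l m.encode = some m := by
  have h : ∃ m' : Msg l, m'.encode = m.encode := ⟨m, rfl⟩
  rw [Msg.decode, dif_pos h]
  exact congrArg some (encode_injective h.choose_spec)

theorem isMsg_iff {l : ℕ} {d : Data} : IsMsg l d ↔ ∃ m : Msg l, m.encode = d := by
  constructor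
  · rintro ⟨h1, h2⟩
    refine ⟨fun j => if d.toList.getD j nil = nil then 0 else 1, ?_⟩
    rw [← Data.ofList_toList d, Msg.encode]
    congr 1
    refine List.ext_getElem (by simp [h1]) fun j h3 h4 => ?_
    have h5 := h2 _ (List.getElem_mem h4)
    simp only [Data.ofList_toList] at h4 h5 ⊢
    simp only [List.getElem_ofFn, List.getD_eq_getElem _ _ h4]
    rcases h5 with h5 | h5 <;> simp [h5, ofBool]
  · rintro ⟨m, rfl⟩
    refine ⟨by simp [Msg.encode], fun a ha => ?_⟩
    simp only [Msg.encode, Data.toList_ofList, List.mem_ofFn] at ha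
    obtain ⟨j, rfl⟩ := ha
    cases decide (m j = 1) <;> simp [ofBool]

theorem decode_eq_none {l : ℕ} {d : Data} (h : ¬ IsMsg l d) : Msg.decode l d = none := by
  rw [isMsg_iff] at h
  rw [Msg.decode, dif_neg h]

theorem BPoly.isMsg {e f : Data → Data} (he : DPoly e) (hf : DPoly f) :
    BPoly fun d => IsMsg (e d).toList.length (f d) :=
  (BPoly.and (BPoly.and (BPoly.not (BPoly.lt he hf)) (BPoly.not (BPoly.lt hf he)))
    (BPoly.all (c := fun _ a => a = nil ∨ a = ofBool Bool.true)
      (BPoly.or (BPoly.eq DPoly.id.snd (DPoly.const _)) (BPoly.eq DPoly.id.snd (DPoly.const _))) hf)).congr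
    fun d => by
      rw [IsMsg]
      refine and_congr_left fun _ => ?_
      omega

/-- A uniformly random message with `e` bits. -/
def randomMsg (e : ℕ) : PMF Data :=
  ((List.range e).mapM fun _ => uniformList [nil, ofBool true]).map ofList

theorem randomMsg_eq (l : ℕ) :
    randomMsg l = (PMF.uniformOfFintype (Msg l)).map Msg.encode := by
  have h1 : uniformList [nil, ofBool true] =
      (PMF.uniformOfFintype (ZMod 2)).map fun a => ofBool (decide (a = 1)) := by
    have h : 0 < [nil, ofBool true].length := by simp
    rw [uniformList, dif_pos h]
    -- `ZMod 2` is `Fin 2` by definition, so both sides are images of the same uniform distribution.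
    change (PMF.uniformOfFintype (Fin 2)).map _ = (PMF.uniformOfFintype (Fin 2)).map _
    have : ∀ a : Fin 2, [nil, ofBool true].get a =
        ofBool (decide ((show ZMod 2 from a) = 1)) := by
      intro a
      fin_cases a
      · exact congrArg ofBool (decide_eq_false (by decide)).symm
      · exact congrArg ofBool (decide_eq_true rfl).symm
    exact congrArg (fun f => PMF.map f (PMF.uniformOfFintype (Fin 2))) (funext this)
  have h2 : List.range l = List.ofFn fun j : Fin l => (j : ℕ) := by
    refine List.ext_getElem (by simp) (by simp)
  rw [randomMsg, h1, h2, List.mapM_ofFn]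
  have h3 := seqFin_map (m := PMF) (fun _ : Fin l => PMF.uniformOfFintype (ZMod 2))
    fun _ a => ofBool (decide (a = 1))
  have h4 := uniformOfFintype_pi (α := ZMod 2) l
  refine Eq.trans ?_ (congrArg (PMF.map Msg.encode) h4.symm)
  refine (congrArg (fun t => PMF.map ofList (t >>= fun t => pure (List.ofFn t))) h3).trans ?_
  rw [bind_assoc]
  simp only [pure_bind]
  exact (PMF.map_bind _ _ _).trans (congrArg _ (funext fun t => PMF.pure_map _ _))

theorem RPoly.randomMsg {e : Data → Data} (he : DPoly e) :
    RPoly fun d => randomMsg (e d).toList.length :=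
  (RPoly.mapM (F := fun _ _ => uniformList [nil, ofBool true])
    (RPoly.choose (l := fun _ => ofList [nil, ofBool true]) (DPoly.const _) |>.congr
      fun d => by rw [Data.toList_ofList])
    (DPoly.range he)).congr fun d => by
      rw [Data.toList_range, List.mapM_map]
      rfl

open Data (fst_pair snd_pair erase_toQ toList_ofList length_toList_unary)

/-! ### The reduction -/

namespace Sim

abbrev tt : Data := pair nil nil

/-- The constants of the reduction: the security parameter, the position of the outer instance, the
number of columns, the message length, the bound, and the table of the keys. -/
def constData (lam i k w ell q tab : Data) : Data :=
  pair lam (pair i (pair k (pair w (pair ell (pair q tab)))))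

def lamOf (c : Data) : Data := c.fst
def rowOf (c : Data) : Data := c.snd.fst
def colOf (c : Data) : Data := c.snd.snd.fst
def widthOf (c : Data) : Data := c.snd.snd.snd.fst
def ellOf (c : Data) : Data := c.snd.snd.snd.snd.fst
def boundOf (c : Data) : Data := c.snd.snd.snd.snd.snd.fst
def tabOf (c : Data) : Data := c.snd.snd.snd.snd.snd.snd

/-- The variables of the reduction: whether the public key has been sent, the target, the attribute
of the challenge query, the keys, and the attributes of the verified keys. -/
def varData (started target chal keys log : Data) : Data :=
  pair started (pair target (pair chal (pair keys log)))

def startedOf (u : Data) : Data := u.fst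
def targetOf (u : Data) : Data := u.snd.fst
def chalOf (u : Data) : Data := u.snd.snd.fst
def keysOf (u : Data) : Data := u.snd.snd.snd.fst
def logOf (u : Data) : Data := u.snd.snd.snd.snd

/-- The first part of a simulated oracle call: whether to call the outer oracle, the message for it
or the answer, and information for the second part. -/
def reply (ctl : Data) (q : QData) (info : Data) (qu : QData) : QData :=
  QData.pair ctl.toQ (QData.pair q (QData.pair tt.toQ (QData.pair info.toQ qu)))

/-! ### Simulated key generation -/

section KeyGeneration

variable (P : ABESKLPrograms)

/-- Here `c` consists of the constants and the attribute. Cells of the table are pairs of a public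
key and a master secret key, hence the second component. -/
def kgArg (c row j : Data) : Data :=
  pair (lamOf c.fst) (pair (row.toList.getD j.toList.length nil).snd c.snd)

def columns (c : Data) : Data := Data.range (widthOf c).toList.length

/-- A key for one row of the table, with a record of the instance and the verification key. -/
def kgRow (c row : Data) : QM QData :=
  (StateT.lift (uniformList (columns c.fst).toList) : QM Data) >>= fun j =>
    P.kg.kernel (kgArg c row j).toQ >>= fun r =>
      pure (QData.pair (pair j r.snd.erase).toQ (QData.pair j.toQ r.fst))

/-- The state is a pair of lists, both growing at the front: the classical records and the pieces of
the key. With `t` a piece is stored as a frame, tagged `nil`, that will put it to the left of the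
outer answer. -/
def kgStep (t : Bool) (c row : Data) (st : QData) : QM QData :=
  kgRow P c row >>= fun r => pure (QData.pair (QData.pair r.fst st.fst)
    (QData.pair (if t then QData.pair QData.nil r.snd else r.snd) st.snd))

/-- The list of frames starts with one that puts `nil` to the right. As later frames are put in
front, this one is applied last and gives the answer the form `(usk, nil)` of the key oracle. -/
def kgPrefix (c : Data) : QM QData :=
  ((tabOf c.fst).toList.take (rowOf c.fst).toList.length).foldlM (fun st row => kgStep P true c row st)
    (pair nil (pair (pair tt nil) nil)).toQ

def kgSuffix (c : Data) : QM QData :=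
  ((tabOf c.fst).toList.drop ((rowOf c.fst).toList.length + 1)).foldlM
    (fun st row => kgStep P false c row st) tt.toQ

/-- Before the call of the outer key generation oracle: the rows above the outer instance. -/
def kgBefore (e : Data) : QM QData :=
  kgPrefix P (pair e.snd.fst e.fst) >>= fun st =>
    (StateT.lift (uniformList (columns e.snd.fst).toList) : QM Data) >>= fun j =>
      if j = colOf e.snd.fst then
        pure (reply tt e.fst.toQ (pair e (pair st.fst.erase (pair j nil))) st.snd)
      else
        P.kg.kernel (kgArg (pair e.snd.fst e.fst) ((tabOf e.snd.fst).toList.getD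
          (rowOf e.snd.fst).toList.length nil) j).toQ >>= fun r =>
        pure (reply nil (QData.pair r.fst QData.nil)
          (pair e (pair st.fst.erase (pair j r.snd.erase))) st.snd)

def kgEntry (y recs rec recs' : Data) : Data :=
  pair y (ofList (recs.toList.reverse ++ rec :: recs'.toList.reverse))

def addKey (s entry : Data) : Data :=
  pair s.fst (varData (startedOf s.snd) (targetOf s.snd) (chalOf s.snd)
    (pair entry (keysOf s.snd)) (logOf s.snd))

/-- After the call: the rows below the outer instance. -/
def kgAfter (e' : Data) (qu : QData) : QM QData :=
  kgSuffix P (pair e'.snd.fst.snd.fst e'.snd.fst.fst) >>= fun st =>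
    pure (QData.pair (addKey e'.snd.fst.snd (kgEntry e'.snd.fst.fst e'.snd.snd.fst e'.snd.snd.snd
        st.fst.erase)).toQ
      (QData.pair (pair (pair nil tt) nil).toQ
        (QData.pair (pair nil e'.snd.snd.snd.fst).toQ
          (QData.pair (QData.pair tt.toQ (QData.ofList st.snd.toList.reverse)) qu))))

variable {P} (hP : P.kg.IsQPT)

theorem kgArg_poly {c row j : Data → Data} (hc : DPoly c) (hr : DPoly row) (hj : DPoly j) :
    DPoly fun d => kgArg (c d) (row d) (j d) :=
  hc.fst.fst.pair ((DPoly.get hj hr).snd.pair hc.snd)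

theorem columns_poly {c : Data → Data} (hc : DPoly c) : DPoly fun d => columns (c d) :=
  DPoly.range hc.snd.snd.snd.fst

include hP in
theorem kgRow_poly : EPoly fun e q => kgRow P e.fst e.snd >>= fun r => pure (QData.pair r q) := by
  refine (EPoly.sample (R := fun e => uniformList (columns e.fst.fst).toList)
    (RPoly.choose (columns_poly DPoly.id.fst.fst))
    ((EPoly.call (QPoly.of_isQPT hP) (f := fun d => kgArg d.fst.fst d.fst.snd d.snd)
      (kgArg_poly DPoly.id.fst.fst DPoly.id.fst.snd DPoly.id.snd)).bind
      (EPoly.env (f := fun d => d)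
        ((EPoly.onFst (EPoly.of_qpoly QPoly.fst)).bind
          ((EPoly.onFst (EPoly.push DPoly.id.fst.snd)).bind
            (EPoly.onFst (EPoly.push (DPoly.id.fst.snd.pair DPoly.id.snd.fst.snd)))))
        DPoly.id))).congr fun e q => ?_
  simp only [kgRow, bind_assoc, pure_bind, QData.fst_pair, QData.snd_pair, fst_pair,
    snd_pair, QData.erase_pair, QData.erase_snd]

include hP in
theorem kgStep_poly (t : Bool) : EPoly fun e q => kgStep P t e.fst e.snd q := by
  have h1 : EPoly fun _ q => pure (if t then QData.pair QData.nil q else q) := by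
    cases t
    · exact EPoly.of_qpoly QPoly.id
    · exact EPoly.push (DPoly.const nil)
  refine ((kgRow_poly hP).bind ((EPoly.of_qpoly QPoly.assocR).bind ((EPoly.onSnd
    ((EPoly.onFst h1).bind (EPoly.of_qpoly QPoly.exch))).bind
      (EPoly.of_qpoly QPoly.assocL)))).congr fun e q => ?_
  simp only [kgStep, bind_assoc, pure_bind, QData.fst_pair, QData.snd_pair]

theorem size_fst_add_snd_le (d : QData) : d.fst.size + d.snd.size ≤ d.size := by
  cases d <;> simp [QData.size, QData.fst, QData.snd]

include hP in
-- Making one row of a key ignores the accumulator, so its size can be bounded with an empty one.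
-- The growth therefore depends on the context only.
theorem kgStep_size (t : Bool) : ∃ g : Polynomial ℕ, ∀ (e : Data) s m, ∀ r ∈ (kgStep P t e.fst e.snd s m).support,
    r.1.size ≤ s.size + g.eval e.size := by
  obtain ⟨p, hp⟩ := EPoly.size_le (kgRow_poly hP)
  refine ⟨p + 4, fun e s m r hr => ?_⟩
  rw [kgStep, QM.bind_apply, PMF.mem_support_bind_iff] at hr
  obtain ⟨⟨a, m'⟩, ha, hr⟩ := hr
  rw [QM.pure_apply, PMF.support_pure, Set.mem_singleton_iff] at hr
  have h1 := hp e QData.nil m (QData.pair a QData.nil, m') (by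
    rw [QM.bind_apply, PMF.mem_support_bind_iff]
    exact ⟨_, ha, by rw [QM.pure_apply, PMF.support_pure]; rfl⟩)
  have h2 := size_fst_add_snd_le a
  have h3 := size_fst_add_snd_le s
  simp only [QData.size, add_zero] at h1
  have h4 : (if t then QData.pair QData.nil a.snd else a.snd).size ≤ a.snd.size + 1 := by
    cases t <;> simp [QData.size]
  rw [hr]
  simp only [QData.size, Polynomial.eval_add, Polynomial.eval_ofNat]
  omega

include hP in
theorem kgPrefix_poly : EPoly fun e _ => kgPrefix P e := by
  obtain ⟨g, hg⟩ := kgStep_size hP true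
  refine ((EPoly.pure (DPoly.const (pair nil (pair (pair tt nil) nil)))).bind
    (EPoly.fold (kgStep_poly hP true) g hg (DPoly.take (n := fun d => rowOf d.fst)
    (l := fun d => tabOf d.fst) DPoly.id.fst.snd.fst DPoly.id.fst.snd.snd.snd.snd.snd.snd))).congr
    fun e q => ?_
  simp only [pure_bind, toList_ofList, kgPrefix, fst_pair, snd_pair]

include hP in
theorem kgSuffix_poly : EPoly fun e q => kgSuffix P e >>= fun r => pure (QData.pair r q) := by
  obtain ⟨g, hg⟩ := kgStep_size hP false
  refine ((EPoly.push (DPoly.const tt)).bind (EPoly.onFst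
    (EPoly.fold (kgStep_poly hP false) g hg (DPoly.drop (n := fun d => pair nil (rowOf d.fst))
    (l := fun d => tabOf d.fst) ((DPoly.const nil).pair DPoly.id.fst.snd.fst)
    DPoly.id.fst.snd.snd.snd.snd.snd.snd)))).congr
    fun e q => ?_
  simp only [pure_bind, toList_ofList, kgSuffix, fst_pair, snd_pair, QData.fst_pair,
    QData.snd_pair]
  rfl

include hP in
theorem kgBefore_poly : EPoly fun e _ => kgBefore P e := by
  have h1 : EPoly fun e _ => kgPrefix P (pair e.snd.fst e.fst) :=
    EPoly.comp (kgPrefix_poly hP) (f := fun e => pair e.snd.fst e.fst)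
      (DPoly.id.snd.fst.pair DPoly.id.fst)
  have hrow : ∀ {s : Data → Data}, DPoly s → DPoly fun d => (tabOf (s d)).toList.getD
      (rowOf (s d)).toList.length nil := fun hs =>
    DPoly.get hs.snd.fst hs.snd.snd.snd.snd.snd.snd
  have hA : EPoly fun E st => pure (reply tt E.fst.fst.fst.toQ (pair E.fst.fst
      (pair E.snd.fst (pair E.fst.snd nil))) st.snd) :=
    ((EPoly.of_qpoly QPoly.snd).bind ((EPoly.push (DPoly.id.fst.fst.pair (DPoly.id.snd.fst.pair
      (DPoly.id.fst.snd.pair (DPoly.const nil))))).bind ((EPoly.push (DPoly.const tt)).bind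
      ((EPoly.push DPoly.id.fst.fst.fst).bind (EPoly.push (DPoly.const tt)))))).congr fun E st => by
    simp only [pure_bind, reply]
  have hB : EPoly fun E st => P.kg.kernel (kgArg (pair E.fst.fst.snd.fst E.fst.fst.fst)
      ((tabOf E.fst.fst.snd.fst).toList.getD (rowOf E.fst.fst.snd.fst).toList.length nil)
        E.fst.snd).toQ >>= fun r => pure (reply nil (QData.pair r.fst QData.nil)
          (pair E.fst.fst (pair E.snd.fst (pair E.fst.snd r.snd.erase))) st.snd) :=
    ((EPoly.of_qpoly QPoly.snd).bind ((EPoly.call (QPoly.of_isQPT hP)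
      (f := fun E => kgArg (pair E.fst.fst.snd.fst E.fst.fst.fst)
      ((tabOf E.fst.fst.snd.fst).toList.getD (rowOf E.fst.fst.snd.fst).toList.length nil)
        E.fst.snd) (kgArg_poly (DPoly.id.fst.fst.snd.fst.pair DPoly.id.fst.fst.fst)
          (hrow DPoly.id.fst.fst.snd.fst) DPoly.id.fst.snd)).bind
      (EPoly.env (f := fun d => d) ((EPoly.onFst (EPoly.of_qpoly QPoly.fst)).bind
        ((EPoly.onSnd (EPoly.push (DPoly.id.fst.fst.fst.pair (DPoly.id.fst.snd.fst.pair
          (DPoly.id.fst.fst.snd.pair DPoly.id.snd.fst.snd))))).bind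
        ((EPoly.onSnd (EPoly.push (DPoly.const tt))).bind
        ((EPoly.onFst ((EPoly.push (DPoly.const nil)).bind (EPoly.of_qpoly QPoly.swap))).bind
        (EPoly.push (DPoly.const nil)))))) DPoly.id))).congr fun E st => by
    simp only [bind_assoc, pure_bind, reply, QData.fst_pair, QData.snd_pair, fst_pair,
      snd_pair, QData.erase_pair, QData.erase_snd]
    rfl
  refine (h1.bind (EPoly.sample (R := fun e => uniformList (columns e.snd.fst).toList)
    (RPoly.choose (columns_poly DPoly.id.snd.fst)) (EPoly.env (f := fun d => d)
      (EPoly.ite' (BPoly.eq DPoly.id.fst.snd (f := fun d => d.fst.snd)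
        (g := fun d => colOf d.fst.fst.snd.fst) DPoly.id.fst.fst.snd.fst.snd.snd.fst) hA hB)
      DPoly.id))).congr fun e q => ?_
  simp only [kgBefore, fst_pair, snd_pair, QData.erase_fst]
  congr!

include hP in
theorem kgAfter_poly : EPoly (kgAfter P) := by
  refine ((EPoly.comp (kgSuffix_poly hP) (f := fun e' => pair e'.snd.fst.snd.fst e'.snd.fst.fst)
      (DPoly.id.snd.fst.snd.fst.pair DPoly.id.snd.fst.fst)).bind
    (EPoly.env (f := fun d => d) ((EPoly.onFst (EPoly.of_qpoly (QPoly.snd.bind QPoly.reverse))).bind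
      ((EPoly.onFst (EPoly.push (DPoly.const tt))).bind
      ((EPoly.push ((DPoly.const nil).pair DPoly.id.fst.snd.snd.snd.fst)).bind
      ((EPoly.push (DPoly.const (pair (pair nil tt) nil))).bind
      (EPoly.push (f := fun d => addKey d.fst.snd.fst.snd (kgEntry d.fst.snd.fst.fst d.fst.snd.snd.fst
        d.fst.snd.snd.snd d.snd.fst.fst)) ?_))))) DPoly.id)).congr fun e' qu => ?_
  · have hs : DPoly fun d => d.fst.snd.fst.snd := DPoly.id.fst.snd.fst.snd
    have he : DPoly fun d => kgEntry d.fst.snd.fst.fst d.fst.snd.snd.fst d.fst.snd.snd.snd d.snd.fst.fst :=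
      DPoly.id.fst.snd.fst.fst.pair ((DPoly.append (DPoly.reverse DPoly.id.fst.snd.snd.fst)
        (DPoly.id.fst.snd.snd.snd.pair (DPoly.reverse DPoly.id.snd.fst.fst))).congr fun d => by
          simp [Data.toList])
    exact hs.fst.pair (hs.snd.fst.pair (hs.snd.snd.fst.pair (hs.snd.snd.snd.fst.pair
      ((he.pair hs.snd.snd.snd.snd.fst).pair hs.snd.snd.snd.snd.snd))))
  · simp only [kgAfter, bind_assoc, pure_bind, QData.fst_pair, QData.snd_pair, fst_pair,
      snd_pair, QData.erase_pair, QData.erase_fst, Data.toQ_pair]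

end KeyGeneration

/-! ### Simulated verification -/

section Verification

variable (P : ABESKLPrograms)

def entryOf (e : Data) : Data :=
  ((keysOf e.snd.snd).toList.find? fun a => decide (a.fst = e.fst.fst)).elim nil
    fun a => pair a nil

def recordsOf (e : Data) : Data := (entryOf e).fst.snd

/-- The state holds the verdict so far and the pieces not yet consumed. Verification goes on after a
rejection, as in the scheme, since every call acts on the quantum memory. -/
def vrfyStep (e rec : Data) (st : QData) : QM QData :=
  P.vrfy.kernel (QData.pair (lamOf e.snd.fst).toQ (QData.pair rec.snd.toQ st.snd.fst.snd)) >>= fun r =>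
    pure (QData.pair (ofBool (decide (st.fst.erase ≠ nil ∧ r.erase ≠ nil))).toQ st.snd.snd)

/-- Before the call of the outer verification oracle: the rows above the outer instance. -/
def vrfyBefore (e : Data) (q : QData) : QM QData :=
  ((recordsOf e).toList.take (rowOf e.snd.fst).toList.length).foldlM (fun st rec => vrfyStep P e rec st)
    (QData.pair tt.toQ q.snd) >>= fun st =>
  if ((recordsOf e).toList.getD (rowOf e.snd.fst).toList.length nil).fst = colOf e.snd.fst then
    pure (reply tt (QData.pair e.fst.fst.toQ st.snd.fst.snd) (pair e st.fst.erase) st.snd.snd)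
  else
    P.vrfy.kernel (QData.pair (lamOf e.snd.fst).toQ (QData.pair ((recordsOf e).toList.getD
      (rowOf e.snd.fst).toList.length nil).snd.toQ st.snd.fst.snd)) >>= fun r =>
    pure (reply nil r (pair e st.fst.erase) st.snd.snd)

/-- The log keeps the attributes whose key was accepted at least once; it is needed to decide at the
challenge whether all related keys have been returned. -/
def addLog (s y flag : Data) : Data :=
  pair s.fst (varData (startedOf s.snd) (targetOf s.snd) (chalOf s.snd) (keysOf s.snd)
    (if flag = nil then logOf s.snd else pair y (logOf s.snd)))

/-- After the call: the rows below the outer instance. -/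
def vrfyAfter (e' : Data) (qu : QData) : QM QData :=
  ((recordsOf e'.snd.fst).toList.drop ((rowOf e'.snd.fst.snd.fst).toList.length + 1)).foldlM
    (fun st rec => vrfyStep P e'.snd.fst rec st)
    (QData.pair (ofBool (decide (e'.snd.snd ≠ nil ∧ e'.fst ≠ nil))).toQ qu) >>= fun st =>
  pure (QData.pair (addLog e'.snd.fst.snd e'.snd.fst.fst.fst st.fst.erase).toQ
    (pair (pair (pair tt nil) st.fst.erase) nil).toQ)

variable {P} (hP : P.vrfy.IsQPT)

theorem entryOf_poly : DPoly entryOf :=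
  DPoly.find (c := fun e a => a.fst = e.fst.fst) (l := fun e => keysOf e.snd.snd)
    (BPoly.eq DPoly.id.snd.fst DPoly.id.fst.fst.fst) DPoly.id.snd.snd.snd.snd.snd.fst

theorem recordsOf_poly : DPoly recordsOf := entryOf_poly.fst.snd

include hP in
theorem vrfyStep_poly : EPoly fun E st => vrfyStep P E.fst E.snd st := by
  refine ((EPoly.onSnd ((EPoly.onFst (EPoly.of_qpoly QPoly.snd)).bind
    ((EPoly.onFst (EPoly.push DPoly.id.snd.snd)).bind
    ((EPoly.onFst (EPoly.push (f := fun E => lamOf E.fst.snd.fst) DPoly.id.fst.snd.fst.fst)).bind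
    (EPoly.onFst (EPoly.of_qpoly (QPoly.of_isQPT hP))))))).bind
    (EPoly.env (f := fun d => d) ((EPoly.of_qpoly (QPoly.snd.bind QPoly.snd)).bind
      (EPoly.push (f := fun d => ofBool (decide (d.snd.fst ≠ nil ∧ d.snd.snd.fst ≠ nil)))
        (DPoly.congr (BPoly.and (BPoly.ne_nil DPoly.id.snd.fst) (BPoly.ne_nil DPoly.id.snd.snd.fst)).dpoly
          fun _ => by congr))) DPoly.id)).congr fun E st => ?_
  simp only [vrfyStep, bind_assoc, pure_bind, QData.fst_pair, QData.snd_pair, fst_pair,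
      snd_pair, QData.erase_pair, QData.erase_fst]

theorem vrfyStep_size (E : Data) (s : QData) (m : QState) :
    ∀ r ∈ (vrfyStep P E.fst E.snd s m).support, r.1.size ≤ s.size + (2 : Polynomial ℕ).eval E.size := by
  intro r hr
  rw [vrfyStep, QM.bind_apply, PMF.mem_support_bind_iff] at hr
  obtain ⟨⟨a, m'⟩, ha, hr⟩ := hr
  rw [QM.pure_apply, PMF.support_pure, Set.mem_singleton_iff] at hr
  have h2 := s.size_snd_le
  have h3 := s.snd.size_snd_le
  have h4 : ∀ b : Bool, (ofBool b).toQ.size ≤ 1 := by decide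
  have h5 := h4 (decide (s.fst.erase ≠ nil ∧ a.erase ≠ nil))
  rw [hr]
  simp only [QData.size, Polynomial.eval_ofNat]
  omega

include hP in
theorem vrfyBefore_poly : EPoly (vrfyBefore P) := by
  have hrec : ∀ {s : Data → Data}, DPoly s → DPoly fun d => (recordsOf (s d)).toList.getD
      (rowOf (s d).snd.fst).toList.length nil := fun hs =>
    DPoly.get hs.snd.fst.snd.fst (recordsOf_poly.comp hs)
  have hA : EPoly fun E st => pure (reply tt (QData.pair E.fst.fst.fst.toQ st.snd.fst.snd)
      (pair E.fst E.snd.fst) st.snd.snd) :=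
    ((EPoly.of_qpoly QPoly.snd).bind ((EPoly.onFst ((EPoly.of_qpoly QPoly.snd).bind
      (EPoly.push DPoly.id.fst.fst.fst))).bind ((EPoly.onSnd ((EPoly.push
        (DPoly.id.fst.pair DPoly.id.snd.fst)).bind (EPoly.push (DPoly.const tt)))).bind
        (EPoly.push (DPoly.const tt))))).congr fun E st => by
    simp only [pure_bind, reply, QData.fst_pair, QData.snd_pair]
  have hB : EPoly fun E st => P.vrfy.kernel (QData.pair (lamOf E.fst.snd.fst).toQ
      (QData.pair ((recordsOf E.fst).toList.getD
      (rowOf E.fst.snd.fst).toList.length nil).snd.toQ st.snd.fst.snd)) >>= fun r =>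
    pure (reply nil r (pair E.fst E.snd.fst) st.snd.snd) :=
    ((EPoly.of_qpoly QPoly.snd).bind ((EPoly.onFst ((EPoly.of_qpoly QPoly.snd).bind
      ((EPoly.push (hrec DPoly.id.fst).snd).bind ((EPoly.push (f := fun E => lamOf E.fst.snd.fst)
        DPoly.id.fst.snd.fst.fst).bind
      (EPoly.of_qpoly (QPoly.of_isQPT hP)))))).bind ((EPoly.onSnd ((EPoly.push
        (DPoly.id.fst.pair DPoly.id.snd.fst)).bind (EPoly.push (DPoly.const tt)))).bind
        (EPoly.push (DPoly.const nil))))).congr fun E st => by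
    simp only [bind_assoc, pure_bind, reply, QData.fst_pair, QData.snd_pair]
  refine (((EPoly.of_qpoly QPoly.snd).bind (EPoly.push (DPoly.const tt))).bind
    ((EPoly.fold (vrfyStep_poly hP) 2 vrfyStep_size (DPoly.take (n := fun e => rowOf e.snd.fst)
      DPoly.id.snd.fst.snd.fst recordsOf_poly)).bind (EPoly.env (f := fun d => d)
      (EPoly.ite' (BPoly.eq (hrec DPoly.id.fst).fst (g := fun d => colOf d.fst.snd.fst)
        DPoly.id.fst.snd.fst.snd.snd.fst) hA hB) DPoly.id))).congr fun e q => ?_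
  simp only [vrfyBefore, pure_bind, fst_pair, snd_pair, QData.erase_fst,
    toList_ofList]
  congr!

include hP in
theorem vrfyAfter_poly : EPoly (vrfyAfter P) := by
  have hs : DPoly fun d => d.fst.snd.fst.snd := DPoly.id.fst.snd.fst.snd
  have hflag : DPoly fun d => ofBool (decide (d.snd.snd ≠ nil ∧ d.fst ≠ nil)) :=
    DPoly.congr (BPoly.and (BPoly.ne_nil DPoly.id.snd.snd) (BPoly.ne_nil DPoly.id.fst)).dpoly
      fun _ => by congr
  have h1 : EPoly fun e' st => vrfyStep P e'.fst.snd.fst e'.snd st :=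
    (EPoly.comp (vrfyStep_poly hP) (f := fun d => pair d.fst.snd.fst d.snd)
      (DPoly.id.fst.snd.fst.pair DPoly.id.snd)).congr fun e q => by
        simp only [fst_pair, snd_pair]
  have h2 : EPoly fun e' st => pure (QData.pair (addLog e'.snd.fst.snd e'.snd.fst.fst.fst st.fst.erase).toQ
      (pair (pair (pair tt nil) st.fst.erase) nil).toQ) :=
    (EPoly.env (f := fun d => d) (EPoly.pure (f := fun d => pair
      (addLog d.fst.snd.fst.snd d.fst.snd.fst.fst.fst d.snd.fst)
      (pair (pair (pair tt nil) d.snd.fst) nil))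
      ((hs.fst.pair (hs.snd.fst.pair (hs.snd.snd.fst.pair (hs.snd.snd.snd.fst.pair
        (hs.snd.snd.snd.snd.fst.pair (DPoly.ite (BPoly.eq DPoly.id.snd.fst (DPoly.const _))
          hs.snd.snd.snd.snd.snd (DPoly.id.fst.snd.fst.fst.fst.pair hs.snd.snd.snd.snd.snd))))))).pair
      (((DPoly.const (pair tt nil)).pair DPoly.id.snd.fst).pair (DPoly.const nil))))
      DPoly.id).congr fun e' st => by
        simp only [fst_pair, snd_pair, QData.erase_fst, Data.toQ_pair]
  refine ((EPoly.push hflag).bind ((EPoly.fold h1 2 (fun e s m => ?_) (DPoly.drop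
    (n := fun e' => pair nil (rowOf e'.snd.fst.snd.fst))
    ((DPoly.const nil).pair DPoly.id.snd.fst.snd.fst.snd.fst)
    (recordsOf_poly.comp DPoly.id.snd.fst))).bind h2)).congr fun e' qu => ?_
  · have := vrfyStep_size (P := P) (pair e.fst.snd.fst e.snd) s m
    simpa using this
  · simp only [vrfyAfter, pure_bind, fst_pair, snd_pair, toList_ofList]
    rfl

end Verification

/-! ### Simulated start of the experiment -/

section Start

variable (sel : Bool)

/-- The public keys in the table. -/
def publicKeys (c : Data) : Data :=
  ofList ((tabOf c).toList.map fun row => ofList (row.toList.map Data.fst))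

def setStarted (s msg : Data) : Data :=
  pair s.fst (varData tt (if sel then pair msg nil else nil) (chalOf s.snd)
    (keysOf s.snd) (logOf s.snd))

/-- The outer public key arrives only as the answer of the call, so the frames insert it into the
table of the public keys sampled by the reduction. -/
def startAfter (e' : Data) : Data :=
  pair (setStarted sel e'.snd.snd e'.snd.fst) (ofList (tableFrames
    (rowOf e'.snd.snd.fst).toList.length (colOf e'.snd.snd.fst).toList.length
    (publicKeys e'.snd.snd.fst).toList))

theorem startAfter_poly : DPoly (startAfter sel) := by
  have hs : DPoly fun d => d.snd.snd := DPoly.id.snd.snd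
  have h1 : DPoly fun d => if sel then pair d.snd.fst nil else nil := by
    cases sel
    · exact DPoly.const _
    · exact DPoly.id.snd.fst.pair (DPoly.const _)
  exact (hs.fst.pair ((DPoly.const tt).pair (h1.pair (hs.snd.snd.snd.fst.pair
    (hs.snd.snd.snd.snd.fst.pair hs.snd.snd.snd.snd.snd))))).pair (DPoly.tableFrames hs.fst.snd.fst
      hs.fst.snd.snd.fst (DPoly.map (f := fun _ row => ofList (row.toList.map Data.fst))
      (DPoly.map (f := fun _ x => x.fst) (l := fun d => d.snd) DPoly.id.snd.fst DPoly.id.snd)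
      hs.fst.snd.snd.snd.snd.snd.snd))

end Start

/-! ### Simulated challenge query -/

section Challenge

variable (P : ABESKLPrograms) (RR : Data → PMF Data)

/-- The attribute of a challenge query. -/
def attrOf (u x : Data) : Data := if targetOf u = nil then x else (targetOf u).fst

/-- The verdict of `RR` is attached to every entry before filtering, because the decision algorithm
is formally randomized. -/
def relatedOf (e : Data) : PMF Data :=
  ((keysOf e.snd.snd).toList.mapM fun a => (RR (pair (lamOf e.snd.fst)
    (pair (attrOf e.snd.snd e.fst.fst) a.fst))).map fun b => pair b a).map fun L =>
      ofList ((L.filter fun a => decide (a.fst ≠ nil)).map Data.snd)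

/-- The instances in row `r`. -/
def instancesOf (dist : List Data) (r : ℕ) : List Data :=
  dist.map fun a => (a.snd.toList.getD r nil).fst

/-- Everything the hybrid game requires except membership of the attribute in `X`, which need not be
decidable and is left to the outer challenger. The last two conditions say that the guessed row is
the first one without collisions. -/
def Checks (e dist : Data) : Prop :=
  (IsMsg (ellOf e.snd.fst).toList.length e.fst.snd.fst ∧
    IsMsg (ellOf e.snd.fst).toList.length e.fst.snd.snd) ∧
  (¬ (boundOf e.snd.fst).toList.length < dist.toList.length ∧
    ∀ a ∈ dist.toList, a.fst ∈ (logOf e.snd.snd).toList) ∧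
  (instancesOf dist.toList (rowOf e.snd.fst).toList.length).Nodup ∧
    ∀ r ∈ (Data.range (rowOf e.snd.fst).toList.length).toList,
      ¬ (instancesOf dist.toList r.toList.length).Nodup

/-- A share that hides the message `m`. -/
def hiddenMsg (e μ m : Data) : Data :=
  xorData (ellOf e.snd.fst).toList.length
    (μ.toList.getD (rowOf e.snd.fst).toList.length nil :: m :: μ.toList)

/-- In the guessed row, columns to the left of the outer instance already belong to the second
message, the others to the first. A value is computed for the outer cell as well, but that cell is
overwritten later. -/
def shareOf (e μ r j : Data) : Data :=
  if r = rowOf e.snd.fst then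
    if j.toList.length < (colOf e.snd.fst).toList.length then hiddenMsg e μ e.fst.snd.snd
    else hiddenMsg e μ e.fst.snd.fst
  else μ.toList.getD r.toList.length nil

def encArg (e μ r j : Data) : Data :=
  pair (lamOf e.snd.fst) (pair (((tabOf e.snd.fst).toList.getD r.toList.length
    nil).toList.getD j.toList.length nil).fst
      (pair (attrOf e.snd.snd e.fst.fst) (shareOf e μ r j)))

def rowsOf (c : Data) : Data := Data.range (tabOf c).toList.length

def randomShares (e : Data) : PMF Data :=
  ((rowsOf e.snd.fst).toList.mapM fun _ => randomMsg (ellOf e.snd.fst).toList.length).map ofList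

def encTable (e μ : Data) : PMF Data :=
  ((rowsOf e.snd.fst).toList.mapM fun r => ((columns e.snd.fst).toList.mapM fun j =>
    P.enc.result (encArg e μ r j)).map ofList).map ofList

/-- The message for the outer challenger, and the table of ciphertexts. -/
def encData (e : Data) : PMF Data :=
  (randomShares e).bind fun μ => (encTable P e μ).map fun ct =>
    pair (pair e.fst.fst (pair (hiddenMsg e μ e.fst.snd.fst)
      (hiddenMsg e μ e.fst.snd.snd))) ct

/-- A challenge query that is not well-formed. -/
def badQuery : Data :=
  pair nil (pair (pair (pair tt tt) nil) nil)

/-- When the checks fail, an ill-formed query makes the outer experiment stop with output 0, exactly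
as the hybrid game does. -/
def challengeData (e : Data) : PMF Data :=
  (relatedOf RR e).bind fun dist =>
    if Checks e dist then encData P e else PMF.pure (pair badQuery nil)

def challengeBefore (e : Data) : QM QData :=
  (StateT.lift (challengeData P RR e) : QM Data) >>= fun d =>
    pure (reply tt d.fst.toQ (pair e d.snd) QData.nil)

def setChal (s x : Data) : Data :=
  pair s.fst (varData (startedOf s.snd) (targetOf s.snd) (pair x nil)
    (keysOf s.snd) (logOf s.snd))

def challengeAfter (e' : Data) : Data :=
  pair (setChal e'.snd.fst.snd e'.snd.fst.fst.fst) (ofList (tableFrames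
    (rowOf e'.snd.fst.snd.fst).toList.length (colOf e'.snd.fst.snd.fst).toList.length
    e'.snd.snd.toList))

variable {P RR}

theorem attrOf_poly {u x : Data → Data} (hu : DPoly u) (hx : DPoly x) :
    DPoly fun d => attrOf (u d) (x d) :=
  DPoly.ite (BPoly.eq hu.snd.fst (DPoly.const _)) hx hu.snd.fst.fst

theorem relatedOf_poly (hRR : RPoly RR) : RPoly (relatedOf RR) := by
  have h1 : RPoly fun p => (RR (pair (lamOf p.fst.snd.fst)
      (pair (attrOf p.fst.snd.snd p.fst.fst.fst) p.snd.fst))).map fun b => pair b p.snd :=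
    RPoly.bind₂ (G := fun p b => PMF.pure (pair b p.snd)) (hRR.comp (f := fun p =>
      pair (lamOf p.fst.snd.fst) (pair (attrOf p.fst.snd.snd p.fst.fst.fst) p.snd.fst))
      (DPoly.id.fst.snd.fst.fst.pair ((attrOf_poly DPoly.id.fst.snd.snd DPoly.id.fst.fst.fst).pair
        DPoly.id.snd.fst))) (DPoly.id.snd.pair DPoly.id.fst.snd)
  have h2 : DPoly fun L => ofList ((L.toList.filter fun a => decide (a.fst ≠ nil)).map Data.snd) :=
    (DPoly.map (f := fun _ a => a.snd) DPoly.id.snd.snd (DPoly.filter (c := fun _ a => a.fst ≠ nil)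
      (BPoly.ne_nil DPoly.id.snd.fst) DPoly.id)).congr fun L => by
        rw [toList_ofList]
        congr!
  exact (RPoly.bind (RPoly.mapM (F := fun e a => (RR (pair (lamOf e.snd.fst)
      (pair (attrOf e.snd.snd e.fst.fst) a.fst))).map fun b => pair b a)
      (l := fun e => keysOf e.snd.snd) h1 DPoly.id.snd.snd.snd.snd.snd.fst) h2.rpoly).congr fun e => by
    rw [PMF.bind_map, relatedOf]
    simp only [Function.comp_def, toList_ofList]
    rfl

theorem instancesOf_poly {dist r : Data → Data} (hd : DPoly dist) (hr : DPoly r) :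
    DPoly fun d => ofList (instancesOf (dist d).toList (r d).toList.length) :=
  DPoly.map (f := fun d a => (a.snd.toList.getD (r d).toList.length nil).fst)
    (DPoly.get (hr.comp DPoly.id.fst) DPoly.id.snd.snd).fst hd

theorem Checks_poly : BPoly fun p => Checks p.fst p.snd := by
  have hell : DPoly fun p => ellOf p.fst.snd.fst := DPoly.id.fst.snd.fst.snd.snd.snd.snd.fst
  refine (BPoly.and (BPoly.isMsg hell DPoly.id.fst.fst.snd.fst) (BPoly.isMsg hell
    DPoly.id.fst.fst.snd.snd)).and ((BPoly.and (BPoly.not (BPoly.lt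
      (f := fun p => boundOf p.fst.snd.fst) DPoly.id.fst.snd.fst.snd.snd.snd.snd.snd.fst DPoly.id.snd))
    (BPoly.all (c := fun p a => a.fst ∈ (logOf p.fst.snd.snd).toList) (BPoly.mem DPoly.id.snd.fst
      DPoly.id.fst.fst.snd.snd.snd.snd.snd.snd) DPoly.id.snd)).and (BPoly.and
    ((BPoly.nodup (instancesOf_poly (r := fun p => rowOf p.fst.snd.fst) DPoly.id.snd
      DPoly.id.fst.snd.fst.snd.fst)).congr fun d => by rw [toList_ofList])
    (BPoly.all (c := fun p r => ¬ (instancesOf p.snd.toList r.toList.length).Nodup)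
      ((BPoly.nodup (instancesOf_poly DPoly.id.fst.snd DPoly.id.snd)).not.congr fun d => by
        rw [toList_ofList]) (DPoly.range (n := fun p => rowOf p.fst.snd.fst)
        DPoly.id.fst.snd.fst.snd.fst))))

theorem hiddenMsg_poly {e μ m : Data → Data} (he : DPoly e) (hμ : DPoly μ) (hm : DPoly m) :
    DPoly fun d => hiddenMsg (e d) (μ d) (m d) :=
  (DPoly.xorData (e := fun d => ellOf (e d).snd.fst) he.snd.fst.snd.snd.snd.snd.fst
    ((DPoly.get (n := fun d => rowOf (e d).snd.fst) he.snd.fst.snd.fst hμ).pair (hm.pair hμ))).congr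
      fun _ => rfl

theorem shareOf_poly {e μ r j : Data → Data} (he : DPoly e) (hμ : DPoly μ) (hr : DPoly r)
    (hj : DPoly j) : DPoly fun d => shareOf (e d) (μ d) (r d) (j d) :=
  DPoly.congr (DPoly.ite (BPoly.eq hr (g := fun d => rowOf (e d).snd.fst) he.snd.fst.snd.fst)
    (DPoly.ite (BPoly.lt hj (g := fun d => colOf (e d).snd.fst) he.snd.fst.snd.snd.fst)
      (hiddenMsg_poly he hμ he.fst.snd.snd) (hiddenMsg_poly he hμ he.fst.snd.fst))
    (DPoly.get hr hμ)) fun d => by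
      simp only [shareOf]
      congr

theorem encArg_poly {e μ r j : Data → Data} (he : DPoly e) (hμ : DPoly μ) (hr : DPoly r)
    (hj : DPoly j) : DPoly fun d => encArg (e d) (μ d) (r d) (j d) :=
  he.snd.fst.fst.pair ((DPoly.get hj (DPoly.get hr
    (l := fun d => tabOf (e d).snd.fst) he.snd.fst.snd.snd.snd.snd.snd.snd)).fst.pair
    ((attrOf_poly he.snd.snd he.fst.fst).pair (shareOf_poly he hμ hr hj)))

theorem rowsOf_poly {c : Data → Data} (hc : DPoly c) : DPoly fun d => rowsOf (c d) :=
  DPoly.range (n := fun d => tabOf (c d)) hc.snd.snd.snd.snd.snd.snd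

theorem challengeData_poly (hP : P.enc.IsPPT) (hRR : RPoly RR) : RPoly (challengeData P RR) := by
  have h1 : RPoly randomShares :=
    RPoly.mapM (F := fun e _ => randomMsg (ellOf e.snd.fst).toList.length)
      (RPoly.randomMsg (e := fun p => ellOf p.fst.snd.fst) DPoly.id.fst.snd.fst.snd.snd.snd.snd.fst)
      (rowsOf_poly DPoly.id.snd.fst)
  have h2 : RPoly fun p => encTable P p.fst p.snd :=
    RPoly.mapM (F := fun p r => ((columns p.fst.snd.fst).toList.mapM fun j =>
        P.enc.result (encArg p.fst p.snd r j)).map ofList) (l := fun p => rowsOf p.fst.snd.fst)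
      (RPoly.mapM (F := fun p j => P.enc.result (encArg p.fst.fst p.fst.snd p.snd j))
        ((RPoly.of_isPPT hP).comp (encArg_poly DPoly.id.fst.fst.fst DPoly.id.fst.fst.snd
          DPoly.id.fst.snd DPoly.id.snd)) (columns_poly DPoly.id.fst.fst.snd.fst))
      (rowsOf_poly DPoly.id.fst.snd.fst)
  have h3 : RPoly (encData P) := h1.bind₂ (G := fun e μ => (encTable P e μ).map fun ct =>
    pair (pair e.fst.fst (pair (hiddenMsg e μ e.fst.snd.fst)
      (hiddenMsg e μ e.fst.snd.snd))) ct) (h2.bind₂ (G := fun p ct => PMF.pure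
        (pair (pair p.fst.fst.fst (pair (hiddenMsg p.fst p.snd p.fst.fst.snd.fst)
      (hiddenMsg p.fst p.snd p.fst.fst.snd.snd))) ct)) ((DPoly.id.fst.fst.fst.fst.pair
        ((hiddenMsg_poly DPoly.id.fst.fst DPoly.id.fst.snd DPoly.id.fst.fst.fst.snd.fst).pair
        (hiddenMsg_poly DPoly.id.fst.fst DPoly.id.fst.snd DPoly.id.fst.fst.fst.snd.snd))).pair
        DPoly.id.snd))
  exact (relatedOf_poly hRR).bind₂ (RPoly.ite Checks_poly (h3.comp DPoly.id.fst) (DPoly.const _).rpoly)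

theorem challengeBefore_poly (hP : P.enc.IsPPT) (hRR : RPoly RR) :
    EPoly fun e _ => challengeBefore P RR e :=
  (EPoly.sample (challengeData_poly hP hRR) ((EPoly.pure (DPoly.const nil)).bind
    ((EPoly.push (DPoly.id.fst.pair DPoly.id.snd.snd)).bind ((EPoly.push (DPoly.const tt)).bind
      ((EPoly.push DPoly.id.snd.fst).bind (EPoly.push (DPoly.const tt))))))).congr fun e q => by
    simp only [challengeBefore, reply, pure_bind, fst_pair, snd_pair]
    rfl

theorem challengeAfter_poly : DPoly challengeAfter := by
  have hs : DPoly fun d => d.snd.fst.snd := DPoly.id.snd.fst.snd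
  exact (hs.fst.pair (hs.snd.fst.pair (hs.snd.snd.fst.pair ((DPoly.id.snd.fst.fst.fst.pair
    (DPoly.const _)).pair (hs.snd.snd.snd.snd.fst.pair hs.snd.snd.snd.snd.snd))))).pair
    (DPoly.tableFrames hs.fst.snd.fst hs.fst.snd.snd.fst DPoly.id.snd.snd)

end Challenge

/-! ### The four simulated oracles put together -/

section Oracle

variable (P : ABESKLPrograms) (RR : Data → PMF Data) (YY : Data → Prop) (sel : Bool)

/-- Whether a call of the simulated oracles is answered. -/
def guard : ℕ → Data → PMF Data
  | 0, e => PMF.pure (ofBool (decide (startedOf e.snd.snd = nil)))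
  | 1, e =>
    if startedOf e.snd.snd ≠ nil ∧ (∀ a ∈ (keysOf e.snd.snd).toList, ¬ a.fst = e.fst) ∧
        YY (pair (lamOf e.snd.fst) e.fst) then
      if chalOf e.snd.snd = nil then PMF.pure tt
      else (RR (pair (lamOf e.snd.fst) (pair (attrOf e.snd.snd (chalOf e.snd.snd).fst)
        e.fst))).map fun b => ofBool (decide (b = nil))
    else PMF.pure nil
  | 2, e => PMF.pure (ofBool (decide (startedOf e.snd.snd ≠ nil ∧ entryOf e ≠ nil)))
  | 3, e => PMF.pure (ofBool (decide (startedOf e.snd.snd ≠ nil ∧ chalOf e.snd.snd = nil)))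
  | _, _ => PMF.pure nil

def before : ℕ → Data → QData → QM QData
  | 0, e, _ => pure (reply tt e.fst.toQ e QData.nil)
  | 1, e, _ => kgBefore P e
  | 2, e, q => vrfyBefore P e q
  | 3, e, _ => challengeBefore P RR e
  | _, _, _ => pure QData.nil

def after : ℕ → Data → QData → QM QData
  | 0, e', _ => pure (startAfter sel e').toQ
  | 1, e', qu => kgAfter P e' qu
  | 2, e', qu => vrfyAfter P e' qu
  | 3, e', _ => pure (challengeAfter e').toQ
  | _, _, _ => pure QData.nil

/-- On refusal there is no outer call, the answer is `nil`, and the untouched state is handed on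
under the flag `nil`. Otherwise the state travels inside the information recorded by `reply`, whose
flag is not `nil`. -/
def pre (k : ℕ) (v : QData) : QM QData :=
  (StateT.lift (guard RR YY k v.erase) : QM Data) >>= fun g =>
    if g = nil then pure (QData.pair QData.nil (QData.pair QData.nil (QData.pair QData.nil v.snd)))
    else before P RR k v.erase v.fst

def post (k : ℕ) (w : QData) : QM QData :=
  if w.erase.snd.fst = nil then pure (QData.pair w.snd.snd QData.nil)
  else after P sel k (pair w.erase.fst w.erase.snd.snd.fst) w.snd.snd.snd

theorem pre_min (k : ℕ) : pre P RR YY k = pre P RR YY (min k 4) := by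
  match k with
  | 0 | 1 | 2 | 3 => rfl
  | k + 4 => rw [min_eq_right (by omega)]; rfl

theorem post_min (k : ℕ) : post P sel k = post P sel (min k 4) := by
  match k with
  | 0 | 1 | 2 | 3 => rfl
  | k + 4 => rw [min_eq_right (by omega)]; rfl

variable {P RR YY}

theorem guard_poly (hRR : RPoly RR) (hYY : BPoly YY) (k : ℕ) : RPoly (guard RR YY k) := by
  match k with
  | 0 => exact (BPoly.eq DPoly.id.snd.snd.fst (DPoly.const _)).dpoly.rpoly
  | 1 =>
    refine RPoly.congr (RPoly.ite ((BPoly.ne_nil DPoly.id.snd.snd.fst).and (BPoly.and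
      (BPoly.all (c := fun e a => ¬ a.fst = e.fst) (BPoly.not (BPoly.eq DPoly.id.snd.fst DPoly.id.fst.fst))
        DPoly.id.snd.snd.snd.snd.snd.fst) (hYY.comp (f := fun e => pair (lamOf e.snd.fst) e.fst)
        (DPoly.id.snd.fst.fst.pair DPoly.id.fst)))) (RPoly.ite
        (BPoly.eq DPoly.id.snd.snd.snd.snd.fst (DPoly.const _)) (DPoly.const tt).rpoly
        (G := fun e => (RR (pair (lamOf e.snd.fst) (pair (attrOf e.snd.snd
          (chalOf e.snd.snd).fst) e.fst))).map fun b => ofBool (decide (b = nil))) ?_)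
      (DPoly.const nil).rpoly) fun e => by simp only [guard]; congr
    exact (RPoly.bind (hRR.comp (f := fun e => pair (lamOf e.snd.fst) (pair
      (attrOf e.snd.snd (chalOf e.snd.snd).fst) e.fst)) (DPoly.id.snd.fst.fst.pair
      ((attrOf_poly DPoly.id.snd.snd DPoly.id.snd.snd.snd.snd.fst.fst).pair DPoly.id.fst)))
      (BPoly.eq DPoly.id (DPoly.const nil)).dpoly.rpoly)
  | 2 =>
    exact ((BPoly.ne_nil DPoly.id.snd.snd.fst).and (BPoly.ne_nil entryOf_poly)).dpoly.rpoly.congr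
      fun _ => by simp only [guard]; congr
  | 3 =>
    exact ((BPoly.ne_nil DPoly.id.snd.snd.fst).and
      (BPoly.eq DPoly.id.snd.snd.snd.snd.fst (DPoly.const _))).dpoly.rpoly.congr
      fun _ => by simp only [guard]; congr
  | k + 4 => exact (DPoly.const nil).rpoly

theorem before_poly (hP : P.Efficient) (hRR : RPoly RR) (k : ℕ) : EPoly (before P RR k) := by
  match k with
  | 0 =>
    exact ((EPoly.pure (DPoly.const nil)).bind ((EPoly.push DPoly.id).bind
      ((EPoly.push (DPoly.const tt)).bind ((EPoly.push DPoly.id.fst).bind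
        (EPoly.push (DPoly.const tt)))))).congr fun e q => by
        simp only [before, reply, pure_bind]
        rfl
  | 1 => exact kgBefore_poly hP.2.1
  | 2 => exact vrfyBefore_poly hP.2.2.2.2
  | 3 => exact challengeBefore_poly hP.2.2.1 hRR
  | k + 4 => exact EPoly.pure (DPoly.const nil)

theorem after_poly (hP : P.Efficient) (k : ℕ) : EPoly (after P sel k) := by
  match k with
  | 0 => exact EPoly.pure (startAfter_poly sel)
  | 1 => exact kgAfter_poly hP.2.1
  | 2 => exact vrfyAfter_poly hP.2.2.2.2
  | 3 => exact EPoly.pure challengeAfter_poly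
  | k + 4 => exact EPoly.pure (DPoly.const nil)

theorem pre_poly (hP : P.Efficient) (hRR : RPoly RR) (hYY : BPoly YY) (k : ℕ) :
    QPoly (pre P RR YY k) := by
  have h1 : EPoly fun E v => if E.snd = nil then
      pure (QData.pair QData.nil (QData.pair QData.nil (QData.pair QData.nil v.snd)))
      else before P RR k E.fst v.fst :=
    EPoly.ite' (BPoly.eq DPoly.id.snd (DPoly.const _))
      (((EPoly.of_qpoly QPoly.snd).bind ((EPoly.push (DPoly.const nil)).bind
        ((EPoly.push (DPoly.const nil)).bind (EPoly.push (DPoly.const nil))))).congr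
          fun _ _ => by simp only [pure_bind]; rfl)
      (((EPoly.of_qpoly QPoly.fst).bind (EPoly.comp (before_poly hP hRR k) DPoly.id.fst)).congr
        fun _ _ => by simp only [pure_bind])
  refine ((QPoly.tag DPoly.id).bind (EPoly.sample (guard_poly hRR hYY k) h1)).congr fun v => ?_
  simp only [pre, pure_bind, QData.fst_pair, QData.snd_pair, erase_toQ, fst_pair, snd_pair]

theorem post_poly (hP : P.Efficient) (k : ℕ) : QPoly (post P sel k) := by
  have h1 : EPoly fun E w => if E.snd.fst = nil then
      pure (QData.pair w.snd.snd QData.nil)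
      else after P sel k (pair E.fst E.snd.snd.fst) w.snd.snd.snd :=
    EPoly.ite' (BPoly.eq DPoly.id.snd.fst (DPoly.const _))
      (((EPoly.of_qpoly (QPoly.snd.bind QPoly.snd)).bind ((EPoly.push (DPoly.const nil)).bind
        (EPoly.of_qpoly QPoly.swap))).congr fun _ _ => by simp only [pure_bind]; rfl)
      (((EPoly.of_qpoly (QPoly.snd.bind (QPoly.snd.bind QPoly.snd))).bind (EPoly.comp (after_poly sel hP k)
        (f := fun E => pair E.fst E.snd.snd.fst) (DPoly.id.fst.pair DPoly.id.snd.snd.fst))).congr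
        fun _ _ => by simp only [pure_bind])
  refine ((QPoly.tag DPoly.id).bind h1).congr fun v => ?_
  simp only [post, pure_bind, QData.fst_pair, QData.snd_pair, erase_toQ]

end Oracle

end Sim

/-! ### The growth of the reduction's state -/

theorem Data.size_fst_add_snd_le (d : Data) : d.fst.size + d.snd.size ≤ d.size := by
  cases d <;> simp [Data.size, Data.fst, Data.snd]

theorem Data.size_ofList_append (l l' : List Data) :
    (ofList (l ++ l')).size = (ofList l).size + (ofList l').size := by
  induction l with
  | nil => simp [ofList, Data.size]
  | cons a l ih => simp [ofList, Data.size, ih]; omega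

theorem Data.size_ofList_reverse (l : List Data) :
    (ofList l.reverse).size = (ofList l).size := by
  induction l with
  | nil => rfl
  | cons a l ih => simp [Data.size_ofList_append, ih, ofList, Data.size]; omega

theorem QM.mem_support_pure {α : Type} {a : α} {m : QState} {r : α × QState}
    (h : r ∈ ((pure a : QM α) m).support) : r = (a, m) := by
  rw [QM.pure_apply] at h
  exact (PMF.mem_support_pure_iff _ _).1 h

theorem QM.mem_support_bind {α β : Type} {x : QM α} {f : α → QM β} {m : QState} {r : β × QState}
    (h : r ∈ ((x >>= f) m).support) : ∃ a m', (a, m') ∈ (x m).support ∧ r ∈ (f a m').support := by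
  rw [QM.bind_apply, PMF.mem_support_bind_iff] at h
  obtain ⟨⟨a, m'⟩, h1, h2⟩ := h
  exact ⟨a, m', h1, h2⟩

namespace Sim

theorem size_varData (a b c d e : Data) :
    (varData a b c d e).size = a.size + b.size + c.size + d.size + e.size + 4 := by
  simp only [varData, Data.size]; omega

theorem size_fields (u : Data) : (startedOf u).size + (targetOf u).size + (chalOf u).size +
    (keysOf u).size + (logOf u).size ≤ u.size := by
  have h1 := u.size_fst_add_snd_le
  have h2 := u.snd.size_fst_add_snd_le
  have h3 := u.snd.snd.size_fst_add_snd_le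
  have h4 := u.snd.snd.snd.size_fst_add_snd_le
  simp only [startedOf, targetOf, chalOf, keysOf, logOf]
  omega

variable {P : ABESKLPrograms} {RR : Data → PMF Data} {YY : Data → Prop} {sel : Bool}

theorem post_reply (k : ℕ) (b : QData) (ctl : Data) (q : QData) (info : Data) (qu : QData) :
    post P sel k (QData.pair b (reply ctl q info qu).snd.snd) =
      after P sel k (pair b.erase info) qu := by
  rw [post, if_neg (by simp [reply])]
  simp [reply]

theorem post_nil_left (k : ℕ) (b s : QData) :
    post P sel k (QData.pair b (QData.pair QData.nil s)) = pure (QData.pair s QData.nil) :=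
  if_pos (c := (QData.pair b (QData.pair QData.nil s)).erase.snd.fst = nil) rfl

theorem post_nil (k : ℕ) (b : QData) :
    post P sel k (QData.pair b QData.nil) = pure (QData.pair QData.nil QData.nil) :=
  if_pos (c := (QData.pair b QData.nil).erase.snd.fst = nil) rfl

/-- Before the outer call, key generation uses only the attribute and the constants; the variables
of the reduction are merely passed through. So its output can be bounded independently of how much
has accumulated in them. -/
theorem kgBefore_eq (e : Data) : kgBefore P e =
    kgBefore P (pair e.fst (pair e.snd.fst nil)) >>= fun r =>
      pure (reply r.fst.erase r.snd.fst (pair e r.snd.snd.snd.fst.erase.snd)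
        r.snd.snd.snd.snd) := by
  have h0 : kgBefore P (pair e.fst (pair e.snd.fst nil)) =
    kgPrefix P (pair e.snd.fst e.fst) >>= fun st =>
    (StateT.lift (uniformList (columns e.snd.fst).toList) : QM Data) >>= fun j =>
      if j = colOf e.snd.fst then
        pure (reply tt e.fst.toQ (pair (pair e.fst (pair e.snd.fst nil))
          (pair st.fst.erase (pair j nil))) st.snd)
      else
        P.kg.kernel (kgArg (pair e.snd.fst e.fst) ((tabOf e.snd.fst).toList.getD
          (rowOf e.snd.fst).toList.length nil) j).toQ >>= fun r =>
        pure (reply nil (QData.pair r.fst QData.nil)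
          (pair (pair e.fst (pair e.snd.fst nil))
            (pair st.fst.erase (pair j r.snd.erase))) st.snd) := rfl
  rw [h0, kgBefore]
  simp only [bind_assoc]
  refine congrArg _ (funext fun st => congrArg _ (funext fun j => ?_))
  by_cases h : j = colOf e.snd.fst
  · rw [if_pos h, if_pos h]
    simp only [pure_bind, reply, QData.fst_pair, QData.snd_pair, erase_toQ, snd_pair]
  · rw [if_neg h, if_neg h]
    simp only [bind_assoc, pure_bind, reply, QData.fst_pair, QData.snd_pair, erase_toQ,
      snd_pair]

theorem kgBefore_form {e : Data} {m : QState} {r : QData × QState}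
    (hr : r ∈ (kgBefore P e m).support) :
    ∃ ctl q recs rec qu, r.1 = reply ctl q (pair e (pair recs rec)) qu := by
  obtain ⟨st, m1, -, hr⟩ := QM.mem_support_bind hr
  obtain ⟨j, m2, -, hr⟩ := QM.mem_support_bind hr
  split at hr
  · exact ⟨_, _, _, _, _, congrArg Prod.fst (QM.mem_support_pure hr)⟩
  · obtain ⟨a, m3, -, hr⟩ := QM.mem_support_bind hr
    exact ⟨_, _, _, _, _, congrArg Prod.fst (QM.mem_support_pure hr)⟩

theorem kg_size (hP : P.kg.IsQPT) : ∃ g : Polynomial ℕ, ∀ e m, ∀ r ∈ (kgBefore P e m).support,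
    ∀ b m', ∀ p ∈ (post P sel 1 (QData.pair b r.1.snd.snd) m').support,
      p.1.fst.fst.size ≤ e.snd.fst.size ∧
      p.1.fst.snd.size ≤ e.snd.snd.size + g.eval (e.snd.fst.size + e.fst.size) := by
  obtain ⟨p₁, h₁⟩ := EPoly.size_le (kgBefore_poly hP)
  obtain ⟨p₂, h₂⟩ := EPoly.size_le (kgSuffix_poly hP)
  refine ⟨Polynomial.X + p₁.comp (Polynomial.X + 2) + p₂.comp (Polynomial.X + 1) + 8,
    fun e m r hr b m' p hp => ?_⟩
  have hr' := hr
  rw [kgBefore_eq] at hr'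
  obtain ⟨r₀, m₁, hr₀, hr'⟩ := QM.mem_support_bind hr'
  have h3 := h₁ _ QData.nil m _ hr₀
  obtain ⟨ctl, q, recs, rec, qu, h4⟩ := kgBefore_form hr₀
  have h5 := QM.mem_support_pure hr'
  simp only at h4
  rw [h5, post_reply] at hp
  obtain ⟨st, m₂, hst, hp⟩ := QM.mem_support_bind hp
  have h6 := h₂ _ QData.nil _ (QData.pair st QData.nil, m₂) (by
    rw [QM.bind_apply, PMF.mem_support_bind_iff]
    exact ⟨_, hst, by rw [QM.pure_apply, PMF.support_pure]; rfl⟩)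
  have h7 := QM.mem_support_pure hp
  have h8 := size_fields e.snd.snd
  have h9 := st.size_fst_le
  have h10 := st.fst.size_erase_le
  have h11 : recs.size + rec.size ≤ r₀.size := by
    rw [h4]
    simp only [reply, QData.size, Data.toQ_pair, Data.size_toQ]
    omega
  rw [h4] at h7
  simp only [fst_pair, snd_pair, Data.size, QData.size, add_zero] at h3 h6
  simp only [reply, QData.fst_pair, QData.snd_pair, erase_toQ, fst_pair, snd_pair] at h7
  rw [h7]
  simp only [addKey, QData.fst_pair, Data.toQ_fst, Data.toQ_snd, Data.size_toQ, fst_pair, snd_pair,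
    size_varData, Data.size, kgEntry, Data.size_ofList_append, ofList,
    Data.size_ofList_reverse, Data.ofList_toList, Polynomial.eval_add, Polynomial.eval_comp,
    Polynomial.eval_X, Polynomial.eval_ofNat, Polynomial.eval_one]
  refine ⟨le_rfl, ?_⟩
  rw [show e.fst.size + (e.snd.fst.size + 0 + 1) + 1 = e.snd.fst.size + e.fst.size + 2 by ring] at h3
  omega

theorem start_size (e : Data) (m : QState) : ∀ r ∈ (before P RR 0 e QData.nil m).support,
    ∀ b m', ∀ p ∈ (post P sel 0 (QData.pair b r.1.snd.snd) m').support,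
      p.1.fst.fst.size ≤ e.snd.fst.size ∧
      p.1.fst.snd.size ≤ e.snd.snd.size + (Polynomial.X + 8 : Polynomial ℕ).eval (e.snd.fst.size + e.fst.size) := by
  intro r hr b m' p hp
  rw [QM.mem_support_pure hr, post_reply] at hp
  rw [QM.mem_support_pure hp]
  have h8 := size_fields e.snd.snd
  have h9 : (if sel then pair e.fst nil else nil).size ≤ e.fst.size + 1 := by
    cases sel <;> simp [Data.size]
  simp only [startAfter, setStarted, Data.toQ_fst, Data.toQ_snd, Data.size_toQ,
    fst_pair, snd_pair, size_varData, Polynomial.eval_add, Polynomial.eval_X,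
    Polynomial.eval_ofNat]
  refine ⟨le_rfl, ?_⟩
  simp only [Data.size]
  omega

theorem vrfyBefore_form {e : Data} {q : QData} {m : QState} {r : QData × QState}
    (hr : r ∈ (vrfyBefore P e q m).support) :
    ∃ ctl q flag qu, r.1 = reply ctl q (pair e flag) qu := by
  obtain ⟨st, m1, -, hr⟩ := QM.mem_support_bind hr
  split at hr
  · exact ⟨_, _, _, _, congrArg Prod.fst (QM.mem_support_pure hr)⟩
  · obtain ⟨a, m3, -, hr⟩ := QM.mem_support_bind hr
    exact ⟨_, _, _, _, congrArg Prod.fst (QM.mem_support_pure hr)⟩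

theorem vrfy_size (e : Data) (q : QData) (m : QState) : ∀ r ∈ (vrfyBefore P e q m).support,
    ∀ b m', ∀ p ∈ (post P sel 2 (QData.pair b r.1.snd.snd) m').support,
      p.1.fst.fst.size ≤ e.snd.fst.size ∧
      p.1.fst.snd.size ≤ e.snd.snd.size + (Polynomial.X + 8 : Polynomial ℕ).eval (e.snd.fst.size + e.fst.size) := by
  intro r hr b m' p hp
  obtain ⟨ctl, q, flag, qu, h⟩ := vrfyBefore_form hr
  rw [h, post_reply] at hp
  obtain ⟨st, m₂, hst, hp⟩ := QM.mem_support_bind hp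
  rw [QM.mem_support_pure hp]
  have h8 := size_fields e.snd.snd
  have h10 := e.fst.size_fst_le
  simp only [addLog, QData.fst_pair, Data.toQ_fst, Data.toQ_snd, Data.size_toQ,
    fst_pair, snd_pair, size_varData, Polynomial.eval_add, Polynomial.eval_X,
    Polynomial.eval_ofNat]
  refine ⟨le_rfl, ?_⟩
  split
  · omega
  · simp only [Data.size]
    omega

theorem challenge_size (e : Data) (m : QState) : ∀ r ∈ (challengeBefore P RR e m).support,
    ∀ b m', ∀ p ∈ (post P sel 3 (QData.pair b r.1.snd.snd) m').support,
      p.1.fst.fst.size ≤ e.snd.fst.size ∧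
      p.1.fst.snd.size ≤ e.snd.snd.size + (Polynomial.X + 8 : Polynomial ℕ).eval (e.snd.fst.size + e.fst.size) := by
  intro r hr b m' p hp
  obtain ⟨d, m₁, -, hr⟩ := QM.mem_support_bind hr
  rw [QM.mem_support_pure hr, post_reply] at hp
  rw [QM.mem_support_pure hp]
  have h8 := size_fields e.snd.snd
  have h10 := e.fst.size_fst_le
  simp only [challengeAfter, setChal, Data.toQ_fst, Data.toQ_snd, Data.size_toQ,
    fst_pair, snd_pair, size_varData, Data.size, Polynomial.eval_add, Polynomial.eval_X,
    Polynomial.eval_ofNat]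
  refine ⟨le_rfl, ?_⟩
  omega

/-- The constants never grow, and the variables grow in each call by a polynomial in the constants
and the message. This additive form prevents an exponential blow-up over polynomially many calls and
is what `exists_reduction` requires. -/
theorem size_bound (hP : P.Efficient) : ∃ g : Polynomial ℕ, ∀ k msg s m,
    ∀ r ∈ (pre P RR YY k (QData.pair msg s) m).support, ∀ b m',
      ∀ p ∈ (post P sel k (QData.pair b r.1.snd.snd) m').support, p.1.fst.fst.size ≤ s.fst.size ∧
      p.1.fst.snd.size ≤ s.snd.size + g.eval (s.fst.size + msg.size) := by
  obtain ⟨g₁, h₁⟩ := kg_size (sel := sel) hP.2.1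
  refine ⟨g₁ + Polynomial.X + 8, fun k msg s m r hr b m' p hp => ?_⟩
  obtain ⟨a, m₁, -, hr⟩ := QM.mem_support_bind hr
  split at hr
  · rw [QM.mem_support_pure hr] at hp
    replace hp : p ∈ (post P sel k (QData.pair b (QData.pair QData.nil s)) m').support := hp
    rw [post_nil_left] at hp
    rw [QM.mem_support_pure hp]
    exact ⟨le_rfl, Nat.le_add_right _ _⟩
  · have h2 : s.erase.fst.size ≤ s.fst.size := by
      rw [← QData.erase_fst]
      exact s.fst.size_erase_le
    have h3 : s.erase.snd.size ≤ s.snd.size := by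
      rw [← QData.erase_snd]
      exact s.snd.size_erase_le
    have h4 := msg.size_erase_le
    have hmono : ∀ g : Polynomial ℕ, g.eval (s.erase.fst.size + msg.erase.size) ≤
        g.eval (s.fst.size + msg.size) := fun g => g.eval_mono_nat (by omega)
    suffices h : p.1.fst.fst.size ≤ s.erase.fst.size ∧ (p.1.fst.snd.size ≤ s.erase.snd.size +
        g₁.eval (s.erase.fst.size + msg.erase.size) ∨ p.1.fst.snd.size ≤ s.erase.snd.size +
        (Polynomial.X + 8 : Polynomial ℕ).eval (s.erase.fst.size + msg.erase.size)) by
      have h5 := hmono g₁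
      have h6 := hmono (Polynomial.X + 8)
      simp only [Polynomial.eval_add, Polynomial.eval_X, Polynomial.eval_ofNat] at h h5 h6 ⊢
      omega
    match k with
    | 0 =>
      have := start_size (P := P) (RR := RR) _ _ r hr b m' p hp
      exact ⟨this.1, Or.inr this.2⟩
    | 1 =>
      have := h₁ _ _ r hr b m' p hp
      exact ⟨this.1, Or.inl this.2⟩
    | 2 =>
      have := vrfy_size _ _ _ r hr b m' p hp
      exact ⟨this.1, Or.inr this.2⟩
    | 3 =>
      have := challenge_size _ _ r hr b m' p hp
      exact ⟨this.1, Or.inr this.2⟩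
    | k + 4 =>
      rw [QM.mem_support_pure hr] at hp
      replace hp : p ∈ (post P sel (k + 4) (QData.pair b QData.nil) m').support := hp
      rw [post_nil] at hp
      rw [QM.mem_support_pure hp]
      exact ⟨Nat.zero_le _, Or.inl (Nat.zero_le _)⟩

variable {P : ABESKLPrograms} {RR : Data → PMF Data} {YY : Data → Prop} {sel : Bool}

theorem simOracle_refuse {σ : Type} (O : Oracle σ) {k : ℕ} {msg : QData} {s : Data} (o : σ)
    (h : guard RR YY k (pair msg.erase s) = PMF.pure nil) :
    simOracle (pre P RR YY) (post P sel) O k msg (s.toQ, o) = pure (QData.nil, (s.toQ, o)) := by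
  have h1 : pre P RR YY k (QData.pair msg s.toQ) =
      pure (QData.pair QData.nil (QData.pair QData.nil (QData.pair QData.nil s.toQ))) := by
    rw [pre, QData.erase_pair, erase_toQ, h]
    refine (congrArg (· >>= _) (QM.lift_pure nil)).trans ?_
    rw [pure_bind, if_pos rfl]
    rfl
  simp only [simOracle, handlerSem, h1, pure_bind]
  rw [if_pos (show (QData.pair QData.nil (QData.pair QData.nil (QData.pair QData.nil s.toQ))).fst.erase =
    nil from rfl)]
  simp only [pure_bind, post_nil_left, QData.fst_pair, QData.snd_pair]
  rfl

theorem simOracle_accept {σ : Type} (O : Oracle σ) {k : ℕ} {msg : QData} {s g : Data} (o : σ)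
    (h : guard RR YY k (pair msg.erase s) = PMF.pure g) (hg : g ≠ nil) :
    simOracle (pre P RR YY) (post P sel) O k msg (s.toQ, o) =
      before P RR k (pair msg.erase s) msg >>= fun r =>
        (if r.fst.erase = nil then pure (r.snd.fst, o) else O k r.snd.fst o) >>= fun a =>
          post P sel k (QData.pair (ofBool (decide (a.1.erase ≠ nil))).toQ r.snd.snd) >>=
            fun p => pure (p.snd.toList.foldl plugFrame a.1, (p.fst, a.2)) := by
  have h1 : pre P RR YY k (QData.pair msg s.toQ) = before P RR k (pair msg.erase s) msg := by
    rw [pre, QData.erase_pair, erase_toQ, h]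
    refine (congrArg (· >>= _) (QM.lift_pure g)).trans ?_
    rw [pure_bind, if_neg hg]
    rfl
  simp only [simOracle, handlerSem, h1, bind_assoc, pure_bind, QData.fst_pair, QData.snd_pair]

/-- The second part, with an answer of the outer oracle. -/
theorem reply_call {σ : Type} (O : Oracle σ) (k : ℕ) (o : σ) (ctl info : Data) (q qu : QData)
    (hc : ctl ≠ nil) :
    ((if (reply ctl q info qu).fst.erase = nil then pure ((reply ctl q info qu).snd.fst, o)
      else O k (reply ctl q info qu).snd.fst o) >>= fun a =>
        post P sel k (QData.pair (ofBool (decide (a.1.erase ≠ nil))).toQ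
          (reply ctl q info qu).snd.snd) >>=
            fun p => (pure (p.snd.toList.foldl plugFrame a.1, (p.fst, a.2)) : QM (QData × (QData × σ)))) =
      O k q o >>= fun a => after P sel k (pair (ofBool (decide (a.1.erase ≠ nil))) info) qu >>=
        fun p => pure (p.snd.toList.foldl plugFrame a.1, (p.fst, a.2)) := by
  simp only [post_reply, erase_toQ]
  rw [if_neg (by simpa [reply] using hc)]
  rfl

/-- The second part, with an own answer. -/
theorem reply_nil {σ : Type} (O : Oracle σ) (k : ℕ) (o : σ) (info : Data) (q qu : QData) :
    ((if (reply nil q info qu).fst.erase = nil then pure ((reply nil q info qu).snd.fst, o)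
      else O k (reply nil q info qu).snd.fst o) >>= fun a =>
        post P sel k (QData.pair (ofBool (decide (a.1.erase ≠ nil))).toQ
          (reply nil q info qu).snd.snd) >>=
            fun p => (pure (p.snd.toList.foldl plugFrame a.1, (p.fst, a.2)) : QM (QData × (QData × σ)))) =
      after P sel k (pair (ofBool (decide (q.erase ≠ nil))) info) qu >>=
        fun p => pure (p.snd.toList.foldl plugFrame q, (p.fst, o)) := by
  simp only [post_reply, erase_toQ]
  rw [if_pos (by simp [reply, Data.toQ, QData.erase])]
  rw [pure_bind]
  rfl

/-- An entry of the list of keys of the balls-and-bins scheme with recorded instances. -/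
abbrev Entry (v w : ℕ → ℕ) (lam : ℕ) : Type := Data × ((Fin (v lam) → Fin (w lam)) × (Fin (v lam) → Data)) × Bool

/-- The algorithm `RR` decides the relation. -/
abbrev Decides (RR : Data → PMF Data) (T : AttrRel) (lam : ℕ) : Prop := ∀ x ∈ T.X lam, ∀ y ∈ T.Y lam,
  ∀ b ∈ (RR (pair (unary lam) (pair x y))).support, (b ≠ nil ↔ T.R lam x y)

/-! ### The invariant between the reduction and the hybrid experiment -/

section Relation

variable (P RR YY sel) {ell : ℕ → ℕ} {v w : ℕ → ℕ} (hw : ∀ lam, 0 < w lam) (T : AttrRel) (q : ℕ → ℕ)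
  {lam : ℕ} (i : Fin (v lam)) (k : Fin (w lam)) (coin : Bool)
  (pk msk : Fin (v lam) → Fin (w lam) → Data) (dummy : Data)

/-- The table with a dummy in place of the outer instance. -/
def cells : Fin (v lam) → Fin (w lam) → Data :=
  update (fun r j => pair (pk r j) (msk r j)) i
    (update (fun j => pair (pk i j) (msk i j)) k dummy)

variable (ell) in
def constants : Data :=
  constData (unary lam) (unary i) (unary k) (unary (w lam)) (unary (ell lam))
    (unary (q lam)) (tableData (cells i k pk msk dummy))

def optData : Option Data → Data
  | none => nil
  | some x => pair x nil

/-- The record of a key. -/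
def recordData (vk : (Fin (v lam) → Fin (w lam)) × (Fin (v lam) → Data)) (r : Fin (v lam)) : Data :=
  pair (unary (vk.1 r)) (if r = i ∧ vk.1 i = k then nil else vk.2 r)

def keysData (keys : List (Entry v w lam)) : Data :=
  ofList (keys.map fun e => pair e.1 (ofList (List.ofFn (recordData i k e.2.1))))

/-- The keys of the outer instance. -/
def outerKeys (V : Data → Bool) (keys : List (Entry v w lam)) :
    List (Data × Data × Bool) :=
  (keys.filter fun e => decide (e.2.1.1 i = k)).map fun e => (e.1, e.2.1.2 i, V e.1)

/-- The state of the reduction and its challenger, and that of the hybrid experiment. -/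
def Rel (st : QData × ChalState (P.scheme ell) lam)
    (h : ChalState (recorded (P.scheme ell) v w hw) lam) : Prop :=
  ∃ (x : Option Data) (log : List Data) (V : Data → Bool),
    st.1 = (pair (constants ell q i k pk msk dummy) (varData (ofBool h.started)
      (optData h.target) (optData x) (keysData i k h.keys) (ofList log))).toQ ∧
    st.2 = ⟨h.started, h.target, outerKeys i k V h.keys, h.challenged, false⟩ ∧
    h.aborted = false ∧ h.challenged = x.map h.target.getD ∧ (x.isSome → h.started = true) ∧
    (∀ a ∈ h.challenged, a ∈ T.X lam) ∧ (h.keys.map Prod.fst).Nodup ∧ (∀ e ∈ h.keys, e.1 ∈ T.Y lam) ∧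
    (∀ e ∈ h.keys, e.2.2 = true → V e.1 = true) ∧
    ∀ y, y ∈ log ↔ ∃ e ∈ h.keys, e.1 = y ∧ e.2.2 = true

variable {P RR YY sel T q i k pk msk dummy}

local notation "consts" => constants ell q i k pk msk dummy

theorem publicKeys_eq : publicKeys consts =
    tableData fun r j => (cells i k pk msk dummy r j).fst := by
  simp [publicKeys, constants, constData, tabOf, tableData, List.map_ofFn, Function.comp_def]

theorem update_cells_fst : update (fun r j => (cells i k pk msk dummy r j).fst) i
    (update (fun j => (cells i k pk msk dummy i j).fst) k (pk i k)) = pk := by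
  funext r j
  by_cases hr : r = i
  · subst hr
    by_cases hj : j = k
    · subst hj; simp
    · simp [cells, update_of_ne hj]
  · simp [cells, update_of_ne hr]

/-- The conclusion for one oracle call. -/
abbrev Good (hw : ∀ lam, 0 < w lam) (i : Fin (v lam)) (k : Fin (w lam))
    (pk msk : Fin (v lam) → Fin (w lam) → Data) (dummy : Data) (P : ABESKLPrograms) (T : AttrRel) (q : ℕ → ℕ)
    (r : (QData × (QData × ChalState (P.scheme ell) lam)) × QState)
    (r' : (QData × ChalState (recorded (P.scheme ell) v w hw) lam) × QState) : Prop :=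
  (r.1.1 = r'.1.1 ∧ r.2 = r'.2 ∧ Rel P hw T q i k pk msk dummy r.1.2 r'.1.2) ∨
    r.1.2.2.aborted = true ∧ r'.1.2.aborted = true

/-- Inserting the outer public key into the table turns the table with the dummy cell into the
public key of the hybrid experiment. A second start is refused on both sides. -/
theorem start_rel (msg : QData) (st : QData × ChalState (P.scheme ell) lam)
    (h : ChalState (recorded (P.scheme ell) v w hw) lam) (m : QState)
    (ok : List ((recorded (P.scheme ell) v w hw).VK lam) → Prop) (encf)
    (hst : Rel P hw T q i k pk msk dummy st h) :
    PMFRel (Good hw i k pk msk dummy P T q)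
      (simOracle (pre P RR YY) (post P sel) (challenger (P.scheme ell) T sel (fun _ => 1) coin lam
        (pk i k) (msk i k)) 0 msg st m)
      (game (recorded (P.scheme ell) v w hw) T sel q lam ok encf pk msk 0 msg h m) := by
  obtain ⟨s, o⟩ := st
  obtain ⟨x, log, V, h1, h2, h3⟩ := id hst
  dsimp only at h1 h2
  subst h1
  have hg : guard RR YY 0 (pair msg.erase (pair consts
      (varData (ofBool h.started) (optData h.target) (optData x) (keysData i k h.keys)
        (ofList log)))) = PMF.pure (ofBool (!h.started)) := by
    simp only [guard, snd_pair, startedOf, varData, fst_pair]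
    cases h.started <;> simp [ofBool]
  by_cases hs : h.started = true
  · rw [simOracle_refuse _ _ (by rw [hg, hs]; rfl)]
    have : game (recorded (P.scheme ell) v w hw) T sel q lam ok encf pk msk 0 msg h =
        pure (QData.nil, h) := if_pos hs
    rw [this]
    exact PMFRel.pure (Or.inl ⟨rfl, rfl, hst⟩)
  · have hs' : o.started = false := by rw [h2]; simpa using hs
    have hs0 : h.started = false := by simpa using hs
    have hgame : game (recorded (P.scheme ell) v w hw) T sel q lam ok encf pk msk 0 msg h =
        pure ((tableData pk).toQ, { h with
          started := true, target := if sel then some msg.erase else none }) := if_neg hs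
    have hchal : challenger (P.scheme ell) T sel (fun _ => 1) coin lam (pk i k) (msk i k) 0
        msg.erase.toQ o = pure ((pk i k).toQ, { o with
          started := true, target := if sel then some msg.erase else none }) :=
      (if_neg (by simp [hs'])).trans (by rw [erase_toQ]; rfl)
    rw [simOracle_accept _ _ hg (by simp [hs]), hgame]
    simp only [before, pure_bind]
    rw [reply_call _ _ _ _ _ _ _ (by simp), fst_pair, hchal]
    simp only [pure_bind, after]
    obtain ⟨h3, h4, h5, h6, h7⟩ := h3
    -- Before the start there has been no challenge, so replacing the target cannot affect the
    -- recorded challenge attribute.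
    have hx : x = none := by
      rcases x with - | x
      · rfl
      · exact absurd (h5 rfl) hs
    subst hx
    refine PMFRel.pure (Or.inl ⟨?_, rfl, none, log, V, ?_, ?_, h3, ?_, by simp, h6, h7⟩)
    · simp only [startAfter, Data.toQ_pair, QData.snd_pair, QData.toList_toQ, toList_ofList,
        snd_pair, publicKeys_eq, fst_pair]
      have := foldl_tableFrames (fun r j => (cells i k pk msk dummy r j).fst) i k (pk i k)
      rw [update_cells_fst] at this
      rw [← this]
      simp [constants, constData, rowOf, colOf]
    · have : (if sel = true then pair msg.erase nil else nil) =
          optData (if sel = true then some msg.erase else none) := by cases sel <;> rfl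
      simp only [startAfter, setStarted, Data.toQ_pair, QData.fst_pair, snd_pair, fst_pair, this,
        chalOf, keysOf, logOf, varData, ofBool]
    · rw [h2]
    · exact h4

end Relation

end Sim

/-! ### Auxiliary facts on lists, pieces of keys and independent sampling -/

theorem List.foldlM_congr_mem {m : Type → Type} [Monad m] {α γ : Type} {f g : γ → α → m γ} {l : List α}
    (h : ∀ s, ∀ a ∈ l, f s a = g s a) (s : γ) : l.foldlM f s = l.foldlM g s := by
  induction l generalizing s with
  | nil => rfl
  | cons a l ih =>
    simp only [List.foldlM_cons]
    rw [h s a (by simp)]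
    congr 1
    funext t
    exact ih (fun s b hb => h s b (by simp [hb])) t

theorem List.take_append_cons_drop_ofFn {α : Type} {n : ℕ} (g : Fin n → α) (i : Fin n) (a : α) :
    (List.ofFn g).take i ++ a :: (List.ofFn g).drop (i + 1) = List.ofFn (update g i a) := by
  rw [List.ofFn_eq_take_cons_drop (update g i a) i, update_self]
  have h : ∀ (j : ℕ) (hj : j < n), j ≠ i → update g i a ⟨j, hj⟩ = g ⟨j, hj⟩ :=
    fun j hj hji => update_of_ne (fun h => hji (congrArg Fin.val h)) _ _
  congr 1
  · refine List.ext_getElem (by simp) fun j h1 h2 => ?_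
    simp only [List.length_take, List.length_ofFn] at h1
    simp only [List.getElem_take, List.getElem_ofFn]
    rw [h _ _ (by omega)]
  · congr 1
    refine List.ext_getElem (by simp) fun j h1 h2 => ?_
    simp only [List.getElem_drop, List.getElem_ofFn]
    rw [h _ _ (by omega)]

theorem ne_of_mem_take {n : ℕ} {i r : Fin n} (h : r ∈ (List.ofFn fun r : Fin n => r).take i) : r ≠ i := by
  obtain ⟨j, hj, rfl⟩ := List.mem_iff_getElem.1 h
  simp only [List.length_take] at hj
  simp only [List.getElem_take, List.getElem_ofFn, ne_eq, Fin.ext_iff]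
  omega

theorem ne_of_mem_drop {n : ℕ} {i r : Fin n} (h : r ∈ (List.ofFn fun r : Fin n => r).drop (i + 1)) :
    r ≠ i := by
  obtain ⟨j, hj, rfl⟩ := List.mem_iff_getElem.1 h
  simp only [List.getElem_drop, List.getElem_ofFn, ne_eq, Fin.ext_iff]
  omega

@[simp] theorem QData.erase_ofList (l : List QData) :
    (QData.ofList l).erase = Data.ofList (l.map QData.erase) := by
  induction l with
  | nil => rfl
  | cons a l ih => simp [QData.ofList, Data.ofList, ih]

theorem foldl_pairs {α : Type} (a b : α → QData) (L : List α) (A B : List QData) :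
    L.foldl (fun s t => QData.pair (QData.pair (a t) s.fst) (QData.pair (b t) s.snd))
      (QData.pair (QData.ofList A) (QData.ofList B)) =
    QData.pair (QData.ofList ((L.map a).reverse ++ A)) (QData.ofList ((L.map b).reverse ++ B)) := by
  induction L generalizing A B with
  | nil => rfl
  | cons t L ih => simpa [QData.ofList] using ih (a t :: A) (b t :: B)

theorem List.take_ofFn_update {α : Type} {n : ℕ} (g : Fin n → α) (i : Fin n) (a : α) :
    (List.ofFn (update g i a)).take i = (List.ofFn g).take i := by
  rw [← List.take_append_cons_drop_ofFn, List.take_left' (by simp)]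

theorem List.drop_ofFn_update {α : Type} {n : ℕ} (g : Fin n → α) (i : Fin n) (a : α) :
    (List.ofFn (update g i a)).drop (i + 1) = (List.ofFn g).drop (i + 1) := by
  rw [← List.take_append_cons_drop_ofFn, List.append_cons, List.drop_left' (by simp)]

/-- The elements of a list with the pieces of a key. -/
def zipPieces {α : Type} : List α → QData → List (α × QData)
  | [], _ => []
  | a :: l, u => (a, u.fst.snd) :: zipPieces l u.snd

theorem zipPieces_take {α : Type} (l : List α) (n : ℕ) (u : QData) :
    zipPieces (l.take n) u = (zipPieces l u).take n := by
  induction l generalizing n u with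
  | nil => simp [zipPieces]
  | cons a l ih => cases n <;> simp [zipPieces, ih]

theorem zipPieces_drop {α : Type} (l : List α) (n : ℕ) (u : QData) :
    zipPieces (l.drop n) (QData.snd^[n] u) = (zipPieces l u).drop n := by
  induction l generalizing n u with
  | nil => simp [zipPieces]
  | cons a l ih => cases n <;> simp [zipPieces, ih]

theorem QData.get_eq_iterate (u : QData) (n : ℕ) : u.get n = (QData.snd^[n] u).fst := by
  induction n generalizing u with
  | zero => rfl
  | succ n ih => exact ih u.snd

theorem zipPieces_ofFn {α : Type} {n : ℕ} (f : Fin n → α) (u : QData) :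
    zipPieces (List.ofFn f) u = List.ofFn fun r => (f r, (u.get r).snd) := by
  induction n generalizing u with
  | zero => rfl
  | succ n ih =>
    rw [List.ofFn_succ, List.ofFn_succ, zipPieces, ih]
    rfl

theorem decide_and_eq {p r : Prop} {_ : Decidable (p ∧ r)} {b c : Bool} (hp : p ↔ b = true)
    (hr : r ↔ c = true) : decide (p ∧ r) = (b && c) := by
  rw [Bool.eq_iff_iff, decide_eq_true_iff, Bool.and_eq_true, hp, hr]

theorem Data.ofBool_ne_nil (b : Bool) : Data.ofBool b ≠ Data.nil ↔ b = true := by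
  cases b <;> simp [ofBool]

theorem Data.erase_ofBool_ne_nil (b : Bool) : (Data.ofBool b).toQ.erase ≠ Data.nil ↔ b = true := by
  rw [erase_toQ, Data.ofBool_ne_nil]

/-- The decision algorithm may toss coins, but each possible verdict is correct, so the filtered
list is deterministic. -/
theorem PMF.map_filter_mapM (F : Data → PMF Data) (p : Data → Prop) (l : List Data)
    (h : ∀ a ∈ l, ∀ b ∈ (F a).support, (b ≠ nil ↔ p a)) :
    ((l.mapM fun a => (F a).map fun b => pair b a).map fun L =>
      (L.filter fun x => decide (x.fst ≠ nil)).map Data.snd) = PMF.pure (l.filter fun a => decide (p a)) := by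
  induction l with
  | nil => exact PMF.pure_map _ _
  | cons a l ih =>
    rw [List.mapM_cons]
    refine PMF.eq_pure_of_support _ fun M hM => ?_
    obtain ⟨L, hL, rfl⟩ := (PMF.mem_support_map_iff _ _ _).1 hM
    obtain ⟨x, hx, hL⟩ := (PMF.mem_support_bind_iff _ _ _).1 hL
    obtain ⟨L', hL', hL⟩ := (PMF.mem_support_bind_iff _ _ _).1 hL
    obtain rfl := (PMF.mem_support_pure_iff _ _).1 hL
    obtain ⟨b, hb, rfl⟩ := (PMF.mem_support_map_iff _ _ _).1 hx
    have h1 : (L'.filter fun x => decide (x.fst ≠ nil)).map Data.snd = l.filter fun a => decide (p a) := by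
      have h2 : (L'.filter fun x => decide (x.fst ≠ nil)).map Data.snd ∈
          (PMF.pure (l.filter fun a => decide (p a))).support := by
        rw [← ih fun a ha => h a (by simp [ha])]
        exact (PMF.mem_support_map_iff _ _ _).2 ⟨_, hL', rfl⟩
      exact (PMF.mem_support_pure_iff _ _).1 h2
    have h3 := h a (by simp) b hb
    by_cases hp : p a
    · have hb' := h3.2 hp
      simp only [List.filter_cons, fst_pair, snd_pair, hb', hp, decide_true, if_true, List.map_cons, ne_eq, not_false_eq_true] at h1 ⊢
      rw [h1]
    · have hb' : b = nil := by_contra fun hb' => hp (h3.1 hb')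
      simp only [List.filter_cons, fst_pair, hb', hp, decide_false, ne_eq, not_true_eq_false, Bool.false_eq_true,
        if_false] at h1 ⊢
      rw [h1]

theorem QM.lift_map_bind {α β γ : Type} (p : PMF α) (g : α → β) (f : β → QM γ) :
    ((StateT.lift (p.map g) : QM β) >>= f) = (StateT.lift p : QM α) >>= fun a => f (g a) := by
  funext m
  rw [QM.bind_apply, QM.bind_apply, QM.lift_apply, QM.lift_apply, PMF.bind_map, PMF.bind_map, PMF.bind_map]
  rfl

theorem PMF.seqFin_map {α β : Type} {n : ℕ} (f : Fin n → PMF α) (g : α → β) :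
    seqFin (fun r => (f r).map g) = (seqFin f).map fun t r => g (t r) :=
  (_root_.seqFin_map f fun _ => g)

theorem map_seqFin_update₂ {α β : Type} {n m : ℕ} (g : (Fin n → Fin m → α) → β) (f : Fin n → Fin m → PMF α)
    (i : Fin n) (k : Fin m) (p : PMF α) :
    ((seqFin fun r => seqFin (f r)).bind fun t =>
      p.map fun a => g (update t i (update (t i) k a))) =
    (seqFin fun r => seqFin (update f i (update (f i) k p) r)).map g := by
  rw [← seqFin_update₂, PMF.map_bind]
  simp only [PMF.map_comp]
  rfl

theorem PMF.mapM_range {α : Type} (n : ℕ) (F : Data → PMF α) :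
    (Data.range n).toList.mapM F = (seqFin fun r : Fin n => F (unary r)).map List.ofFn := by
  have : (Data.range n).toList = List.ofFn fun r : Fin n => unary r := by
    refine List.ext_getElem (by simp) fun j h1 h2 => by simp
  rw [this, List.mapM_ofFn]
  rfl

theorem firstGood_eq_some {V W : ℕ} (J : List (Fin V → Fin W)) (i : Fin V) :
    firstGood J = some i ↔ (J.map fun j => j i).Nodup ∧ ∀ r < i, ¬ (J.map fun j => j r).Nodup := by
  rw [firstGood, List.find?_eq_some_iff_getElem]
  simp only [decide_eq_true_iff, List.getElem_finRange]
  refine and_congr Iff.rfl ⟨?_, fun h => ⟨i, by simp, rfl, fun j hj => ?_⟩⟩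
  · rintro ⟨n, hn, rfl, h⟩ r hr
    simpa using h r hr
  · simpa using h ⟨j, by omega⟩ hj

namespace Sim

section Oracles

variable {ell : ℕ → ℕ} {S : ABESKL ell} {T : AttrRel} {q : ℕ → ℕ} {lam : ℕ}

theorem challengeOracle_accept {coin : Bool} {pk : S.PK lam} {msg : QData} {o : ChalState S lam} {X : Data}
    {M₀ M₁ : Msg (ell lam)} (ho : o.started = true ∧ o.aborted = false ∧ o.challenged = none)
    (hX : o.target.getD msg.erase.fst = X) (h₀ : M₀.encode = msg.erase.snd.fst) (h₁ : M₁.encode = msg.erase.snd.snd)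
    (hc : X ∈ T.X lam ∧ (o.keys.filter fun e => decide (T.R lam X e.1)).length ≤ q lam ∧
      ∀ e ∈ o.keys.filter fun e => decide (T.R lam X e.1), e.2.2 = true) :
    challengeOracle S T q coin lam pk msg o =
      StateT.lift (S.enc lam pk X (if coin then M₁ else M₀)) >>= fun ct =>
        pure ((S.encodeCT lam ct).toQ, { o with challenged := some X }) := by
  subst hX
  refine (if_pos ho).trans ?_
  rw [← h₀, ← h₁, decode_encode, decode_encode]
  exact if_pos hc

theorem gameChallenge_accept {ok : List (S.VK lam) → Prop} {encf : Data → Msg (ell lam) → Msg (ell lam) → PMF Data}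
    {msg : QData} {o : ChalState S lam} {X : Data}
    {M₀ M₁ : Msg (ell lam)} (ho : o.started = true ∧ o.aborted = false ∧ o.challenged = none)
    (hX : o.target.getD msg.erase.fst = X) (h₀ : M₀.encode = msg.erase.snd.fst) (h₁ : M₁.encode = msg.erase.snd.snd)
    (hc : (X ∈ T.X lam ∧ (o.keys.filter fun e => decide (T.R lam X e.1)).length ≤ q lam ∧
      ∀ e ∈ o.keys.filter fun e => decide (T.R lam X e.1), e.2.2 = true) ∧ ok (relatedKeys T X o.keys)) :
    gameChallenge S T q lam ok encf msg o =
      StateT.lift (encf X M₀ M₁) >>= fun ct => pure (ct.toQ, { o with challenged := some X }) := by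
  subst hX
  refine (if_pos ho).trans ?_
  rw [← h₀, ← h₁, decode_encode, decode_encode]
  exact if_pos hc

theorem gameChallenge_abort {ok : List (S.VK lam) → Prop} {encf : Data → Msg (ell lam) → Msg (ell lam) → PMF Data}
    {msg : QData} {o : ChalState S lam} {X : Data}
    (ho : o.started = true ∧ o.aborted = false ∧ o.challenged = none)
    (hX : o.target.getD msg.erase.fst = X)
    (hc : ¬ (((∃ m : Msg (ell lam), m.encode = msg.erase.snd.fst) ∧ ∃ m : Msg (ell lam), m.encode = msg.erase.snd.snd) ∧
      (X ∈ T.X lam ∧ (o.keys.filter fun e => decide (T.R lam X e.1)).length ≤ q lam ∧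
      ∀ e ∈ o.keys.filter fun e => decide (T.R lam X e.1), e.2.2 = true) ∧ ok (relatedKeys T X o.keys))) :
    gameChallenge S T q lam ok encf msg o = pure (QData.nil, { o with aborted := true }) := by
  subst hX
  refine (if_pos ho).trans ?_
  rcases h0 : Msg.decode (ell lam) msg.erase.snd.fst with - | M₀
  · rfl
  · rcases h1 : Msg.decode (ell lam) msg.erase.snd.snd with - | M₁
    · rfl
    · refine if_neg fun h => hc ⟨⟨?_, ?_⟩, h⟩
      · by_contra hm
        rw [decode_eq_none fun h => hm (isMsg_iff.1 h)] at h0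
        cases h0
      · by_contra hm
        rw [decode_eq_none fun h => hm (isMsg_iff.1 h)] at h1
        cases h1

end Oracles

/-- The reason why 1-bounded security is enough: the related keys of the outer instance are those
with column `k` in row `i`, and if row `i` has no collision, `k` occurs there at most once. -/
theorem outerKeys_related_length {v w : ℕ → ℕ} {T : AttrRel} {lam : ℕ} {i : Fin (v lam)} {k : Fin (w lam)}
    (V : Data → Bool) (X : Data)
    (keys : List (Entry v w lam))
    (h : (((keys.filter fun e => decide (T.R lam X e.1)).map fun e => e.2.1.1).map fun j => j i).Nodup) :
    ((outerKeys i k V keys).filter fun e => decide (T.R lam X e.1)).length ≤ 1 := by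
  have h1 : ((outerKeys i k V keys).filter fun e => decide (T.R lam X e.1)).length =
      ((((keys.filter fun e => decide (T.R lam X e.1)).map fun e => e.2.1.1).map fun j => j i).count k) := by
    rw [outerKeys, List.filter_map, List.length_map, List.filter_filter, List.map_map, List.count, List.countP_map,
      List.countP_filter, List.countP_eq_length_filter]
    congr 1
    refine List.filter_congr fun e _ => ?_
    simp [Bool.and_comm, Bool.beq_eq_decide_eq]
  rw [h1]
  exact List.nodup_iff_count_le_one.1 h k

/-- A key accepted as a whole was in particular accepted in row `i`, so the outer challenger regards
it as returned. -/
theorem outerKeys_related_returned {v w : ℕ → ℕ} {T : AttrRel} {lam : ℕ} {i : Fin (v lam)} {k : Fin (w lam)}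
    {V : Data → Bool} {X : Data}
    {keys : List (Entry v w lam)}
    (hV : ∀ e ∈ keys, e.2.2 = true → V e.1 = true)
    (h : ∀ e ∈ keys.filter (fun e => decide (T.R lam X e.1)), e.2.2 = true) :
    ∀ e ∈ (outerKeys i k V keys).filter (fun e => decide (T.R lam X e.1)), e.2.2 = true := by
  intro e he
  obtain ⟨he, hr⟩ := List.mem_filter.1 he
  obtain ⟨e', he', rfl⟩ := List.mem_map.1 he
  have := List.mem_of_mem_filter he'
  exact hV _ this (h _ (List.mem_filter.2 ⟨this, hr⟩))

/-! ### Exactness of the simulation, one oracle at a time -/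

section OracleCalls

variable {P : ABESKLPrograms} {RR : Data → PMF Data} {YY : Data → Prop} {sel : Bool}
  {ell : ℕ → ℕ} {v w : ℕ → ℕ} (hw : ∀ lam, 0 < w lam) {T : AttrRel} {q : ℕ → ℕ}
  {lam : ℕ} {i : Fin (v lam)} {k : Fin (w lam)} (coin : Bool)
  {pk msk : Fin (v lam) → Fin (w lam) → Data} {dummy : Data}

local notation "consts" => constants ell q i k pk msk dummy

local notation "simulated" => simOracle (pre P RR YY) (post P sel)
  (challenger (ABESKLPrograms.scheme P ell) T sel (fun _ => 1) coin lam (pk i k) (msk i k))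

variable (P ell) in
/-- A key for row `r`. -/
def keyRow [Nonempty (Fin (w lam))] (msk : Fin (v lam) → Fin (w lam) → Data) (y : Data) (r : Fin (v lam)) :
    QM (Fin (w lam) × QData × Data) :=
  (StateT.lift (PMF.uniformOfFintype (Fin (w lam))) : QM (Fin (w lam))) >>= fun j =>
    (P.scheme ell).kg lam (msk r j) y >>= fun t => pure (j, t)

/-- The scheme's key generation, rewritten as one self-contained step per row, which is how the
reduction proceeds. -/
theorem recorded_kg_eq [Nonempty (Fin (w lam))] (y : Data) :
    (recorded (P.scheme ell) v w hw).kg lam msk y =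
      seqFin (keyRow P ell msk y) >>= fun t =>
        pure (QData.ofList (List.ofFn fun r => QData.pair (unary (t r).1).toQ (t r).2.1),
          (fun r => (t r).1, fun r => (t r).2.2)) := by
  have h := lift_seqFin_bind (fun _ : Fin (v lam) => PMF.uniformOfFintype (Fin (w lam)))
    fun r j => (P.scheme ell).kg lam (msk r j) y
  rw [← uniformOfFintype_pi] at h
  refine Eq.trans ?_ (congrArg (· >>= fun t : Fin (v lam) → Fin (w lam) × QData × Data =>
    (pure (QData.ofList (List.ofFn fun r => QData.pair (unary (t r).1).toQ (t r).2.1),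
      (fun r => (t r).1, fun r => (t r).2.2)) : QM _)) h)
  refine Eq.symm ((bind_assoc _ _ _).trans (congrArg _ (funext fun j => ?_)))
  refine (bind_assoc _ _ _).trans (congrArg _ (funext fun t => ?_))
  exact pure_bind _ _

theorem kernel_bind {β : Type} (x y : Data) (f : QData → Data → QM β) :
    (P.kg.kernel (pair (unary lam) (pair x y)).toQ >>= fun r => f r.fst r.snd.erase) =
      (P.scheme ell).kg lam x y >>= fun t => f t.1 t.2 := by
  funext m
  rw [QM.bind_apply, QM.bind_apply, Prog.kernel, PMF.bind_map]
  refine Eq.symm ((PMF.bind_map _ _ _).trans ?_)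
  rfl

theorem lift_columns_bind [Nonempty (Fin (w lam))] {β : Type} (f : Data → QM β) :
    ((StateT.lift (uniformList (columns consts).toList) : QM Data) >>= f) =
      (StateT.lift (PMF.uniformOfFintype (Fin (w lam))) : QM (Fin (w lam))) >>= fun j => f (unary j) := by
  have : (columns consts).toList = (List.range (w lam)).map unary := by
    simp [columns, constants, constData, widthOf]
  rw [this, uniformList_range]
  funext m
  rw [QM.bind_apply, QM.bind_apply, QM.lift_apply, QM.lift_apply, PMF.map_comp, PMF.bind_map, PMF.bind_map]
  rfl

theorem kgArg_eq (y : Data) (r : Fin (v lam)) (j : Fin (w lam)) (h : ¬ (r = i ∧ j = k)) :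
    kgArg (pair consts y)
      (ofList (List.ofFn (cells i k pk msk dummy r))) (unary j) =
    pair (unary lam) (pair (msk r j) y) := by
  have h1 : (cells i k pk msk dummy r j).snd = msk r j := by
    by_cases hr : r = i
    · subst hr
      have hj : j ≠ k := fun hj => h ⟨rfl, hj⟩
      simp [cells, update_of_ne hj]
    · simp [cells, update_of_ne hr]
  simp [kgArg, constants, constData, lamOf, h1]

theorem kgRow_eq [Nonempty (Fin (w lam))] (y : Data) (r : Fin (v lam)) (h : r ≠ i) :
    kgRow P (pair consts y)
      (ofList (List.ofFn (cells i k pk msk dummy r))) =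
    keyRow P ell msk y r >>= fun t => pure (QData.pair (pair (unary t.1) t.2.2).toQ
      (QData.pair (unary t.1).toQ t.2.1)) := by
  rw [kgRow, fst_pair, lift_columns_bind]
  simp only [keyRow, bind_assoc, pure_bind]
  refine congrArg _ (funext fun j => ?_)
  rw [kgArg_eq y r j fun h' => h h'.1]
  exact kernel_bind (msk r j) y fun a b => pure (QData.pair (pair (unary j) b).toQ
    (QData.pair (unary j).toQ a))

/-- The record of a key, for rows other than that of the outer instance. -/
def rowRecord (t : Fin (w lam) × QData × Data) : Data := pair (unary t.1) t.2.2

def rowPiece (t : Fin (w lam) × QData × Data) : QData := QData.pair (unary t.1).toQ t.2.1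

theorem kgFold_eq [Nonempty (Fin (w lam))] (y : Data) (b : Bool) (l : List (Fin (v lam)))
    (hl : ∀ r ∈ l, r ≠ i) (A B : List QData) :
    (l.map fun r => ofList (List.ofFn (cells i k pk msk dummy r))).foldlM (fun st row =>
      kgStep P b (pair consts y) row st)
        (QData.pair (QData.ofList A) (QData.ofList B)) =
    l.mapM (keyRow P ell msk y) >>= fun L =>
      pure (QData.pair (QData.ofList ((L.map fun t => (rowRecord t).toQ).reverse ++ A))
        (QData.ofList ((L.map fun t => if b then QData.pair QData.nil (rowPiece t)
          else rowPiece t).reverse ++ B))) := by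
  rw [List.foldlM_map]
  refine (List.foldlM_congr_mem (g := fun s r => keyRow P ell msk y r >>= fun t =>
    pure (QData.pair (QData.pair (rowRecord t).toQ s.fst) (QData.pair
      (if b then QData.pair QData.nil (rowPiece t) else rowPiece t) s.snd))) (fun s r hr => ?_) _).trans ?_
  · rw [kgStep, kgRow_eq y r (hl r hr)]
    simp only [bind_assoc, pure_bind, QData.fst_pair, QData.snd_pair, rowPiece, rowRecord]
  · rw [List.foldlM_eq_mapM (keyRow P ell msk y) (fun s t => QData.pair (QData.pair (rowRecord t).toQ s.fst)
      (QData.pair (if b then QData.pair QData.nil (rowPiece t) else rowPiece t) s.snd))]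
    simp only [foldl_pairs]

theorem tabOf_constants : (tabOf consts).toList =
    (List.ofFn fun r : Fin (v lam) => r).map fun r => ofList (List.ofFn (cells i k pk msk dummy r)) := by
  simp [tabOf, constants, constData, tableData, List.map_ofFn, Function.comp_def]

theorem rowOf_constants : rowOf consts = unary i := rfl

theorem colOf_constants : colOf consts = unary k := rfl

theorem kgPrefix_eq [Nonempty (Fin (w lam))] (y : Data) :
    kgPrefix P (pair consts y) =
    ((List.ofFn fun r : Fin (v lam) => r).take i).mapM (keyRow P ell msk y) >>= fun L =>
      pure (QData.pair (QData.ofList (L.map fun t => (rowRecord t).toQ).reverse)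
        (QData.ofList ((L.map fun t => QData.pair QData.nil (rowPiece t)).reverse ++
          [QData.pair tt.toQ QData.nil]))) := by
  have := kgFold_eq (P := P) (ell := ell) (q := q) (k := k) (pk := pk) (msk := msk) (dummy := dummy) y true
    ((List.ofFn fun r : Fin (v lam) => r).take i) (fun r hr => ne_of_mem_take hr) []
    [QData.pair tt.toQ QData.nil]
  simp only [List.append_nil, if_true] at this
  rw [kgPrefix, fst_pair, tabOf_constants, rowOf_constants, length_toList_unary, ← List.map_take]
  exact this

theorem kgSuffix_eq [Nonempty (Fin (w lam))] (y : Data) :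
    kgSuffix P (pair consts y) =
    ((List.ofFn fun r : Fin (v lam) => r).drop (i + 1)).mapM (keyRow P ell msk y) >>= fun L =>
      pure (QData.pair (QData.ofList (L.map fun t => (rowRecord t).toQ).reverse)
        (QData.ofList (L.map rowPiece).reverse)) := by
  have := kgFold_eq (P := P) (ell := ell) (q := q) (k := k) (pk := pk) (msk := msk) (dummy := dummy) y false
    ((List.ofFn fun r : Fin (v lam) => r).drop (i + 1)) (fun r hr => ne_of_mem_drop hr) [] []
  simp only [List.append_nil, Bool.false_eq_true, if_false] at this
  rw [kgSuffix, fst_pair, tabOf_constants, rowOf_constants, length_toList_unary, ← List.map_drop]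
  exact this

/-- The reduction stores the attribute of the challenge query as it was sent; the target, if there
is one, takes precedence. The decision algorithm is reliable on the resulting attribute since a
granted challenge lies in `X`. -/
theorem guard_kg (hYY : ∀ y, YY (pair (unary lam) y) ↔ y ∈ T.Y lam)
    (hRR : Decides RR T lam) {started : Bool} {target x chal : Option Data}
    {keys : List (Entry v w lam)} {log : List Data}
    (y : Data) (h4 : chal = x.map target.getD) (h6 : ∀ a ∈ chal, a ∈ T.X lam) :
    guard RR YY 1 (pair y (pair consts
      (varData (ofBool started) (optData target) (optData x) (keysData i k keys)
        (ofList log)))) = PMF.pure (ofBool (decide (started = true ∧ y ∈ T.Y lam ∧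
          (∀ e ∈ keys, e.1 ≠ y) ∧ ∀ a ∈ chal, ¬ T.R lam a y))) := by
  have e1 : (startedOf (varData (ofBool started) (optData target) (optData x) (keysData i k keys)
        (ofList log)) ≠ nil ∧ (∀ a ∈ (keysOf (varData (ofBool started) (optData target)
        (optData x) (keysData i k keys) (ofList log))).toList, ¬ a.fst = y) ∧
        YY (pair (lamOf consts) y)) ↔
      (started = true ∧ (∀ e ∈ keys, e.1 ≠ y) ∧ y ∈ T.Y lam) := by
    refine and_congr ?_ (and_congr ?_ (hYY y))
    · simp [startedOf, varData]
    · simp only [keysOf, varData, keysData, snd_pair, fst_pair, toList_ofList,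
        List.forall_mem_map, ne_eq]
  simp only [guard, fst_pair, snd_pair, e1]
  by_cases hc : started = true ∧ (∀ e ∈ keys, e.1 ≠ y) ∧ y ∈ T.Y lam
  · rw [if_pos hc]
    rcases x with - | x
    · refine (if_pos rfl).trans ?_
      rw [decide_eq_true]
      · rfl
      · rw [h4]
        exact ⟨hc.1, hc.2.2, hc.2.1, by simp⟩
    · refine (if_neg (by simp [chalOf, varData, optData])).trans ?_
      have e2 : attrOf (varData (ofBool started) (optData target) (optData (some x))
          (keysData i k keys) (ofList log)) (chalOf (varData (ofBool started)
          (optData target) (optData (some x)) (keysData i k keys) (ofList log))).fst =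
          target.getD x := by
        simp only [attrOf, targetOf, varData, chalOf, fst_pair, snd_pair]
        cases target <;> simp [optData, Data.fst]
      rw [e2]
      have hx : target.getD x ∈ T.X lam := h6 _ (by rw [h4]; rfl)
      refine PMF.eq_pure_of_support _ fun b hb => ?_
      obtain ⟨a, ha, rfl⟩ := (PMF.mem_support_map_iff _ _ _).1 hb
      have := hRR _ hx y hc.2.2 a ha
      congr 1
      rw [decide_eq_decide, h4]
      exact ⟨fun h => ⟨hc.1, hc.2.2, hc.2.1, fun a ha hr => by cases ha; exact this.2 hr h⟩,
        fun h => by_contra fun hn => h.2.2.2 _ rfl (this.1 hn)⟩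
  · rw [if_neg hc, decide_eq_false]
    · rfl
    · tauto

theorem ofBool_decide_ne {p : Prop} {_ : Decidable p} (h : p) : ofBool (decide p) ≠ nil := by
  rw [decide_eq_true h]
  simp [ofBool]

theorem ofBool_decide_eq {p : Prop} {_ : Decidable p} (h : ¬ p) : ofBool (decide p) = nil := by
  rw [decide_eq_false h]
  rfl

variable (i k) in
/-- The record of the row of the outer instance. -/
def rowRecord' (t : Fin (w lam) × QData × Data) : Data :=
  pair (unary t.1) (if t.1 = k then nil else t.2.2)

variable (i) in
theorem recordData_list (t : Fin (v lam) → Fin (w lam) × QData × Data) :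
    ((List.ofFn t).take i).map rowRecord ++ rowRecord' k (t i) ::
      ((List.ofFn t).drop (i + 1)).map rowRecord =
    List.ofFn (recordData i k (fun r => (t r).1, fun r => (t r).2.2)) := by
  have h := List.take_append_cons_drop_ofFn (fun r => rowRecord (t r)) i (rowRecord' k (t i))
  rw [show (List.ofFn fun r => rowRecord (t r)) = (List.ofFn t).map rowRecord by
    rw [List.map_ofFn]; rfl, ← List.map_take, ← List.map_drop] at h
  rw [h]
  congr 1
  funext r
  by_cases hr : r = i
  · subst hr
    simp [recordData, rowRecord']
  · simp [recordData, rowRecord, hr]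

/-- The frames act as follows: take `usk` out of `(usk, nil)`, put the column number to its left,
append the pieces of the rows below, prepend those of the rows above, and wrap the result as an
answer. -/
theorem kgAfter_eq [Nonempty (Fin (w lam))] (y : Data) (u b : Data) (L : List (Fin (w lam) × QData × Data))
    (j : Fin (w lam)) (rec : Data) (z : QData) :
    (kgAfter P (pair b (pair (pair y (pair consts u))
      (pair (QData.ofList (L.map fun t => (rowRecord t).toQ).reverse).erase
        (pair (unary j) rec)))) (QData.ofList ((L.map fun t => QData.pair QData.nil (rowPiece t)).reverse ++
          [QData.pair tt.toQ QData.nil])) >>= fun p => pure (p.snd.toList.foldl plugFrame z, p.fst)) =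
      ((List.ofFn fun r : Fin (v lam) => r).drop (i + 1)).mapM (keyRow P ell msk y) >>= fun L' =>
        pure (QData.pair (QData.ofList (L.map rowPiece ++ QData.pair (unary j).toQ z.fst ::
          L'.map rowPiece)) QData.nil, (addKey (pair consts u)
            (pair y (ofList (L.map rowRecord ++ pair (unary j) rec ::
              L'.map rowRecord)))).toQ) := by
  simp only [kgAfter, fst_pair, snd_pair]
  rw [kgSuffix_eq]
  simp only [bind_assoc, pure_bind, QData.fst_pair, QData.snd_pair]
  refine congrArg _ (funext fun L' => ?_)
  congr 2
  · have : (QData.ofList (L'.map rowPiece).reverse).toList.reverse = L'.map rowPiece := by simp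
    rw [this]
    have e1 : (pair nil (unary j)).toQ = QData.pair QData.nil (unary j).toQ := rfl
    have e2 : (tt.toQ : QData) = QData.pair QData.nil QData.nil := rfl
    have e3 : (L.map fun t => QData.pair QData.nil (rowPiece t)).reverse =
      (L.map rowPiece).reverse.map (QData.pair QData.nil) := by
        rw [← List.map_reverse, ← List.map_reverse, List.map_map]; rfl
    have e4 : ∀ a l, (QData.pair a l).toList = a :: l.toList := fun _ _ => rfl
    have e0 : ((Data.nil.pair tt).pair nil).toQ =
      QData.pair (pair nil (pair nil nil)).toQ QData.nil := rfl
    simp only [e4, List.foldl_cons, QData.toList_ofList, List.foldl_append, List.foldl_nil]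
    rw [e0, plugFrame_strip, e1, plugFrame_left, e2, plugFrame_right, e3, foldl_plugFrame_left]
    have := foldl_pair_ofList (L.map rowPiece).reverse (QData.pair (unary j).toQ z.fst :: L'.map rowPiece)
    rw [List.reverse_reverse] at this
    rw [← this, plugFrame_right]
    rfl
  · simp [kgEntry, List.map_reverse, Function.comp_def]

/-- In row `i` a fresh uniform column decides between the outer oracle (column `k`) and an own key.
Both give a key of the right instance, so the whole is one `keyRow` per row; only the place where
the verification key is kept differs. -/
theorem kg_accept [Nonempty (Fin (w lam))] (y u : Data)
    (o : ChalState (P.scheme ell) lam) (ho : o.started = true ∧ o.aborted = false ∧ y ∈ T.Y lam ∧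
      (∀ e ∈ o.keys, e.1 ≠ y) ∧ ∀ x ∈ o.challenged, ¬ T.R lam x y) :
    (kgBefore P (pair y (pair consts u)) >>= fun r =>
        (if r.fst.erase = nil then pure (r.snd.fst, o) else
          challenger (P.scheme ell) T sel (fun _ => 1) coin lam (pk i k) (msk i k) 1 r.snd.fst o) >>= fun a =>
          post P sel 1 (QData.pair (ofBool (decide (a.1.erase ≠ nil))).toQ r.snd.snd) >>=
            fun p => (pure (p.snd.toList.foldl plugFrame a.1, (p.fst, a.2)) :
              QM (QData × (QData × ChalState (P.scheme ell) lam)))) =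
      seqFin (keyRow P ell msk y) >>= fun t =>
        pure (QData.pair (QData.ofList (List.ofFn fun r => rowPiece (t r))) QData.nil,
          ((addKey (pair consts u) (pair y (ofList
            (List.ofFn (recordData i k (fun r => (t r).1, fun r => (t r).2.2)))))).toQ,
          if (t i).1 = k then { o with keys := (y, (t i).2.2, false) :: o.keys } else o)) := by
  refine Eq.trans ?_ ((mapM_take_cons_drop (fun r : Fin (v lam) => r) (keyRow P ell msk y) i
    (K := fun L t L' => pure (QData.pair (QData.ofList (L.map rowPiece ++ rowPiece t :: L'.map rowPiece))
        QData.nil, ((addKey (pair consts u)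
            (pair y (ofList (L.map rowRecord ++ rowRecord' k t :: L'.map rowRecord)))).toQ,
          if t.1 = k then { o with keys := (y, t.2.2, false) :: o.keys } else o)))).trans ?_)
  · rw [kgBefore]
    simp only [fst_pair, snd_pair]
    rw [kgPrefix_eq]
    simp only [bind_assoc, pure_bind]
    refine congrArg _ (funext fun L => ?_)
    rw [lift_columns_bind]
    rw [keyRow, bind_assoc]
    refine congrArg _ (funext fun j => ?_)
    simp only [QData.fst_pair, QData.snd_pair]
    by_cases hj : j = k
    · subst hj
      refine (congrArg (· >>= _) (if_pos rfl)).trans ?_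
      rw [pure_bind, reply_call _ _ _ _ _ _ _ (by simp)]
      have hch : challenger (P.scheme ell) T sel (fun _ => 1) coin lam (pk i j) (msk i j) 1 y.toQ o =
          (P.scheme ell).kg lam (msk i j) y >>= fun t => pure (QData.pair t.1 QData.nil,
            { o with keys := (y, t.2, false) :: o.keys }) := by
        refine (if_pos ?_).trans ?_
        · rw [erase_toQ]; exact ho
        · rw [erase_toQ]
      rw [hch, bind_assoc, bind_assoc]
      refine congrArg _ (funext fun t => ?_)
      rw [pure_bind, pure_bind]
      have := congrArg (· >>= fun r : QData × QData => (pure (r.1, (r.2,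
        ({ o with keys := (y, t.2, false) :: o.keys } : ChalState (P.scheme ell) lam))) : QM _))
        (kgAfter_eq (P := P) (ell := ell) (q := q) (i := i) (k := j) (pk := pk) (msk := msk) (dummy := dummy) y u
        (ofBool (decide ((QData.pair t.1 QData.nil).erase ≠ nil))) L j nil
        (QData.pair t.1 QData.nil))
      simp only [bind_assoc, pure_bind] at this
      refine Eq.trans this ?_
      refine congrArg _ (funext fun L' => ?_)
      simp only [rowRecord', rowPiece, if_true]
      rfl
    · refine (congrArg (· >>= _) (if_neg fun h => hj (Fin.ext (Data.unary_injective h)))).trans ?_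
      have hrow : (tabOf consts).toList.getD
          (rowOf consts).toList.length nil =
          ofList (List.ofFn (cells i k pk msk dummy i)) := by
        rw [tabOf_constants, rowOf_constants, length_toList_unary]
        simp [List.getD_eq_getElem?_getD]
      have h1 := kernel_bind (P := P) (ell := ell) (lam := lam) (msk i j) y fun a b => (pure (reply nil
        (QData.pair a QData.nil) (pair (pair y (pair consts u))
          (pair (QData.ofList (L.map fun t => (rowRecord t).toQ).reverse).erase
            (pair (unary j) b))) (QData.ofList ((L.map fun t =>
              QData.pair QData.nil (rowPiece t)).reverse ++ [QData.pair tt.toQ QData.nil]))) : QM QData)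
      rw [hrow, kgArg_eq y i j fun h => hj h.2]
      refine (congrArg (· >>= _) h1).trans ?_
      rw [bind_assoc, bind_assoc]
      refine congrArg _ (funext fun t => ?_)
      rw [pure_bind, pure_bind, reply_nil]
      have := congrArg (· >>= fun r : QData × QData => (pure (r.1, (r.2, o)) : QM _))
        (kgAfter_eq (P := P) (ell := ell) (q := q) (i := i) (k := k) (pk := pk) (msk := msk) (dummy := dummy) y u
        (ofBool (decide ((QData.pair t.1 QData.nil).erase ≠ nil))) L j t.2
        (QData.pair t.1 QData.nil))
      simp only [bind_assoc, pure_bind] at this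
      refine Eq.trans this ?_
      refine congrArg _ (funext fun L' => ?_)
      simp only [rowRecord', rowPiece, if_neg hj]
      rfl
  · refine congrArg _ (funext fun t => ?_)
    rw [recordData_list]
    congr 4
    rw [← List.map_cons, ← List.map_append, ← List.ofFn_eq_take_cons_drop, List.map_ofFn]
    rfl

theorem kg_rel (hYY : ∀ y, YY (pair (unary lam) y) ↔ y ∈ T.Y lam)
    (hRR : Decides RR T lam) (msg : QData) (st : QData × ChalState (P.scheme ell) lam)
    (h : ChalState (recorded (P.scheme ell) v w hw) lam) (m : QState)
    (ok : List ((recorded (P.scheme ell) v w hw).VK lam) → Prop) (encf)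
    (hst : Rel P hw T q i k pk msk dummy st h) :
    PMFRel (Good hw i k pk msk dummy P T q)
      (simulated 1 msg st m)
      (game (recorded (P.scheme ell) v w hw) T sel q lam ok encf pk msk 1 msg h m) := by
  have : Nonempty (Fin (w lam)) := ⟨k⟩
  obtain ⟨s, o⟩ := st
  obtain ⟨x, log, V, h1, h2, h0, h4, h5, h6, h7, h8, h9, h10⟩ := id hst
  dsimp only at h1 h2
  subst h1
  have hg := guard_kg (ell := ell) (q := q) (i := i) (k := k) (pk := pk) (msk := msk) (dummy := dummy)
    hYY hRR (started := h.started) (keys := h.keys) (log := log) msg.erase h4 h6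
  by_cases hc : h.started = true ∧ msg.erase ∈ T.Y lam ∧ (∀ e ∈ h.keys, e.1 ≠ msg.erase) ∧
      ∀ a ∈ h.challenged, ¬ T.R lam a msg.erase
  · have hgame : game (recorded (P.scheme ell) v w hw) T sel q lam ok encf pk msk 1 msg h =
        (recorded (P.scheme ell) v w hw).kg lam msk msg.erase >>= fun t => pure (QData.pair t.1 QData.nil,
          { h with keys := (msg.erase, t.2, false) :: h.keys }) :=
      if_pos ⟨hc.1, h0, hc.2⟩
    replace hgame := hgame.trans ((congrArg (· >>= _) (recorded_kg_eq hw msg.erase)).trans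
      ((bind_assoc _ _ _).trans (congrArg _ (funext fun t => pure_bind _ _))))
    have hacc := kg_accept (P := P) (ell := ell) (q := q) (i := i) (k := k) (pk := pk) (msk := msk)
      (dummy := dummy) (T := T) (sel := sel) coin msg.erase (varData (ofBool h.started)
        (optData h.target) (optData x) (keysData i k h.keys) (ofList log)) o (by
        rw [h2]
        refine ⟨hc.1, rfl, hc.2.1, fun e he => ?_, hc.2.2.2⟩
        obtain ⟨e', he', rfl⟩ := List.mem_map.1 he
        exact hc.2.2.1 _ (List.mem_of_mem_filter he'))
    rw [simOracle_accept _ _ hg (ofBool_decide_ne hc), hgame]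
    refine (congrArg (fun X => PMFRel _ (X m) _) hacc).mpr ?_
    refine (PMFRel.refl (seqFin (keyRow P ell msk msg.erase) m)).bind ?_
    rintro t _ rfl
    -- The status `V` of the new attribute is set to false, the initial status of the outer entry.
    -- Older entries keep theirs because the attribute is new.
    refine PMFRel.pure (Or.inl ⟨rfl, rfl, x, log, fun y => if y = msg.erase then false else V y, ?_, ?_, h0,
      h4, h5, h6, ?_, ?_, ?_, ?_⟩)
    · rfl
    · have e1 : (h.keys.filter fun e => decide (e.2.1.1 i = k)).map (fun e =>
          (e.1, e.2.1.2 i, if e.1 = msg.erase then false else V e.1)) = outerKeys i k V h.keys :=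
        List.map_congr_left fun e he => by
          rw [if_neg (hc.2.2.1 e (List.mem_of_mem_filter he))]
          rfl
      by_cases hk : (t.1 i).1 = k
      · refine (if_pos hk).trans ?_
        rw [h2, ← e1]
        refine congrArg (fun L => (⟨h.started, h.target, L, h.challenged, false⟩ :
          ChalState (P.scheme ell) lam)) ?_
        refine Eq.trans ?_ (congrArg (List.map fun e : Data × ((Fin (v lam) → Fin (w lam)) ×
          (Fin (v lam) → Data)) × Bool => (e.1, e.2.1.2 i, if e.1 = msg.erase then false else V e.1))
          (List.filter_cons_of_pos (by exact decide_eq_true hk)).symm)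
        exact congrArg (fun b => (msg.erase, (t.1 i).2.2, b) :: (h.keys.filter fun e =>
          decide (e.2.1.1 i = k)).map fun e => (e.1, e.2.1.2 i, if e.1 = msg.erase then false else V e.1))
          (if_pos rfl).symm
      · refine (if_neg hk).trans ?_
        rw [h2, ← e1]
        refine congrArg (fun L => (⟨h.started, h.target, L, h.challenged, false⟩ :
          ChalState (P.scheme ell) lam)) ?_
        exact congrArg (List.map fun e : Data × ((Fin (v lam) → Fin (w lam)) ×
          (Fin (v lam) → Data)) × Bool => (e.1, e.2.1.2 i, if e.1 = msg.erase then false else V e.1))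
          (List.filter_cons_of_neg (by simpa using hk)).symm
    · refine List.nodup_cons.2 ⟨fun hm => ?_, h7⟩
      obtain ⟨e, he, hee⟩ := List.mem_map.1 hm
      exact hc.2.2.1 e he hee
    · exact List.forall_mem_cons.2 ⟨hc.2.1, h8⟩
    · refine List.forall_mem_cons.2 ⟨fun h => absurd h (by simp), fun e he hd => ?_⟩
      exact (if_neg (hc.2.2.1 e he)).trans (h9 e he hd)
    · intro y
      rw [h10]
      refine Iff.trans ?_ (List.exists_mem_cons_iff _ _ _).symm
      exact ⟨Or.inr, fun hy => hy.resolve_left fun hy => absurd hy.2 (by simp)⟩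
  · rw [simOracle_refuse _ _ (hg.trans (congrArg PMF.pure (ofBool_decide_eq hc)))]
    have : game (recorded (P.scheme ell) v w hw) T sel q lam ok encf pk msk 1 msg h =
        pure (QData.nil, h) := if_neg fun h' => hc ⟨h'.1, h'.2.2⟩
    rw [this]
    exact PMFRel.pure (Or.inl ⟨rfl, rfl, hst⟩)

variable (ell) in
theorem vrfy_kernel_bind {β : Type} (x : Data) (u : QData) (f : Bool → QM β) :
    (P.vrfy.kernel (QData.pair (unary lam).toQ (QData.pair x.toQ u)) >>=
      fun r => f (decide (r.erase ≠ nil))) = (P.scheme ell).vrfy lam x u >>= f := by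
  funext m
  rw [QM.bind_apply, QM.bind_apply, Prog.kernel, PMF.bind_map]
  exact Eq.symm (PMF.bind_map _ _ _)

variable (P ell lam) in
/-- The verification of one piece. -/
def vrfyRow (p : Data × QData) : QM Bool := (P.scheme ell).vrfy lam p.1.snd p.2

/-- The running conjunction of verdicts can be separated from the verifications, since all of them
are executed whatever the verdicts are. -/
theorem vrfyFold_eq (y u : Data) (L : List Data) (b : Bool) (usk : QData) :
    L.foldlM (fun st rec => vrfyStep P (pair y (pair consts u)) rec st)
      (QData.pair (ofBool b).toQ usk) =
    (zipPieces L usk).mapM (vrfyRow P ell lam) >>= fun bs =>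
      pure (QData.pair (ofBool (b && bs.all id)).toQ (QData.snd^[L.length] usk)) := by
  induction L generalizing b usk with
  | nil => simp [zipPieces]
  | cons a L ih =>
    rw [List.foldlM_cons, zipPieces, List.mapM_cons, vrfyStep]
    simp only [QData.fst_pair, QData.snd_pair, bind_assoc, pure_bind]
    have h := vrfy_kernel_bind (P := P) (lam := lam) ell a.snd usk.fst.snd fun d =>
      L.foldlM (fun st rec => vrfyStep P (pair y (pair consts u)) rec st)
      (QData.pair (ofBool (b && d)).toQ usk.snd)
    refine Eq.trans ?_ (h.trans ?_)
    · refine congrArg _ (funext fun r => ?_)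
      congr 4
      exact decide_and_eq (Data.erase_ofBool_ne_nil b) decide_eq_true_iff.symm
    · refine congrArg _ (funext fun d => ?_)
      rw [ih]
      refine congrArg _ (funext fun bs => ?_)
      simp [Bool.and_assoc]

variable (i k) in
/-- The records of a key, with all verification keys. -/
def fullRecord (vk : (Fin (v lam) → Fin (w lam)) × (Fin (v lam) → Data)) (r : Fin (v lam)) : Data :=
  pair (unary (vk.1 r)) (vk.2 r)

theorem recordData_eq_update (vk : (Fin (v lam) → Fin (w lam)) × (Fin (v lam) → Data)) :
    recordData i k vk = update (fullRecord vk) i (recordData i k vk i) := by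
  funext r
  by_cases hr : r = i
  · subst hr; simp
  · simp [recordData, fullRecord, hr]

theorem all_take_drop {n : ℕ} (t : Fin n → Bool) (i : Fin n) {_ : Decidable (∀ r, t r = true)} :
    ((true && ((List.ofFn t).take i).all id && t i) && ((List.ofFn t).drop (i + 1)).all id) =
      decide (∀ r, t r = true) := by
  rw [Bool.true_and, Bool.and_assoc]
  have h : (((List.ofFn t).take i).all id && (t i && ((List.ofFn t).drop (i + 1)).all id)) =
      (List.ofFn t).all id := by
    conv_rhs => rw [List.ofFn_eq_take_cons_drop t i]
    simp
  rw [h, Bool.eq_iff_iff, decide_eq_true_iff, List.all_eq_true, List.forall_mem_ofFn_iff]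
  rfl

theorem vrfyAfter_eq (y : Data) (msg u : Data) (b : Bool) (c : Data) (d : Bool) (hy : msg.fst = y) (hc : c ≠ nil ↔ d = true)
    (usk : QData) (vk : (Fin (v lam) → Fin (w lam)) × (Fin (v lam) → Data)) (z : QData)
    (hrec : recordsOf (pair msg (pair consts u)) =
      ofList (List.ofFn (recordData i k vk))) :
    (vrfyAfter P (pair c (pair (pair msg
      (pair consts u)) (ofBool b))) (QData.snd^[i + 1] usk) >>= fun p =>
        pure (p.snd.toList.foldl plugFrame z, p.fst)) =
    ((List.ofFn fun r => (fullRecord vk r, (usk.get r).snd)).drop (i + 1)).mapM (vrfyRow P ell lam) >>= fun L =>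
      pure ((ofBool ((b && d) && L.all id)).toQ, (addLog (pair consts u)
        y (ofBool ((b && d) && L.all id))).toQ) := by
  rw [vrfyAfter, show (decide ((pair c (pair (pair msg
      (pair consts u)) (ofBool b))).snd.snd ≠ nil ∧
      (pair c (pair (pair msg
      (pair consts u)) (ofBool b))).fst ≠ nil)) = (b && d) from
    decide_and_eq (Data.ofBool_ne_nil b) hc]
  simp only [fst_pair, snd_pair, hy]
  rw [hrec, rowOf_constants, length_toList_unary, toList_ofList, recordData_eq_update,
    List.drop_ofFn_update, vrfyFold_eq (ell := ell), zipPieces_drop, zipPieces_ofFn]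
  simp only [bind_assoc, pure_bind, QData.fst_pair, QData.snd_pair]
  refine congrArg _ (funext fun L => ?_)
  generalize ofBool ((b && d) && L.all id) = f
  rw [erase_toQ]
  refine congrArg (fun z => pure (z, _)) ?_
  exact plugFrame_replace z f.toQ |>.trans (by rw [erase_toQ])

/-- Row `i` is verified by the outer oracle if the key belongs to the outer instance, and otherwise
with the recorded verification key. In both cases this is the verification of the scheme; in the
first one the verdict on row `i` is also noted by the outer challenger. -/
theorem vrfy_accept (y : Data) (msg : QData) (u : Data) (hy : msg.erase.fst = y)
    (o : ChalState (P.scheme ell) lam) (ho : o.started = true ∧ o.aborted = false)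
    (vk : (Fin (v lam) → Fin (w lam)) × (Fin (v lam) → Data))
    (hrec : recordsOf (pair msg.erase (pair consts u)) =
      ofList (List.ofFn (recordData i k vk)))
    (hfind : vk.1 i = k → ∃ b, o.keys.find? (fun e => decide (e.1 = y)) = some (y, vk.2 i, b)) :
    (vrfyBefore P (pair msg.erase (pair consts u)) msg >>= fun r =>
        (if r.fst.erase = nil then pure (r.snd.fst, o) else
          challenger (P.scheme ell) T sel (fun _ => 1) coin lam (pk i k) (msk i k) 2 r.snd.fst o) >>= fun a =>
          post P sel 2 (QData.pair (ofBool (decide (a.1.erase ≠ nil))).toQ r.snd.snd) >>=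
            fun p => (pure (p.snd.toList.foldl plugFrame a.1, (p.fst, a.2)) :
              QM (QData × (QData × ChalState (P.scheme ell) lam)))) =
      seqFin (fun r => (P.scheme ell).vrfy lam (vk.2 r) (msg.snd.get r).snd) >>= fun t =>
        pure ((ofBool (decide (∀ r, t r = true))).toQ,
          ((addLog (pair consts u) y
            (ofBool (decide (∀ r, t r = true)))).toQ,
          if vk.1 i = k then { o with keys := o.keys.map fun e' =>
            if e'.1 = y then (e'.1, e'.2.1, e'.2.2 || t i) else e' } else o)) := by
  refine Eq.trans ?_ ((mapM_take_cons_drop (fun r : Fin (v lam) => (fullRecord vk r, (msg.snd.get r).snd))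
    (vrfyRow P ell lam) i (K := fun L b L' => pure ((ofBool (((true && L.all id) && b) && L'.all id)).toQ,
      ((addLog (pair consts u) y
        (ofBool (((true && L.all id) && b) && L'.all id))).toQ,
      if vk.1 i = k then { o with keys := o.keys.map fun e' =>
            if e'.1 = y then (e'.1, e'.2.1, e'.2.2 || b) else e' } else o)))).trans ?_)
  · have hpre : ((recordsOf (pair msg.erase (pair consts u))).toList.take
        (rowOf consts).toList.length).foldlM (fun st rec => vrfyStep P
          (pair msg.erase (pair consts u)) rec st)
        (QData.pair tt.toQ msg.snd) = ((List.ofFn fun r : Fin (v lam) =>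
          (fullRecord vk r, (msg.snd.get r).snd)).take i).mapM (vrfyRow P ell lam) >>= fun bs =>
      pure (QData.pair (ofBool (true && bs.all id)).toQ (QData.snd^[i] msg.snd)) := by
      rw [hrec, toList_ofList, rowOf_constants, length_toList_unary, recordData_eq_update,
        List.take_ofFn_update,
        show QData.pair tt.toQ msg.snd = QData.pair (ofBool true).toQ msg.snd from rfl,
        vrfyFold_eq (ell := ell), zipPieces_take, zipPieces_ofFn]
      simp
    have hrow : (recordsOf (pair msg.erase (pair consts u))).toList.getD
          (rowOf consts).toList.length nil = recordData i k vk i := by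
      rw [hrec, toList_ofList, rowOf_constants, length_toList_unary]
      simp [List.getD_eq_getElem?_getD]
    rw [vrfyBefore]
    refine (congrArg (· >>= _) (congrArg (· >>= _) hpre)).trans ?_
    simp only [bind_assoc, pure_bind]
    refine congrArg _ (funext fun L => ?_)
    by_cases hk : vk.1 i = k
    · refine (congrArg (· >>= _) (if_pos ?_)).trans ?_
      · exact (congrArg Data.fst hrow).trans (by simp only [recordData, fst_pair, hk]; rfl)
      rw [pure_bind, reply_call _ _ _ _ _ _ _ (by simp)]
      obtain ⟨b, hb⟩ := hfind hk
      have hch : ∀ X, challenger (P.scheme ell) T sel (fun _ => 1) coin lam (pk i k) (msk i k) 2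
          (QData.pair msg.erase.fst.toQ X) o = (P.scheme ell).vrfy lam (vk.2 i) X >>= fun d =>
            pure ((ofBool d).toQ, { o with keys := o.keys.map fun e' =>
              if e'.1 = y then (e'.1, e'.2.1, e'.2.2 || d) else e' }) := by
        intro X
        refine (if_pos ho).trans ?_
        simp only [QData.fst_pair, QData.snd_pair, erase_toQ, hy, hb]
      refine ((congrArg (· >>= _) (hch _)).trans (bind_assoc _ _ _)).trans ?_
      have hrow2 : vrfyRow P ell lam (fullRecord vk i, (msg.snd.get i).snd) =
          (P.scheme ell).vrfy lam (vk.2 i) (QData.pair (ofBool (true && L.all id)).toQ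
            (QData.snd^[i] msg.snd)).snd.fst.snd := by
        rw [vrfyRow, QData.get_eq_iterate]
        rfl
      rw [hrow2]
      refine congrArg _ (funext fun d => ?_)
      rw [pure_bind]
      have := congrArg (· >>= fun r : QData × QData => (pure (r.1, (r.2, ({ o with keys := o.keys.map fun e' =>
          if e'.1 = y then (e'.1, e'.2.1, e'.2.2 || d) else e' } : ChalState (P.scheme ell) lam))) : QM _))
        (vrfyAfter_eq (P := P) (ell := ell) (q := q) (i := i) (k := k) (pk := pk) (msk := msk) (dummy := dummy) y
          msg.erase u (true && L.all id) (ofBool (decide ((ofBool d).toQ.erase ≠ nil))) d hy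
          (by cases d <;> simp [ofBool]) msg.snd vk (ofBool d).toQ hrec)
      simp only [bind_assoc, pure_bind, Function.iterate_succ_apply'] at this
      simp only [if_pos hk]
      rw [QData.fst_pair, QData.snd_pair, erase_toQ (ofBool (true && L.all id))]
      exact this
    · refine (congrArg (· >>= _) (if_neg fun h => hk ?_)).trans ?_
      · have := ((congrArg Data.fst hrow).symm.trans h)
        simp only [recordData, fst_pair] at this
        exact Fin.ext (Data.unary_injective this)
      have h1 := vrfy_kernel_bind (P := P) (lam := lam) ell (vk.2 i) (msg.snd.get i).snd fun d =>
        ((List.ofFn fun r => (fullRecord vk r, (msg.snd.get r).snd)).drop (i + 1)).mapM (vrfyRow P ell lam) >>=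
          fun L' => (pure ((ofBool (((true && L.all id) && d) && L'.all id)).toQ,
            ((addLog (pair consts u)
              y (ofBool (((true && L.all id) && d) && L'.all id))).toQ, o)) :
                QM (QData × (QData × ChalState (P.scheme ell) lam)))
      have hr : recordData i k vk i = fullRecord vk i := by simp [recordData, fullRecord, hk]
      rw [bind_assoc]
      refine Eq.trans ?_ (h1.trans ?_)
      · have hrow3 : ∀ X : QData, P.vrfy.kernel (QData.pair (lamOf consts).toQ
            (QData.pair ((recordsOf (pair msg.erase (pair consts
              u))).toList.getD (rowOf consts).toList.length nil).snd.toQ X)) =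
            P.vrfy.kernel (QData.pair (unary lam).toQ (QData.pair (vk.2 i).toQ X)) := by
          intro X
          rw [hrow, hr]
          rfl
        refine (congrArg (· >>= _) ((hrow3 _).trans (by rw [QData.snd_pair, ← QData.get_eq_iterate]))).trans ?_
        refine congrArg _ (funext fun r => ?_)
        rw [pure_bind, reply_nil]
        have := congrArg (· >>= fun r : QData × QData => (pure (r.1, (r.2, o)) : QM _))
          (vrfyAfter_eq (P := P) (ell := ell) (q := q) (i := i) (k := k) (pk := pk) (msk := msk) (dummy := dummy) y
            msg.erase u (true && L.all id) (ofBool (decide (r.erase ≠ nil))) (decide (r.erase ≠ nil)) hy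
            (Data.ofBool_ne_nil _) msg.snd vk r hrec)
        simp only [bind_assoc, pure_bind, Function.iterate_succ_apply'] at this
        rw [QData.fst_pair, QData.snd_pair, erase_toQ (ofBool (true && L.all id))]
        exact this
      · simp only [if_neg hk]
        rfl
  · refine congrArg _ (funext fun t => ?_)
    rw [all_take_drop]

theorem entryOf_eq {y u : Data} {msg : Data} (hy : msg.fst = y)
    {keys : List (Entry v w lam)}
    (hu : keysOf u = keysData i k keys) :
    entryOf (pair msg (pair consts u)) =
      (keys.find? fun e => decide (e.1 = y)).elim nil fun e => pair (pair e.1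
        (ofList (List.ofFn (recordData i k e.2.1)))) nil := by
  simp only [entryOf, fst_pair, snd_pair, hu, hy, keysData, toList_ofList, List.find?_map]
  simp only [Function.comp_def, fst_pair]
  rw [Option.elim_map]
  congr!

theorem outerKeys_find {y : Data} {V : Data → Bool}
    {keys : List (Entry v w lam)}
    {e : Data × ((Fin (v lam) → Fin (w lam)) × (Fin (v lam) → Data)) × Bool}
    (hn : (keys.map Prod.fst).Nodup) (he : keys.find? (fun e => decide (e.1 = y)) = some e)
    (hk : e.2.1.1 i = k) :
    (outerKeys i k V keys).find? (fun e => decide (e.1 = y)) = some (y, e.2.1.2 i, V y) := by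
  have hey : e.1 = y := by simpa using List.find?_some he
  rw [outerKeys, List.find?_map, List.find?_filter]
  have : (keys.find? fun a => decide (decide (a.2.1.1 i = k) = true ∧ ((fun e : Data × Data × Bool =>
      decide (e.1 = y)) ∘ fun e => (e.1, e.2.1.2 i, V e.1)) a = true)) = some e := by
    obtain ⟨-, as, bs, rfl, has⟩ := List.find?_eq_some_iff_append.1 he
    refine List.find?_eq_some_iff_append.2 ⟨by simp [hk, hey], as, bs, rfl, fun a ha => ?_⟩
    have := has a ha
    simp only [Bool.not_eq_true', decide_eq_false_iff_not, Function.comp] at this ⊢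
    simp [this]
  rw [this]
  simp [hey]

/-- The entry of a key after a verification query on `y`. -/
def markKey {α : Type} (y : Data) (d : Bool) (e : Data × α × Bool) : Data × α × Bool :=
  if e.1 = y then (e.1, e.2.1, e.2.2 || d) else e

theorem markKey_fst {α : Type} (y : Data) (d : Bool) (e : Data × α × Bool) : (markKey y d e).1 = e.1 := by
  rw [markKey]; split <;> rfl

theorem markKey_snd {α : Type} (y : Data) (d : Bool) (e : Data × α × Bool) :
    (markKey y d e).2.1 = e.2.1 := by
  rw [markKey]; split <;> rfl

theorem markKey_status {α : Type} (y : Data) (d : Bool) (e : Data × α × Bool) :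
    (markKey y d e).2.2 = true ↔ e.2.2 = true ∨ e.1 = y ∧ d = true := by
  rw [markKey]
  split
  · rename_i h
    simp [h]
  · rename_i h
    simp [h]

theorem keysData_markKey (y : Data) (d : Bool)
    (keys : List (Entry v w lam)) :
    keysData i k (keys.map (markKey y d)) = keysData i k keys := by
  rw [keysData, keysData, List.map_map]
  congr 1
  refine List.map_congr_left fun e _ => ?_
  rw [Function.comp, markKey_fst, markKey_snd]

/-- Attributes in the list of keys are distinct, so a verification query on `y` affects the outer
list only if the single key for `y` belongs to the outer instance. -/
theorem outerKeys_markKey (y : Data) (d b : Bool) (V : Data → Bool)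
    {keys : List (Entry v w lam)}
    {e : Data × ((Fin (v lam) → Fin (w lam)) × (Fin (v lam) → Data)) × Bool}
    (hn : (keys.map Prod.fst).Nodup) (he : e ∈ keys) (hey : e.1 = y) :
    outerKeys i k (fun a => if a = y then V a || b else V a) (keys.map (markKey y d)) =
      if e.2.1.1 i = k then (outerKeys i k V keys).map (markKey y b) else outerKeys i k V keys := by
  have h1 : outerKeys i k (fun a => if a = y then V a || b else V a) (keys.map (markKey y d)) =
      (keys.filter fun e => decide (e.2.1.1 i = k)).map fun e => (e.1, e.2.1.2 i,
        if e.1 = y then V e.1 || b else V e.1) := by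
    rw [outerKeys, List.filter_map, List.map_map]
    simp only [Function.comp_def, markKey_fst, markKey_snd]
  rw [h1]
  split
  · rw [outerKeys, List.map_map]
    refine List.map_congr_left fun e' _ => ?_
    simp only [Function.comp, markKey]
    split <;> rfl
  · rename_i hk
    refine List.map_congr_left fun e' he' => ?_
    have hne : e'.1 ≠ y := fun h => hk (by
      rw [List.inj_on_of_nodup_map hn he (List.mem_of_mem_filter he') (hey.trans h.symm)]
      simpa using List.of_mem_filter he')
    rw [if_neg hne]

theorem addLog_true (c a b x kd y : Data) (log : List Data) :
    addLog (pair c (varData a b x kd (ofList log))) y (ofBool true) =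
      pair c (varData a b x kd (ofList (y :: log))) := by
  simp [addLog, varData, startedOf, targetOf, chalOf, keysOf, logOf, ofBool, ofList]

theorem addLog_false (c a b x kd y : Data) (log : List Data) :
    addLog (pair c (varData a b x kd (ofList log))) y (ofBool false) =
      pair c (varData a b x kd (ofList log)) := by
  simp [addLog, varData, startedOf, targetOf, chalOf, keysOf, logOf, ofBool]

theorem vrfy_rel (msg : QData) (st : QData × ChalState (P.scheme ell) lam)
    (h : ChalState (recorded (P.scheme ell) v w hw) lam) (m : QState)
    (ok : List ((recorded (P.scheme ell) v w hw).VK lam) → Prop) (encf)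
    (hst : Rel P hw T q i k pk msk dummy st h) :
    PMFRel (Good hw i k pk msk dummy P T q)
      (simulated 2 msg st m)
      (game (recorded (P.scheme ell) v w hw) T sel q lam ok encf pk msk 2 msg h m) := by
  obtain ⟨s, o⟩ := st
  obtain ⟨x, log, V, h1, h2, h0, h4, h5, h6, h7, h8, h9, h10⟩ := id hst
  dsimp only at h1 h2
  subst h1
  have hent := entryOf_eq (ell := ell) (q := q) (i := i) (k := k) (pk := pk) (msk := msk) (dummy := dummy)
    (msg := msg.erase) (keys := h.keys) (u := varData (ofBool h.started)
        (optData h.target) (optData x) (keysData i k h.keys) (ofList log)) rfl rfl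
  have hg : guard RR YY 2 (pair msg.erase (pair consts
      (varData (ofBool h.started)
        (optData h.target) (optData x) (keysData i k h.keys) (ofList log)))) = PMF.pure (ofBool
      (h.started && (h.keys.find? fun e => decide (e.1 = msg.erase.fst)).isSome)) := by
    refine congrArg (fun b => PMF.pure (ofBool b)) (decide_and_eq (Data.ofBool_ne_nil _) ?_)
    have hne : ∀ o : Option (Entry v w lam),
        (o.elim nil fun e => pair (pair e.1 (ofList (List.ofFn (recordData i k e.2.1))))
          nil) ≠ nil ↔ o.isSome = true := by
      intro o
      cases o <;> simp
    exact (not_congr (Eq.congr_left hent)).trans (hne _)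
  by_cases hs : h.started = true
  · rcases hf : h.keys.find? (fun e => decide (e.1 = msg.erase.fst)) with - | e
    · rw [simOracle_refuse _ _ (hg.trans (by rw [hf, Option.isSome_none, Bool.and_false]; rfl))]
      have : game (recorded (P.scheme ell) v w hw) T sel q lam ok encf pk msk 2 msg h =
          pure (QData.nil, h) := by
        refine (if_pos ⟨hs, h0⟩).trans ?_
        rw [QData.erase_fst, hf]
      rw [this]
      exact PMFRel.pure (Or.inl ⟨rfl, rfl, hst⟩)
    · have hey : e.1 = msg.erase.fst := by simpa using List.find?_some hf
      have hek := List.mem_of_find?_eq_some hf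
      have hgame : game (recorded (P.scheme ell) v w hw) T sel q lam ok encf pk msk 2 msg h =
          seqFin (fun r => (P.scheme ell).vrfy lam (e.2.1.2 r) (msg.snd.get r).snd) >>= fun t =>
          pure ((ofBool (decide (∀ r, t r = true))).toQ, { h with keys := h.keys.map fun e' =>
            if e'.1 = msg.erase.fst then (e'.1, e'.2.1, e'.2.2 || decide (∀ r, t r = true)) else e' }) := by
        refine (if_pos ⟨hs, h0⟩).trans ?_
        rw [QData.erase_fst, hf]
        refine (bind_assoc _ _ _).trans (congrArg _ (funext fun t => ?_))
        exact pure_bind _ _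
      have hacc := vrfy_accept (P := P) (ell := ell) (q := q) (i := i) (k := k) (pk := pk) (msk := msk)
        (dummy := dummy) (T := T) (sel := sel) coin msg.erase.fst msg (varData (ofBool h.started)
        (optData h.target) (optData x) (keysData i k h.keys) (ofList log)) rfl o (by
        rw [h2]; exact ⟨hs, rfl⟩) e.2.1 (congrArg (fun d : Data => d.fst.snd)
          (hent.trans (congrArg (fun o : Option (Entry v w lam) =>
            o.elim nil fun e => pair (pair e.1 (ofList (List.ofFn (recordData i k e.2.1))))
              nil) hf)))
        (fun hk => ⟨V msg.erase.fst, by rw [h2]; exact outerKeys_find h7 hf hk⟩)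
      rw [simOracle_accept _ _ hg (by rw [hf, hs]; simp [ofBool]), hgame]
      refine (congrArg (fun X => PMFRel _ (X m) _) hacc).mpr ?_
      refine (PMFRel.refl (seqFin (fun r => (P.scheme ell).vrfy lam (e.2.1.2 r) (msg.snd.get r).snd) m)).bind ?_
      rintro ⟨t, m'⟩ _ rfl
      -- `V` collects the verdicts on row `i` for every key, also for keys outside the outer
      -- instance, where it is not consulted. The log grows only if all rows accept.
      refine PMFRel.pure (Or.inl ⟨rfl, rfl, x, if ∀ r, t r = true then msg.erase.fst :: log else log,
        fun a => if a = msg.erase.fst then V a || t i else V a, ?_, ?_, h0, h4, h5, h6, ?_, ?_, ?_, ?_⟩)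
      · have e1 := keysData_markKey (i := i) (k := k) msg.erase.fst (decide (∀ r, t r = true)) h.keys
        refine congrArg Data.toQ ?_
        refine Eq.trans ?_ (congrArg (fun K => pair consts
          (varData (ofBool h.started) (optData h.target) (optData x) K _)) e1.symm)
        by_cases ht : ∀ r, t r = true
        · rw [decide_eq_true ht, if_pos ht]
          exact addLog_true _ _ _ _ _ _ _
        · rw [decide_eq_false ht, if_neg ht]
          exact addLog_false _ _ _ _ _ _ _
      · have := outerKeys_markKey (i := i) (k := k) msg.erase.fst (decide (∀ r, t r = true)) (t i) V h7 hek hey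
        refine Eq.trans ?_ (congrArg (fun L => (⟨h.started, h.target, L, h.challenged, false⟩ :
          ChalState (P.scheme ell) lam)) this.symm)
        by_cases hk : e.2.1.1 i = k
        · refine (if_pos hk).trans ?_
          rw [if_pos hk, h2]
          rfl
        · refine (if_neg hk).trans ?_
          rw [if_neg hk, h2]
      · refine (congrArg List.Nodup ?_).mpr h7
        refine (List.map_map).trans (List.map_congr_left fun e' _ => ?_)
        exact markKey_fst _ _ e'
      · intro e' he'
        obtain ⟨e0, he0, rfl⟩ := List.mem_map.1 he'
        exact (congrArg (· ∈ T.Y lam) (markKey_fst _ _ e0)).mpr (h8 e0 he0)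
      · intro e' he' hd
        obtain ⟨e0, he0, rfl⟩ := List.mem_map.1 he'
        have hd' := (markKey_status _ _ e0).1 hd
        refine (congrArg (fun a => (if a = msg.erase.fst then V a || t i else V a) = true)
          (markKey_fst _ _ e0)).mpr ?_
        split
        · rcases hd' with hd' | ⟨-, hd'⟩
          · rw [h9 e0 he0 hd', Bool.true_or]
          · rw [(decide_eq_true_iff.1 hd') i, Bool.or_true]
        · rename_i hne
          exact h9 e0 he0 (hd'.resolve_right fun h' => hne h'.1)
      · intro a
        have e1 : (∃ e' ∈ h.keys.map (markKey msg.erase.fst (decide (∀ r, t r = true))),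
            e'.1 = a ∧ e'.2.2 = true) ↔ ((∃ e ∈ h.keys, e.1 = a ∧ e.2.2 = true) ∨
              msg.erase.fst = a ∧ ∀ r, t r = true) := by
          constructor
          · rintro ⟨e', he', rfl, hd⟩
            obtain ⟨e0, he0, rfl⟩ := List.mem_map.1 he'
            rw [markKey_fst]
            rcases (markKey_status _ _ e0).1 hd with hd' | ⟨h', hd'⟩
            · exact Or.inl ⟨e0, he0, rfl, hd'⟩
            · exact Or.inr ⟨h'.symm, decide_eq_true_iff.1 hd'⟩
          · rintro (⟨e0, he0, rfl, hd⟩ | ⟨rfl, ht⟩)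
            · exact ⟨_, List.mem_map_of_mem he0, markKey_fst _ _ _, (markKey_status _ _ e0).2 (Or.inl hd)⟩
            · exact ⟨_, List.mem_map_of_mem hek, (markKey_fst _ _ _).trans hey,
                (markKey_status _ _ e).2 (Or.inr ⟨hey, decide_eq_true ht⟩)⟩
        refine Iff.trans ?_ e1.symm
        rw [← h10]
        split
        · rename_i ht
          simp only [List.mem_cons, ht, implies_true, and_true]
          exact or_comm.trans (or_congr Iff.rfl eq_comm)
        · rename_i ht
          exact ⟨Or.inl, fun h' => h'.resolve_right fun h' => ht h'.2⟩
  · rw [simOracle_refuse _ _ (hg.trans (by rw [Bool.eq_false_iff.2 hs]; rfl))]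
    have : game (recorded (P.scheme ell) v w hw) T sel q lam ok encf pk msk 2 msg h =
        pure (QData.nil, h) := if_neg fun h' => hs h'.1
    rw [this]
    exact PMFRel.pure (Or.inl ⟨rfl, rfl, hst⟩)

theorem ellOf_constants : (ellOf consts).toList.length = ell lam := by
  simp [ellOf, constants, constData]

theorem rowsOf_constants : rowsOf consts = Data.range (v lam) := by
  simp [rowsOf, tabOf_constants]

theorem columns_constants : columns consts = Data.range (w lam) := by
  simp [columns, widthOf, constants, constData]

/-- Shares as data. -/
def sharesData {l n : ℕ} (μ : Fin n → Msg l) : Data := ofList (List.ofFn fun r => (μ r).encode)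

theorem randomShares_eq (msg u : Data) :
    randomShares (pair msg (pair consts u)) =
      (PMF.uniformOfFintype (Fin (v lam) → Msg (ell lam))).map sharesData := by
  simp only [randomShares, fst_pair, snd_pair, ellOf_constants, rowsOf_constants, PMF.mapM_range,
    PMF.map_comp, randomMsg_eq]
  rw [PMF.seqFin_map, ← uniformOfFintype_pi, PMF.map_comp]
  rfl

/-- The list contains the share of row `i` twice, once in front and once among all shares. This is
the summand `μ i` in `hiddenShares`, so the dependent share is recovered. -/
theorem hiddenMsg_eq (msg u : Data) (μ : Fin (v lam) → Msg (ell lam)) (m : Msg (ell lam)) :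
    hiddenMsg (pair msg (pair consts u)) (sharesData μ) m.encode =
      (hiddenShares i μ m i).encode := by
  have h : xorData (ell lam) ((μ i :: m :: List.ofFn μ).map Msg.encode) = (hiddenShares i μ m i).encode := by
    rw [xorData_encode, hiddenShares, if_pos rfl, List.sum_cons, List.sum_cons, List.sum_ofFn]
    congr 1
    abel
  rw [← h, hiddenMsg, snd_pair, fst_pair, ellOf_constants, rowOf_constants, length_toList_unary,
    sharesData, toList_ofList]
  simp [List.getD_eq_getElem?_getD, List.map_ofFn, Function.comp_def]

theorem encTable_eq (e μ : Data) (hc : e.snd.fst = consts) :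
    encTable P e μ = (seqFin fun r : Fin (v lam) => seqFin fun j : Fin (w lam) =>
      P.enc.result (encArg e μ (unary r) (unary j))).map tableData := by
  simp only [encTable, hc, rowsOf_constants, columns_constants, PMF.mapM_range, PMF.map_comp]
  rw [PMF.seqFin_map, PMF.map_comp]
  rfl

/-- Away from the outer cell the ciphertext does not depend on the coin: the hybrids with boundaries
`k` and `k + 1` differ in column `k` of row `i` only. -/
theorem encArg_eq (msg u : Data) (X : Data) (hX : attrOf u msg.fst = X) (M₀ M₁ : Msg (ell lam))
    (h₀ : M₀.encode = msg.snd.fst) (h₁ : M₁.encode = msg.snd.snd) (μ : Fin (v lam) → Msg (ell lam)) (r : Fin (v lam))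
    (j : Fin (w lam)) (hrj : ¬ (r = i ∧ j = k)) :
    P.enc.result (encArg (pair msg
      (pair consts u)) (sharesData μ) (unary r) (unary j)) =
    (P.scheme ell).enc lam (pk r j) X (hiddenShares i μ
      (if (j : ℕ) < (k : ℕ) + (if coin then 1 else 0) then M₁ else M₀) r) := by
  have hcell : (cells i k pk msk dummy r j).fst = pk r j := by
    by_cases hr : r = i
    · subst hr
      have hj : j ≠ k := fun hj => hrj ⟨rfl, hj⟩
      simp [cells, update_of_ne hj]
    · simp [cells, update_of_ne hr]
  have hshare : shareOf (pair msg
      (pair consts u)) (sharesData μ) (unary r) (unary j) =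
      (hiddenShares i μ (if (j : ℕ) < (k : ℕ) + (if coin then 1 else 0) then M₁ else M₀) r).encode := by
    rw [shareOf]
    by_cases hr : r = i
    · subst hr
      have hj : (j : ℕ) ≠ k := fun hj => hrj ⟨rfl, Fin.ext hj⟩
      -- Moving the boundary by one matters only for `j = k`, which is excluded.
      have e1 : ((j : ℕ) < (k : ℕ) + (if coin then 1 else 0)) ↔ (j : ℕ) < k := by
        split <;> omega
      refine (if_pos rfl).trans ?_
      simp only [e1, snd_pair, fst_pair, colOf_constants, length_toList_unary, ← h₀, ← h₁,
        hiddenMsg_eq]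
      split <;> rfl
    · refine (if_neg fun h => hr (Fin.ext (Data.unary_injective h))).trans ?_
      simp [hiddenShares, hr, sharesData, List.getD_eq_getElem?_getD]
  have harg : encArg (pair msg
      (pair consts u)) (sharesData μ) (unary r) (unary j) =
      pair (unary lam) (pair (pk r j) (pair X (hiddenShares i μ
      (if (j : ℕ) < (k : ℕ) + (if coin then 1 else 0) then M₁ else M₀) r).encode)) := by
    rw [encArg, hshare]
    simp only [snd_pair, fst_pair, hX, tabOf_constants, length_toList_unary]
    simp [List.getD_eq_getElem?_getD, hcell, lamOf, constants, constData]
  rw [harg]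
  rfl

theorem encData_eq (msg u : Data) (M₀ M₁ : Msg (ell lam))
    (h₀ : M₀.encode = msg.snd.fst) (h₁ : M₁.encode = msg.snd.snd) :
    encData P (pair msg (pair consts u)) =
      (PMF.uniformOfFintype (Fin (v lam) → Msg (ell lam))).bind fun μ =>
        (seqFin fun r : Fin (v lam) => seqFin fun j : Fin (w lam) => P.enc.result (encArg
          (pair msg (pair consts u)) (sharesData μ) (unary r)
            (unary j))).map fun t => pair (pair msg.fst (pair
              (hiddenShares i μ M₀ i).encode (hiddenShares i μ M₁ i).encode)) (tableData t) := by
  rw [encData, randomShares_eq, PMF.bind_map]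
  refine congrArg _ (funext fun μ => ?_)
  rw [Function.comp, encTable_eq _ _ (by rw [snd_pair, fst_pair]), PMF.map_comp, fst_pair, ← h₀, ← h₁,
    hiddenMsg_eq, hiddenMsg_eq]
  rfl

/-- The heart of the hybrid step. Overwriting cell `(i, k)` by an outer encryption of the hidden
share of `m₀` or `m₁` yields the hybrid with boundary `k` or `k + 1`. The cell computed by the
reduction is discarded and does not influence the others. -/
theorem hybridEnc_eq (msg u : Data) (X : Data) (hX : attrOf u msg.fst = X) (M₀ M₁ : Msg (ell lam))
    (h₀ : M₀.encode = msg.snd.fst) (h₁ : M₁.encode = msg.snd.snd) :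
    ((PMF.uniformOfFintype (Fin (v lam) → Msg (ell lam))).bind fun μ =>
        (seqFin fun r : Fin (v lam) => seqFin fun j : Fin (w lam) => P.enc.result (encArg
          (pair msg (pair consts u)) (sharesData μ) (unary r)
            (unary j))).bind fun t => ((P.scheme ell).enc lam (pk i k) X
              (if coin then hiddenShares i μ M₁ i else hiddenShares i μ M₀ i)).map fun a =>
                tableData (update t i (update (t i) k a))) =
      (hybridEnc (P.scheme ell) v w lam i (k + if coin then 1 else 0) pk X M₀ M₁).map
        ((ballsAndBins (P.scheme ell) v w hw).encodeCT lam) := by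
  refine Eq.trans ?_ (PMF.map_bind _ _ _).symm
  refine congrArg _ (funext fun μ => ?_)
  have h := map_seqFin_update₂ tableData (fun (r : Fin (v lam)) (j : Fin (w lam)) =>
    P.enc.result (encArg (pair msg (pair consts u)) (sharesData μ)
      (unary r) (unary j))) i k ((P.scheme ell).enc lam (pk i k) X
        (if coin then hiddenShares i μ M₁ i else hiddenShares i μ M₀ i))
  refine Eq.trans h (congrArg (PMF.map tableData) (congrArg _ (funext fun r => congrArg _ (funext fun j => ?_))))
  by_cases hrj : r = i ∧ j = k
  · obtain ⟨rfl, rfl⟩ := hrj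
    rw [update_self]
    refine (update_self (β := fun _ => PMF Data) _ _ _).trans ?_
    cases coin
    · exact congrArg (fun M => (P.scheme ell).enc lam (pk r j) X (hiddenShares r μ M r)) (if_neg (by simp)).symm
    · exact congrArg (fun M => (P.scheme ell).enc lam (pk r j) X (hiddenShares r μ M r)) (if_pos (by simp)).symm
  · rw [← encArg_eq (msk := msk) (q := q) (dummy := dummy) coin msg u X hX M₀ M₁ h₀ h₁ μ r j hrj]
    by_cases hr : r = i
    · subst hr
      rw [update_self]
      exact update_of_ne (β := fun _ => PMF Data) (fun hj => hrj ⟨rfl, hj⟩) _ _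
    · rw [update_of_ne hr]

/-- The reduction samples the table first and inserts the outer ciphertext by means of frames. Its
two challenge messages are the hidden shares of row `i` for `m₀` and `m₁`, with the same randomness
`μ`. -/
theorem challenge_accept (msg u : Data) (X : Data) (hX : attrOf u msg.fst = X) (M₀ M₁ : Msg (ell lam))
    (h₀ : M₀.encode = msg.snd.fst) (h₁ : M₁.encode = msg.snd.snd) (o : ChalState (P.scheme ell) lam)
    (hch : ∀ N₀ N₁ : Msg (ell lam), challenger (P.scheme ell) T sel (fun _ => 1) coin lam (pk i k) (msk i k) 3
      (pair msg.fst (pair N₀.encode N₁.encode)).toQ o =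
        StateT.lift ((P.scheme ell).enc lam (pk i k) X (if coin then N₁ else N₀)) >>= fun ct =>
          pure (Data.toQ ct, { o with challenged := some X })) :
    ((StateT.lift (encData P (pair msg (pair consts u))) : QM Data) >>= fun d =>
      challenger (P.scheme ell) T sel (fun _ => 1) coin lam (pk i k) (msk i k) 3 d.fst.toQ o >>= fun a =>
        after P sel 3 (pair (ofBool (decide (a.1.erase ≠ nil)))
          (pair (pair msg (pair consts u)) d.snd)) QData.nil >>=
        fun p => (pure (p.snd.toList.foldl plugFrame a.1, (p.fst, a.2)) :
          QM (QData × (QData × ChalState (P.scheme ell) lam)))) =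
      StateT.lift ((hybridEnc (P.scheme ell) v w lam i (k + if coin then 1 else 0) pk X M₀ M₁).map
        ((ballsAndBins (P.scheme ell) v w hw).encodeCT lam)) >>= fun ct =>
          pure (Data.toQ ct, ((setChal (pair consts u) msg.fst).toQ,
            { o with challenged := some X })) := by
  rw [encData_eq msg u M₀ M₁ h₀ h₁, ← hybridEnc_eq (msk := msk) (q := q) (dummy := dummy) hw coin msg u X hX M₀ M₁ h₀ h₁]
  refine (congrArg (· >>= _) (QM.lift_bind _ _)).trans (Eq.symm ((congrArg (· >>= _) (QM.lift_bind _ _)).trans ?_))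
  rw [bind_assoc, bind_assoc]
  refine congrArg _ (funext fun μ => ?_)
  refine (congrArg (· >>= _) (QM.lift_bind _ _)).trans ?_
  rw [QM.lift_map_bind, bind_assoc]
  refine congrArg _ (funext fun t => ?_)
  refine (QM.lift_map_bind (α := Data) _ _ _).trans ?_
  rw [fst_pair]
  refine Eq.symm ((congrArg (· >>= _) (hch _ _)).trans ?_)
  rw [bind_assoc]
  refine congrArg _ (funext fun a => ?_)
  rw [pure_bind]
  simp only [after, pure_bind, challengeAfter, Data.toQ_pair, QData.fst_pair, QData.snd_pair, snd_pair,
    fst_pair, QData.toList_toQ, toList_ofList, rowOf_constants, colOf_constants,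
    length_toList_unary]
  exact congrArg (fun z => pure (z, _)) (foldl_tableFrames t i k a)

theorem relatedOf_eq (hRR : Decides RR T lam)
    (msg u X : Data) (hX : attrOf u msg.fst = X) (hXm : X ∈ T.X lam)
    {keys : List (Entry v w lam)}
    (hk : keysOf u = keysData i k keys) (h8 : ∀ e ∈ keys, e.1 ∈ T.Y lam) :
    relatedOf RR (pair msg (pair consts u)) =
      PMF.pure (keysData i k (keys.filter fun e => decide (T.R lam X e.1))) := by
  have h := PMF.map_filter_mapM (fun a : Data => RR (pair (unary lam) (pair X a.fst)))
    (fun a => T.R lam X a.fst) (keysOf u).toList (by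
      intro a ha b hb
      rw [hk, keysData, toList_ofList] at ha
      obtain ⟨e, he, rfl⟩ := List.mem_map.1 ha
      exact hRR X hXm _ (h8 e he) b hb)
  simp only [relatedOf, fst_pair, snd_pair, hX, show lamOf consts =
      unary lam from rfl]
  have h2 := congrArg (PMF.map ofList) h
  rw [PMF.map_comp, PMF.pure_map] at h2
  refine Eq.trans ?_ (h2.trans ?_)
  · congr 1
  · rw [hk, keysData, keysData, toList_ofList, List.filter_map]
    rfl

/-- The reduction can evaluate the conditions of the hybrid game from its own records: it knows all
columns, and since attributes are distinct, its log of accepted attributes determines which keys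
have been returned. -/
theorem Checks_iff (msg u X : Data)
    {keys : List (Entry v w lam)} {log : List Data}
    (hu : logOf u = ofList log) (h7 : (keys.map Prod.fst).Nodup)
    (h10 : ∀ y, y ∈ log ↔ ∃ e ∈ keys, e.1 = y ∧ e.2.2 = true) :
    Checks (pair msg (pair consts u))
      (keysData i k (keys.filter fun e => decide (T.R lam X e.1))) ↔
    ((∃ m : Msg (ell lam), m.encode = msg.snd.fst) ∧ ∃ m : Msg (ell lam), m.encode = msg.snd.snd) ∧
    ((keys.filter fun e => decide (T.R lam X e.1)).length ≤ q lam ∧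
      ∀ e ∈ keys.filter (fun e => decide (T.R lam X e.1)), e.2.2 = true) ∧
    firstGood ((keys.filter fun e => decide (T.R lam X e.1)).map fun e => e.2.1.1) = some i := by
  have hinst : ∀ r : Fin (v lam), (instancesOf (keysData i k (keys.filter fun e => decide (T.R lam X e.1))).toList r).Nodup ↔
      (((keys.filter fun e => decide (T.R lam X e.1)).map fun e => e.2.1.1).map fun j => j r).Nodup := by
    intro r
    rw [instancesOf, keysData, toList_ofList, List.map_map, List.map_map,
      ← List.nodup_map_iff (f := fun j : Fin (w lam) => unary j)
        (fun a b h => Fin.ext (Data.unary_injective h)), List.map_map]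
    congr! 2
    funext e
    simp [List.getD_eq_getElem?_getD, recordData]
  rw [Checks, firstGood_eq_some]
  simp only [fst_pair, snd_pair, ellOf_constants, isMsg_iff, rowOf_constants, length_toList_unary,
    hinst]
  refine and_congr Iff.rfl (and_congr (and_congr ?_ ?_) (and_congr Iff.rfl ?_))
  · simp [boundOf, constants, constData, keysData]
  · rw [hu, keysData, toList_ofList, toList_ofList, List.forall_mem_map]
    refine forall₂_congr fun e he => ?_
    rw [fst_pair, h10]
    constructor
    · rintro ⟨e', he', h1, h2⟩
      rw [← List.inj_on_of_nodup_map h7 he' (List.mem_of_mem_filter he) h1, h2]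
    · exact fun h => ⟨e, List.mem_of_mem_filter he, rfl, h⟩
  · constructor
    · intro h r hr
      rw [← hinst]
      simpa using h (unary r) (by simp; exact ⟨r, hr, rfl⟩)
    · intro h a ha
      simp at ha
      obtain ⟨r, hr, rfl⟩ := ha
      have := h ⟨r, by omega⟩ hr
      rw [← hinst] at this
      simpa using this

theorem challenger_abort {S : ABESKL ell} {pk' : S.PK lam} {msk' : S.MSK lam} {o : ChalState S lam} (d : Data)
    (ho : o.started = true ∧ o.aborted = false ∧ o.challenged = none)
    (h : o.target.getD d.fst ∉ T.X lam ∨ ¬ IsMsg (ell lam) d.snd.fst) :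
    challenger S T sel (fun _ => 1) coin lam pk' msk' 3 d.toQ o = pure (QData.nil, { o with aborted := true }) := by
  refine (if_pos ho).trans ?_
  rw [erase_toQ]
  rcases h0 : Msg.decode (ell lam) d.snd.fst with - | M₀
  · rfl
  · rcases h1 : Msg.decode (ell lam) d.snd.snd with - | M₁
    · rfl
    · refine if_neg fun hc => ?_
      rcases h with h | h
      · exact h hc.1
      · rw [decode_eq_none h] at h0
        cases h0

/-- For attributes outside `X` nothing is known about the decision algorithm, so the checks may
succeed or fail. In either case the outer query carries the adversary's attribute or is the
ill-formed one. -/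
theorem challengeData_support {msg s d : Data} (hd : d ∈ (challengeData P RR (pair msg s)).support) :
    d.fst.fst = msg.fst ∨ d.fst = badQuery := by
  obtain ⟨dist, -, hd⟩ := (PMF.mem_support_bind_iff _ _ _).1 hd
  split at hd
  · obtain ⟨μ, -, hd⟩ := (PMF.mem_support_bind_iff _ _ _).1 hd
    obtain ⟨ct, -, rfl⟩ := (PMF.mem_support_map_iff _ _ _).1 hd
    exact Or.inl rfl
  · rw [(PMF.mem_support_pure_iff _ _).1 hd]
    exact Or.inr rfl

theorem badQuery_not_isMsg (l : ℕ) : ¬ IsMsg l badQuery.snd.fst := by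
  rintro ⟨-, h⟩
  have := h (pair tt tt) (by simp [badQuery, Data.fst, Data.snd, Data.toList])
  simp [ofBool] at this

/-- If the hybrid game grants the challenge, the outer challenger grants it too, having at most one
related key, which has been returned, and the ciphertext tables agree in law. If not, both sides
abort, which is the common bad state. -/
theorem challenge_rel (hRR : Decides RR T lam)
    (msg : QData) (st : QData × ChalState (P.scheme ell) lam)
    (h : ChalState (recorded (P.scheme ell) v w hw) lam) (m : QState)
    (hst : Rel P hw T q i k pk msk dummy st h) :
    PMFRel (Good hw i k pk msk dummy P T q)
      (simulated 3 msg st m)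
      (game (recorded (P.scheme ell) v w hw) T sel q lam (fun vks => firstGood (vks.map instances) = some i)
        (fun x m₀ m₁ => (hybridEnc (P.scheme ell) v w lam i (k + if coin then 1 else 0) pk x m₀ m₁).map
          ((ballsAndBins (P.scheme ell) v w hw).encodeCT lam)) pk msk 3 msg h m) := by
  obtain ⟨s, o⟩ := st
  obtain ⟨x, log, V, h1, h2, h0, h4, h5, h6, h7, h8, h9, h10⟩ := id hst
  dsimp only at h1 h2
  subst h1
  have hg : guard RR YY 3 (pair msg.erase (pair consts
      (varData (ofBool h.started) (optData h.target) (optData x) (keysData i k h.keys)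
        (ofList log)))) = PMF.pure (ofBool (h.started && x.isNone)) := by
    refine congrArg (fun b => PMF.pure (ofBool b)) (decide_and_eq (Data.ofBool_ne_nil _) ?_)
    simp only [chalOf, varData, snd_pair, fst_pair]
    cases x <;> simp [optData]
  by_cases hs : h.started = true ∧ x = none
  · obtain ⟨hs, rfl⟩ := hs
    have hn : h.challenged = none := h4
    generalize hu : varData (ofBool h.started) (optData h.target) (optData none) (keysData i k h.keys)
        (ofList log) = u at hg
    have hX : attrOf u msg.erase.fst = h.target.getD msg.erase.fst := by
      rw [← hu]
      simp only [attrOf, targetOf, varData, fst_pair, snd_pair]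
      cases h.target <;> simp [optData, Data.fst]
    have ho : o.started = true ∧ o.aborted = false ∧ o.challenged = none := by
      rw [h2]; exact ⟨hs, rfl, hn⟩
    have hacc : simulated 3 msg ((pair consts u).toQ, o) =
        (StateT.lift (challengeData P RR (pair msg.erase (pair consts u))) :
          QM Data) >>= fun d => challenger (P.scheme ell) T sel (fun _ => 1) coin lam (pk i k) (msk i k) 3 d.fst.toQ o >>=
        fun a => after P sel 3 (pair (ofBool (decide (a.1.erase ≠ nil)))
          (pair (pair msg.erase (pair consts u)) d.snd)) QData.nil >>=
        fun p => (pure (p.snd.toList.foldl plugFrame a.1, (p.fst, a.2)) :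
          QM (QData × (QData × ChalState (P.scheme ell) lam))) := by
      rw [simOracle_accept _ _ hg (by rw [hs]; simp [ofBool])]
      refine (congrArg (· >>= _) (show before P RR 3 _ _ = challengeBefore P RR _ from rfl)).trans ?_
      rw [challengeBefore, bind_assoc]
      refine congrArg _ (funext fun d => ?_)
      rw [pure_bind, reply_call _ _ _ _ _ _ _ (by simp)]
    have hk : keysOf u = keysData i k h.keys := by rw [← hu]; simp [keysOf, varData]
    have hlog : logOf u = ofList log := by rw [← hu]; simp [logOf, varData]
    have hCI := Checks_iff (q := q) (ell := ell) (T := T) (i := i) (k := k) (pk := pk) (msk := msk) (dummy := dummy)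
      msg.erase u (h.target.getD msg.erase.fst) hlog h7 h10
    have hro := relatedOf_eq (ell := ell) (q := q) (i := i) (k := k) (pk := pk) (msk := msk) (dummy := dummy)
      hRR msg.erase u _ hX
    refine (congrArg (fun X => PMFRel _ (X m) _) hacc).mpr ?_
    by_cases hc : h.target.getD msg.erase.fst ∈ T.X lam ∧ Checks (pair msg.erase
      (pair consts u)) (keysData i k (h.keys.filter fun e =>
        decide (T.R lam (h.target.getD msg.erase.fst) e.1)))
    · obtain ⟨hXm, hck⟩ := hc
      have hcd : challengeData P RR (pair msg.erase (pair consts u)) =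
          encData P (pair msg.erase (pair consts u)) :=
        (congrArg (fun p => PMF.bind p _) (hro hXm hk h8)).trans ((PMF.pure_bind _ _).trans (if_pos hck))
      obtain ⟨⟨⟨M₀, h₀⟩, ⟨M₁, h₁⟩⟩, ⟨hlen, hret⟩, hfg⟩ := hCI.1 hck
      have hgame := gameChallenge_accept (S := recorded (P.scheme ell) v w hw) (T := T) (q := q)
        (ok := fun vks => firstGood (vks.map instances) = some i)
        (encf := fun x m₀ m₁ => (hybridEnc (P.scheme ell) v w lam i (k + if coin then 1 else 0) pk x m₀ m₁).map
          ((ballsAndBins (P.scheme ell) v w hw).encodeCT lam)) (msg := msg) (o := h) ⟨hs, h0, hn⟩ rfl h₀ h₁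
        ⟨⟨hXm, hlen, hret⟩, by rw [relatedKeys, List.map_map]; exact hfg⟩
      have hch := challenge_accept (P := P) (sel := sel) (q := q) (T := T) hw coin (pk := pk) (msk := msk)
        (dummy := dummy) (i := i) (k := k) msg.erase u _ hX M₀ M₁ h₀ h₁ o (fun N₀ N₁ => by
          refine challengeOracle_accept (S := P.scheme ell) (T := T) (q := fun _ => 1) (coin := coin) (pk := pk i k)
            (o := o) (X := h.target.getD msg.erase.fst) (M₀ := N₀) (M₁ := N₁)
            (msg := (pair msg.erase.fst (pair N₀.encode N₁.encode)).toQ) ho ?_ ?_ ?_ ⟨hXm, ?_, ?_⟩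
          · rw [h2, erase_toQ, fst_pair]
          · rw [erase_toQ, snd_pair, fst_pair]
          · rw [erase_toQ, snd_pair, snd_pair]
          · rw [h2]
            exact outerKeys_related_length V _ h.keys ((firstGood_eq_some _ _).1 hfg).1
          · rw [h2]
            exact outerKeys_related_returned h9 hret)
      refine (congrArg (fun X => PMFRel _ (((StateT.lift X : QM Data) >>= _) m) _) hcd).mpr ?_
      refine (congrArg₂ (fun X Y => PMFRel _ (X m) (Y m)) hch hgame).mpr ?_
      refine (PMFRel.refl (StateT.lift _ m : PMF (Data × QState))).bind ?_
      rintro ct _ rfl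
      refine PMFRel.pure (Or.inl ⟨rfl, rfl, ?_⟩)
      refine ⟨some msg.erase.fst, log, V, ?_, ?_, h0, rfl, fun _ => hs, ?_, h7, h8, h9, h10⟩
      · rw [← hu]
        simp [setChal, varData, startedOf, targetOf, keysOf, logOf, optData]
      · rw [h2]
      · intro a ha
        cases ha
        exact hXm
    · have hgame := gameChallenge_abort (S := recorded (P.scheme ell) v w hw) (T := T) (q := q)
        (ok := fun vks => firstGood (vks.map instances) = some i)
        (encf := fun x m₀ m₁ => (hybridEnc (P.scheme ell) v w lam i (k + if coin then 1 else 0) pk x m₀ m₁).map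
          ((ballsAndBins (P.scheme ell) v w hw).encodeCT lam)) (msg := msg) (o := h) ⟨hs, h0, hn⟩ rfl
        (fun hh => hc ⟨hh.2.1.1, hCI.2 ⟨hh.1, hh.2.1.2, by
          have := hh.2.2
          rwa [relatedKeys, List.map_map] at this⟩⟩)
      refine (congrArg (fun Y => PMFRel _ _ (Y m)) hgame).mpr ?_
      refine PMFRel.of_support fun a ha b hb => ?_
      cases (PMF.mem_support_pure_iff _ _).1 hb
      obtain ⟨⟨d, m'⟩, hd, ha⟩ := (PMF.mem_support_bind_iff _ _ _).1 ha
      obtain ⟨d', hd', hdm⟩ := (PMF.mem_support_bind_iff _ _ _).1 hd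
      cases (PMF.mem_support_pure_iff _ _).1 hdm
      -- An attribute in `X` with failing checks leads to the ill-formed query; an attribute outside
      -- `X` is rejected by the outer challenger itself unless the query is ill-formed anyway.
      have hab : o.target.getD d.fst.fst ∉ T.X lam ∨ ¬ IsMsg (ell lam) d.fst.snd.fst := by
        rcases challengeData_support hd' with hf | hf
        · by_cases hXm : h.target.getD msg.erase.fst ∈ T.X lam
          · have : challengeData P RR (pair msg.erase (pair consts u)) =
                PMF.pure (pair badQuery nil) :=
              (congrArg (fun p => PMF.bind p _) (hro hXm hk h8)).trans
                ((PMF.pure_bind _ _).trans (if_neg fun h => hc ⟨hXm, h⟩))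
            rw [this] at hd'
            cases (PMF.mem_support_pure_iff _ _).1 hd'
            exact Or.inr (badQuery_not_isMsg _)
          · rw [hf, h2]
            exact Or.inl hXm
        · rw [hf]
          exact Or.inr (badQuery_not_isMsg _)
      have hca := challenger_abort (T := T) (sel := sel) coin (S := P.scheme ell) (pk' := pk i k) (msk' := msk i k)
        (o := o) d.fst ho hab
      obtain ⟨⟨a', m''⟩, ha', ha⟩ := (PMF.mem_support_bind_iff _ _ _).1 ha
      have ha'' := congrArg (fun X => (a', m'') ∈ (X m).support) hca
      cases (PMF.mem_support_pure_iff _ _).1 (ha''.mp ha')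
      obtain ⟨⟨p, m'''⟩, -, ha⟩ := (PMF.mem_support_bind_iff _ _ _).1 ha
      cases (PMF.mem_support_pure_iff _ _).1 ha
      exact Or.inr ⟨rfl, rfl⟩
  · rw [simOracle_refuse _ _ (hg.trans (congrArg (fun b => PMF.pure (ofBool b)) (Bool.eq_false_iff.2
      fun h' => hs (by simpa using h'))))]
    have : game (recorded (P.scheme ell) v w hw) T sel q lam (fun vks => firstGood (vks.map instances) = some i)
        (fun x m₀ m₁ => (hybridEnc (P.scheme ell) v w lam i (k + if coin then 1 else 0) pk x m₀ m₁).map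
          ((ballsAndBins (P.scheme ell) v w hw).encodeCT lam)) pk msk 3 msg h =
        pure (QData.nil, h) := if_neg fun h' => hs ⟨h'.1, by
          have := h'.2.2
          rw [h4] at this
          simpa using this⟩
    rw [this]
    exact PMFRel.pure (Or.inl ⟨rfl, rfl, hst⟩)

end OracleCalls

end Sim

theorem challenger_aborted {ell : ℕ → ℕ} {S : ABESKL ell} {T : AttrRel} {sel : Bool} {q : ℕ → ℕ} {coin : Bool} {lam : ℕ}
    {pk : S.PK lam} {msk : S.MSK lam} {k : ℕ} {msg : QData} {st : ChalState S lam} {m : QState}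
    (h : st.aborted = true) {r : (QData × ChalState S lam) × QState}
    (hr : r ∈ (challenger S T sel q coin lam pk msk k msg st m).support) : r.1.2.aborted = true := by
  have hn : ∀ {r : (QData × ChalState S lam) × QState},
      r ∈ ((pure (QData.nil, st) : QM (QData × ChalState S lam)) m).support → r.1.2.aborted = true := fun hr => by
    rw [QM.mem_support_pure hr]; exact h
  match k with
  | 0 =>
    change r ∈ ((if st.started then pure (QData.nil, st) else pure _ : QM (QData × ChalState S lam)) m).support at hr
    split at hr
    · exact hn hr
    · rw [QM.mem_support_pure hr]; exact h
  | 1 =>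
    have : kgOracle S T lam msk msg st = pure (QData.nil, st) := if_neg (by simp [h])
    exact hn (this ▸ hr)
  | 2 =>
    have : vrfyOracle S lam msg st = pure (QData.nil, st) := if_neg (by simp [h])
    exact hn (this ▸ hr)
  | 3 =>
    have : challengeOracle S T q coin lam pk msg st = pure (QData.nil, st) := if_neg (by simp [h])
    exact hn (this ▸ hr)
  | k + 4 => exact hn hr

theorem simOracle_invariant {σ : Type} {pre post : ℕ → QData → QM QData} {O : Oracle σ} {I : σ → Prop} {k : ℕ}
    (hO : ∀ msg st m, I st → ∀ r ∈ (O k msg st m).support, I r.1.2) {msg : QData} {st : QData × σ} {m : QState}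
    (h : I st.2) {r : (QData × (QData × σ)) × QState} (hr : r ∈ (simOracle pre post O k msg st m).support) :
    I r.1.2.2 := by
  obtain ⟨a, m₁, h1, hr⟩ := QM.mem_support_bind hr
  rw [QM.mem_support_pure hr]
  obtain ⟨b, m₂, -, h1⟩ := QM.mem_support_bind h1
  obtain ⟨c, m₃, h2, h1⟩ := QM.mem_support_bind h1
  obtain ⟨p, m₄, -, h1⟩ := QM.mem_support_bind h1
  rw [(Prod.mk.inj (QM.mem_support_pure h1)).1]
  split at h2
  · rw [(Prod.mk.inj (QM.mem_support_pure h2)).1]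
    exact h
  · exact hO _ _ _ h _ h2

theorem UPoly.range {f : ℕ → ℕ} (hf : UPoly f) {g : Data → Data} (hg : DPoly g) :
    DPoly fun d => Data.range (f (g d).toList.length) :=
  (DPoly.range (DPoly.comp hf hg)).congr fun d => by simp

namespace Sim

/-! ### Sampling the initial state of the reduction -/

section Init

variable (P : ABESKLPrograms) (v w ell q : ℕ → ℕ)

def setupCell (d : Data) : PMF Data :=
  (P.setup.result (unary d.toList.length)).map fun r => pair r.fst r.snd

def initTable (d : Data) : PMF Data :=
  ((Data.range (v d.toList.length)).toList.mapM fun _ =>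
    ((Data.range (w d.toList.length)).toList.mapM fun _ => setupCell P d).map ofList).map ofList

/-- The initial state of the reduction. -/
def initData (d : Data) : PMF Data :=
  (uniformList (Data.range (v d.toList.length)).toList).bind fun i =>
    (uniformList (Data.range (w d.toList.length)).toList).bind fun k =>
      (initTable P v w d).map fun tab =>
        pair (constData (unary d.toList.length) i k (unary (w d.toList.length))
          (unary (ell d.toList.length)) (unary (q d.toList.length)) tab)
          (varData nil nil nil nil nil)

variable {P v w ell q}

theorem setupCell_poly (hP : P.setup.IsPPT) : RPoly (setupCell P) :=
  ((RPoly.of_isPPT hP).comp DPoly.id.length).bind (G := fun r => PMF.pure (pair r.fst r.snd))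
    (DPoly.id.fst.pair DPoly.id.snd).rpoly

theorem initTable_poly (hP : P.setup.IsPPT) (hv : UPoly v) (hw : UPoly w) : RPoly (initTable P v w) :=
  RPoly.mapM (F := fun d _ => ((Data.range (w d.toList.length)).toList.mapM fun _ => setupCell P d).map ofList)
    (RPoly.mapM (F := fun p _ => setupCell P p.fst) ((setupCell_poly hP).comp DPoly.id.fst.fst)
      (hw.range DPoly.id.fst)) (hv.range DPoly.id)

theorem initData_poly (hP : P.setup.IsPPT) (hv : UPoly v) (hw : UPoly w) (hell : UPoly ell) (hq : UPoly q) :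
    RPoly (initData P v w ell q) := by
  refine (RPoly.choose (hv.range DPoly.id)).bind₂ ?_
  refine (RPoly.choose (hw.range DPoly.id.fst)).bind₂
    (G := fun p k => (initTable P v w p.fst).map fun tab =>
        pair (constData (unary p.fst.toList.length) p.snd k (unary (w p.fst.toList.length))
          (unary (ell p.fst.toList.length)) (unary (q p.fst.toList.length)) tab)
          (varData nil nil nil nil nil)) ?_
  refine ((initTable_poly hP hv hw).comp DPoly.id.fst.fst).bind₂
    (G := fun p tab => PMF.pure (pair (constData (unary p.fst.fst.toList.length) p.fst.snd p.snd
        (unary (w p.fst.fst.toList.length)) (unary (ell p.fst.fst.toList.length))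
        (unary (q p.fst.fst.toList.length)) tab)
        (varData nil nil nil nil nil))) ?_
  have h : DPoly fun p => p.fst.fst.fst := DPoly.id.fst.fst.fst
  exact (DPoly.pair (DPoly.pair h.length (DPoly.id.fst.fst.snd.pair (DPoly.id.fst.snd.pair
    ((hw.comp h).pair ((hell.comp h).pair ((hq.comp h).pair DPoly.id.snd)))))) (DPoly.const _)).rpoly

theorem setupCell_unary (lam : ℕ) : setupCell P (unary lam) =
    ((P.scheme ell).setup lam).map fun p => pair p.1 p.2 := by
  refine Eq.trans ?_ (PMF.map_comp _ _ _).symm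
  refine (PMF.map_comp _ _ _).trans ?_
  rw [length_toList_unary]
  congr 1
  funext c
  simp
  rfl

theorem map_seqFin_tableData {V W : ℕ} (p : PMF (Data × Data)) :
    ((seqFin fun _ : Fin V => ((seqFin fun _ : Fin W => p.map fun r => pair r.1 r.2).map List.ofFn).map
      ofList).map List.ofFn).map ofList =
    (seqFin fun _ : Fin V => seqFin fun _ : Fin W => p).map fun t =>
      tableData fun r j => pair (t r j).1 (t r j).2 := by
  rw [PMF.seqFin_map (fun _ : Fin W => p)]
  simp only [PMF.map_comp]
  rw [PMF.seqFin_map (fun _ : Fin V => seqFin fun _ : Fin W => p), PMF.map_comp]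
  rfl

theorem initTable_unary (lam : ℕ) : initTable P v w (unary lam) =
    (seqFin fun _ : Fin (v lam) => seqFin fun _ : Fin (w lam) => (P.scheme ell).setup lam).map fun t =>
      tableData fun r j => pair (t r j).1 (t r j).2 := by
  rw [initTable, length_toList_unary, setupCell_unary (ell := ell), PMF.mapM_range, PMF.mapM_range]
  exact map_seqFin_tableData _

theorem initData_unary {lam : ℕ} [Nonempty (Fin (v lam))] [Nonempty (Fin (w lam))] :
    initData P v w ell q (unary lam) =
      (PMF.uniformOfFintype (Fin (v lam))).bind fun i => (PMF.uniformOfFintype (Fin (w lam))).bind fun k =>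
        (seqFin fun _ : Fin (v lam) => seqFin fun _ : Fin (w lam) => (P.scheme ell).setup lam).map fun t =>
          pair (constData (unary lam) (unary i) (unary k) (unary (w lam))
            (unary (ell lam)) (unary (q lam)) (tableData fun r j => pair (t r j).1 (t r j).2))
            (varData nil nil nil nil nil) := by
  rw [initData, length_toList_unary, Data.toList_range, Data.toList_range, uniformList_range, uniformList_range,
    PMF.bind_map, initTable_unary (ell := ell)]
  refine congrArg _ (funext fun i => ?_)
  simp only [Function.comp_apply, PMF.bind_map]
  refine congrArg _ (funext fun k => ?_)
  simp only [Function.comp_apply, PMF.map_comp]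
  rfl

end Init

/-! ### The reduction as an adversary against one instance -/

section Reduction

variable {P : ABESKLPrograms} {RR : Data → PMF Data} {YY : Data → Prop} {sel : Bool}
  {ell : ℕ → ℕ} {v w : ℕ → ℕ} (hw : ∀ lam, 0 < w lam) {T : AttrRel} {q : ℕ → ℕ}
  {lam : ℕ} {i : Fin (v lam)} {k : Fin (w lam)} (coin : Bool)

theorem oracle_rel {pk msk : Fin (v lam) → Fin (w lam) → Data} {dummy : Data}
    (hYY : ∀ y, YY (pair (unary lam) y) ↔ y ∈ T.Y lam)
    (hRR : Decides RR T lam) (c : ℕ) (msg : QData) (st : QData × ChalState (P.scheme ell) lam)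
    (h : ChalState (recorded (P.scheme ell) v w hw) lam) (m : QState)
    (hst : Rel P hw T q i k pk msk dummy st h) :
    PMFRel (Good hw i k pk msk dummy P T q)
      (simOracle (pre P RR YY) (post P sel) (challenger (P.scheme ell) T sel (fun _ => 1) coin lam
        (pk i k) (msk i k)) c msg st m)
      (game (recorded (P.scheme ell) v w hw) T sel q lam (fun vks => firstGood (vks.map instances) = some i)
        (fun x m₀ m₁ => (hybridEnc (P.scheme ell) v w lam i (k + if coin then 1 else 0) pk x m₀ m₁).map
          ((ballsAndBins (P.scheme ell) v w hw).encodeCT lam)) pk msk c msg h m) := by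
  match c with
  | 0 => exact start_rel hw coin msg st h m _ _ hst
  | 1 => exact kg_rel hw coin hYY hRR msg st h m _ _ hst
  | 2 => exact vrfy_rel hw coin msg st h m _ _ hst
  | 3 => exact challenge_rel hw coin hRR msg st h m hst
  | c + 4 =>
    obtain ⟨s, o⟩ := st
    obtain ⟨x, log, V, h1, h2, h3⟩ := id hst
    dsimp only at h1 h2
    subst h1
    rw [simOracle_refuse _ _ rfl]
    exact PMFRel.pure (Or.inl ⟨rfl, rfl, hst⟩)

/-- The reduction samples keys for all cells, including the outer one. Its own pair there plays the
part of the dummy, and the hybrid experiment has the outer keys in that cell. -/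
theorem init_rel (t : Fin (v lam) → Fin (w lam) → Data × Data) (keys : Data × Data) :
    Rel P hw T q i k
      (fun r j => (update t i (update (t i) k keys) r j).1)
      (fun r j => (update t i (update (t i) k keys) r j).2)
      (pair (t i k).1 (t i k).2)
      ((pair (constData (unary lam) (unary i) (unary k) (unary (w lam))
            (unary (ell lam)) (unary (q lam)) (tableData fun r j => pair (t r j).1 (t r j).2))
            (varData nil nil nil nil nil)).toQ, ChalState.init (P.scheme ell) lam)
      (ChalState.init _ lam) := by
  refine ⟨none, [], fun _ => false, ?_, rfl, rfl, rfl, fun h => h, by simp [ChalState.init], List.nodup_nil,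
    fun e he => absurd he (List.not_mem_nil), fun e he => absurd he (List.not_mem_nil), fun y =>
      ⟨fun h => absurd h (List.not_mem_nil), fun ⟨e, he, _⟩ => absurd he (List.not_mem_nil)⟩⟩
  have : cells i k (fun r j => (update t i (update (t i) k keys) r j).1)
      (fun r j => (update t i (update (t i) k keys) r j).2)
      (pair (t i k).1 (t i k).2) = fun r j => pair (t r j).1 (t r j).2 := by
    funext r j
    by_cases hr : r = i
    · subst hr
      by_cases hj : j = k
      · subst hj; simp [cells]
      · simp [cells, update_of_ne hj]
    · simp [cells, update_of_ne hr]
  rw [constants, this]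
  rfl

/-- Single calls are coupled by `oracle_rel`; once both sides have aborted they stay aborted, and
both outputs are 0. So the outputs have the same law for fixed guess and keys. -/
theorem run_eq (hYY : ∀ y, YY (pair (unary lam) y) ↔ y ∈ T.Y lam)
    (hRR : Decides RR T lam) (A : Prog) (u : QData) (m : QState)
    (t : Fin (v lam) → Fin (w lam) → Data × Data) (keys : Data × Data) :
    (A.run (simOracle (pre P RR YY) (post P sel) (challenger (P.scheme ell) T sel (fun _ => 1) coin lam keys.1 keys.2))
      (Conf.start u ((pair (constData (unary lam) (unary i) (unary k) (unary (w lam))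
            (unary (ell lam)) (unary (q lam)) (tableData fun r j => pair (t r j).1 (t r j).2))
            (varData nil nil nil nil nil)).toQ, ChalState.init (P.scheme ell) lam) m)).map
      (fun c => !c.orc.2.aborted && decide ((c.store 0).erase ≠ nil)) =
    (A.run (game (recorded (P.scheme ell) v w hw) T sel q lam (fun vks => firstGood (vks.map instances) = some i)
        (fun x m₀ m₁ => (hybridEnc (P.scheme ell) v w lam i (k + if coin then 1 else 0)
          (fun r j => (update t i (update (t i) k keys) r j).1) x m₀ m₁).map
          ((ballsAndBins (P.scheme ell) v w hw).encodeCT lam))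
          (fun r j => (update t i (update (t i) k keys) r j).1)
          (fun r j => (update t i (update (t i) k keys) r j).2))
      (Conf.start u (ChalState.init _ lam) m)).map outcome := by
  have h1 : (update t i (update (t i) k keys) i k) = keys := by simp
  have h := Prog.run_rel _ _ (Rel P hw T q i k
      (fun r j => (update t i (update (t i) k keys) r j).1)
      (fun r j => (update t i (update (t i) k keys) r j).2)
      (pair (t i k).1 (t i k).2)) (fun st => st.2.aborted = true) (fun h => h.aborted = true)
      (fun c msg st m' hb r hr => simOracle_invariant (I := fun o => o.aborted = true)
        (fun _ _ _ h r hr => challenger_aborted h hr) hb hr)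
      (fun c msg st m' hb r hr => game_aborted hb hr)
      (fun c msg st st' m' hst => oracle_rel (P := P) (RR := RR) (YY := YY) (sel := sel) (ell := ell)
        hw coin hYY hRR c msg st st' m' hst) A u _ _ m (init_rel (P := P) hw t keys)
  rw [h1] at h
  refine h.map_eq ?_
  rintro c d (⟨hs, x, log, V, -, h2, h3, -⟩ | ⟨h2, h3⟩)
  · rw [outcome, hs, h2, h3]
  · rw [outcome, h2, h3]
    rfl

theorem hybrid_eq (A : Prog) (c : ℕ) : hybrid (P.scheme ell) v w hw T sel q lam A i c =
    (seqFin fun _ : Fin (v lam) => seqFin fun _ : Fin (w lam) => (P.scheme ell).setup lam).bind fun t =>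
      (A.run (game (recorded (P.scheme ell) v w hw) T sel q lam (fun vks => firstGood (vks.map instances) = some i)
        (fun x m₀ m₁ => (hybridEnc (P.scheme ell) v w lam i c (fun r j => (t r j).1) x m₀ m₁).map
          ((ballsAndBins (P.scheme ell) v w hw).encodeCT lam)) (fun r j => (t r j).1) (fun r j => (t r j).2))
      (Conf.start (unary lam).toQ (ChalState.init _ lam) QState.blank)).map outcome := by
  rw [hybrid, gameRun, PMF.map_bind]
  exact PMF.bind_map _ _ _

variable (sel) in
-- One program serves all hybrids: it guesses the cell `(i, k)` uniformly, and its experiment is the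
-- average of the hybrids with boundary `k` or `k + 1`, according to the coin.
theorem exists_hybrid_reduction (hP : P.Efficient) (hT : T.PolyTimeDecidable) (hvp : UPoly v) (hwp : UPoly w)
    (hell : UPoly ell) (hq : UPoly q) {A : Prog} (hA : A.IsQPTAdversary) :
    ∃ B : Prog, B.IsQPTAdversary ∧ ∀ (lam : ℕ) [Nonempty (Fin (v lam))] [Nonempty (Fin (w lam))] (coin : Bool),
      experiment (P.scheme ell) T sel (fun _ => 1) coin lam B =
        (PMF.uniformOfFintype (Fin (v lam))).bind fun i => (PMF.uniformOfFintype (Fin (w lam))).bind fun k =>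
          hybrid (P.scheme ell) v w hw T sel q lam A i (k + if coin then 1 else 0) := by
  obtain ⟨⟨RD, hRD, hR⟩, ⟨YD, hYD, hY⟩⟩ := hT
  have hRR : ∀ lam, ∀ x ∈ T.X lam, ∀ y ∈ T.Y lam,
      ∀ b ∈ (RD.result (pair (unary lam) (pair x y))).support, (b ≠ nil ↔ T.R lam x y) := by
    intro lam x hx y hy b hb
    obtain ⟨c, hc, rfl⟩ := (PMF.mem_support_map_iff _ _ _).1 hb
    exact hR lam x hx y hy _ c hc
  -- The key attribute is decided for arbitrary data, so membership in `Y` is a deterministic test;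
  -- the relation is decided only on `X × Y` and enters as the sampler `RD.result`.
  let YY : Data → Prop := fun d => d.snd ∈ T.Y d.fst.toList.length
  have hYY : ∀ lam y, YY (pair (unary lam) y) ↔ y ∈ T.Y lam := by simp [YY]
  have hYp : BPoly YY := by
    change RPoly fun d => PMF.pure (ofBool (decide (YY d)))
    refine RPoly.congr (((RPoly.of_isPPT hYD).comp (DPoly.id.fst.length.pair DPoly.id.snd)).bind
      (G := fun b => PMF.pure (ofBool (decide (b ≠ nil)))) ((BPoly.ne_nil DPoly.id).dpoly.rpoly.congr
        fun _ => by congr!)) fun d => ?_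
    refine (PMF.eq_pure_of_support _ fun b hb => ?_).symm
    obtain ⟨r, hr, hb⟩ := (PMF.mem_support_bind_iff _ _ _).1 hb
    obtain ⟨c, hc, rfl⟩ := (PMF.mem_support_map_iff _ _ _).1 hr
    rw [(PMF.mem_support_pure_iff _ _).1 hb]
    exact congrArg ofBool (decide_eq_decide.2 (hY _ _ _ c hc))
  obtain ⟨g, hg⟩ := size_bound (RR := RD.result) (YY := YY) (sel := sel) hP
  obtain ⟨B, hB, h⟩ := exists_reduction (pre_poly hP (RPoly.of_isPPT hRD) hYp) (post_poly (sel := sel) hP)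
    (pre_min P RD.result YY) (post_min P sel) (initData_poly hP.1 hvp hwp hell hq) g hg hA
  refine ⟨B, hB, fun lam _ _ coin => ?_⟩
  have h1 : experiment (P.scheme ell) T sel (fun _ => 1) coin lam B =
      ((P.scheme ell).setup lam).bind fun keys => ((B.run (challenger (P.scheme ell) T sel (fun _ => 1) coin lam
        keys.1 keys.2) (Conf.start (unary lam).toQ (ChalState.init _ lam) QState.blank)).map
          fun c => (c.orc, decide ((c.store 0).erase ≠ nil))).map fun p => !p.1.aborted && p.2 := by
    simp only [PMF.map_comp]
    rfl
  rw [h1]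
  let G : Fin (v lam) → Fin (w lam) → (Fin (v lam) → Fin (w lam) → Data × Data) → PMF Bool := fun i k t =>
    (A.run (game (recorded (P.scheme ell) v w hw) T sel q lam (fun vks => firstGood (vks.map instances) = some i)
      (fun x m₀ m₁ => (hybridEnc (P.scheme ell) v w lam i (k + if coin then 1 else 0)
        (fun r j => (t r j).1) x m₀ m₁).map ((ballsAndBins (P.scheme ell) v w hw).encodeCT lam))
      (fun r j => (t r j).1) (fun r j => (t r j).2))
      (Conf.start (unary lam).toQ (ChalState.init _ lam) QState.blank)).map outcome
  have h2 : ∀ keys : Data × Data, ((B.run (challenger (P.scheme ell) T sel (fun _ => 1) coin lam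
        keys.1 keys.2) (Conf.start (unary lam).toQ (ChalState.init _ lam) QState.blank)).map
          fun c => (c.orc, decide ((c.store 0).erase ≠ nil))).map (fun p => !p.1.aborted && p.2) =
      (PMF.uniformOfFintype (Fin (v lam))).bind fun i => (PMF.uniformOfFintype (Fin (w lam))).bind fun k =>
        (seqFin fun _ : Fin (v lam) => seqFin fun _ : Fin (w lam) => (P.scheme ell).setup lam).bind fun t =>
          G i k (update t i (update (t i) k keys)) := by
    intro keys
    refine (congrArg (PMF.map _) (h lam _ _ _ _)).trans ?_
    rw [PMF.map_bind, initData_unary, PMF.bind_bind]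
    refine congrArg _ (funext fun i => ?_)
    rw [PMF.bind_bind]
    refine congrArg _ (funext fun k => ?_)
    rw [PMF.bind_map]
    refine congrArg _ (funext fun t => ?_)
    refine (PMF.map_comp _ _ _).trans ?_
    exact run_eq (P := P) (RR := RD.result) (YY := YY) hw coin (hYY lam) (hRR lam) A _ _ t keys
  refine (congrArg (PMF.bind _) (funext h2)).trans ?_
  -- The setup of the outer challenger is moved behind the guess and the table of the reduction,
  -- from which it is independent.
  refine (PMF.bind_comm _ _ _).trans (congrArg _ (funext fun i => ?_))
  refine (PMF.bind_comm _ _ _).trans (congrArg _ (funext fun k => ?_))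
  refine (PMF.bind_comm _ _ _).trans ?_
  rw [hybrid_eq]
  -- Replacing one cell of an independent table by a fresh sample of the same law does not change
  -- the law of the table.
  have h3 : ∀ (p : PMF (Data × Data)) (G : (Fin (v lam) → Fin (w lam) → Data × Data) → PMF Bool),
      ((seqFin fun _ : Fin (v lam) => seqFin fun _ : Fin (w lam) => p).bind fun t => p.bind fun a =>
        G (update t i (update (t i) k a))) =
      (seqFin fun _ : Fin (v lam) => seqFin fun _ : Fin (w lam) => p).bind G := by
    intro p G
    have h4 := congrArg (fun μ => PMF.bind μ G) (seqFin_update₂ (fun (_ : Fin (v lam)) (_ : Fin (w lam)) => p) i k p)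
    simp only [PMF.bind_bind, PMF.bind_map, Function.update_eq_self] at h4
    exact h4
  exact h3 ((P.scheme ell).setup lam) (G i k)

end Reduction

end Sim

/-! ### Advantage bounds and negligibility -/

section Security

theorem PMF.uniform_bind_toReal {n : ℕ} [Nonempty (Fin n)] {α : Type} (f : Fin n → PMF α) (a : α) :
    (((PMF.uniformOfFintype (Fin n)).bind f) a).toReal = (∑ i, (f i a).toReal) / n := by
  rw [PMF.bind_apply, tsum_fintype, ENNReal.toReal_sum fun i _ =>
    ENNReal.mul_ne_top (PMF.apply_ne_top _ _) (PMF.apply_ne_top _ _), Finset.sum_div]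
  refine Finset.sum_congr rfl fun i _ => ?_
  simp [ENNReal.toReal_mul, div_eq_inv_mul]

theorem pow_half_superpolynomialDecay :
    Asymptotics.SuperpolynomialDecay Filter.atTop (fun lam : ℕ => (lam : ℝ)) fun lam => (2⁻¹ : ℝ) ^ lam :=
  fun n => tendsto_pow_const_mul_const_pow_of_lt_one n (by norm_num) (by norm_num)

variable {P : ABESKLPrograms} {ell : ℕ → ℕ} {v w : ℕ → ℕ} (hw : ∀ lam, 0 < w lam) {T : AttrRel} {q : ℕ → ℕ}

/-- For each row the difference of the chain ends telescopes over the columns. The experiments of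
the reduction average over `v * w` cells, so their difference, multiplied by `v * w`, is the sum of
all hybrid steps. -/
theorem advantage_le_reduction {sel : Bool} {lam : ℕ} [Nonempty (Fin (v lam))] [Nonempty (Fin (w lam))] {A B : Prog}
    (hB : ∀ coin : Bool, experiment (P.scheme ell) T sel (fun _ => 1) coin lam B =
        (PMF.uniformOfFintype (Fin (v lam))).bind fun i => (PMF.uniformOfFintype (Fin (w lam))).bind fun k =>
          hybrid (P.scheme ell) v w hw T sel q lam A i (k + if coin then 1 else 0))
    {ε : ℝ≥0∞} (hε' : ε ≠ ⊤)
    (hε : ∀ encf, (gameRun (P.scheme ell) v w hw T sel q lam A (fun _ => True) encf).expect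
      (fun c => if AllCollide T instances c.orc then 1 else 0) ≤ ε) :
    advantage (ballsAndBins (P.scheme ell) v w hw) T sel q lam A ≤
      v lam * w lam * advantage (P.scheme ell) T sel (fun _ => 1) lam B + ε.toReal := by
  refine (advantage_le_hybrids (P.scheme ell) v w hw T sel q lam A ε hε' hε).trans ?_
  refine add_le_add_left (le_of_eq ?_) _
  have hv0 : (v lam : ℝ) ≠ 0 := Nat.cast_ne_zero.2 (Fin.pos_iff_nonempty.2 inferInstance).ne'
  have hw0 : (w lam : ℝ) ≠ 0 := Nat.cast_ne_zero.2 (hw lam).ne'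
  -- Boundary `k` belongs to coin 0 and boundary `k + 1` to coin 1, so the telescoping sum splits
  -- into one sum for each coin.
  have h : ∀ i : Fin (v lam), (hybrid (P.scheme ell) v w hw T sel q lam A i 0 true).toReal -
      (hybrid (P.scheme ell) v w hw T sel q lam A i (w lam) true).toReal =
      ∑ k : Fin (w lam), (hybrid (P.scheme ell) v w hw T sel q lam A i k true).toReal -
      ∑ k : Fin (w lam), (hybrid (P.scheme ell) v w hw T sel q lam A i (k + 1) true).toReal := by
    intro i
    rw [← Finset.sum_sub_distrib, Fin.sum_univ_eq_sum_range (fun k =>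
      (hybrid (P.scheme ell) v w hw T sel q lam A i k true).toReal -
      (hybrid (P.scheme ell) v w hw T sel q lam A i (k + 1) true).toReal), Finset.sum_range_sub']
  rw [Finset.sum_congr rfl fun i _ => h i, Finset.sum_sub_distrib, advantage, hB, hB,
    PMF.uniform_bind_toReal, PMF.uniform_bind_toReal]
  simp only [PMF.uniform_bind_toReal, if_true, Bool.false_eq_true, if_false, add_zero]
  rw [← Finset.sum_div, ← Finset.sum_div, ← abs_of_nonneg (show (0 : ℝ) ≤ v lam * w lam by positivity), ← abs_mul]
  congr 1
  field_simp

/-- A polynomial multiple of a negligible function plus `2^(-lam)` is negligible. At `lam = 0` there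
may be no rows and hence no row to guess; that value is ignored, since negligibility is asymptotic.
-/
theorem boundedKeySecure_of_collisions (hP : P.Efficient) (hT : T.PolyTimeDecidable) (hvp : UPoly v) (hwp : UPoly w)
    (hell : UPoly ell) (hq : UPoly q) {sel : Bool} (hv : ∀ lam, 0 < lam → 0 < v lam)
    (hε : ∀ lam A encf, (gameRun (P.scheme ell) v w hw T sel q lam A (fun _ => True) encf).expect
      (fun c => if AllCollide T instances c.orc then 1 else 0) ≤ (2⁻¹) ^ lam)
    (h : BoundedKeySecure (P.scheme ell) T sel fun _ => 1) :
    BoundedKeySecure (ballsAndBins (P.scheme ell) v w hw) T sel q := by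
  intro A hA
  obtain ⟨B, hB, hAB⟩ := Sim.exists_hybrid_reduction sel hw hP hT hvp hwp hell hq hA
  obtain ⟨p, hp⟩ := (hvp.mul hwp).poly_bound
  have h1 := ((h B hB).mul_polynomial (p.map (Nat.castRingHom ℝ))).add pow_half_superpolynomialDecay
  refine h1.trans_eventually_abs_le (Filter.eventually_atTop.2 ⟨1, fun lam hlam => ?_⟩)
  have : Nonempty (Fin (v lam)) := ⟨⟨0, hv lam hlam⟩⟩
  have : Nonempty (Fin (w lam)) := ⟨⟨0, hw lam⟩⟩
  have h2 := advantage_le_reduction hw (fun coin => hAB lam coin) (ENNReal.pow_ne_top (by simp)) (hε lam A)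
  have h3 : ((v lam : ℝ) * w lam) ≤ (p.map (Nat.castRingHom ℝ)).eval (lam : ℝ) := by
    rw [← Nat.cast_mul, Polynomial.eval_natCast_map, eq_natCast]
    exact Nat.cast_le.2 (hp lam)
  have h0 : 0 ≤ advantage (P.scheme ell) T sel (fun _ => 1) lam B := abs_nonneg _
  rw [Function.comp_apply, abs_of_nonneg (show 0 ≤ advantage (ballsAndBins (P.scheme ell) v w hw) T sel q lam A from
    abs_nonneg _)]
  refine (h2.trans ?_).trans (le_abs_self _)
  simp only [Pi.add_apply, ENNReal.toReal_pow, ENNReal.toReal_inv, ENNReal.toReal_ofNat]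
  refine add_le_add_left ?_ _
  rw [mul_comm (advantage _ _ _ _ _ _)]
  exact mul_le_mul_of_nonneg_right h3 h0

theorem gameRun_allCollide_selective (hq : ∀ lam, 0 < q lam) (hwq : ∀ lam, w lam = q lam ^ 2)
    {S : ABESKL ell} (lam : ℕ) (A : Prog) (encf) :
    (gameRun S v w hw T true q lam A (fun _ => True) encf).expect
      (fun c => if AllCollide T instances c.orc then 1 else 0) ≤ (2⁻¹) ^ v lam := by
  have : Nonempty (Fin (w lam)) := ⟨⟨0, hw lam⟩⟩
  rw [gameRun, PMF.expect_bind]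
  refine PMF.expect_le_const _ fun keys _ => ?_
  refine (game_allCollide_selective (hw lam) (fun y m => recorded_kg S v w hw lam _ y m) A _ _).trans ?_
  rw [hwq]
  exact potential_nil_le _ _ (hq lam)

theorem gameRun_allCollide_adaptive (hq : ∀ lam, 0 < q lam) (hwq : ∀ lam, w lam = q lam ^ 2)
    {S : ABESKL ell} (lam : ℕ) (A : Prog) (encf) :
    (gameRun S v w hw T false q lam A (fun _ => True) encf).expect
      (fun c => if AllCollide T instances c.orc then 1 else 0) ≤ (T.X lam).encard.toENNReal * (2⁻¹) ^ v lam := by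
  have : Nonempty (Fin (w lam)) := ⟨⟨0, hw lam⟩⟩
  rw [gameRun, PMF.expect_bind]
  refine PMF.expect_le_const _ fun keys _ => ?_
  refine (game_allCollide_adaptive (hw lam) (fun y m => recorded_kg S v w hw lam _ y m) A _ _).trans ?_
  rw [hwq]
  exact mul_le_mul_right (potential_nil_le _ _ (hq lam)) _

end Security

theorem mainTheorem7 (T : AttrRel) (hT : T.PolyTimeDecidable)
    (ell : ℕ → ℕ) (hell : UnaryComputable ell)
    (P : ABESKLPrograms) (hP : P.Efficient)
    (q : ℕ → ℕ) (hq : UnaryComputable q) (hq_pos : ∀ lam, 0 < q lam) :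
    (∀ n : ℕ → ℕ, UnaryComputable n → (∀ lam, (T.X lam).encard ≤ 2 ^ n lam) →
      AdaINDKLA (P.scheme ell) T (fun _ => 1) →
      AdaINDKLA (ballsAndBins (P.scheme ell) (fun lam => 2 * (lam + n lam)) (fun lam => q lam ^ 2)
        (fun lam => pow_pos (hq_pos lam) 2)) T q) ∧
    (SelINDKLA (P.scheme ell) T (fun _ => 1) →
      SelINDKLA (ballsAndBins (P.scheme ell) (fun lam => lam) (fun lam => q lam ^ 2)
        (fun lam => pow_pos (hq_pos lam) 2)) T q) := by
  have hqp := UPoly.of_unaryComputable hq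
  have hwp : UPoly fun lam => q lam ^ 2 := by
    simp only [pow_two]
    exact hqp.mul hqp
  have hellp := UPoly.of_unaryComputable hell
  refine ⟨fun n hn hX => ?_, ?_⟩
  · have hvp : UPoly fun lam => 2 * (lam + n lam) := by
      simp only [two_mul]
      have := UPoly.id.add (UPoly.of_unaryComputable hn)
      exact this.add this
    refine boundedKeySecure_of_collisions (v := fun lam => 2 * (lam + n lam)) (w := fun lam => q lam ^ 2)
      (fun lam => pow_pos (hq_pos lam) 2) hP hT hvp hwp hellp hqp (fun lam h => by omega) fun lam A encf => ?_
    refine (gameRun_allCollide_adaptive (v := fun lam => 2 * (lam + n lam)) (w := fun lam => q lam ^ 2)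
      (fun lam => pow_pos (hq_pos lam) 2) hq_pos (fun _ => rfl) lam A encf).trans ?_
    have h1 : (T.X lam).encard.toENNReal ≤ 2 ^ n lam := by
      refine (ENat.toENNReal_mono (hX lam)).trans_eq ?_
      simp
    -- Half of the rows, `lam + n lam`, already absorbs the factor `2 ^ n lam` of the union bound
    -- and leaves `2^(-lam)`.
    calc (T.X lam).encard.toENNReal * (2⁻¹ : ℝ≥0∞) ^ (2 * (lam + n lam))
        ≤ 2 ^ n lam * (2⁻¹) ^ (lam + n lam) :=
          mul_le_mul' h1 (pow_le_pow_right_of_le_one' (by simp) (by omega))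
      _ = (2⁻¹) ^ lam := by
          rw [pow_add, mul_left_comm, ← mul_pow, ENNReal.mul_inv_cancel (by simp) (by simp), one_pow, mul_one]
  · exact boundedKeySecure_of_collisions (v := fun lam => lam) (w := fun lam => q lam ^ 2)
      (fun lam => pow_pos (hq_pos lam) 2) hP hT UPoly.id hwp hellp hqp (fun lam h => h) fun lam A encf =>
      gameRun_allCollide_selective (v := fun lam => lam) (w := fun lam => q lam ^ 2)
        (fun lam => pow_pos (hq_pos lam) 2) hq_pos (fun _ => rfl) lam A encf

end
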